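/- **Setting.** $\mathrm{PILL}_Y$ is the polymorphic dual intuitionistic/linear $\lambda$-calculus with types $\sigma ::= \alpha \mid F(\vec\sigma) \mid I \mid \sigma\otimes\sigma \mid \sigma\multimap\sigma \mid {!}\sigma \mid \Pi\alpha.\sigma$ and a fixed-point combinator $Y:\Pi\alpha.\,(\alpha\to\alpha)\to\alpha$ (where $\sigma\to\tau$ means ${!}\sigma\multimap\tau$), over an arbitrary polymorphic signature of type constants $F$ and term constants. LAPL (Linear Abadi–Plotkin Logic) is the intuitionistic higher-order logic over $\mathrm{PILL}_Y$ with propositions about terms, definable relations $\rho:\mathrm{Rel}(\sigma,\tau)$, admissible relations $\rho:\mathrm{Adm}(\sigma,\tau)$, internal equality $=_\sigma$, and the relational interpretation $\sigma[\rho_1,\dots,\rho_n]$ of types (which, for types with type constants, is taken to be insensitive to reordering of the type variables and to type variables that do not occur). Consider LAPL, possibly with further closed axioms, and assume that it proves * identity extension: $\forall\vec\alpha.\ \sigma[\mathrm{eq}_{\alpha_1},\dots,\mathrm{eq}_{\alpha_n}]\equiv \mathrm{eq}_{\sigma(\vec\alpha)}$ for every type $\vec\alpha\vdash\sigma$; *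 extensionality: $(\forall x{:}\sigma.\ t\,x=_\tau u\,x)\supset t=_{\sigma\multimap\tau}u$ and $(\forall\alpha.\ t\,\alpha=_\tau u\,\alpha)\supset t=_{\Pi\alpha.\tau}u$, for all terms $t,u$ in all contexts. Let $\alpha\vdash\sigma(\alpha)$ be a type that is inductively constructed (built from type variables and closed types with $\multimap,\otimes,I,{!},\Pi$) and in which $\alpha$ occurs only positively. For $f:\tau\multimap\tau'$ let $\sigma(f)=M_\sigma\,\tau\,\tau'\,{!}f:\sigma(\tau)\multimap\sigma(\tau')$ be the functorial action, where $M_\sigma:\Pi\alpha,\beta.\,(\alpha\multimap\beta)\to\sigma(\alpha)\multimap\sigma(\beta)$ is defined by recursion on $\sigma$. Put $$\mu\alpha.\sigma=\Pi\alpha.\,(\sigma(\alpha)\multimap\alpha)\to\alpha,\qquad \nu\alpha.\sigma=\Pi\beta.\,\bigl(\Pi\alpha.\,{!}(\alpha\multimap\sigma(\alpha))\otimes\alpha\multimap\beta\bigr)\multimap\beta .$$ Let $\mathit{fold}=\Lambda\alpha.\lambda f.\lambda^\circ u.\,u\,\alpha\,{!}f$, and let $\mathit{in}:\sigma(\mu\alpha.\sigma)\multimap\mu\alpha.\sigma$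 be given by $\mathit{in}\,z=\Lambda\alpha.\lambda f{:}\sigma(\alpha)\multimap\alpha.\ f(\sigma(\mathit{fold}\,\alpha\,{!}f)\,z)$. Let $\mathit{unfold}=\Lambda\alpha.\lambda^\circ f{:}{!}(\alpha\multimap\sigma(\alpha)).\lambda^\circ x{:}\alpha.\,\mathit{pack}\,\alpha\,(f\otimes x)$, where $\mathit{pack}\,\alpha\,y=\Lambda\beta.\lambda^\circ g.\,g\,\alpha\,y$, and let $\mathit{out}:\nu\alpha.\sigma\multimap\sigma(\nu\alpha.\sigma)$ be given by $\mathit{out}\,x=x\,\sigma(\nu\alpha.\sigma)\,r$, where $r=\Lambda\alpha.\lambda^\circ y.\ \mathsf{let}\ w\otimes z\ \mathsf{be}\ y\ \mathsf{in}\ \mathsf{let}\ {!}f\ \mathsf{be}\ w\ \mathsf{in}\ \sigma(\mathit{unfold}\,\alpha\,{!}f)(f\,z)$. **Theorem (Algebraic compactness).** There are closed terms $\mathit{in}^{-1}:\mu\alpha.\sigma\multimap\sigma(\mu\alpha.\sigma)$ and $\mathit{out}^{-1}:\sigma(\nu\alpha.\sigma)\multimap\nu\alpha.\sigma$ of $\mathrm{PILL}_Y$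 that are, up to internal equality, two-sided inverses of $\mathit{in}$ and $\mathit{out}$, such that $\mathit{in}^{-1}$ is internally a final coalgebra and $\mathit{out}^{-1}$ is internally an initial algebra for the functor $\sigma$. That is: in every context $\Xi\mid\Gamma\mid\Theta\mid\Phi$ and for every type $\Xi\vdash\tau$, * each coalgebra $\Xi\mid\Gamma;-\vdash f:\tau\multimap\sigma(\tau)$ has a map $h:\tau\multimap\mu\alpha.\sigma$ with $\mathit{in}^{-1}\circ h=\sigma(h)\circ f$, and any two such maps are equal; * each algebra $\Xi\mid\Gamma;-\vdash f:\sigma(\tau)\multimap\tau$ has a map $h:\nu\alpha.\sigma\multimap\tau$ with $h\circ\mathit{out}^{-1}=f\circ\sigma(h)$, and any two such maps are equal; where all equations between maps are provable internal equalities. Moreover $\mu\alpha.\sigma$ and $\nu\alpha.\sigma$ coincide: the closed term $h=Y\,(\nu\alpha.\sigma\multimap\mu\alpha.\sigma)\,{!}(\lambda h.\ \mathit{in}\circ\sigma(h)\circ\mathit{out})$ has a two-sided inverse closed term up to internal equality, and it is a map of coalgebras from $\mathit{out}$ to $\mathit{in}^{-1}$ and a map of algebras from $\mathit{out}^{-1}$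 to $\mathit{in}$. -/

import Mathlib

universe u v

namespace LAPL

/-! # The calculus PILL_Y

Syntax is well scoped, with de Bruijn indices: index `0` is the most recently bound variable. -/

/-- The list `a, f 0, f 1, …`; used for extending contexts and substitutions. -/
def push {A : Sort*} {n : ℕ} (a : A) (f : Fin n → A) : Fin (n + 1) → A :=
  Fin.cases a f

/-- A renaming taken under one binder. -/
def up {n m : ℕ} (f : Fin n → Fin m) : Fin (n + 1) → Fin (m + 1) :=
  push 0 fun i => (f i).succ

/-- Type constants `α₁, …, αₙ ⊢ F(α₁, …, αₙ)`, each with its arity. -/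
structure TySig where
  TyCon : Type u
  arity : TyCon → ℕ

/-- `Ty T k`: the types in a kind context with `k` type variables. -/
inductive Ty (T : TySig.{u}) : ℕ → Type u
  | var {k : ℕ} (i : Fin k) : Ty T k
  | con {k : ℕ} (c : T.TyCon) (args : Fin (T.arity c) → Ty T k) : Ty T k
  | one {k : ℕ} : Ty T k
  | tensor {k : ℕ} (σ τ : Ty T k) : Ty T k
  | lolli {k : ℕ} (σ τ : Ty T k) : Ty T k
  | bang {k : ℕ} (σ : Ty T k) : Ty T k
  | all {k : ℕ} (σ : Ty T (k + 1)) : Ty T k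

namespace Ty

variable {T : TySig.{u}}

def ren : {k m : ℕ} → (Fin k → Fin m) → Ty T k → Ty T m
  | _, _, f, var i => var (f i)
  | _, _, f, con c args => con c fun j => (args j).ren f
  | _, _, _, one => one
  | _, _, f, tensor σ τ => tensor (σ.ren f) (τ.ren f)
  | _, _, f, lolli σ τ => lolli (σ.ren f) (τ.ren f)
  | _, _, f, bang σ => bang (σ.ren f)
  | _, _, f, all σ => all (σ.ren (up f))

/-- Weakening by one type variable. -/
def wk {k : ℕ} (σ : Ty T k) : Ty T (k + 1) := σ.ren Fin.succ

/-- A closed type in an arbitrary kind context. -/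
def cl {k : ℕ} (σ : Ty T 0) : Ty T k := σ.ren Fin.elim0

/-- A substitution taken under one binder. -/
def upS {k m : ℕ} (θ : Fin k → Ty T m) : Fin (k + 1) → Ty T (m + 1) :=
  push (var 0) fun i => (θ i).wk

/-- Simultaneous substitution `σ(τ₁, …, τₖ)`. -/
def subst : {k m : ℕ} → (Fin k → Ty T m) → Ty T k → Ty T m
  | _, _, θ, var i => θ i
  | _, _, θ, con c args => con c fun j => (args j).subst θ
  | _, _, _, one => one
  | _, _, θ, tensor σ τ => tensor (σ.subst θ) (τ.subst θ)
  | _, _, θ, lolli σ τ => lolli (σ.subst θ) (τ.subst θ)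
  | _, _, θ, bang σ => bang (σ.subst θ)
  | _, _, θ, all σ => all (σ.subst (upS θ))

/-- `σ[τ/α]` for the most recently bound variable `α`. -/
def inst {k : ℕ} (σ : Ty T (k + 1)) (τ : Ty T k) : Ty T k := σ.subst (push τ var)

/-- `σ(τ)` for a type `α ⊢ σ(α)` with a single type variable, and a type `τ` in any context. -/
def at1 {k : ℕ} (σ : Ty T 1) (τ : Ty T k) : Ty T k := σ.subst fun _ => τ

/-- `σ → τ`, that is `!σ ⊸ τ`. -/
def arrow {k : ℕ} (σ τ : Ty T k) : Ty T k := lolli (bang σ) τ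

/-- The type `Πα. (α → α) → α` of the fixed-point combinator. -/
def fixTy : Ty T 0 := all (arrow (arrow (var 0) (var 0)) (var 0))

/-- `Occ true i σ`: the variable `i` has a positive occurrence in `σ`;
`Occ false i σ`: it has a negative one.
(An occurrence in an argument of a type constant has no variance and counts as both.) -/
def Occ : Bool → {k : ℕ} → Fin k → Ty T k → Prop
  | p, _, i, var j => p = true ∧ i = j
  | _, _, i, con _ args => ∃ j, Occ true i (args j) ∨ Occ false i (args j)
  | _, _, _, one => False
  | p, _, i, tensor σ τ => Occ p i σ ∨ Occ p i τ
  | p, _, i, lolli σ τ => Occ (!p) i σ ∨ Occ p i τ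
  | p, _, i, bang σ => Occ p i σ
  | p, _, i, all σ => Occ p i.succ σ

/-- The variable `i` occurs only positively in `σ`. -/
def OnlyPositive {k : ℕ} (i : Fin k) (σ : Ty T k) : Prop := ¬ Occ false i σ

/-- Inductively constructed types: built from type variables and closed types by the type
constructors `⊸, ⊗, I, !, Π`. -/
inductive Inductively : {k : ℕ} → Ty T k → Prop
  | var {k : ℕ} (i : Fin k) : Inductively (var i)
  | closed {k : ℕ} (σ : Ty T 0) : Inductively (σ.cl : Ty T k)
  | one {k : ℕ} : Inductively (one : Ty T k)
  | tensor {k : ℕ} {σ τ : Ty T k} : Inductively σ → Inductively τ → Inductively (tensor σ τ)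
  | lolli {k : ℕ} {σ τ : Ty T k} : Inductively σ → Inductively τ → Inductively (lolli σ τ)
  | bang {k : ℕ} {σ : Ty T k} : Inductively σ → Inductively (bang σ)
  | all {k : ℕ} {σ : Ty T (k + 1)} : Inductively σ → Inductively (all σ)

end Ty

/-- A polymorphic signature: type constants and term constants. A term constant in a kind context
is given through its closed type, which quantifies over the type variables. -/
structure Sig extends TySig.{u} where
  Const : Type v
  constTy : Const → Ty toTySig 0

/-- The types of PILL_Y over the signature `S`. -/
abbrev Typ (S : Sig.{u, v}) (k : ℕ) : Type u := Ty S.toTySig k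

/-- `Tm S k n`: raw terms with `k` type variables and `n` term variables. Whether a term variable
is linear or intuitionistic is recorded by the typing judgement. -/
inductive Tm (S : Sig.{u, v}) : ℕ → ℕ → Type (max u v)
  | var {k n : ℕ} (i : Fin n) : Tm S k n
  | star {k n : ℕ} : Tm S k n
  | fix {k n : ℕ} : Tm S k n
  | const {k n : ℕ} (c : S.Const) : Tm S k n
  | lam {k n : ℕ} (σ : Typ S k) (t : Tm S k (n + 1)) : Tm S k n
  | app {k n : ℕ} (t s : Tm S k n) : Tm S k n
  | tensor {k n : ℕ} (t s : Tm S k n) : Tm S k n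
  | bang {k n : ℕ} (t : Tm S k n) : Tm S k n
  | tyLam {k n : ℕ} (t : Tm S (k + 1) n) : Tm S k n
  | tyApp {k n : ℕ} (t : Tm S k n) (σ : Typ S k) : Tm S k n
  /-- `let ⋆ be t in s` -/
  | letStar {k n : ℕ} (t s : Tm S k n) : Tm S k n
  /-- `let x:σ ⊗ y:τ be t in s`; in `s` the variable `y` has index `0` and `x` has index `1` -/
  | letTensor {k n : ℕ} (σ τ : Typ S k) (t : Tm S k n) (s : Tm S k (n + 2)) : Tm S k n
  /-- `let !x:σ be t in s` -/
  | letBang {k n : ℕ} (σ : Typ S k) (t : Tm S k n) (s : Tm S k (n + 1)) : Tm S k n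

namespace Tm

variable {S : Sig.{u, v}}

def ren : {k n k' n' : ℕ} → (Fin k → Fin k') → (Fin n → Fin n') → Tm S k n → Tm S k' n'
  | _, _, _, _, _, g, var i => var (g i)
  | _, _, _, _, _, _, star => star
  | _, _, _, _, _, _, fix => fix
  | _, _, _, _, _, _, const c => const c
  | _, _, _, _, f, g, lam σ t => lam (σ.ren f) (t.ren f (up g))
  | _, _, _, _, f, g, app t s => app (t.ren f g) (s.ren f g)
  | _, _, _, _, f, g, tensor t s => tensor (t.ren f g) (s.ren f g)
  | _, _, _, _, f, g, bang t => bang (t.ren f g)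
  | _, _, _, _, f, g, tyLam t => tyLam (t.ren (up f) g)
  | _, _, _, _, f, g, tyApp t σ => tyApp (t.ren f g) (σ.ren f)
  | _, _, _, _, f, g, letStar t s => letStar (t.ren f g) (s.ren f g)
  | _, _, _, _, f, g, letTensor σ τ t s =>
      letTensor (σ.ren f) (τ.ren f) (t.ren f g) (s.ren f (up (up g)))
  | _, _, _, _, f, g, letBang σ t s => letBang (σ.ren f) (t.ren f g) (s.ren f (up g))

/-- Weakening by one term variable. -/
def wk {k n : ℕ} (t : Tm S k n) : Tm S k (n + 1) := t.ren id Fin.succ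

/-- Weakening by one type variable. -/
def wkTy {k n : ℕ} (t : Tm S k n) : Tm S (k + 1) n := t.ren Fin.succ id

/-- A closed term in an arbitrary context. -/
def cl {k n : ℕ} (t : Tm S 0 0) : Tm S k n := t.ren Fin.elim0 Fin.elim0

/-- A substitution taken under one term binder. -/
def upS {k n m : ℕ} (s : Fin n → Tm S k m) : Fin (n + 1) → Tm S k (m + 1) :=
  push (var 0) fun i => (s i).wk

/-- Simultaneous substitution of types and terms. -/
def subst : {k n k' n' : ℕ} → (Fin k → Typ S k') → (Fin n → Tm S k' n') → Tm S k n → Tm S k' n'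
  | _, _, _, _, _, s, var i => s i
  | _, _, _, _, _, _, star => star
  | _, _, _, _, _, _, fix => fix
  | _, _, _, _, _, _, const c => const c
  | _, _, _, _, θ, s, lam σ t => lam (σ.subst θ) (t.subst θ (upS s))
  | _, _, _, _, θ, s, app t t' => app (t.subst θ s) (t'.subst θ s)
  | _, _, _, _, θ, s, tensor t t' => tensor (t.subst θ s) (t'.subst θ s)
  | _, _, _, _, θ, s, bang t => bang (t.subst θ s)
  | _, _, _, _, θ, s, tyLam t => tyLam (t.subst (Ty.upS θ) fun i => (s i).wkTy)
  | _, _, _, _, θ, s, tyApp t σ => tyApp (t.subst θ s) (σ.subst θ)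
  | _, _, _, _, θ, s, letStar t t' => letStar (t.subst θ s) (t'.subst θ s)
  | _, _, _, _, θ, s, letTensor σ τ t t' =>
      letTensor (σ.subst θ) (τ.subst θ) (t.subst θ s) (t'.subst θ (upS (upS s)))
  | _, _, _, _, θ, s, letBang σ t t' =>
      letBang (σ.subst θ) (t.subst θ s) (t'.subst θ (upS s))

/-- `t[s/x]` for the most recent term variable `x`. -/
def inst {k n : ℕ} (t : Tm S k (n + 1)) (s : Tm S k n) : Tm S k n :=
  t.subst Ty.var (push s var)

/-- `t[s,s'/x,y]` where `x` has index `1` and `y` has index `0`. -/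
def inst2 {k n : ℕ} (t : Tm S k (n + 2)) (s s' : Tm S k n) : Tm S k n :=
  t.subst Ty.var (push s' (push s var))

/-- `t[σ/α]` for the most recent type variable `α`. -/
def instTy {k n : ℕ} (t : Tm S (k + 1) n) (σ : Typ S k) : Tm S k n :=
  t.subst (push σ Ty.var) var

/-- Intuitionistic abstraction `λx:σ. t = λ°y:!σ. let !x:σ be y in t`. -/
def ilam {k n : ℕ} (σ : Typ S k) (t : Tm S k (n + 1)) : Tm S k n :=
  lam (Ty.bang σ) (letBang σ (var 0) (t.ren id (up Fin.succ)))

/-- The identity `λ°x:σ. x`. -/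
def idTm {k n : ℕ} (σ : Typ S k) : Tm S k n := lam σ (var 0)

/-- The composite `t ∘ s = λ°x:σ. t (s x)`, where `σ` is the domain of `s`. -/
def comp {k n : ℕ} (σ : Typ S k) (t s : Tm S k n) : Tm S k n :=
  lam σ (app t.wk (app s.wk (var 0)))

end Tm

/-! ## Typing

A context `Ξ | Γ; Δ` is given by the number of type variables, the types of all term variables,
and for each term variable a multiplicity: `many` for the variables of `Γ`, `one` for those of `Δ`,
`zero` for the variables that are in scope but belong to the other part of a split of the linear
context. -/

inductive Mult
  | zero
  | one
  | many

/-- One way of distributing a variable over the two parts of a disjoint union `Δ, Δ'`. -/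
inductive Mult.Split : Mult → Mult → Mult → Prop
  | zero : Split .zero .zero .zero
  | left : Split .one .one .zero
  | right : Split .one .zero .one
  | many : Split .many .many .many

/-- The linear context is a disjoint union of two parts, which share the intuitionistic context. -/
def Splits {n : ℕ} (u u₁ u₂ : Fin n → Mult) : Prop := ∀ i, Mult.Split (u i) (u₁ i) (u₂ i)

/-- The linear context is empty. -/
def NoLinear {n : ℕ} (u : Fin n → Mult) : Prop := ∀ i, u i ≠ Mult.one

section Typing

variable {S : Sig.{u, v}}

/-- Weakening of the types in a context by one type variable. -/
def wkCtx {k n : ℕ} (Γ : Fin n → Typ S k) : Fin n → Typ S (k + 1) := fun i => (Γ i).wk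

/-- The judgement `Ξ | Γ; Δ ⊢ t : τ`. -/
inductive HasTy : {k n : ℕ} → (Fin n → Typ S k) → (Fin n → Mult) → Tm S k n → Typ S k → Prop
  | var {k n : ℕ} {Γ : Fin n → Typ S k} {u : Fin n → Mult} (i : Fin n) :
      u i ≠ Mult.zero → (∀ j, j ≠ i → u j ≠ Mult.one) → HasTy Γ u (.var i) (Γ i)
  | star {k n : ℕ} {Γ : Fin n → Typ S k} {u : Fin n → Mult} :
      NoLinear u → HasTy Γ u .star .one
  | fix {k n : ℕ} {Γ : Fin n → Typ S k} {u : Fin n → Mult} :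
      NoLinear u → HasTy Γ u .fix Ty.fixTy.cl
  | const {k n : ℕ} {Γ : Fin n → Typ S k} {u : Fin n → Mult} (c : S.Const) :
      NoLinear u → HasTy Γ u (.const c) (S.constTy c).cl
  | lam {k n : ℕ} {Γ : Fin n → Typ S k} {u : Fin n → Mult} {σ τ : Typ S k} {t : Tm S k (n + 1)} :
      HasTy (push σ Γ) (push Mult.one u) t τ → HasTy Γ u (.lam σ t) (.lolli σ τ)
  | app {k n : ℕ} {Γ : Fin n → Typ S k} {u u₁ u₂ : Fin n → Mult} {σ τ : Typ S k}
      {t s : Tm S k n} : Splits u u₁ u₂ → HasTy Γ u₁ t (.lolli σ τ) → HasTy Γ u₂ s σ →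
      HasTy Γ u (.app t s) τ
  | tensor {k n : ℕ} {Γ : Fin n → Typ S k} {u u₁ u₂ : Fin n → Mult} {σ τ : Typ S k}
      {t s : Tm S k n} : Splits u u₁ u₂ → HasTy Γ u₁ t σ → HasTy Γ u₂ s τ →
      HasTy Γ u (.tensor t s) (.tensor σ τ)
  | bang {k n : ℕ} {Γ : Fin n → Typ S k} {u : Fin n → Mult} {σ : Typ S k} {t : Tm S k n} :
      NoLinear u → HasTy Γ u t σ → HasTy Γ u (.bang t) (.bang σ)
  | tyLam {k n : ℕ} {Γ : Fin n → Typ S k} {u : Fin n → Mult} {σ : Typ S (k + 1)}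
      {t : Tm S (k + 1) n} : HasTy (wkCtx Γ) u t σ → HasTy Γ u (.tyLam t) (.all σ)
  | tyApp {k n : ℕ} {Γ : Fin n → Typ S k} {u : Fin n → Mult} {σ : Typ S (k + 1)}
      {t : Tm S k n} (τ : Typ S k) : HasTy Γ u t (.all σ) → HasTy Γ u (.tyApp t τ) (σ.inst τ)
  | letStar {k n : ℕ} {Γ : Fin n → Typ S k} {u u₁ u₂ : Fin n → Mult} {σ : Typ S k}
      {t s : Tm S k n} : Splits u u₁ u₂ → HasTy Γ u₁ t .one → HasTy Γ u₂ s σ →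
      HasTy Γ u (.letStar t s) σ
  | letTensor {k n : ℕ} {Γ : Fin n → Typ S k} {u u₁ u₂ : Fin n → Mult} {σ σ' τ : Typ S k}
      {t : Tm S k n} {s : Tm S k (n + 2)} : Splits u u₁ u₂ → HasTy Γ u₁ t (.tensor σ σ') →
      HasTy (push σ' (push σ Γ)) (push Mult.one (push Mult.one u₂)) s τ →
      HasTy Γ u (.letTensor σ σ' t s) τ
  | letBang {k n : ℕ} {Γ : Fin n → Typ S k} {u u₁ u₂ : Fin n → Mult} {σ τ : Typ S k}
      {t : Tm S k n} {s : Tm S k (n + 1)} : Splits u u₁ u₂ → HasTy Γ u₁ t (.bang σ) →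
      HasTy (push σ Γ) (push Mult.many u₂) s τ → HasTy Γ u (.letBang σ t s) τ

/-- The judgement `Ξ | Γ; - ⊢ t : τ`. -/
def HasTyI {k n : ℕ} (Γ : Fin n → Typ S k) (t : Tm S k n) (τ : Typ S k) : Prop :=
  HasTy Γ (fun _ => Mult.many) t τ

/-- External equality `Ξ | Γ; Δ ⊢ t = s : τ`. Closure under term contexts is given by one
compatibility rule for each term constructor. In the commuting conversions, a linear context that
does not capture variables is a term `e` with a distinguished linear variable (index `0`) for its
hole; conversions for capturing contexts follow by the `η` rules and the other conversions. -/
inductive ExtEq : {k n : ℕ} → (Fin n → Typ S k) → (Fin n → Mult) → Tm S k n → Tm S k n →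
    Typ S k → Prop
  | refl {k n : ℕ} {Γ : Fin n → Typ S k} {u : Fin n → Mult} {t : Tm S k n} {τ : Typ S k} :
      HasTy Γ u t τ → ExtEq Γ u t t τ
  | symm {k n : ℕ} {Γ : Fin n → Typ S k} {u : Fin n → Mult} {t s : Tm S k n} {τ : Typ S k} :
      ExtEq Γ u t s τ → ExtEq Γ u s t τ
  | trans {k n : ℕ} {Γ : Fin n → Typ S k} {u : Fin n → Mult} {t s r : Tm S k n} {τ : Typ S k} :
      ExtEq Γ u t s τ → ExtEq Γ u s r τ → ExtEq Γ u t r τ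
  -- computation and uniqueness rules
  | beta {k n : ℕ} {Γ : Fin n → Typ S k} {u : Fin n → Mult} {σ τ : Typ S k}
      {t : Tm S k (n + 1)} {s : Tm S k n} :
      HasTy Γ u (.app (.lam σ t) s) τ → ExtEq Γ u (.app (.lam σ t) s) (t.inst s) τ
  | betaTy {k n : ℕ} {Γ : Fin n → Typ S k} {u : Fin n → Mult} {σ τ : Typ S k}
      {t : Tm S (k + 1) n} :
      HasTy Γ u (.tyApp (.tyLam t) σ) τ → ExtEq Γ u (.tyApp (.tyLam t) σ) (t.instTy σ) τ
  | eta {k n : ℕ} {Γ : Fin n → Typ S k} {u : Fin n → Mult} {σ τ : Typ S k} {t : Tm S k n} :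
      HasTy Γ u t (.lolli σ τ) → ExtEq Γ u (.lam σ (.app t.wk (.var 0))) t (.lolli σ τ)
  | etaTy {k n : ℕ} {Γ : Fin n → Typ S k} {u : Fin n → Mult} {σ : Typ S (k + 1)}
      {t : Tm S k n} :
      HasTy Γ u t (.all σ) → ExtEq Γ u (.tyLam (.tyApp t.wkTy (.var 0))) t (.all σ)
  | betaStar {k n : ℕ} {Γ : Fin n → Typ S k} {u : Fin n → Mult} {τ : Typ S k} {t : Tm S k n} :
      HasTy Γ u t τ → ExtEq Γ u (.letStar .star t) t τ
  | etaStar {k n : ℕ} {Γ : Fin n → Typ S k} {u : Fin n → Mult} {t : Tm S k n} :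
      HasTy Γ u t .one → ExtEq Γ u (.letStar t .star) t .one
  | betaTensor {k n : ℕ} {Γ : Fin n → Typ S k} {u : Fin n → Mult} {σ σ' τ : Typ S k}
      {s s' : Tm S k n} {t : Tm S k (n + 2)} :
      HasTy Γ u (.letTensor σ σ' (.tensor s s') t) τ →
      ExtEq Γ u (.letTensor σ σ' (.tensor s s') t) (t.inst2 s s') τ
  | etaTensor {k n : ℕ} {Γ : Fin n → Typ S k} {u : Fin n → Mult} {σ σ' : Typ S k}
      {t : Tm S k n} : HasTy Γ u t (.tensor σ σ') →
      ExtEq Γ u (.letTensor σ σ' t (.tensor (.var 1) (.var 0))) t (.tensor σ σ')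
  | betaBang {k n : ℕ} {Γ : Fin n → Typ S k} {u : Fin n → Mult} {σ τ : Typ S k}
      {s : Tm S k n} {t : Tm S k (n + 1)} : HasTy Γ u (.letBang σ (.bang s) t) τ →
      ExtEq Γ u (.letBang σ (.bang s) t) (t.inst s) τ
  | etaBang {k n : ℕ} {Γ : Fin n → Typ S k} {u : Fin n → Mult} {σ : Typ S k} {t : Tm S k n} :
      HasTy Γ u t (.bang σ) → ExtEq Γ u (.letBang σ t (.bang (.var 0))) t (.bang σ)
  -- commuting conversions
  | commStar {k n : ℕ} {Γ : Fin n → Typ S k} {u u₁ u₂ : Fin n → Mult} {ω τ : Typ S k}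
      {t s : Tm S k n} {e : Tm S k (n + 1)} : Splits u u₁ u₂ →
      HasTy (push ω Γ) (push Mult.one u₁) e τ → HasTy Γ u₂ (.letStar t s) ω →
      ExtEq Γ u (.letStar t (e.inst s)) (e.inst (.letStar t s)) τ
  | commTensor {k n : ℕ} {Γ : Fin n → Typ S k} {u u₁ u₂ : Fin n → Mult} {σ σ' ω τ : Typ S k}
      {t : Tm S k n} {s : Tm S k (n + 2)} {e : Tm S k (n + 1)} : Splits u u₁ u₂ →
      HasTy (push ω Γ) (push Mult.one u₁) e τ → HasTy Γ u₂ (.letTensor σ σ' t s) ω →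
      ExtEq Γ u (.letTensor σ σ' t ((e.ren id (up fun i => i.succ.succ)).inst s))
        (e.inst (.letTensor σ σ' t s)) τ
  | commBang {k n : ℕ} {Γ : Fin n → Typ S k} {u u₁ u₂ : Fin n → Mult} {σ ω τ : Typ S k}
      {t : Tm S k n} {s : Tm S k (n + 1)} {e : Tm S k (n + 1)} : Splits u u₁ u₂ →
      HasTy (push ω Γ) (push Mult.one u₁) e τ → HasTy Γ u₂ (.letBang σ t s) ω →
      ExtEq Γ u (.letBang σ t ((e.ren id (up Fin.succ)).inst s))
        (e.inst (.letBang σ t s)) τ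
  -- the fixed-point rule
  | fixpoint {k n : ℕ} {Γ : Fin n → Typ S k} {u : Fin n → Mult} {σ : Typ S k} {f : Tm S k n} :
      NoLinear u → HasTy Γ u f (.arrow σ σ) →
      ExtEq Γ u (.app f (.bang (.app (.tyApp .fix σ) (.bang f))))
        (.app (.tyApp .fix σ) (.bang f)) σ
  -- compatibility rules
  | lam {k n : ℕ} {Γ : Fin n → Typ S k} {u : Fin n → Mult} {σ τ : Typ S k}
      {t t' : Tm S k (n + 1)} : ExtEq (push σ Γ) (push Mult.one u) t t' τ →
      ExtEq Γ u (.lam σ t) (.lam σ t') (.lolli σ τ)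
  | app {k n : ℕ} {Γ : Fin n → Typ S k} {u u₁ u₂ : Fin n → Mult} {σ τ : Typ S k}
      {t t' s s' : Tm S k n} : Splits u u₁ u₂ → ExtEq Γ u₁ t t' (.lolli σ τ) →
      ExtEq Γ u₂ s s' σ → ExtEq Γ u (.app t s) (.app t' s') τ
  | tensor {k n : ℕ} {Γ : Fin n → Typ S k} {u u₁ u₂ : Fin n → Mult} {σ τ : Typ S k}
      {t t' s s' : Tm S k n} : Splits u u₁ u₂ → ExtEq Γ u₁ t t' σ → ExtEq Γ u₂ s s' τ →
      ExtEq Γ u (.tensor t s) (.tensor t' s') (.tensor σ τ)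
  | bang {k n : ℕ} {Γ : Fin n → Typ S k} {u : Fin n → Mult} {σ : Typ S k} {t t' : Tm S k n} :
      NoLinear u → ExtEq Γ u t t' σ → ExtEq Γ u (.bang t) (.bang t') (.bang σ)
  | tyLam {k n : ℕ} {Γ : Fin n → Typ S k} {u : Fin n → Mult} {σ : Typ S (k + 1)}
      {t t' : Tm S (k + 1) n} : ExtEq (wkCtx Γ) u t t' σ →
      ExtEq Γ u (.tyLam t) (.tyLam t') (.all σ)
  | tyApp {k n : ℕ} {Γ : Fin n → Typ S k} {u : Fin n → Mult} {σ : Typ S (k + 1)}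
      {t t' : Tm S k n} (τ : Typ S k) : ExtEq Γ u t t' (.all σ) →
      ExtEq Γ u (.tyApp t τ) (.tyApp t' τ) (σ.inst τ)
  | letStar {k n : ℕ} {Γ : Fin n → Typ S k} {u u₁ u₂ : Fin n → Mult} {σ : Typ S k}
      {t t' s s' : Tm S k n} : Splits u u₁ u₂ → ExtEq Γ u₁ t t' .one → ExtEq Γ u₂ s s' σ →
      ExtEq Γ u (.letStar t s) (.letStar t' s') σ
  | letTensor {k n : ℕ} {Γ : Fin n → Typ S k} {u u₁ u₂ : Fin n → Mult} {σ σ' τ : Typ S k}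
      {t t' : Tm S k n} {s s' : Tm S k (n + 2)} : Splits u u₁ u₂ →
      ExtEq Γ u₁ t t' (.tensor σ σ') →
      ExtEq (push σ' (push σ Γ)) (push Mult.one (push Mult.one u₂)) s s' τ →
      ExtEq Γ u (.letTensor σ σ' t s) (.letTensor σ σ' t' s') τ
  | letBang {k n : ℕ} {Γ : Fin n → Typ S k} {u u₁ u₂ : Fin n → Mult} {σ τ : Typ S k}
      {t t' : Tm S k n} {s s' : Tm S k (n + 1)} : Splits u u₁ u₂ →
      ExtEq Γ u₁ t t' (.bang σ) → ExtEq (push σ Γ) (push Mult.many u₂) s s' τ →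
      ExtEq Γ u (.letBang σ t s) (.letBang σ t' s') τ

end Typing

/-! # The logic

Propositions and definable relations, in contexts with `k` type variables, `n` (intuitionistic)
term variables and `r` relation variables. -/

mutual

/-- Propositions. In `allRel` and `exRel` the flag is `true` for quantification over admissible
relations and `false` for quantification over all relations. -/
inductive Form (S : Sig.{u, v}) : ℕ → ℕ → ℕ → Type (max u v)
  | eq {k n r : ℕ} (σ : Typ S k) (t s : Tm S k n) : Form S k n r
  | rel {k n r : ℕ} (ρ : Rel S k n r) (t s : Tm S k n) : Form S k n r
  | imp {k n r : ℕ} (φ ψ : Form S k n r) : Form S k n r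
  | bot {k n r : ℕ} : Form S k n r
  | top {k n r : ℕ} : Form S k n r
  | and {k n r : ℕ} (φ ψ : Form S k n r) : Form S k n r
  | or {k n r : ℕ} (φ ψ : Form S k n r) : Form S k n r
  | allTy {k n r : ℕ} (φ : Form S (k + 1) n r) : Form S k n r
  | allTm {k n r : ℕ} (σ : Typ S k) (φ : Form S k (n + 1) r) : Form S k n r
  | allRel {k n r : ℕ} (adm : Bool) (σ τ : Typ S k) (φ : Form S k n (r + 1)) : Form S k n r
  | exTy {k n r : ℕ} (φ : Form S (k + 1) n r) : Form S k n r
  | exTm {k n r : ℕ} (σ : Typ S k) (φ : Form S k (n + 1) r) : Form S k n r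
  | exRel {k n r : ℕ} (adm : Bool) (σ τ : Typ S k) (φ : Form S k n (r + 1)) : Form S k n r

/-- Definable relations `R`, `(x:σ, y:τ). φ` (where `x` has index `1` and `y` index `0`), and
`σ[ρ₁, …, ρₘ]` for a type `α₁, …, αₘ ⊢ σ`. -/
inductive Rel (S : Sig.{u, v}) : ℕ → ℕ → ℕ → Type (max u v)
  | var {k n r : ℕ} (j : Fin r) : Rel S k n r
  | abs {k n r : ℕ} (σ τ : Typ S k) (φ : Form S k (n + 2) r) : Rel S k n r
  | interp {k n r m : ℕ} (σ : Typ S m) (ρ : Fin m → Rel S k n r) : Rel S k n r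

end

section Renaming

variable {S : Sig.{u, v}}

mutual

def Form.ren : {k n r k' n' r' : ℕ} → (Fin k → Fin k') → (Fin n → Fin n') → (Fin r → Fin r') →
    Form S k n r → Form S k' n' r'
  | _, _, _, _, _, _, f, g, _, .eq σ t s => .eq (σ.ren f) (t.ren f g) (s.ren f g)
  | _, _, _, _, _, _, f, g, h, .rel ρ t s => .rel (ρ.ren f g h) (t.ren f g) (s.ren f g)
  | _, _, _, _, _, _, f, g, h, .imp φ ψ => .imp (φ.ren f g h) (ψ.ren f g h)
  | _, _, _, _, _, _, _, _, _, .bot => .bot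
  | _, _, _, _, _, _, _, _, _, .top => .top
  | _, _, _, _, _, _, f, g, h, .and φ ψ => .and (φ.ren f g h) (ψ.ren f g h)
  | _, _, _, _, _, _, f, g, h, .or φ ψ => .or (φ.ren f g h) (ψ.ren f g h)
  | _, _, _, _, _, _, f, g, h, .allTy φ => .allTy (φ.ren (up f) g h)
  | _, _, _, _, _, _, f, g, h, .allTm σ φ => .allTm (σ.ren f) (φ.ren f (up g) h)
  | _, _, _, _, _, _, f, g, h, .allRel a σ τ φ =>
      .allRel a (σ.ren f) (τ.ren f) (φ.ren f g (up h))
  | _, _, _, _, _, _, f, g, h, .exTy φ => .exTy (φ.ren (up f) g h)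
  | _, _, _, _, _, _, f, g, h, .exTm σ φ => .exTm (σ.ren f) (φ.ren f (up g) h)
  | _, _, _, _, _, _, f, g, h, .exRel a σ τ φ =>
      .exRel a (σ.ren f) (τ.ren f) (φ.ren f g (up h))

def Rel.ren : {k n r k' n' r' : ℕ} → (Fin k → Fin k') → (Fin n → Fin n') → (Fin r → Fin r') →
    Rel S k n r → Rel S k' n' r'
  | _, _, _, _, _, _, _, _, h, .var j => .var (h j)
  | _, _, _, _, _, _, f, g, h, .abs σ τ φ => .abs (σ.ren f) (τ.ren f) (φ.ren f (up (up g)) h)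
  | _, _, _, _, _, _, f, g, h, .interp σ ρ => .interp σ fun i => (ρ i).ren f g h

end

/-- A relation substitution taken under one relation binder. -/
def Rel.upS {k n r r' : ℕ} (q : Fin r → Rel S k n r') : Fin (r + 1) → Rel S k n (r' + 1) :=
  push (.var 0) fun j => (q j).ren id id Fin.succ

mutual

/-- Simultaneous substitution of types, terms and relations. -/
def Form.subst : {k n r k' n' r' : ℕ} → (Fin k → Typ S k') → (Fin n → Tm S k' n') →
    (Fin r → Rel S k' n' r') → Form S k n r → Form S k' n' r'
  | _, _, _, _, _, _, θ, s, _, .eq σ t t' => .eq (σ.subst θ) (t.subst θ s) (t'.subst θ s)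
  | _, _, _, _, _, _, θ, s, q, .rel ρ t t' => .rel (ρ.subst θ s q) (t.subst θ s) (t'.subst θ s)
  | _, _, _, _, _, _, θ, s, q, .imp φ ψ => .imp (φ.subst θ s q) (ψ.subst θ s q)
  | _, _, _, _, _, _, _, _, _, .bot => .bot
  | _, _, _, _, _, _, _, _, _, .top => .top
  | _, _, _, _, _, _, θ, s, q, .and φ ψ => .and (φ.subst θ s q) (ψ.subst θ s q)
  | _, _, _, _, _, _, θ, s, q, .or φ ψ => .or (φ.subst θ s q) (ψ.subst θ s q)
  | _, _, _, _, _, _, θ, s, q, .allTy φ =>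
      .allTy (φ.subst (Ty.upS θ) (fun i => (s i).wkTy) fun j => (q j).ren Fin.succ id id)
  | _, _, _, _, _, _, θ, s, q, .allTm σ φ =>
      .allTm (σ.subst θ) (φ.subst θ (Tm.upS s) fun j => (q j).ren id Fin.succ id)
  | _, _, _, _, _, _, θ, s, q, .allRel a σ τ φ =>
      .allRel a (σ.subst θ) (τ.subst θ) (φ.subst θ s (Rel.upS q))
  | _, _, _, _, _, _, θ, s, q, .exTy φ =>
      .exTy (φ.subst (Ty.upS θ) (fun i => (s i).wkTy) fun j => (q j).ren Fin.succ id id)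
  | _, _, _, _, _, _, θ, s, q, .exTm σ φ =>
      .exTm (σ.subst θ) (φ.subst θ (Tm.upS s) fun j => (q j).ren id Fin.succ id)
  | _, _, _, _, _, _, θ, s, q, .exRel a σ τ φ =>
      .exRel a (σ.subst θ) (τ.subst θ) (φ.subst θ s (Rel.upS q))

def Rel.subst : {k n r k' n' r' : ℕ} → (Fin k → Typ S k') → (Fin n → Tm S k' n') →
    (Fin r → Rel S k' n' r') → Rel S k n r → Rel S k' n' r'
  | _, _, _, _, _, _, _, _, q, .var j => q j
  | _, _, _, _, _, _, θ, s, q, .abs σ τ φ =>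
      .abs (σ.subst θ) (τ.subst θ)
        (φ.subst θ (Tm.upS (Tm.upS s)) fun j => (q j).ren id (fun i => i.succ.succ) id)
  | _, _, _, _, _, _, θ, s, q, .interp σ ρ => .interp σ fun i => (ρ i).subst θ s q

end

/-- Weakening by one type variable, by one term variable, by one relation variable. -/
def Form.wkTy {k n r : ℕ} (φ : Form S k n r) : Form S (k + 1) n r := φ.ren Fin.succ id id
def Form.wkTm {k n r : ℕ} (φ : Form S k n r) : Form S k (n + 1) r := φ.ren id Fin.succ id
def Form.wkRel {k n r : ℕ} (φ : Form S k n r) : Form S k n (r + 1) := φ.ren id id Fin.succ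

/-- Weakening of a relation by two term variables. -/
def Rel.wk2 {k n r : ℕ} (ρ : Rel S k n r) : Rel S k (n + 2) r :=
  ρ.ren id (fun i => i.succ.succ) id

/-- Bi-implication. -/
def Form.iff {k n r : ℕ} (φ ψ : Form S k n r) : Form S k n r := .and (.imp φ ψ) (.imp ψ φ)

/-- `∀x:σ. ∀y:τ. φ`. -/
def Form.allTm2 {k n r : ℕ} (σ τ : Typ S k) (φ : Form S k (n + 2) r) : Form S k n r :=
  .allTm σ (.allTm τ φ)

/-- `φ[t,s/x,y]`, where `x` has index `1` and `y` has index `0`. -/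
def Form.inst2 {k n r : ℕ} (φ : Form S k (n + 2) r) (t s : Tm S k n) : Form S k n r :=
  φ.subst Ty.var (push s (push t Tm.var)) Rel.var

/-- The universal closure `∀α₁ … ∀αₖ. φ`. -/
def Form.closeTy : {k : ℕ} → Form S k 0 0 → Form S 0 0 0
  | 0, φ => φ
  | _ + 1, φ => Form.closeTy (.allTy φ)

end Renaming

/-! ## Constructions on relations -/

namespace Rel

variable {S : Sig.{u, v}} {k n r : ℕ}

/-- `ρ ≡ ρ'`, that is `∀x:σ. ∀y:τ. ρ(x,y) ⊃⊂ ρ'(x,y)`. -/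
def equiv (σ τ : Typ S k) (ρ ρ' : Rel S k n r) : Form S k n r :=
  .allTm2 σ τ (.iff (.rel ρ.wk2 (.var 1) (.var 0)) (.rel ρ'.wk2 (.var 1) (.var 0)))

/-- The graph `⟨f⟩ = (x:σ, y:τ). f x =_τ y`. -/
def graph (σ τ : Typ S k) (f : Tm S k n) : Rel S k n r :=
  .abs σ τ (.eq τ (.app f.wk.wk (.var 1)) (.var 0))

/-- The equality relation: the graph of the identity. -/
def eqRel (σ : Typ S k) : Rel S k n r := graph σ σ (Tm.idTm σ)

/-- `(x:σ', y:τ'). ρ(t x, u y)`. -/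
def pullback (σ' τ' : Typ S k) (t u : Tm S k n) (ρ : Rel S k n r) : Rel S k n r :=
  .abs σ' τ' (.rel ρ.wk2 (.app t.wk.wk (.var 1)) (.app u.wk.wk (.var 0)))

/-- `ρ ⊸ ρ'` for `ρ : Rel(σ,τ)` and `ρ' : Rel(σ',τ')`. -/
def lolli (σ τ σ' τ' : Typ S k) (ρ ρ' : Rel S k n r) : Rel S k n r :=
  .abs (.lolli σ σ') (.lolli τ τ')
    (.allTm2 σ τ (.imp (.rel ρ.wk2.wk2 (.var 1) (.var 0))
      (.rel ρ'.wk2.wk2 (.app (.var 3) (.var 1)) (.app (.var 2) (.var 0)))))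

/-- `ρ → ρ'` for `ρ : Rel(σ,τ)` and `ρ' : Rel(σ',τ')`. -/
def arrow (σ τ σ' τ' : Typ S k) (ρ ρ' : Rel S k n r) : Rel S k n r :=
  .abs (.arrow σ σ') (.arrow τ τ')
    (.allTm2 σ τ (.imp (.rel ρ.wk2.wk2 (.var 1) (.var 0))
      (.rel ρ'.wk2.wk2 (.app (.var 3) (.bang (.var 1))) (.app (.var 2) (.bang (.var 0))))))

/-- `∀α. ∀β. ∀R : Adm(α,β). φ`, where `α` has index `1` and `β` has index `0`. -/
def allAdm (φ : Form S (k + 2) n (r + 1)) : Form S k n r :=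
  .allTy (.allTy (.allRel true (.var 1) (.var 0) φ))

/-- Weakening along `α, β, R : Adm(α,β)` and two term variables. -/
def wkAll (ρ : Rel S k n r) : Rel S (k + 2) (n + 2) (r + 1) :=
  ρ.ren (fun i => i.succ.succ) (fun i => i.succ.succ) Fin.succ

/-- `∀(α, β, R : Adm(α,β)). ρ`, from `Πα. σ` to `Πβ. τ`. Here `σ` lives in the context extended by
`α`, `τ` in the context extended by `β`, and `ρ` in the context extended by `α, β, R`. -/
def all (σ τ : Typ S (k + 1)) (ρ : Rel S (k + 2) n (r + 1)) : Rel S k n r :=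
  .abs (.all σ) (.all τ)
    (allAdm (.rel ρ.wk2 (.tyApp (.var 1) (.var 1)) (.tyApp (.var 0) (.var 0))))

/-- The relation `I_Rel`: the pairs `(x,y)` such that for all `α, β, R : Adm(α,β)` and `z R w`,
`(let ⋆ be x in z) R (let ⋆ be y in w)`. -/
def oneRel : Rel S k n r :=
  .abs .one .one (allAdm (.allTm2 (.var 1) (.var 0)
    (.imp (.rel (.var 0) (.var 1) (.var 0))
      (.rel (.var 0) (.letStar (.var 3) (.var 1)) (.letStar (.var 2) (.var 0))))))

/-- `ρ ⊗ ρ'`: the pairs `(x,y)` such that for all `α, β, R : Adm(α,β)` and all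
`t : σ ⊸ σ' ⊸ α`, `t' : τ ⊸ τ' ⊸ β` related by `ρ ⊸ ρ' ⊸ R`,
`(let x'⊗x'' be x in t x' x'') R (let y'⊗y'' be y in t' y' y'')`. -/
def tensor (σ τ σ' τ' : Typ S k) (ρ ρ' : Rel S k n r) : Rel S k n r :=
  .abs (.tensor σ σ') (.tensor τ τ') (allAdm
    (.allTm2 (.lolli σ.wk.wk (.lolli σ'.wk.wk (.var 1)))
      (.lolli τ.wk.wk (.lolli τ'.wk.wk (.var 0)))
      (.imp
        (.rel (lolli σ.wk.wk τ.wk.wk (.lolli σ'.wk.wk (.var 1)) (.lolli τ'.wk.wk (.var 0))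
            ρ.wkAll.wk2 (lolli σ'.wk.wk τ'.wk.wk (.var 1) (.var 0) ρ'.wkAll.wk2 (.var 0)))
          (.var 1) (.var 0))
        (.rel (.var 0)
          (.letTensor σ.wk.wk σ'.wk.wk (.var 3) (.app (.app (.var 3) (.var 1)) (.var 0)))
          (.letTensor τ.wk.wk τ'.wk.wk (.var 2) (.app (.app (.var 2) (.var 1)) (.var 0)))))))

/-- `!ρ`: the pairs `(x,y)` such that for all `α, β, R : Adm(α,β)` and all `g : σ → α`,
`g' : τ → β` related by `ρ → R`, `(g x) R (g' y)`. -/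
def bang (σ τ : Typ S k) (ρ : Rel S k n r) : Rel S k n r :=
  .abs (.bang σ) (.bang τ) (allAdm
    (.allTm2 (.arrow σ.wk.wk (.var 1)) (.arrow τ.wk.wk (.var 0))
      (.imp
        (.rel (arrow σ.wk.wk τ.wk.wk (.var 1) (.var 0) ρ.wkAll.wk2 (.var 0)) (.var 1) (.var 0))
        (.rel (.var 0) (.app (.var 1) (.var 3)) (.app (.var 0) (.var 2))))))

end Rel

/-! ## Judgements of the logic -/

/-- Declaration of a relation variable between two types; `adm` is `true` if the variable ranges
over admissible relations. -/
structure RelDecl (S : Sig.{u, v}) (k : ℕ) where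
  adm : Bool
  dom : Typ S k
  cod : Typ S k

section Logic

variable {S : Sig.{u, v}}

/-- Weakening of a relational context by one type variable. -/
def wkRCtx {k r : ℕ} (Θ : Fin r → RelDecl S k) : Fin r → RelDecl S (k + 1) :=
  fun j => ⟨(Θ j).adm, (Θ j).dom.wk, (Θ j).cod.wk⟩

variable (Ax : Form S 0 0 0 → Prop)

mutual

/-- `Ξ | Γ | Θ ⊢ φ : Prop`. -/
inductive FormWF : {k n r : ℕ} → (Fin n → Typ S k) → (Fin r → RelDecl S k) →
    Form S k n r → Prop
  | eq {k n r : ℕ} {Γ : Fin n → Typ S k} {Θ : Fin r → RelDecl S k} {σ : Typ S k}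
      {t s : Tm S k n} : HasTyI Γ t σ → HasTyI Γ s σ → FormWF Γ Θ (.eq σ t s)
  | rel {k n r : ℕ} {Γ : Fin n → Typ S k} {Θ : Fin r → RelDecl S k} {σ τ : Typ S k}
      {ρ : Rel S k n r} {t s : Tm S k n} : RelWF Γ Θ ρ σ τ → HasTyI Γ t σ → HasTyI Γ s τ →
      FormWF Γ Θ (.rel ρ t s)
  | imp {k n r : ℕ} {Γ : Fin n → Typ S k} {Θ : Fin r → RelDecl S k} {φ ψ : Form S k n r} :
      FormWF Γ Θ φ → FormWF Γ Θ ψ → FormWF Γ Θ (.imp φ ψ)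
  | bot {k n r : ℕ} {Γ : Fin n → Typ S k} {Θ : Fin r → RelDecl S k} : FormWF Γ Θ .bot
  | top {k n r : ℕ} {Γ : Fin n → Typ S k} {Θ : Fin r → RelDecl S k} : FormWF Γ Θ .top
  | and {k n r : ℕ} {Γ : Fin n → Typ S k} {Θ : Fin r → RelDecl S k} {φ ψ : Form S k n r} :
      FormWF Γ Θ φ → FormWF Γ Θ ψ → FormWF Γ Θ (.and φ ψ)
  | or {k n r : ℕ} {Γ : Fin n → Typ S k} {Θ : Fin r → RelDecl S k} {φ ψ : Form S k n r} :
      FormWF Γ Θ φ → FormWF Γ Θ ψ → FormWF Γ Θ (.or φ ψ)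
  | allTy {k n r : ℕ} {Γ : Fin n → Typ S k} {Θ : Fin r → RelDecl S k} {φ : Form S (k + 1) n r} :
      FormWF (wkCtx Γ) (wkRCtx Θ) φ → FormWF Γ Θ (.allTy φ)
  | allTm {k n r : ℕ} {Γ : Fin n → Typ S k} {Θ : Fin r → RelDecl S k} {σ : Typ S k}
      {φ : Form S k (n + 1) r} : FormWF (push σ Γ) Θ φ → FormWF Γ Θ (.allTm σ φ)
  | allRel {k n r : ℕ} {Γ : Fin n → Typ S k} {Θ : Fin r → RelDecl S k} {a : Bool}
      {σ τ : Typ S k} {φ : Form S k n (r + 1)} : FormWF Γ (push ⟨a, σ, τ⟩ Θ) φ →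
      FormWF Γ Θ (.allRel a σ τ φ)
  | exTy {k n r : ℕ} {Γ : Fin n → Typ S k} {Θ : Fin r → RelDecl S k} {φ : Form S (k + 1) n r} :
      FormWF (wkCtx Γ) (wkRCtx Θ) φ → FormWF Γ Θ (.exTy φ)
  | exTm {k n r : ℕ} {Γ : Fin n → Typ S k} {Θ : Fin r → RelDecl S k} {σ : Typ S k}
      {φ : Form S k (n + 1) r} : FormWF (push σ Γ) Θ φ → FormWF Γ Θ (.exTm σ φ)
  | exRel {k n r : ℕ} {Γ : Fin n → Typ S k} {Θ : Fin r → RelDecl S k} {a : Bool}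
      {σ τ : Typ S k} {φ : Form S k n (r + 1)} : FormWF Γ (push ⟨a, σ, τ⟩ Θ) φ →
      FormWF Γ Θ (.exRel a σ τ φ)

/-- `Ξ | Γ | Θ ⊢ ρ : Rel(σ,τ)`. -/
inductive RelWF : {k n r : ℕ} → (Fin n → Typ S k) → (Fin r → RelDecl S k) →
    Rel S k n r → Typ S k → Typ S k → Prop
  | var {k n r : ℕ} {Γ : Fin n → Typ S k} {Θ : Fin r → RelDecl S k} (j : Fin r) :
      RelWF Γ Θ (.var j) (Θ j).dom (Θ j).cod
  | abs {k n r : ℕ} {Γ : Fin n → Typ S k} {Θ : Fin r → RelDecl S k} {σ τ : Typ S k}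
      {φ : Form S k (n + 2) r} : FormWF (push τ (push σ Γ)) Θ φ → RelWF Γ Θ (.abs σ τ φ) σ τ
  | ofAdm {k n r : ℕ} {Γ : Fin n → Typ S k} {Θ : Fin r → RelDecl S k} {σ τ : Typ S k}
      {ρ : Rel S k n r} : Adm Γ Θ ρ σ τ → RelWF Γ Θ ρ σ τ

/-- `Ξ | Γ | Θ ⊢ ρ : Adm(σ,τ)`: admissible relations. -/
inductive Adm : {k n r : ℕ} → (Fin n → Typ S k) → (Fin r → RelDecl S k) →
    Rel S k n r → Typ S k → Typ S k → Prop
  | var {k n r : ℕ} {Γ : Fin n → Typ S k} {Θ : Fin r → RelDecl S k} (j : Fin r) :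
      (Θ j).adm = true → Adm Γ Θ (.var j) (Θ j).dom (Θ j).cod
  | eqRel {k n r : ℕ} {Γ : Fin n → Typ S k} {Θ : Fin r → RelDecl S k} (σ : Typ S k) :
      Adm Γ Θ (Rel.eqRel σ) σ σ
  | pullback {k n r : ℕ} {Γ : Fin n → Typ S k} {Θ : Fin r → RelDecl S k} {σ τ σ' τ' : Typ S k}
      {ρ : Rel S k n r} {t s : Tm S k n} : Adm Γ Θ ρ σ τ → HasTyI Γ t (.lolli σ' σ) →
      HasTyI Γ s (.lolli τ' τ) → Adm Γ Θ (Rel.pullback σ' τ' t s ρ) σ' τ'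
  | and {k n r : ℕ} {Γ : Fin n → Typ S k} {Θ : Fin r → RelDecl S k} {σ τ : Typ S k}
      {ρ ρ' : Rel S k n r} : Adm Γ Θ ρ σ τ → Adm Γ Θ ρ' σ τ →
      Adm Γ Θ (.abs σ τ (.and (.rel ρ.wk2 (.var 1) (.var 0)) (.rel ρ'.wk2 (.var 1) (.var 0)))) σ τ
  | op {k n r : ℕ} {Γ : Fin n → Typ S k} {Θ : Fin r → RelDecl S k} {σ τ : Typ S k}
      {ρ : Rel S k n r} : Adm Γ Θ ρ σ τ →
      Adm Γ Θ (.abs τ σ (.rel ρ.wk2 (.var 0) (.var 1))) τ σ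
  | top {k n r : ℕ} {Γ : Fin n → Typ S k} {Θ : Fin r → RelDecl S k} (σ τ : Typ S k) :
      Adm Γ Θ (.abs σ τ .top) σ τ
  | imp {k n r : ℕ} {Γ : Fin n → Typ S k} {Θ : Fin r → RelDecl S k} {σ τ : Typ S k}
      {ρ : Rel S k n r} {φ : Form S k n r} : Adm Γ Θ ρ σ τ → FormWF Γ Θ φ →
      Adm Γ Θ (.abs σ τ (.imp φ.wkTm.wkTm (.rel ρ.wk2 (.var 1) (.var 0)))) σ τ
  | allTy {k n r : ℕ} {Γ : Fin n → Typ S k} {Θ : Fin r → RelDecl S k} {σ τ : Typ S k}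
      {ρ : Rel S (k + 1) n r} : Adm (wkCtx Γ) (wkRCtx Θ) ρ σ.wk τ.wk →
      Adm Γ Θ (.abs σ τ (.allTy (.rel ρ.wk2 (.var 1) (.var 0)))) σ τ
  | allTm {k n r : ℕ} {Γ : Fin n → Typ S k} {Θ : Fin r → RelDecl S k} {σ τ ω : Typ S k}
      {ρ : Rel S k (n + 1) r} : Adm (push ω Γ) Θ ρ σ τ →
      Adm Γ Θ (.abs σ τ (.allTm ω
        (.rel (ρ.ren id (up fun i => i.succ.succ) id) (.var 2) (.var 1)))) σ τ
  | allRel {k n r : ℕ} {Γ : Fin n → Typ S k} {Θ : Fin r → RelDecl S k} {σ τ ω ω' : Typ S k}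
      {a : Bool} {ρ : Rel S k n (r + 1)} : Adm Γ (push ⟨a, ω, ω'⟩ Θ) ρ σ τ →
      Adm Γ Θ (.abs σ τ (.allRel a ω ω' (.rel ρ.wk2 (.var 1) (.var 0)))) σ τ
  | equiv {k n r : ℕ} {Γ : Fin n → Typ S k} {Θ : Fin r → RelDecl S k} {σ τ : Typ S k}
      {ρ ρ' : Rel S k n r} : Adm Γ Θ ρ σ τ → RelWF Γ Θ ρ' σ τ →
      Prov Γ Θ [] (Rel.equiv σ τ ρ ρ') → Adm Γ Θ ρ' σ τ
  | interp {k n r m : ℕ} {Γ : Fin n → Typ S k} {Θ : Fin r → RelDecl S k} (σ : Typ S m)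
      {τ τ' : Fin m → Typ S k} {ρ : Fin m → Rel S k n r} : (∀ i, Adm Γ Θ (ρ i) (τ i) (τ' i)) →
      Adm Γ Θ (.interp σ ρ) (σ.subst τ) (σ.subst τ')

/-- `Ξ | Γ | Θ | Φ ⊢ ψ`: provability in LAPL extended by the closed propositions in `Ax` as
axioms. The predicate logic is intuitionistic. -/
inductive Prov : {k n r : ℕ} → (Fin n → Typ S k) → (Fin r → RelDecl S k) →
    List (Form S k n r) → Form S k n r → Prop
  | ax {Γ : Fin 0 → Typ S 0} {Θ : Fin 0 → RelDecl S 0} {φ : Form S 0 0 0} :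
      Ax φ → FormWF Γ Θ φ → Prov Γ Θ [] φ
  -- structural rules
  | hyp {k n r : ℕ} {Γ : Fin n → Typ S k} {Θ : Fin r → RelDecl S k} {Φ : List (Form S k n r)}
      {φ : Form S k n r} : φ ∈ Φ → FormWF Γ Θ φ → Prov Γ Θ Φ φ
  | weaken {k n r : ℕ} {Γ : Fin n → Typ S k} {Θ : Fin r → RelDecl S k}
      {Φ Φ' : List (Form S k n r)} {φ : Form S k n r} : (∀ χ ∈ Φ, χ ∈ Φ') → Prov Γ Θ Φ φ →
      Prov Γ Θ Φ' φ
  /-- The substitution rules for types, terms, relations and admissible relations, in simultaneous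
  form; weakening and exchange of variables are special cases. -/
  | subst {k n r k' n' r' : ℕ} {Γ : Fin n → Typ S k} {Θ : Fin r → RelDecl S k}
      {Γ' : Fin n' → Typ S k'} {Θ' : Fin r' → RelDecl S k'} {Φ : List (Form S k n r)}
      {φ : Form S k n r} (θ : Fin k → Typ S k') (s : Fin n → Tm S k' n')
      (q : Fin r → Rel S k' n' r') : (∀ i, HasTyI Γ' (s i) ((Γ i).subst θ)) →
      (∀ j, RelWF Γ' Θ' (q j) ((Θ j).dom.subst θ) ((Θ j).cod.subst θ)) →
      (∀ j, (Θ j).adm = true → Adm Γ' Θ' (q j) ((Θ j).dom.subst θ) ((Θ j).cod.subst θ)) →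
      Prov Γ Θ Φ φ → Prov Γ' Θ' (Φ.map (Form.subst θ s q)) (φ.subst θ s q)
  -- connectives
  | topI {k n r : ℕ} {Γ : Fin n → Typ S k} {Θ : Fin r → RelDecl S k}
      {Φ : List (Form S k n r)} : Prov Γ Θ Φ .top
  | botE {k n r : ℕ} {Γ : Fin n → Typ S k} {Θ : Fin r → RelDecl S k}
      {Φ : List (Form S k n r)} {φ : Form S k n r} : FormWF Γ Θ φ → Prov Γ Θ Φ .bot → Prov Γ Θ Φ φ
  | impI {k n r : ℕ} {Γ : Fin n → Typ S k} {Θ : Fin r → RelDecl S k}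
      {Φ : List (Form S k n r)} {φ ψ : Form S k n r} : FormWF Γ Θ φ → Prov Γ Θ (φ :: Φ) ψ →
      Prov Γ Θ Φ (.imp φ ψ)
  | impE {k n r : ℕ} {Γ : Fin n → Typ S k} {Θ : Fin r → RelDecl S k}
      {Φ : List (Form S k n r)} {φ ψ : Form S k n r} : Prov Γ Θ Φ (.imp φ ψ) → Prov Γ Θ Φ φ →
      Prov Γ Θ Φ ψ
  | andI {k n r : ℕ} {Γ : Fin n → Typ S k} {Θ : Fin r → RelDecl S k}
      {Φ : List (Form S k n r)} {φ ψ : Form S k n r} : Prov Γ Θ Φ φ → Prov Γ Θ Φ ψ →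
      Prov Γ Θ Φ (.and φ ψ)
  | andE₁ {k n r : ℕ} {Γ : Fin n → Typ S k} {Θ : Fin r → RelDecl S k}
      {Φ : List (Form S k n r)} {φ ψ : Form S k n r} : Prov Γ Θ Φ (.and φ ψ) → Prov Γ Θ Φ φ
  | andE₂ {k n r : ℕ} {Γ : Fin n → Typ S k} {Θ : Fin r → RelDecl S k}
      {Φ : List (Form S k n r)} {φ ψ : Form S k n r} : Prov Γ Θ Φ (.and φ ψ) → Prov Γ Θ Φ ψ
  | orI₁ {k n r : ℕ} {Γ : Fin n → Typ S k} {Θ : Fin r → RelDecl S k}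
      {Φ : List (Form S k n r)} {φ ψ : Form S k n r} : FormWF Γ Θ ψ → Prov Γ Θ Φ φ →
      Prov Γ Θ Φ (.or φ ψ)
  | orI₂ {k n r : ℕ} {Γ : Fin n → Typ S k} {Θ : Fin r → RelDecl S k}
      {Φ : List (Form S k n r)} {φ ψ : Form S k n r} : FormWF Γ Θ φ → Prov Γ Θ Φ ψ →
      Prov Γ Θ Φ (.or φ ψ)
  | orE {k n r : ℕ} {Γ : Fin n → Typ S k} {Θ : Fin r → RelDecl S k}
      {Φ : List (Form S k n r)} {φ ψ χ : Form S k n r} : Prov Γ Θ Φ (.or φ ψ) →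
      Prov Γ Θ (φ :: Φ) χ → Prov Γ Θ (ψ :: Φ) χ → Prov Γ Θ Φ χ
  -- the rules for quantifiers, in both directions
  | allTyI {k n r : ℕ} {Γ : Fin n → Typ S k} {Θ : Fin r → RelDecl S k}
      {Φ : List (Form S k n r)} {ψ : Form S (k + 1) n r} :
      Prov (wkCtx Γ) (wkRCtx Θ) (Φ.map Form.wkTy) ψ → Prov Γ Θ Φ (.allTy ψ)
  | allTyE {k n r : ℕ} {Γ : Fin n → Typ S k} {Θ : Fin r → RelDecl S k}
      {Φ : List (Form S k n r)} {ψ : Form S (k + 1) n r} :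
      Prov Γ Θ Φ (.allTy ψ) → Prov (wkCtx Γ) (wkRCtx Θ) (Φ.map Form.wkTy) ψ
  | allTmI {k n r : ℕ} {Γ : Fin n → Typ S k} {Θ : Fin r → RelDecl S k}
      {Φ : List (Form S k n r)} {σ : Typ S k} {ψ : Form S k (n + 1) r} :
      Prov (push σ Γ) Θ (Φ.map Form.wkTm) ψ → Prov Γ Θ Φ (.allTm σ ψ)
  | allTmE {k n r : ℕ} {Γ : Fin n → Typ S k} {Θ : Fin r → RelDecl S k}
      {Φ : List (Form S k n r)} {σ : Typ S k} {ψ : Form S k (n + 1) r} :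
      Prov Γ Θ Φ (.allTm σ ψ) → Prov (push σ Γ) Θ (Φ.map Form.wkTm) ψ
  | allRelI {k n r : ℕ} {Γ : Fin n → Typ S k} {Θ : Fin r → RelDecl S k}
      {Φ : List (Form S k n r)} {a : Bool} {σ τ : Typ S k} {ψ : Form S k n (r + 1)} :
      Prov Γ (push ⟨a, σ, τ⟩ Θ) (Φ.map Form.wkRel) ψ → Prov Γ Θ Φ (.allRel a σ τ ψ)
  | allRelE {k n r : ℕ} {Γ : Fin n → Typ S k} {Θ : Fin r → RelDecl S k}
      {Φ : List (Form S k n r)} {a : Bool} {σ τ : Typ S k} {ψ : Form S k n (r + 1)} :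
      Prov Γ Θ Φ (.allRel a σ τ ψ) → Prov Γ (push ⟨a, σ, τ⟩ Θ) (Φ.map Form.wkRel) ψ
  | exTyE {k n r : ℕ} {Γ : Fin n → Typ S k} {Θ : Fin r → RelDecl S k}
      {Φ : List (Form S k n r)} {φ : Form S (k + 1) n r} {ψ : Form S k n r} : FormWF Γ Θ ψ →
      Prov (wkCtx Γ) (wkRCtx Θ) (φ :: Φ.map Form.wkTy) ψ.wkTy → Prov Γ Θ (.exTy φ :: Φ) ψ
  | exTyI {k n r : ℕ} {Γ : Fin n → Typ S k} {Θ : Fin r → RelDecl S k}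
      {Φ : List (Form S k n r)} {φ : Form S (k + 1) n r} {ψ : Form S k n r} :
      Prov Γ Θ (.exTy φ :: Φ) ψ →
      Prov (wkCtx Γ) (wkRCtx Θ) (φ :: Φ.map Form.wkTy) ψ.wkTy
  | exTmE {k n r : ℕ} {Γ : Fin n → Typ S k} {Θ : Fin r → RelDecl S k}
      {Φ : List (Form S k n r)} {σ : Typ S k} {φ : Form S k (n + 1) r} {ψ : Form S k n r} :
      FormWF Γ Θ ψ → Prov (push σ Γ) Θ (φ :: Φ.map Form.wkTm) ψ.wkTm →
      Prov Γ Θ (.exTm σ φ :: Φ) ψ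
  | exTmI {k n r : ℕ} {Γ : Fin n → Typ S k} {Θ : Fin r → RelDecl S k}
      {Φ : List (Form S k n r)} {σ : Typ S k} {φ : Form S k (n + 1) r} {ψ : Form S k n r} :
      Prov Γ Θ (.exTm σ φ :: Φ) ψ → Prov (push σ Γ) Θ (φ :: Φ.map Form.wkTm) ψ.wkTm
  | exRelE {k n r : ℕ} {Γ : Fin n → Typ S k} {Θ : Fin r → RelDecl S k}
      {Φ : List (Form S k n r)} {a : Bool} {σ τ : Typ S k} {φ : Form S k n (r + 1)}
      {ψ : Form S k n r} : FormWF Γ Θ ψ →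
      Prov Γ (push ⟨a, σ, τ⟩ Θ) (φ :: Φ.map Form.wkRel) ψ.wkRel →
      Prov Γ Θ (.exRel a σ τ φ :: Φ) ψ
  | exRelI {k n r : ℕ} {Γ : Fin n → Typ S k} {Θ : Fin r → RelDecl S k}
      {Φ : List (Form S k n r)} {a : Bool} {σ τ : Typ S k} {φ : Form S k n (r + 1)}
      {ψ : Form S k n r} : Prov Γ Θ (.exRel a σ τ φ :: Φ) ψ →
      Prov Γ (push ⟨a, σ, τ⟩ Θ) (φ :: Φ.map Form.wkRel) ψ.wkRel
  -- internal equality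
  | extEq {k n r : ℕ} {Γ : Fin n → Typ S k} {Θ : Fin r → RelDecl S k}
      {Φ : List (Form S k n r)} {σ : Typ S k} {t s : Tm S k n} :
      HasTyI Γ t σ → HasTyI Γ s σ → ExtEq Γ (fun _ => Mult.many) t s σ →
      Prov Γ Θ Φ (.eq σ t s)
  | symm {k n r : ℕ} {Γ : Fin n → Typ S k} {Θ : Fin r → RelDecl S k}
      {Φ : List (Form S k n r)} {σ : Typ S k} {t s : Tm S k n} :
      Prov Γ Θ Φ (.eq σ t s) → Prov Γ Θ Φ (.eq σ s t)
  | trans {k n r : ℕ} {Γ : Fin n → Typ S k} {Θ : Fin r → RelDecl S k}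
      {Φ : List (Form S k n r)} {σ : Typ S k} {t s s' : Tm S k n} :
      Prov Γ Θ Φ (.eq σ t s) → Prov Γ Θ Φ (.eq σ s s') → Prov Γ Θ Φ (.eq σ t s')
  /-- The substitution axiom `R(x,y) ∧ x =_α x' ∧ y =_β y' ⊃ R(x',y')`, as a rule. -/
  | substitution {k n r : ℕ} {Γ : Fin n → Typ S k} {Θ : Fin r → RelDecl S k}
      {Φ : List (Form S k n r)} {σ τ : Typ S k} {ρ : Rel S k n r} {t t' s s' : Tm S k n} :
      RelWF Γ Θ ρ σ τ → Prov Γ Θ Φ (.rel ρ t s) → Prov Γ Θ Φ (.eq σ t t') →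
      Prov Γ Θ Φ (.eq τ s s') → Prov Γ Θ Φ (.rel ρ t' s')
  -- definable relations
  | defRel {k n r : ℕ} {Γ : Fin n → Typ S k} {Θ : Fin r → RelDecl S k}
      {Φ : List (Form S k n r)} {σ τ : Typ S k} {φ : Form S k (n + 2) r} {t s : Tm S k n} :
      FormWF (push τ (push σ Γ)) Θ φ → HasTyI Γ t σ → HasTyI Γ s τ →
      Prov Γ Θ Φ (.iff (.rel (.abs σ τ φ) t s) (φ.inst2 t s))
  -- the relational interpretation of types
  | interpVar {k n r m : ℕ} {Γ : Fin n → Typ S k} {Θ : Fin r → RelDecl S k}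
      {Φ : List (Form S k n r)} {τ τ' : Fin m → Typ S k} {ρ : Fin m → Rel S k n r} (i : Fin m) :
      (∀ i, Adm Γ Θ (ρ i) (τ i) (τ' i)) →
      Prov Γ Θ Φ (Rel.equiv (τ i) (τ' i) (.interp (.var i) ρ) (ρ i))
  | interpLolli {k n r m : ℕ} {Γ : Fin n → Typ S k} {Θ : Fin r → RelDecl S k}
      {Φ : List (Form S k n r)} {τ τ' : Fin m → Typ S k} {ρ : Fin m → Rel S k n r}
      (σ σ' : Typ S m) : (∀ i, Adm Γ Θ (ρ i) (τ i) (τ' i)) →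
      Prov Γ Θ Φ (Rel.equiv ((Ty.lolli σ σ').subst τ) ((Ty.lolli σ σ').subst τ')
        (.interp (.lolli σ σ') ρ)
        (Rel.lolli (σ.subst τ) (σ.subst τ') (σ'.subst τ) (σ'.subst τ')
          (.interp σ ρ) (.interp σ' ρ)))
  | interpTensor {k n r m : ℕ} {Γ : Fin n → Typ S k} {Θ : Fin r → RelDecl S k}
      {Φ : List (Form S k n r)} {τ τ' : Fin m → Typ S k} {ρ : Fin m → Rel S k n r}
      (σ σ' : Typ S m) : (∀ i, Adm Γ Θ (ρ i) (τ i) (τ' i)) →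
      Prov Γ Θ Φ (Rel.equiv ((Ty.tensor σ σ').subst τ) ((Ty.tensor σ σ').subst τ')
        (.interp (.tensor σ σ') ρ)
        (Rel.tensor (σ.subst τ) (σ.subst τ') (σ'.subst τ) (σ'.subst τ')
          (.interp σ ρ) (.interp σ' ρ)))
  | interpOne {k n r m : ℕ} {Γ : Fin n → Typ S k} {Θ : Fin r → RelDecl S k}
      {Φ : List (Form S k n r)} {τ τ' : Fin m → Typ S k} {ρ : Fin m → Rel S k n r} :
      (∀ i, Adm Γ Θ (ρ i) (τ i) (τ' i)) →
      Prov Γ Θ Φ (Rel.equiv .one .one (.interp .one ρ) Rel.oneRel)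
  | interpAll {k n r m : ℕ} {Γ : Fin n → Typ S k} {Θ : Fin r → RelDecl S k}
      {Φ : List (Form S k n r)} {τ τ' : Fin m → Typ S k} {ρ : Fin m → Rel S k n r}
      (σ : Typ S (m + 1)) : (∀ i, Adm Γ Θ (ρ i) (τ i) (τ' i)) →
      Prov Γ Θ Φ (Rel.equiv ((Ty.all σ).subst τ) ((Ty.all σ).subst τ') (.interp (.all σ) ρ)
        (Rel.all (σ.subst (Ty.upS τ)) (σ.subst (Ty.upS τ'))
          (.interp σ (push (.var 0)
            fun i => (ρ i).ren (fun i => i.succ.succ) id Fin.succ))))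
  | interpBang {k n r m : ℕ} {Γ : Fin n → Typ S k} {Θ : Fin r → RelDecl S k}
      {Φ : List (Form S k n r)} {τ τ' : Fin m → Typ S k} {ρ : Fin m → Rel S k n r}
      (σ : Typ S m) : (∀ i, Adm Γ Θ (ρ i) (τ i) (τ' i)) →
      Prov Γ Θ Φ (Rel.equiv ((Ty.bang σ).subst τ) ((Ty.bang σ).subst τ')
        (.interp (.bang σ) ρ)
        (Rel.bang (σ.subst τ) (σ.subst τ') (.interp σ ρ)))
  /-- `σ[ρ₁/α₁, …, ρₘ/αₘ]` depends neither on the order of the variables `α₁, …, αₘ` nor on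
  variables that are not in `σ`. (With named variables both sides are the same expression. For
  types without type constants this is derivable from the preceding rules.) -/
  | interpRen {k n r m m' : ℕ} {Γ : Fin n → Typ S k} {Θ : Fin r → RelDecl S k}
      {Φ : List (Form S k n r)} {τ τ' : Fin m' → Typ S k} {ρ : Fin m' → Rel S k n r}
      (σ : Typ S m) (f : Fin m → Fin m') : Function.Injective f →
      (∀ i, Adm Γ Θ (ρ i) (τ i) (τ' i)) →
      Prov Γ Θ Φ (Rel.equiv ((σ.ren f).subst τ) ((σ.ren f).subst τ')
        (.interp (σ.ren f) ρ) (.interp σ fun i => ρ (f i)))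
  /-- The fixed-point combinator is related to itself. -/
  | fixRel {k n r : ℕ} {Γ : Fin n → Typ S k} {Θ : Fin r → RelDecl S k}
      {Φ : List (Form S k n r)} :
      Prov Γ Θ Φ (.rel (.interp Ty.fixTy Fin.elim0) .fix .fix)

end

/-- The identity extension schema `- | - | - ⊢ ∀α₁ … ∀αₘ. σ[eq_α₁, …, eq_αₘ] ≡ eq_σ`, for all
types `α₁, …, αₘ ⊢ σ`. -/
def IdentityExtension : Prop :=
  ∀ (m : ℕ) (σ : Typ S m), Prov Ax (Fin.elim0 : Fin 0 → Typ S 0) (Fin.elim0 : Fin 0 → RelDecl S 0)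
    [] (Form.closeTy
      (Rel.equiv σ σ (.interp σ fun i => Rel.eqRel (.var i)) (Rel.eqRel σ)))

/-- The two extensionality schemes `(∀x:σ. t x =_τ s x) ⊃ t =_{σ ⊸ τ} s` and
`(∀α. t α =_τ s α) ⊃ t =_{Πα.τ} s`. -/
def Extensionality : Prop :=
  (∀ (k n r : ℕ) (Γ : Fin n → Typ S k) (Θ : Fin r → RelDecl S k) (σ τ : Typ S k)
      (t s : Tm S k n), HasTyI Γ t (.lolli σ τ) → HasTyI Γ s (.lolli σ τ) →
      Prov Ax Γ Θ [] (.imp (.allTm σ (.eq τ (.app t.wk (.var 0)) (.app s.wk (.var 0))))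
        (.eq (.lolli σ τ) t s))) ∧
  (∀ (k n r : ℕ) (Γ : Fin n → Typ S k) (Θ : Fin r → RelDecl S k) (τ : Typ S (k + 1))
      (t s : Tm S k n), HasTyI Γ t (.all τ) → HasTyI Γ s (.all τ) →
      Prov Ax Γ Θ [] (.imp (.allTy (.eq τ (.tyApp t.wkTy (.var 0)) (.tyApp s.wkTy (.var 0))))
        (.eq (.all τ) t s)))

end Logic

/-! # Types as functors, algebras and coalgebras -/

section Functors

variable {S : Sig.{u, v}}

/-- The functorial action of a type `σ` with `m` type variables. For every variable `i` that occurs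
positively `F i` is a map `a i ⊸ b i`, for every variable that occurs negatively it is a map
`b i ⊸ a i`, and for a parameter `a i = b i` and `F i` is the identity. The result is a map
`σ(a) ⊸ σ(b)`. On the left of `⊸` the roles of `a` and `b` are exchanged. The clause for type
constants is used for inductively constructed types only; there, the arguments of type constants
contain parameters only, so that the two types `con c args` agree. -/
def act : {m : ℕ} → Typ S m → {k n : ℕ} → (a b : Fin m → Typ S k) → (F : Fin m → Tm S k n) →
    Tm S k n
  | _, .var i, _, _, _, _, F => F i
  | _, .con c args, _, _, a, _, _ => Tm.idTm ((Ty.con c args).subst a)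
  | _, .one, _, _, _, _, _ => Tm.idTm .one
  | _, .tensor σ τ, _, _, a, b, F =>
      .lam ((Ty.tensor σ τ).subst a) (.letTensor (σ.subst a) (τ.subst a) (.var 0)
        (.tensor (.app (act σ a b fun i => (F i).wk.wk.wk) (.var 1))
          (.app (act τ a b fun i => (F i).wk.wk.wk) (.var 0))))
  | _, .lolli σ τ, _, _, a, b, F =>
      .lam ((Ty.lolli σ τ).subst a) (.lam (σ.subst b)
        (.app (act τ a b fun i => (F i).wk.wk)
          (.app (.var 1) (.app (act σ b a fun i => (F i).wk.wk) (.var 0)))))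
  | _, .bang σ, _, _, a, b, F =>
      .lam ((Ty.bang σ).subst a) (.letBang (σ.subst a) (.var 0)
        (.bang (.app (act σ a b fun i => (F i).wk.wk) (.var 0))))
  | _, .all σ, _, _, a, b, F =>
      .lam ((Ty.all σ).subst a) (.tyLam
        (.app (act σ (Ty.upS a) (Ty.upS b)
            (push (Tm.idTm (.var 0)) fun i => (F i).wk.wkTy))
          (.tyApp (.var 0) (.var 0))))

/-- `M_σ : Πα. Πβ. (α ⊸ β) → σ(α) ⊸ σ(β)`, for `σ(α)` in which `α` occurs only positively. -/
def mapTm (σ : Typ S 1) : Tm S 0 0 :=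
  .tyLam (.tyLam (.ilam (.lolli (.var 1) (.var 0))
    (act σ (fun _ => .var 1) (fun _ => .var 0) fun _ => .var 0)))

/-- `σ(f) = M_σ τ τ' !f : σ(τ) ⊸ σ(τ')`, for `f : τ ⊸ τ'`. -/
def fmap (σ : Typ S 1) {k n : ℕ} (τ τ' : Typ S k) (f : Tm S k n) : Tm S k n :=
  .app (.tyApp (.tyApp (mapTm σ).cl τ) τ') (.bang f)

/-- `μα.σ(α) = Πα. (σ(α) ⊸ α) → α`. -/
def mu (σ : Typ S 1) : Typ S 0 :=
  .all (.arrow (.lolli (σ.at1 (.var 0)) (.var 0)) (.var 0))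

/-- `fold = Λα. λf:σ(α) ⊸ α. λ°u:μα.σ(α). u α !f`. -/
def foldTm (σ : Typ S 1) : Tm S 0 0 :=
  .tyLam (.ilam (.lolli (σ.at1 (.var 0)) (.var 0))
    (.lam (mu σ).cl (.app (.tyApp (.var 0) (.var 0)) (.bang (.var 1)))))

/-- `in = λ°z:σ(μα.σ(α)). Λα. λf:σ(α) ⊸ α. f (σ(fold α !f) z)`. -/
def inTm (σ : Typ S 1) : Tm S 0 0 :=
  .lam (σ.at1 (mu σ)) (.tyLam (.ilam (.lolli (σ.at1 (.var 0)) (.var 0))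
    (.app (.var 0)
      (.app (fmap σ (mu σ).cl (.var 0)
        (.app (.tyApp (foldTm σ).cl (.var 0)) (.bang (.var 0)))) (.var 1)))))

/-- The existential type `∐α.σ = Πβ. (Πα. σ ⊸ β) ⊸ β`. -/
def exTy (σ : Typ S 1) : Typ S 0 :=
  .all (.lolli (.all (.lolli (σ.at1 (.var 0)) (.var 1))) (.var 0))

/-- `pack = Λα. λ°x:σ. Λβ. λ°f:(Πα. σ ⊸ β). f α x`, of type `Πα. σ ⊸ ∐α.σ`. -/
def packTm (σ : Typ S 1) : Tm S 0 0 :=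
  .tyLam (.lam (σ.at1 (.var 0)) (.tyLam
    (.lam (.all (.lolli (σ.at1 (.var 0)) (.var 1)))
      (.app (.tyApp (.var 0) (.var 1)) (.var 1)))))

/-- `!(α ⊸ σ(α)) ⊗ α`. -/
def nuBody (σ : Typ S 1) : Typ S 1 :=
  .tensor (.bang (.lolli (.var 0) (σ.at1 (.var 0)))) (.var 0)

/-- `να.σ(α) = ∐α. !(α ⊸ σ(α)) ⊗ α`. -/
def nu (σ : Typ S 1) : Typ S 0 := exTy (nuBody σ)

/-- `unfold = Λα. λ°f:!(α ⊸ σ(α)). λ°x:α. pack α (f ⊗ x)`. -/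
def unfoldTm (σ : Typ S 1) : Tm S 0 0 :=
  .tyLam (.lam (.bang (.lolli (.var 0) (σ.at1 (.var 0)))) (.lam (.var 0)
    (.app (.tyApp (packTm (nuBody σ)).cl (.var 0)) (.tensor (.var 1) (.var 0)))))

/-- `r = Λα. λ°y:!(α ⊸ σ(α)) ⊗ α. let w ⊗ z be y in let !f be w in σ(unfold α !f) (f z)`. -/
def outAux (σ : Typ S 1) : Tm S 0 0 :=
  .tyLam (.lam (nuBody σ)
    (.letTensor (.bang (.lolli (.var 0) (σ.at1 (.var 0)))) (.var 0) (.var 0)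
      (.letBang (.lolli (.var 0) (σ.at1 (.var 0))) (.var 1)
        (.app (fmap σ (.var 0) (nu σ).cl
            (.app (.tyApp (unfoldTm σ).cl (.var 0)) (.bang (.var 0))))
          (.app (.var 0) (.var 1))))))

/-- `out = λ°x:να.σ(α). x σ(να.σ(α)) r`. -/
def outTm (σ : Typ S 1) : Tm S 0 0 :=
  .lam (nu σ) (.app (.tyApp (.var 0) (σ.at1 (nu σ))) (outAux σ).cl)

/-- The map `h = Y (να.σ(α) ⊸ μα.σ(α)) !(λh. in ∘ σ(h) ∘ out)` from `να.σ(α)` to `μα.σ(α)`. -/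
def nuToMu (σ : Typ S 1) : Tm S 0 0 :=
  .app (.tyApp .fix (.lolli (nu σ) (mu σ))) (.bang (.ilam (.lolli (nu σ) (mu σ))
    (.comp (nu σ) (inTm σ).cl
      (.comp (nu σ) (fmap σ (nu σ) (mu σ) (.var 0)) (outTm σ).cl))))

/-- `t` is a closed term of the closed type `τ`. -/
def Closed (t : Tm S 0 0) (τ : Typ S 0) : Prop := HasTyI Fin.elim0 t τ

variable (Ax : Form S 0 0 0 → Prop)

/-- Two closed terms of type `τ` are provably equal. -/
def ClosedEq (τ : Typ S 0) (t s : Tm S 0 0) : Prop :=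
  Prov Ax (Fin.elim0 : Fin 0 → Typ S 0) (Fin.elim0 : Fin 0 → RelDecl S 0) [] (.eq τ t s)

/-- `f : σ ⊸ τ` and `g : τ ⊸ σ` are inverse to each other up to internal equality. -/
def Inverse (σ τ : Typ S 0) (f g : Tm S 0 0) : Prop :=
  Closed f (.lolli σ τ) ∧ Closed g (.lolli τ σ) ∧
    ClosedEq Ax (.lolli σ σ) (.comp σ g f) (Tm.idTm σ) ∧
    ClosedEq Ax (.lolli τ τ) (.comp τ f g) (Tm.idTm τ)

/-- `Ξ | Γ | Θ | Φ ⊢ h ∘ f = g ∘ σ(h)`: internally, `h : τ ⊸ τ'` is a map of algebras from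
`f : σ(τ) ⊸ τ` to `g : σ(τ') ⊸ τ'`. -/
def AlgMap (σ : Typ S 1) {k n r : ℕ} (Γ : Fin n → Typ S k) (Θ : Fin r → RelDecl S k)
    (Φ : List (Form S k n r)) (τ τ' : Typ S k) (f g h : Tm S k n) : Prop :=
  Prov Ax Γ Θ Φ (.eq (.lolli (σ.at1 τ) τ') (.comp (σ.at1 τ) h f)
    (.comp (σ.at1 τ) g (fmap σ τ τ' h)))

/-- `Ξ | Γ | Θ | Φ ⊢ g ∘ h = σ(h) ∘ f`: internally, `h : τ ⊸ τ'` is a map of coalgebras from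
`f : τ ⊸ σ(τ)` to `g : τ' ⊸ σ(τ')`. -/
def CoalgMap (σ : Typ S 1) {k n r : ℕ} (Γ : Fin n → Typ S k) (Θ : Fin r → RelDecl S k)
    (Φ : List (Form S k n r)) (τ τ' : Typ S k) (f g h : Tm S k n) : Prop :=
  Prov Ax Γ Θ Φ (.eq (.lolli τ (σ.at1 τ')) (.comp τ g h) (.comp τ (fmap σ τ τ' h) f))

/-- The closed algebra `c : σ(ω) ⊸ ω` is internally initial: in every context, each algebra
receives a map of algebras from `c`, which is unique up to internal equality. (With empty
`Γ, Θ, Φ` this is initiality in the category `LinType_Ξ` of types and provable-equality classes of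
closed linear maps, for each kind context `Ξ`.) -/
def InitialAlgebra (σ : Typ S 1) (ω : Typ S 0) (c : Tm S 0 0) : Prop :=
  Closed c (.lolli (σ.at1 ω) ω) ∧
  ∀ (k n r : ℕ) (Γ : Fin n → Typ S k) (Θ : Fin r → RelDecl S k) (Φ : List (Form S k n r))
    (τ : Typ S k) (f : Tm S k n), HasTyI Γ f (.lolli (σ.at1 τ) τ) →
    ∃ h : Tm S k n, HasTyI Γ h (.lolli ω.cl τ) ∧ AlgMap Ax σ Γ Θ Φ ω.cl τ c.cl f h ∧
      ∀ h' : Tm S k n, HasTyI Γ h' (.lolli ω.cl τ) → AlgMap Ax σ Γ Θ Φ ω.cl τ c.cl f h' →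
        Prov Ax Γ Θ Φ (.eq (.lolli ω.cl τ) h' h)

/-- The closed coalgebra `c : ω ⊸ σ(ω)` is internally final: in every context, each coalgebra has
a map of coalgebras to `c`, which is unique up to internal equality. (With empty `Γ, Θ, Φ` this is
finality in the category `LinType_Ξ`, for each kind context `Ξ`.) -/
def FinalCoalgebra (σ : Typ S 1) (ω : Typ S 0) (c : Tm S 0 0) : Prop :=
  Closed c (.lolli ω (σ.at1 ω)) ∧
  ∀ (k n r : ℕ) (Γ : Fin n → Typ S k) (Θ : Fin r → RelDecl S k) (Φ : List (Form S k n r))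
    (τ : Typ S k) (f : Tm S k n), HasTyI Γ f (.lolli τ (σ.at1 τ)) →
    ∃ h : Tm S k n, HasTyI Γ h (.lolli τ ω.cl) ∧ CoalgMap Ax σ Γ Θ Φ τ ω.cl f c.cl h ∧
      ∀ h' : Tm S k n, HasTyI Γ h' (.lolli τ ω.cl) → CoalgMap Ax σ Γ Θ Φ τ ω.cl f c.cl h' →
        Prov Ax Γ Θ Φ (.eq (.lolli τ ω.cl) h' h)

/-- The closed map `h : ω ⊸ ω'` is internally a map of coalgebras from `f` to `g`. -/
def ClosedCoalgMap (σ : Typ S 1) (ω ω' : Typ S 0) (f g h : Tm S 0 0) : Prop :=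
  CoalgMap Ax σ (Fin.elim0 : Fin 0 → Typ S 0) (Fin.elim0 : Fin 0 → RelDecl S 0) [] ω ω' f g h

/-- The closed map `h : ω ⊸ ω'` is internally a map of algebras from `f` to `g`. -/
def ClosedAlgMap (σ : Typ S 1) (ω ω' : Typ S 0) (f g h : Tm S 0 0) : Prop :=
  AlgMap Ax σ (Fin.elim0 : Fin 0 → Typ S 0) (Fin.elim0 : Fin 0 → RelDecl S 0) [] ω ω' f g h

end Functors

end LAPL

set_option linter.unusedSimpArgs false
set_option linter.unusedVariables false

-- Parametricity is used in one form only. The graph of a linear map is an admissible relation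
-- (`Adm.graph`), and by identity extension every term of a closed type, a variable included, is
-- related to itself by the interpretation of that type (`Related.closed`). So quantifiers are only
-- ever instantiated at graphs, and `Related` is the corresponding notion of relatedness. Applied to
-- the closed polymorphic term M_σ, this shows that σ[⟨f⟩] is the graph of σ(f)
-- (`Related.graph_iff`). The proof needs σ(id) = id, which is a separate induction on types
-- (`IEq.act_id`); preservation of composition then follows by parametricity.
--
-- With the graph lemma, parametricity at the type μα.σ says that x A !f is natural in the algebra f
-- (`IEq.mu_natural`). Hence `in` is an initial algebra (`IEq.foldAt_unique`), and Lambek's argument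
-- inverts it by the fold of σ(in). For να.σ, parametricity of existential types (`IEq.ex_natural`)
-- and of `unfold` (`IEq.unfold_natural`) makes `out` a final coalgebra (`IEq.unfoldAt_unique`),
-- inverted in the dual way.
--
-- Compactness comes from the fixed-point combinator. For an algebra a on B and a coalgebra c on A
-- let hylo(a, c) : A ⊸ B be the fixed point of h ↦ a ∘ σ(h) ∘ c. Parametricity of Y at the graph of
-- a linear map (`IEq.fix_natural`), applied to precomposition and to postcomposition, gives fusion:
-- hylo(a, c) ∘ g = hylo(a, c') for a coalgebra map g from c' to c, and g ∘ hylo(a, c) = hylo(a', c)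
-- for an algebra map g from a to a' (`IEq.hylo_comp`, `IEq.comp_hylo`). Initiality gives hylo(in,
-- in⁻¹) = id. So hylo(in, f) is a coalgebra map from f to in⁻¹, and any coalgebra map h satisfies h
-- = hylo(in, in⁻¹) ∘ h = hylo(in, f), which is finality of in⁻¹. Dually out⁻¹ is initial. The map
-- of the theorem from να.σ to μα.σ is hylo(in, out); both ends are initial algebras, so it is
-- invertible.
--
-- Linearity is handled by counting. A typing derivation can be redone for any multiplicities
-- compatible with the numbers of occurrences (`HasTy.of_cnt`), so nearly all the work takes place
-- in purely intuitionistic contexts, with a check at each linear binder that the bound variable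
-- occurs exactly once.

namespace LAPL

-- Extension of finite families and renamings under binders.

section Push

variable {A : Sort*} {n : ℕ}

@[simp] theorem push_zero (a : A) (f : Fin n → A) : push a f 0 = a := rfl

@[simp] theorem push_succ (a : A) (f : Fin n → A) (i : Fin n) : push a f i.succ = f i := rfl

@[simp] theorem push_one (a : A) (f : Fin (n + 1) → A) : push a f 1 = f 0 := rfl

@[simp] theorem push_two (a : A) (f : Fin (n + 2) → A) : push a f 2 = f 1 := rfl

@[simp] theorem push_three (a : A) (f : Fin (n + 3) → A) : push a f 3 = f 2 := rfl

theorem push_ext {f g : Fin (n + 1) → A} (h0 : f 0 = g 0) (hs : ∀ i : Fin n, f i.succ = g i.succ) :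
    f = g := by
  funext i
  exact Fin.cases h0 hs i

@[simp] theorem push_eta (f : Fin (n + 1) → A) : push (f 0) (fun i => f i.succ) = f :=
  push_ext rfl fun _ => rfl

@[simp] theorem up_zero {m : ℕ} (f : Fin n → Fin m) : up f 0 = 0 := rfl

@[simp] theorem up_succ {m : ℕ} (f : Fin n → Fin m) (i : Fin n) : up f i.succ = (f i).succ := rfl

@[simp] theorem up_one {m : ℕ} (f : Fin (n + 1) → Fin m) : up f 1 = (f 0).succ := rfl

@[simp] theorem up_id : up (id : Fin n → Fin n) = id := push_ext rfl fun _ => rfl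

theorem up_up {m l : ℕ} (f : Fin n → Fin m) (g : Fin m → Fin l) :
    (fun i => up g (up f i)) = up fun i => g (f i) :=
  push_ext rfl fun _ => rfl

end Push

-- Renaming and substitution in types.

namespace Ty

variable {T : TySig.{u}}

theorem ren_ren {k m l : ℕ} (f : Fin k → Fin m) (g : Fin m → Fin l) (σ : Ty T k) :
    (σ.ren f).ren g = σ.ren fun i => g (f i) := by
  induction σ generalizing m l <;> simp_all only [up_up, up_id, id_eq, ren]

theorem upS_up {k m l : ℕ} (f : Fin k → Fin m) (θ : Fin m → Ty T l) :
    (fun i => upS θ (up f i)) = upS fun i => θ (f i) :=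
  push_ext rfl fun _ => rfl

theorem subst_ren {k m l : ℕ} (f : Fin k → Fin m) (θ : Fin m → Ty T l) (σ : Ty T k) :
    (σ.ren f).subst θ = σ.subst fun i => θ (f i) := by
  induction σ generalizing m l <;> simp_all only [up_up, up_id, id_eq, ren, subst, upS_up]

theorem ren_upS {k m l : ℕ} (θ : Fin k → Ty T m) (f : Fin m → Fin l) :
    (fun i => (upS θ i).ren (up f)) = upS fun i => (θ i).ren f := by
  refine push_ext rfl fun i => ?_
  simp [upS, wk, ren_ren]

theorem ren_subst {k m l : ℕ} (θ : Fin k → Ty T m) (f : Fin m → Fin l) (σ : Ty T k) :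
    (σ.subst θ).ren f = σ.subst fun i => (θ i).ren f := by
  induction σ generalizing m l <;> simp_all only [up_up, up_id, id_eq, ren, subst, ren_upS]

theorem subst_upS {k m l : ℕ} (θ : Fin k → Ty T m) (θ' : Fin m → Ty T l) :
    (fun i => (upS θ i).subst (upS θ')) = upS fun i => (θ i).subst θ' := by
  refine push_ext rfl fun i => ?_
  simp [upS, wk, ren_subst, subst_ren]

/-- The last of four composition laws, and the order matters: under the binder Π each law needs that
`up` and `upS` are compatible with composition. For a renaming after a substitution this uses
`ren_ren`, and for two substitutions it uses both mixed laws. Terms, relations and propositions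
follow the same pattern. -/
theorem subst_subst {k m l : ℕ} (θ : Fin k → Ty T m) (θ' : Fin m → Ty T l) (σ : Ty T k) :
    (σ.subst θ).subst θ' = σ.subst fun i => (θ i).subst θ' := by
  induction σ generalizing m l <;> simp_all only [up_up, up_id, id_eq, subst, subst_upS]

theorem upS_var {k m : ℕ} (f : Fin k → Fin m) :
    upS (fun i => (var (f i) : Ty T m)) = fun i => var (up f i) :=
  push_ext rfl fun _ => rfl

theorem ren_eq_subst {k m : ℕ} (f : Fin k → Fin m) (σ : Ty T k) :
    σ.ren f = σ.subst fun i => var (f i) := by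
  induction σ generalizing m <;> simp_all only [up_up, up_id, id_eq, ren, subst, upS_var]

theorem ren_id {k : ℕ} (σ : Ty T k) : σ.ren id = σ := by
  induction σ <;> simp_all only [up_up, up_id, id_eq, ren]

theorem subst_var {k : ℕ} (σ : Ty T k) : σ.subst var = σ := by
  rw [← ren_id σ, subst_ren]; rw [ren_id]; exact (ren_eq_subst id σ).symm.trans (ren_id σ)

end Ty

-- Renaming and substitution in terms.

namespace Tm

variable {S : Sig.{u, v}}

theorem ren_ren {k n k' n' k'' n'' : ℕ} (f : Fin k → Fin k') (g : Fin n → Fin n')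
    (f' : Fin k' → Fin k'') (g' : Fin n' → Fin n'') (t : Tm S k n) :
    (t.ren f g).ren f' g' = t.ren (fun i => f' (f i)) fun i => g' (g i) := by
  induction t generalizing k' n' k'' n'' <;> simp_all only [up_up, up_id, id_eq, ren, Ty.ren_ren]

theorem upS_up {k n n' n'' : ℕ} (g : Fin n → Fin n') (s : Fin n' → Tm S k n'') :
    (fun i => upS s (up g i)) = upS fun i => s (g i) :=
  push_ext rfl fun _ => rfl

theorem subst_ren {k n k' n' k'' n'' : ℕ} (f : Fin k → Fin k') (g : Fin n → Fin n')
    (θ : Fin k' → Typ S k'') (s : Fin n' → Tm S k'' n'') (t : Tm S k n) :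
    (t.ren f g).subst θ s = t.subst (fun i => θ (f i)) fun i => s (g i) := by
  induction t generalizing k' n' k'' n'' <;>
    simp_all only [up_up, up_id, id_eq, ren, subst, Ty.subst_ren, upS_up, Ty.upS_up]

theorem ren_upS {k n n' k' n'' : ℕ} (s : Fin n → Tm S k n') (f : Fin k → Fin k')
    (g : Fin n' → Fin n'') :
    (fun i => (upS s i).ren f (up g)) = upS fun i => (s i).ren f g := by
  refine push_ext rfl fun i => ?_
  simp [upS, wk, ren_ren]

theorem ren_wkTy {k n k' n' : ℕ} (t : Tm S k n) (f : Fin k → Fin k') (g : Fin n → Fin n') :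
    t.wkTy.ren (up f) g = (t.ren f g).wkTy := by
  simp [wkTy, ren_ren]

theorem ren_subst {k n k' n' k'' n'' : ℕ} (θ : Fin k → Typ S k') (s : Fin n → Tm S k' n')
    (f : Fin k' → Fin k'') (g : Fin n' → Fin n'') (t : Tm S k n) :
    (t.subst θ s).ren f g = t.subst (fun i => (θ i).ren f) fun i => (s i).ren f g := by
  induction t generalizing k' n' k'' n'' <;>
    simp_all only [up_up, up_id, id_eq, ren, subst, Ty.ren_subst, ren_upS, Ty.ren_upS, ren_wkTy]

theorem subst_upS {k n k' n' n'' : ℕ} (s : Fin n → Tm S k n') (θ : Fin k → Typ S k')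
    (s' : Fin n' → Tm S k' n'') :
    (fun i => (upS s i).subst θ (upS s')) = upS fun i => (s i).subst θ s' := by
  refine push_ext rfl fun i => ?_
  simp [upS, wk, ren_subst, subst_ren, Ty.ren_id]

theorem subst_wkTy {k n k' n' : ℕ} (t : Tm S k n) (θ : Fin k → Typ S k') (s : Fin n → Tm S k' n') :
    t.wkTy.subst (Ty.upS θ) (fun i => (s i).wkTy) = (t.subst θ s).wkTy := by
  simp [wkTy, subst_ren, ren_subst, Ty.upS, Ty.wk]

theorem subst_subst {k n k' n' k'' n'' : ℕ} (θ : Fin k → Typ S k') (s : Fin n → Tm S k' n')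
    (θ' : Fin k' → Typ S k'') (s' : Fin n' → Tm S k'' n'') (t : Tm S k n) :
    (t.subst θ s).subst θ' s' =
      t.subst (fun i => (θ i).subst θ') fun i => (s i).subst θ' s' := by
  induction t generalizing k' n' k'' n'' <;>
    simp_all only [up_up, up_id, id_eq, subst, Ty.subst_subst, subst_upS, Ty.subst_upS, subst_wkTy]

theorem upS_var {k n n' : ℕ} (g : Fin n → Fin n') :
    upS (fun i => (var (g i) : Tm S k n')) = fun i => var (up g i) :=
  push_ext rfl fun _ => rfl

theorem ren_eq_subst {k n k' n' : ℕ} (f : Fin k → Fin k') (g : Fin n → Fin n') (t : Tm S k n) :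
    t.ren f g = t.subst (fun i => Ty.var (f i)) fun i => var (g i) := by
  induction t generalizing k' n' <;>
    simp_all only [ren, subst, Ty.ren_eq_subst, upS_var, Ty.upS_var, wkTy, id_eq]

theorem ren_id {k n : ℕ} (t : Tm S k n) : t.ren id id = t := by
  induction t <;> simp_all only [up_up, up_id, id_eq, ren, Ty.ren_id]

theorem subst_var {k n : ℕ} (t : Tm S k n) : t.subst Ty.var var = t :=
  (ren_eq_subst id id t).symm.trans (ren_id t)

end Tm

-- Renaming and substitution in propositions and definable relations.

section FormSubst

variable {S : Sig.{u, v}}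

/-- Propositions and relations are defined by mutual recursion. Taking both conclusions as one
conjunction lets each syntactic law be proved by a single induction for the two sorts at once. -/
theorem Form.induct {P : ∀ {k n r : ℕ}, Form S k n r → Prop} {Q : ∀ {k n r : ℕ}, Rel S k n r → Prop}
    (eq : ∀ {k n r : ℕ} (σ : Typ S k) (t s : Tm S k n), P (.eq σ t s : Form S k n r))
    (rel : ∀ {k n r : ℕ} (ρ : Rel S k n r) (t s : Tm S k n), Q ρ → P (.rel ρ t s))
    (imp : ∀ {k n r : ℕ} (φ ψ : Form S k n r), P φ → P ψ → P (.imp φ ψ))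
    (bot : ∀ {k n r : ℕ}, P (.bot : Form S k n r))
    (top : ∀ {k n r : ℕ}, P (.top : Form S k n r))
    (and : ∀ {k n r : ℕ} (φ ψ : Form S k n r), P φ → P ψ → P (.and φ ψ))
    (or : ∀ {k n r : ℕ} (φ ψ : Form S k n r), P φ → P ψ → P (.or φ ψ))
    (allTy : ∀ {k n r : ℕ} (φ : Form S (k + 1) n r), P φ → P (.allTy φ))
    (allTm : ∀ {k n r : ℕ} (σ : Typ S k) (φ : Form S k (n + 1) r), P φ → P (.allTm σ φ))
    (allRel : ∀ {k n r : ℕ} (a : Bool) (σ τ : Typ S k) (φ : Form S k n (r + 1)), P φ →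
      P (.allRel a σ τ φ))
    (exTy : ∀ {k n r : ℕ} (φ : Form S (k + 1) n r), P φ → P (.exTy φ))
    (exTm : ∀ {k n r : ℕ} (σ : Typ S k) (φ : Form S k (n + 1) r), P φ → P (.exTm σ φ))
    (exRel : ∀ {k n r : ℕ} (a : Bool) (σ τ : Typ S k) (φ : Form S k n (r + 1)), P φ →
      P (.exRel a σ τ φ))
    (var : ∀ {k n r : ℕ} (j : Fin r), Q (.var j : Rel S k n r))
    (abs : ∀ {k n r : ℕ} (σ τ : Typ S k) (φ : Form S k (n + 2) r), P φ → Q (.abs σ τ φ))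
    (interp : ∀ {k n r m : ℕ} (σ : Typ S m) (ρ : Fin m → Rel S k n r), (∀ i, Q (ρ i)) →
      Q (.interp σ ρ)) :
    (∀ {k n r : ℕ} (φ : Form S k n r), P φ) ∧ ∀ {k n r : ℕ} (ρ : Rel S k n r), Q ρ :=
  ⟨fun φ => Form.rec (motive_1 := fun _ _ _ φ => P φ) (motive_2 := fun _ _ _ ρ => Q ρ)
    eq rel imp bot top and or allTy allTm allRel exTy exTm exRel var abs interp φ,
  fun ρ => Rel.rec (motive_1 := fun _ _ _ φ => P φ) (motive_2 := fun _ _ _ ρ => Q ρ)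
    eq rel imp bot top and or allTy allTm allRel exTy exTm exRel var abs interp ρ⟩

theorem ren_ren_form_rel :
    (∀ {k n r : ℕ} (φ : Form S k n r) {k' n' r' k'' n'' r'' : ℕ} (f : Fin k → Fin k')
      (g : Fin n → Fin n') (h : Fin r → Fin r') (f' : Fin k' → Fin k'') (g' : Fin n' → Fin n'')
      (h' : Fin r' → Fin r''), (φ.ren f g h).ren f' g' h' =
        φ.ren (fun i => f' (f i)) (fun i => g' (g i)) fun i => h' (h i)) ∧
    ∀ {k n r : ℕ} (ρ : Rel S k n r) {k' n' r' k'' n'' r'' : ℕ} (f : Fin k → Fin k')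
      (g : Fin n → Fin n') (h : Fin r → Fin r') (f' : Fin k' → Fin k'') (g' : Fin n' → Fin n'')
      (h' : Fin r' → Fin r''), (ρ.ren f g h).ren f' g' h' =
        ρ.ren (fun i => f' (f i)) (fun i => g' (g i)) fun i => h' (h i) := by
  apply Form.induct <;> intros <;> simp_all only [up_up, up_id, id_eq, Form.ren, Rel.ren, Ty.ren_ren, Tm.ren_ren]

theorem Form.ren_ren {k n r k' n' r' k'' n'' r'' : ℕ} (f : Fin k → Fin k') (g : Fin n → Fin n')
    (h : Fin r → Fin r') (f' : Fin k' → Fin k'') (g' : Fin n' → Fin n'') (h' : Fin r' → Fin r'')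
    (φ : Form S k n r) : (φ.ren f g h).ren f' g' h' =
      φ.ren (fun i => f' (f i)) (fun i => g' (g i)) fun i => h' (h i) :=
  ren_ren_form_rel.1 φ f g h f' g' h'

theorem Rel.ren_ren {k n r k' n' r' k'' n'' r'' : ℕ} (f : Fin k → Fin k') (g : Fin n → Fin n')
    (h : Fin r → Fin r') (f' : Fin k' → Fin k'') (g' : Fin n' → Fin n'') (h' : Fin r' → Fin r'')
    (ρ : Rel S k n r) : (ρ.ren f g h).ren f' g' h' =
      ρ.ren (fun i => f' (f i)) (fun i => g' (g i)) fun i => h' (h i) :=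
  ren_ren_form_rel.2 ρ f g h f' g' h'

theorem Rel.upS_up {k n r r' r'' : ℕ} (g : Fin r → Fin r') (q : Fin r' → Rel S k n r'') :
    (fun i => Rel.upS q (up g i)) = Rel.upS fun i => q (g i) :=
  push_ext rfl fun _ => rfl

theorem subst_ren_form_rel :
    (∀ {k n r : ℕ} (φ : Form S k n r) {k' n' r' k'' n'' r'' : ℕ} (f : Fin k → Fin k')
      (g : Fin n → Fin n') (h : Fin r → Fin r') (θ : Fin k' → Typ S k'')
      (s : Fin n' → Tm S k'' n'') (q : Fin r' → Rel S k'' n'' r''),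
      (φ.ren f g h).subst θ s q =
        φ.subst (fun i => θ (f i)) (fun i => s (g i)) fun i => q (h i)) ∧
    ∀ {k n r : ℕ} (ρ : Rel S k n r) {k' n' r' k'' n'' r'' : ℕ} (f : Fin k → Fin k')
      (g : Fin n → Fin n') (h : Fin r → Fin r') (θ : Fin k' → Typ S k'')
      (s : Fin n' → Tm S k'' n'') (q : Fin r' → Rel S k'' n'' r''),
      (ρ.ren f g h).subst θ s q =
        ρ.subst (fun i => θ (f i)) (fun i => s (g i)) fun i => q (h i) := by
  apply Form.induct <;> intros <;>
    simp_all only [up_up, up_id, id_eq, Form.ren, Form.subst, Rel.ren, Rel.subst, Ty.subst_ren, Tm.subst_ren, Ty.upS_up,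
      Tm.upS_up, Rel.upS_up]

theorem Form.subst_ren {k n r k' n' r' k'' n'' r'' : ℕ} (f : Fin k → Fin k') (g : Fin n → Fin n')
    (h : Fin r → Fin r') (θ : Fin k' → Typ S k'') (s : Fin n' → Tm S k'' n'')
    (q : Fin r' → Rel S k'' n'' r'') (φ : Form S k n r) : (φ.ren f g h).subst θ s q =
      φ.subst (fun i => θ (f i)) (fun i => s (g i)) fun i => q (h i) :=
  subst_ren_form_rel.1 φ f g h θ s q

theorem Rel.subst_ren {k n r k' n' r' k'' n'' r'' : ℕ} (f : Fin k → Fin k') (g : Fin n → Fin n')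
    (h : Fin r → Fin r') (θ : Fin k' → Typ S k'') (s : Fin n' → Tm S k'' n'')
    (q : Fin r' → Rel S k'' n'' r'') (ρ : Rel S k n r) : (ρ.ren f g h).subst θ s q =
      ρ.subst (fun i => θ (f i)) (fun i => s (g i)) fun i => q (h i) :=
  subst_ren_form_rel.2 ρ f g h θ s q

theorem Rel.ren_upS {k n r r' k' n' r'' : ℕ} (q : Fin r → Rel S k n r') (f : Fin k → Fin k')
    (g : Fin n → Fin n') (h : Fin r' → Fin r'') :
    (fun i => (Rel.upS q i).ren f g (up h)) = Rel.upS fun i => (q i).ren f g h := by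
  refine push_ext rfl fun i => ?_
  simp [Rel.upS, Rel.ren_ren]

theorem ren_subst_form_rel :
    (∀ {k n r : ℕ} (φ : Form S k n r) {k' n' r' k'' n'' r'' : ℕ} (θ : Fin k → Typ S k')
      (s : Fin n → Tm S k' n') (q : Fin r → Rel S k' n' r') (f : Fin k' → Fin k'')
      (g : Fin n' → Fin n'') (h : Fin r' → Fin r''), (φ.subst θ s q).ren f g h =
        φ.subst (fun i => (θ i).ren f) (fun i => (s i).ren f g) fun i => (q i).ren f g h) ∧
    ∀ {k n r : ℕ} (ρ : Rel S k n r) {k' n' r' k'' n'' r'' : ℕ} (θ : Fin k → Typ S k')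
      (s : Fin n → Tm S k' n') (q : Fin r → Rel S k' n' r') (f : Fin k' → Fin k'')
      (g : Fin n' → Fin n'') (h : Fin r' → Fin r''), (ρ.subst θ s q).ren f g h =
        ρ.subst (fun i => (θ i).ren f) (fun i => (s i).ren f g) fun i => (q i).ren f g h := by
  apply Form.induct <;> intros <;>
    simp_all only [up_up, up_id, id_eq, Form.ren, Form.subst, Rel.ren, Rel.subst, Ty.ren_subst, Tm.ren_subst, Ty.ren_upS,
      Tm.ren_upS, Rel.ren_upS, Tm.ren_wkTy, Rel.ren_ren, up_succ]

theorem Rel.ren_subst {k n r k' n' r' k'' n'' r'' : ℕ} (θ : Fin k → Typ S k')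
    (s : Fin n → Tm S k' n') (q : Fin r → Rel S k' n' r') (f : Fin k' → Fin k'')
    (g : Fin n' → Fin n'') (h : Fin r' → Fin r'') (ρ : Rel S k n r) :
    (ρ.subst θ s q).ren f g h =
      ρ.subst (fun i => (θ i).ren f) (fun i => (s i).ren f g) fun i => (q i).ren f g h :=
  ren_subst_form_rel.2 ρ θ s q f g h

theorem Rel.subst_upS {k n r r' k' n' r'' : ℕ} (q : Fin r → Rel S k n r') (θ : Fin k → Typ S k')
    (s : Fin n → Tm S k' n') (q' : Fin r' → Rel S k' n' r'') :
    (fun i => (Rel.upS q i).subst θ s (Rel.upS q')) = Rel.upS fun i => (q i).subst θ s q' := by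
  refine push_ext rfl fun i => ?_
  simp [Rel.upS, Rel.ren_subst, Rel.subst_ren, Ty.ren_id, Tm.ren_id]

theorem Ty.upS_succ {T : TySig.{u}} {k m : ℕ} (θ : Fin k → Ty T m) (i : Fin k) :
    Ty.upS θ i.succ = (θ i).ren Fin.succ := rfl

theorem Tm.upS_succ {k n n' : ℕ} (s : Fin n → Tm S k n') (i : Fin n) :
    Tm.upS s i.succ = (s i).ren id Fin.succ := rfl

theorem Tm.upS_two_succ {k n n' : ℕ} (s : Fin n → Tm S k n') :
    (fun i : Fin n => Tm.upS (Tm.upS s) i.succ.succ) =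
      fun i => (s i).ren id fun j => j.succ.succ := by
  funext i
  simp only [Tm.upS, Tm.wk, push_succ, Tm.ren_ren, id_eq]
  rfl

theorem subst_subst_form_rel :
    (∀ {k n r : ℕ} (φ : Form S k n r) {k' n' r' k'' n'' r'' : ℕ} (θ : Fin k → Typ S k')
      (s : Fin n → Tm S k' n') (q : Fin r → Rel S k' n' r') (θ' : Fin k' → Typ S k'')
      (s' : Fin n' → Tm S k'' n'') (q' : Fin r' → Rel S k'' n'' r''),
      (φ.subst θ s q).subst θ' s' q' = φ.subst (fun i => (θ i).subst θ')
        (fun i => (s i).subst θ' s') fun i => (q i).subst θ' s' q') ∧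
    ∀ {k n r : ℕ} (ρ : Rel S k n r) {k' n' r' k'' n'' r'' : ℕ} (θ : Fin k → Typ S k')
      (s : Fin n → Tm S k' n') (q : Fin r → Rel S k' n' r') (θ' : Fin k' → Typ S k'')
      (s' : Fin n' → Tm S k'' n'') (q' : Fin r' → Rel S k'' n'' r''),
      (ρ.subst θ s q).subst θ' s' q' = ρ.subst (fun i => (θ i).subst θ')
        (fun i => (s i).subst θ' s') fun i => (q i).subst θ' s' q' := by
  apply Form.induct <;> intros <;>
    simp_all only [up_up, up_id, id_eq, Form.subst, Rel.subst, Ty.subst_subst, Tm.subst_subst, Ty.subst_upS,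
      Tm.subst_upS, Rel.subst_upS, Tm.subst_wkTy, Tm.wkTy, Rel.subst_ren, Rel.ren_subst, Ty.ren_id,
      Tm.upS_two_succ, Tm.upS_succ, Ty.upS_succ, Tm.subst_ren, Tm.ren_subst, Tm.ren_ren]
  all_goals rfl

theorem Form.subst_subst {k n r k' n' r' k'' n'' r'' : ℕ} (θ : Fin k → Typ S k')
    (s : Fin n → Tm S k' n') (q : Fin r → Rel S k' n' r') (θ' : Fin k' → Typ S k'')
    (s' : Fin n' → Tm S k'' n'') (q' : Fin r' → Rel S k'' n'' r'') (φ : Form S k n r) :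
    (φ.subst θ s q).subst θ' s' q' = φ.subst (fun i => (θ i).subst θ')
      (fun i => (s i).subst θ' s') fun i => (q i).subst θ' s' q' :=
  subst_subst_form_rel.1 φ θ s q θ' s' q'

theorem Rel.subst_subst {k n r k' n' r' k'' n'' r'' : ℕ} (θ : Fin k → Typ S k')
    (s : Fin n → Tm S k' n') (q : Fin r → Rel S k' n' r') (θ' : Fin k' → Typ S k'')
    (s' : Fin n' → Tm S k'' n'') (q' : Fin r' → Rel S k'' n'' r'') (ρ : Rel S k n r) :
    (ρ.subst θ s q).subst θ' s' q' = ρ.subst (fun i => (θ i).subst θ')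
      (fun i => (s i).subst θ' s') fun i => (q i).subst θ' s' q' :=
  subst_subst_form_rel.2 ρ θ s q θ' s' q'

theorem Rel.upS_var {k n r r' : ℕ} (h : Fin r → Fin r') :
    Rel.upS (fun i => (.var (h i) : Rel S k n r')) = fun i => .var (up h i) :=
  push_ext rfl fun _ => rfl

theorem ren_eq_subst_form_rel :
    (∀ {k n r : ℕ} (φ : Form S k n r) {k' n' r' : ℕ} (f : Fin k → Fin k')
      (g : Fin n → Fin n') (h : Fin r → Fin r'), φ.ren f g h =
        φ.subst (fun i => Ty.var (f i)) (fun i => Tm.var (g i)) fun i => Rel.var (h i)) ∧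
    ∀ {k n r : ℕ} (ρ : Rel S k n r) {k' n' r' : ℕ} (f : Fin k → Fin k')
      (g : Fin n → Fin n') (h : Fin r → Fin r'), ρ.ren f g h =
        ρ.subst (fun i => Ty.var (f i)) (fun i => Tm.var (g i)) fun i => Rel.var (h i) := by
  apply Form.induct <;> intros <;>
    simp_all only [up_up, up_id, id_eq, Form.ren, Form.subst, Rel.ren, Rel.subst, Ty.ren_eq_subst, Tm.ren_eq_subst,
      Ty.upS_var, Tm.upS_var, Rel.upS_var, Tm.wkTy, Tm.subst]
  

theorem Form.ren_eq_subst {k n r k' n' r' : ℕ} (f : Fin k → Fin k') (g : Fin n → Fin n')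
    (h : Fin r → Fin r') (φ : Form S k n r) : φ.ren f g h =
      φ.subst (fun i => Ty.var (f i)) (fun i => Tm.var (g i)) fun i => Rel.var (h i) :=
  ren_eq_subst_form_rel.1 φ f g h

theorem Rel.ren_eq_subst {k n r k' n' r' : ℕ} (f : Fin k → Fin k') (g : Fin n → Fin n')
    (h : Fin r → Fin r') (ρ : Rel S k n r) : ρ.ren f g h =
      ρ.subst (fun i => Ty.var (f i)) (fun i => Tm.var (g i)) fun i => Rel.var (h i) :=
  ren_eq_subst_form_rel.2 ρ f g h

theorem ren_id_form_rel :
    (∀ {k n r : ℕ} (φ : Form S k n r), φ.ren id id id = φ) ∧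
    ∀ {k n r : ℕ} (ρ : Rel S k n r), ρ.ren id id id = ρ := by
  apply Form.induct <;> intros <;> simp_all only [up_up, up_id, id_eq, Form.ren, Rel.ren, Ty.ren_id, Tm.ren_id]

theorem Form.subst_var {k n r : ℕ} (φ : Form S k n r) : φ.subst Ty.var Tm.var Rel.var = φ :=
  (ren_eq_subst_form_rel.1 φ id id id).symm.trans (ren_id_form_rel.1 φ)

theorem Rel.subst_var {k n r : ℕ} (ρ : Rel S k n r) : ρ.subst Ty.var Tm.var Rel.var = ρ :=
  (ren_eq_subst_form_rel.2 ρ id id id).symm.trans (ren_id_form_rel.2 ρ)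

end FormSubst

-- Closed types, weakening and instantiation.

section TypeLemmas

variable {T : TySig.{u}} {k m l : ℕ}

namespace Ty

theorem subst_congr {θ θ' : Fin k → Ty T m} (h : ∀ i, θ i = θ' i) (σ : Ty T k) :
    σ.subst θ = σ.subst θ' := by
  rw [funext h]

@[simp] theorem subst_cl (σ : Ty T 0) (θ : Fin k → Ty T m) : (σ.cl : Ty T k).subst θ = σ.cl := by
  rw [cl, cl, subst_ren, ren_eq_subst]
  exact subst_congr (fun i => i.elim0) σ

@[simp] theorem ren_cl (σ : Ty T 0) (f : Fin k → Fin m) : (σ.cl : Ty T k).ren f = σ.cl := by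
  rw [ren_eq_subst, subst_cl]

@[simp] theorem wk_cl (σ : Ty T 0) : (σ.cl : Ty T k).wk = σ.cl := ren_cl σ _

@[simp] theorem cl_self (σ : Ty T 0) : σ.cl = σ := by
  rw [cl, ← ren_id σ, ren_ren]
  congr 1
  funext i
  exact i.elim0

theorem subst_zero (σ : Ty T 0) (θ : Fin 0 → Ty T m) : σ.subst θ = σ.cl := by
  rw [← cl_self σ, subst_cl, cl_self]

@[simp] theorem wk_subst_push (τ : Ty T m) (θ : Fin k → Ty T m) (σ : Ty T k) :
    σ.wk.subst (push τ θ) = σ.subst θ := subst_ren _ _ _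

@[simp] theorem wk_subst_upS (θ : Fin k → Ty T m) (σ : Ty T k) :
    σ.wk.subst (upS θ) = (σ.subst θ).wk := by
  rw [wk, wk, subst_ren, ren_subst]
  rfl

@[simp] theorem wk_ren_up (f : Fin k → Fin m) (σ : Ty T k) : σ.wk.ren (up f) = (σ.ren f).wk := by
  simp only [wk, ren_ren, up_succ]

@[simp] theorem at1_subst (σ : Ty T 1) (τ : Ty T k) (θ : Fin k → Ty T m) :
    (σ.at1 τ).subst θ = σ.at1 (τ.subst θ) := subst_subst _ _ _

@[simp] theorem at1_ren (σ : Ty T 1) (τ : Ty T k) (f : Fin k → Fin m) :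
    (σ.at1 τ).ren f = σ.at1 (τ.ren f) := ren_subst _ _ _

@[simp] theorem at1_wk (σ : Ty T 1) (τ : Ty T k) : (σ.at1 τ).wk = σ.at1 τ.wk := at1_ren _ _ _

theorem inst_ren (σ : Ty T (k + 1)) (τ : Ty T k) (f : Fin k → Fin m) :
    (σ.inst τ).ren f = (σ.ren (up f)).inst (τ.ren f) := by
  rw [inst, inst, ren_subst, subst_ren]
  congr 1
  exact push_ext rfl fun _ => rfl

theorem inst_subst (σ : Ty T (k + 1)) (τ : Ty T k) (θ : Fin k → Ty T m) :
    (σ.inst τ).subst θ = (σ.subst (upS θ)).inst (τ.subst θ) := by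
  rw [inst, inst, subst_subst, subst_subst]
  congr 1
  refine push_ext rfl fun i => ?_
  simp only [push_succ, subst, upS, wk_subst_push, subst_var]

theorem upS_inst (σ : Ty T (k + 1)) (τ : Ty T m) (θ : Fin k → Ty T m) :
    (σ.subst (upS θ)).inst τ = σ.subst (push τ θ) := by
  rw [inst, subst_subst]
  congr 1
  refine push_ext rfl fun i => ?_
  simp only [push_succ, upS, wk_subst_push, subst_var]

end Ty

end TypeLemmas

-- Occurrence counts of term variables.

section Count

variable {S : Sig.{u, v}}

/-- The number of occurrences of a variable, where an occurrence under `!` counts twice. -/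
def Tm.cnt : {k n : ℕ} → Tm S k n → Fin n → ℕ
  | _, _, .var i, j => if i = j then 1 else 0
  | _, _, .star, _ => 0
  | _, _, .fix, _ => 0
  | _, _, .const _, _ => 0
  | _, _, .lam _ t, j => t.cnt j.succ
  | _, _, .app t s, j => t.cnt j + s.cnt j
  | _, _, .tensor t s, j => t.cnt j + s.cnt j
  | _, _, .bang t, j => 2 * t.cnt j
  | _, _, .tyLam t, j => t.cnt j
  | _, _, .tyApp t _, j => t.cnt j
  | _, _, .letStar t s, j => t.cnt j + s.cnt j
  | _, _, .letTensor _ _ t s, j => t.cnt j + s.cnt j.succ.succ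
  | _, _, .letBang _ t s, j => t.cnt j + s.cnt j.succ

namespace Tm

theorem cnt_ren {k n k' n' : ℕ} (f : Fin k → Fin k') (g : Fin n → Fin n') (t : Tm S k n)
    (i : Fin n') : (t.ren f g).cnt i = ∑ j, t.cnt j * if g j = i then 1 else 0 := by
  induction t generalizing k' n' <;>
    simp_all only [ren, cnt, Fin.sum_univ_succ, add_mul, Finset.sum_add_distrib, up_zero, up_succ,
      Finset.mul_sum, zero_mul, Finset.sum_const_zero, mul_assoc, Fin.succ_inj,
      (Fin.succ_ne_zero _).symm, if_false, mul_zero, zero_add, add_zero, ite_mul, one_mul,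
      Finset.sum_ite_eq, Finset.mem_univ, if_true]

theorem cnt_wk_zero {k n : ℕ} (t : Tm S k n) : t.wk.cnt 0 = 0 := by
  simp [wk, cnt_ren]

theorem cnt_wk_succ {k n : ℕ} (t : Tm S k n) (i : Fin n) : t.wk.cnt i.succ = t.cnt i := by
  simp [wk, cnt_ren]

theorem cnt_ren_up_zero {k n k' n' : ℕ} (f : Fin k → Fin k') (g : Fin n → Fin n')
    (t : Tm S k (n + 1)) : (t.ren f (up g)).cnt 0 = t.cnt 0 := by
  simp [cnt_ren, Fin.sum_univ_succ]

theorem cnt_ren_up_up_one {k n k' n' : ℕ} (f : Fin k → Fin k') (g : Fin n → Fin n')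
    (t : Tm S k (n + 2)) : (t.ren f (up (up g))).cnt 1 = t.cnt 1 := by
  have : (1 : Fin (n' + 2)) = Fin.succ 0 := rfl
  rw [cnt_ren, Fin.sum_univ_succ, Fin.sum_univ_succ, this]
  simp only [up_zero, up_succ, Fin.succ_inj, (Fin.succ_ne_zero _).symm, if_false, mul_zero,
    zero_add, if_true, mul_one, Fin.succ_ne_zero, Finset.sum_const_zero, add_zero]
  rfl

theorem cnt_ren_up_succ {k n k' n' : ℕ} (f : Fin k → Fin k') (g : Fin n → Fin n')
    (t : Tm S k (n + 1)) (i : Fin n') :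
    (t.ren f (up g)).cnt i.succ = ∑ j, t.cnt j.succ * if g j = i then 1 else 0 := by
  simp [cnt_ren, Fin.sum_univ_succ, (Fin.succ_ne_zero _).symm]

/-- Counts compose like matrices: an occurrence of j in t contributes the occurrences of i in s j.
Doubling under `!` is multiplication by a scalar and so is compatible with this. -/
theorem cnt_subst {k n k' n' : ℕ} (θ : Fin k → Typ S k') (s : Fin n → Tm S k' n') (t : Tm S k n)
    (i : Fin n') : (t.subst θ s).cnt i = ∑ j, t.cnt j * (s j).cnt i := by
  have hwk : ∀ {k n : ℕ} (t : Tm S k n) (i : Fin n), t.wkTy.cnt i = t.cnt i := fun t i => by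
    simp [wkTy, cnt_ren]
  induction t generalizing k' n' <;>
    simp_all only [subst, cnt, Fin.sum_univ_succ, add_mul, Finset.sum_add_distrib, upS, push_zero,
      push_succ, cnt_wk_succ, Finset.mul_sum, zero_mul, Finset.sum_const_zero, mul_assoc,
      (Fin.succ_ne_zero _).symm, if_false, mul_zero, zero_add, add_zero, ite_mul, one_mul,
      Finset.sum_ite_eq, Finset.mem_univ, if_true]

theorem cnt_wkTy {k n : ℕ} (t : Tm S k n) (i : Fin n) : t.wkTy.cnt i = t.cnt i := by
  simp [wkTy, cnt_ren]

theorem cnt_cl {k n : ℕ} (t : Tm S 0 0) (i : Fin n) : (t.cl : Tm S k n).cnt i = 0 := by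
  simp [cl, cnt_ren]

theorem cnt_subst_upS_zero {k n k' n' : ℕ} (θ : Fin k → Typ S k') (s : Fin n → Tm S k' n')
    (t : Tm S k (n + 1)) : (t.subst θ (upS s)).cnt 0 = t.cnt 0 := by
  simp [cnt_subst, Fin.sum_univ_succ, upS, cnt, cnt_wk_zero]

theorem cnt_subst_upS_upS_one {k n k' n' : ℕ} (θ : Fin k → Typ S k') (s : Fin n → Tm S k' n')
    (t : Tm S k (n + 2)) : (t.subst θ (upS (upS s))).cnt 1 = t.cnt 1 := by
  have : (1 : Fin (n' + 2)) = Fin.succ 0 := rfl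
  rw [cnt_subst, Fin.sum_univ_succ, Fin.sum_univ_succ, this]
  simp only [upS, push_zero, push_succ, cnt_wk_succ, cnt_wk_zero, cnt, (Fin.succ_ne_zero _).symm,
    if_false, mul_zero, zero_add, if_true, mul_one, Finset.sum_const_zero, add_zero]
  rfl

end Tm

end Count

-- Linear typing recovered from intuitionistic typing and counts.

section Typing

variable {S : Sig.{u, v}}

/-- A split of the context hands each linear variable to exactly one of the two subterms, so the
counts of the subterms add up to 1; under `!` there are no linear variables. -/
theorem HasTy.cnt_eq {k n : ℕ} {Γ : Fin n → Typ S k} {u : Fin n → Mult} {t : Tm S k n}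
    {τ : Typ S k} (h : HasTy Γ u t τ) :
    ∀ i, (u i = .one → t.cnt i = 1) ∧ (u i = .zero → t.cnt i = 0) := by
  have key : ∀ {n : ℕ} {u u₁ u₂ : Fin n → Mult} (_ : Splits u u₁ u₂) (i : Fin n) (a b : ℕ),
      (u₁ i = .one → a = 1) ∧ (u₁ i = .zero → a = 0) →
      (u₂ i = .one → b = 1) ∧ (u₂ i = .zero → b = 0) →
      (u i = .one → a + b = 1) ∧ (u i = .zero → a + b = 0) := by
    intro n u u₁ u₂ hs i a b ha hb
    have := hs i
    revert this ha hb
    generalize u i = x, u₁ i = y, u₂ i = z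
    intro ha hb hs
    cases hs <;> simp_all
  have none : ∀ {n : ℕ} {u : Fin n → Mult}, NoLinear u →
      ∀ i, (u i = .one → 0 = 1) ∧ (u i = .zero → 0 = 0) :=
    fun hu i => ⟨fun h => absurd h (hu i), fun _ => rfl⟩
  induction h with
  | var i hi hj =>
    intro j
    by_cases hij : i = j
    · subst hij
      simp [Tm.cnt, hi]
    · simp [Tm.cnt, hij, hj j (Ne.symm hij)]
  | star hu => exact none hu
  | fix hu => exact none hu
  | const c hu => exact none hu
  | lam _ ih => exact fun i => ih i.succ
  | app hs _ _ ih₁ ih₂ => exact fun i => key hs i _ _ (ih₁ i) (ih₂ i)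
  | tensor hs _ _ ih₁ ih₂ => exact fun i => key hs i _ _ (ih₁ i) (ih₂ i)
  | bang hu _ ih =>
    exact fun i => ⟨fun h => absurd h (hu i), fun h => by simp [Tm.cnt, (ih i).2 h]⟩
  | tyLam _ ih => exact ih
  | tyApp _ _ ih => exact ih
  | letStar hs _ _ ih₁ ih₂ => exact fun i => key hs i _ _ (ih₁ i) (ih₂ i)
  | letTensor hs _ _ ih₁ ih₂ => exact fun i => key hs i _ _ (ih₁ i) (ih₂ i.succ.succ)
  | letBang hs _ _ ih₁ ih₂ => exact fun i => key hs i _ _ (ih₁ i) (ih₂ i.succ)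

/-- The multiplicities are determined by the occurrence counts. -/
def CntOK {n : ℕ} (c : Fin n → ℕ) (u : Fin n → Mult) : Prop :=
  ∀ i, (u i = .one → c i = 1) ∧ (u i = .zero → c i = 0)

theorem CntOK.split {n : ℕ} {a b : Fin n → ℕ} {u : Fin n → Mult} (h : CntOK (fun i => a i + b i) u) :
    ∃ u₁ u₂, Splits u u₁ u₂ ∧ CntOK a u₁ ∧ CntOK b u₂ := by
  have : ∀ i, ∃ m₁ m₂, Mult.Split (u i) m₁ m₂ ∧ ((m₁ = .one → a i = 1) ∧ (m₁ = .zero → a i = 0)) ∧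
      ((m₂ = .one → b i = 1) ∧ (m₂ = .zero → b i = 0)) := by
    intro i
    have := h i
    revert this
    cases u i with
    | zero =>
      intro h
      exact ⟨_, _, .zero, ⟨nofun, fun _ => by have : a i + b i = 0 := h.2 rfl; omega⟩,
        ⟨nofun, fun _ => by have : a i + b i = 0 := h.2 rfl; omega⟩⟩
    | many => exact fun _ => ⟨_, _, .many, ⟨nofun, nofun⟩, ⟨nofun, nofun⟩⟩
    | one =>
      intro h
      have : a i + b i = 1 := h.1 rfl
      by_cases ha : a i = 1
      · exact ⟨_, _, .left, ⟨fun _ => ha, nofun⟩, ⟨nofun, fun _ => by omega⟩⟩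
      · exact ⟨_, _, .right, ⟨nofun, fun _ => by omega⟩, ⟨fun _ => by omega, nofun⟩⟩
  choose u₁ u₂ hs h₁ h₂ using this
  exact ⟨u₁, u₂, hs, h₁, h₂⟩

theorem CntOK.push {n : ℕ} {c : Fin (n + 1) → ℕ} {u : Fin n → Mult} {m : Mult}
    (h : CntOK (fun i => c i.succ) u) (h1 : m = .one → c 0 = 1) (h0 : m = .zero → c 0 = 0) :
    CntOK c (push m u) := by
  intro i
  refine Fin.cases ⟨h1, h0⟩ h i

/-- The converse of `HasTy.cnt_eq`: the derivation is rebuilt for the new multiplicities, and at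
every split a linear variable goes to the subterm where its count is 1. At `!t` the counts are even,
hence never 1, so no variable of the new context can be linear there. This is the reason for
counting occurrences under `!` twice. -/
theorem HasTy.of_cnt {k n : ℕ} {Γ : Fin n → Typ S k} {u : Fin n → Mult} {t : Tm S k n}
    {τ : Typ S k} (h : HasTy Γ u t τ) : ∀ {u' : Fin n → Mult}, CntOK t.cnt u' → HasTy Γ u' t τ := by
  have none : ∀ {n : ℕ} {u : Fin n → Mult}, CntOK (fun _ => 0) u → NoLinear u :=
    fun hc i hi => by simpa using (hc i).1 hi
  induction h with
  | var i hi hj =>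
    intro u' h
    refine .var i (fun h0 => by simpa [Tm.cnt] using (h i).2 h0) fun j hj h1 => ?_
    simpa [Tm.cnt, Ne.symm hj] using (h j).1 h1
  | star hu => exact fun h => .star (none h)
  | fix hu => exact fun h => .fix (none h)
  | const c hu => exact fun h => .const c (none h)
  | lam ht ih => exact fun h => .lam (ih (.push h (fun _ => (ht.cnt_eq 0).1 rfl) nofun))
  | app hs _ _ ih₁ ih₂ =>
    intro u' h
    obtain ⟨u₁, u₂, hs, h₁, h₂⟩ := CntOK.split h
    exact .app hs (ih₁ h₁) (ih₂ h₂)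
  | tensor hs _ _ ih₁ ih₂ =>
    intro u' h
    obtain ⟨u₁, u₂, hs, h₁, h₂⟩ := CntOK.split h
    exact .tensor hs (ih₁ h₁) (ih₂ h₂)
  | bang hu _ ih =>
    intro u' h
    have hn : NoLinear u' := fun i hi => by
      have := (h i).1 hi
      simp only [Tm.cnt] at this
      omega
    exact .bang hn (ih fun i => ⟨fun hi => absurd hi (hn i), fun hi => by
      simpa [Tm.cnt] using (h i).2 hi⟩)
  | tyLam _ ih => exact fun h => .tyLam (ih h)
  | tyApp τ _ ih => exact fun h => .tyApp τ (ih h)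
  | letStar hs _ _ ih₁ ih₂ =>
    intro u' h
    obtain ⟨u₁, u₂, hs, h₁, h₂⟩ := CntOK.split h
    exact .letStar hs (ih₁ h₁) (ih₂ h₂)
  | letTensor hs _ ht ih₁ ih₂ =>
    intro u' h
    obtain ⟨u₁, u₂, hs, h₁, h₂⟩ := CntOK.split h
    exact .letTensor hs (ih₁ h₁) (ih₂ (.push (.push h₂ (fun _ => (ht.cnt_eq 1).1 rfl) nofun)
      (fun _ => (ht.cnt_eq 0).1 rfl) nofun))
  | letBang hs _ _ ih₁ ih₂ =>
    intro u' h
    obtain ⟨u₁, u₂, hs, h₁, h₂⟩ := CntOK.split h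
    exact .letBang hs (ih₁ h₁) (ih₂ (h₂.push nofun nofun))

theorem HasTy.toI {k n : ℕ} {Γ : Fin n → Typ S k} {u : Fin n → Mult} {t : Tm S k n}
    {τ : Typ S k} (h : HasTy Γ u t τ) : HasTyI Γ t τ :=
  h.of_cnt fun _ => ⟨nofun, nofun⟩

theorem splits_many {n : ℕ} :
    Splits (fun _ : Fin n => Mult.many) (fun _ => Mult.many) fun _ => Mult.many :=
  fun _ => .many

theorem noLinear_many {n : ℕ} : NoLinear (fun _ : Fin n => Mult.many) := nofun

/-- A body typed with every variable intuitionistic may be abstracted linearly as soon as the bound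
variable has count 1. This is what allows the typing rules below to be stated for `HasTyI` alone. -/
theorem HasTyI.linear {k n : ℕ} {Γ : Fin n → Typ S k} {σ : Typ S k} {t : Tm S k (n + 1)}
    {τ : Typ S k} (h : HasTyI (push σ Γ) t τ) (hc : t.cnt 0 = 1) :
    HasTy (push σ Γ) (push .one fun _ => .many) t τ :=
  h.of_cnt (CntOK.push (fun _ => ⟨nofun, nofun⟩) (fun _ => hc) nofun)

namespace HasTyI

variable {k n : ℕ} {Γ : Fin n → Typ S k} {σ σ' τ : Typ S k} {t s : Tm S k n}

theorem var (i : Fin n) : HasTyI Γ (.var i) (Γ i) := HasTy.var i nofun nofun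

theorem var' {i : Fin n} (h : Γ i = τ) : HasTyI Γ (.var i) τ := h ▸ var i

theorem fix : HasTyI Γ .fix Ty.fixTy.cl := HasTy.fix noLinear_many

theorem lam {t : Tm S k (n + 1)} (h : HasTyI (push σ Γ) t τ) (hc : t.cnt 0 = 1) :
    HasTyI Γ (.lam σ t) (.lolli σ τ) := HasTy.lam (h.linear hc)

theorem app (ht : HasTyI Γ t (.lolli σ τ)) (hs : HasTyI Γ s σ) : HasTyI Γ (.app t s) τ :=
  HasTy.app splits_many ht hs

theorem tensor (ht : HasTyI Γ t σ) (hs : HasTyI Γ s τ) : HasTyI Γ (.tensor t s) (.tensor σ τ) :=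
  HasTy.tensor splits_many ht hs

theorem bang (ht : HasTyI Γ t σ) : HasTyI Γ (.bang t) (.bang σ) := HasTy.bang noLinear_many ht

theorem tyLam {τ : Typ S (k + 1)} {t : Tm S (k + 1) n} (h : HasTyI (wkCtx Γ) t τ) :
    HasTyI Γ (.tyLam t) (.all τ) := HasTy.tyLam h

theorem tyApp {τ : Typ S (k + 1)} (σ : Typ S k) (h : HasTyI Γ t (.all τ)) :
    HasTyI Γ (.tyApp t σ) (τ.inst σ) := HasTy.tyApp σ h

theorem tyApp' {τ : Typ S (k + 1)} {σ τ' : Typ S k} (h : HasTyI Γ t (.all τ)) (e : τ.inst σ = τ') :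
    HasTyI Γ (.tyApp t σ) τ' := e ▸ HasTy.tyApp σ h

theorem letStar (ht : HasTyI Γ t .one) (hs : HasTyI Γ s τ) : HasTyI Γ (.letStar t s) τ :=
  HasTy.letStar splits_many ht hs

theorem letTensor {s : Tm S k (n + 2)} (ht : HasTyI Γ t (.tensor σ σ'))
    (hs : HasTyI (push σ' (push σ Γ)) s τ) (h0 : s.cnt 0 = 1) (h1 : s.cnt 1 = 1) :
    HasTyI Γ (.letTensor σ σ' t s) τ :=
  HasTy.letTensor splits_many ht (hs.of_cnt (CntOK.push (CntOK.push (fun _ => ⟨nofun, nofun⟩)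
    (fun _ => h1) nofun) (fun _ => h0) nofun))

theorem letBang {s : Tm S k (n + 1)} (ht : HasTyI Γ t (.bang σ)) (hs : HasTyI (push σ Γ) s τ) :
    HasTyI Γ (.letBang σ t s) τ :=
  HasTy.letBang splits_many ht (hs.of_cnt (CntOK.push (fun _ => ⟨nofun, nofun⟩) nofun nofun))

end HasTyI

theorem wkCtx_ren {k n k' n' : ℕ} {Γ : Fin n → Typ S k} {Γ' : Fin n' → Typ S k'}
    {f : Fin k → Fin k'} {g : Fin n → Fin n'} (h : ∀ i, Γ' (g i) = (Γ i).ren f) (i : Fin n) :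
    wkCtx Γ' (g i) = (wkCtx Γ i).ren (up f) := by
  simp only [wkCtx, h, Ty.wk_ren_up]

theorem push_ren {k n k' n' : ℕ} {Γ : Fin n → Typ S k} {Γ' : Fin n' → Typ S k'}
    {f : Fin k → Fin k'} {g : Fin n → Fin n'} (h : ∀ i, Γ' (g i) = (Γ i).ren f) (σ : Typ S k)
    (i : Fin (n + 1)) :
    (push (σ.ren f) Γ' : Fin (n' + 1) → Typ S k') (up g i) =
      ((push σ Γ : Fin (n + 1) → Typ S k) i).ren f :=
  Fin.cases rfl h i

/-- A renaming may identify variables, so linearity of the free variables is not preserved; the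
conclusion is therefore intuitionistic. Bound variables keep their counts, which is what the linear
binders require. The same holds for `HasTy.subst`. -/
theorem HasTy.ren {k n : ℕ} {Γ : Fin n → Typ S k} {u : Fin n → Mult} {t : Tm S k n}
    {τ : Typ S k} (ht : HasTy Γ u t τ) : ∀ {k' n' : ℕ} {Γ' : Fin n' → Typ S k'} {f : Fin k → Fin k'}
      {g : Fin n → Fin n'}, (∀ i, Γ' (g i) = (Γ i).ren f) →
      HasTyI Γ' (t.ren f g) (τ.ren f) := by
  induction ht with
  | var i => exact fun h => .var' (h i)
  | star => exact fun _ => HasTy.star noLinear_many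
  | fix => exact fun _ => by rw [Ty.ren_cl]; exact .fix
  | const c => exact fun _ => by rw [Ty.ren_cl]; exact HasTy.const c noLinear_many
  | lam ht ih =>
    exact fun h => .lam (ih (push_ren h _)) ((Tm.cnt_ren_up_zero _ _ _).trans ((ht.cnt_eq 0).1 rfl))
  | app _ _ _ ih₁ ih₂ => exact fun h => .app (ih₁ h) (ih₂ h)
  | tensor _ _ _ ih₁ ih₂ => exact fun h => .tensor (ih₁ h) (ih₂ h)
  | bang _ _ ih => exact fun h => .bang (ih h)
  | tyLam _ ih => exact fun h => .tyLam (ih (wkCtx_ren h))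
  | tyApp τ _ ih => exact fun h => .tyApp' (ih h) (Ty.inst_ren _ _ _).symm
  | letStar _ _ _ ih₁ ih₂ => exact fun h => .letStar (ih₁ h) (ih₂ h)
  | letTensor _ _ ht ih₁ ih₂ =>
    exact fun h => .letTensor (ih₁ h) (ih₂ (push_ren (push_ren h _) _))
      ((Tm.cnt_ren_up_zero _ _ _).trans ((ht.cnt_eq 0).1 rfl))
      ((Tm.cnt_ren_up_up_one _ _ _).trans ((ht.cnt_eq 1).1 rfl))
  | letBang _ _ _ ih₁ ih₂ => exact fun h => .letBang (ih₁ h) (ih₂ (push_ren h _))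

theorem HasTyI.wk {k n : ℕ} {Γ : Fin n → Typ S k} {t : Tm S k n} {τ : Typ S k} (h : HasTyI Γ t τ)
    (σ : Typ S k) : HasTyI (push σ Γ) t.wk τ := by
  have := h.ren (Γ' := push σ Γ) (f := id) (g := Fin.succ) fun i => (Ty.ren_id _).symm
  rwa [Ty.ren_id] at this

theorem HasTyI.wkTy {k n : ℕ} {Γ : Fin n → Typ S k} {t : Tm S k n} {τ : Typ S k}
    (h : HasTyI Γ t τ) : HasTyI (wkCtx Γ) t.wkTy τ.wk :=
  h.ren fun _ => rfl

theorem wkCtx_subst {k n k' n' : ℕ} {Γ : Fin n → Typ S k} {Γ' : Fin n' → Typ S k'}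
    {θ : Fin k → Typ S k'} {s : Fin n → Tm S k' n'} (h : ∀ i, HasTyI Γ' (s i) ((Γ i).subst θ))
    (i : Fin n) : HasTyI (wkCtx Γ') (s i).wkTy ((wkCtx Γ i).subst (Ty.upS θ)) := by
  rw [wkCtx, Ty.wk_subst_upS]
  exact (h i).wkTy

theorem push_subst {k n k' n' : ℕ} {Γ : Fin n → Typ S k} {Γ' : Fin n' → Typ S k'}
    {θ : Fin k → Typ S k'} {s : Fin n → Tm S k' n'} (h : ∀ i, HasTyI Γ' (s i) ((Γ i).subst θ))
    (σ : Typ S k) (i : Fin (n + 1)) : HasTyI (push (σ.subst θ) Γ') (Tm.upS s i)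
      (((push σ Γ : Fin (n + 1) → Typ S k) i).subst θ) :=
  Fin.cases (.var 0) (fun i => (h i).wk _) i

theorem HasTy.subst {k n : ℕ} {Γ : Fin n → Typ S k} {u : Fin n → Mult} {t : Tm S k n}
    {τ : Typ S k} (ht : HasTy Γ u t τ) : ∀ {k' n' : ℕ} {Γ' : Fin n' → Typ S k'}
      {θ : Fin k → Typ S k'} {s : Fin n → Tm S k' n'}, (∀ i, HasTyI Γ' (s i) ((Γ i).subst θ)) →
      HasTyI Γ' (t.subst θ s) (τ.subst θ) := by
  induction ht with
  | var i => exact fun h => h i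
  | star => exact fun _ => HasTy.star noLinear_many
  | fix => exact fun _ => by rw [Ty.subst_cl]; exact .fix
  | const c => exact fun _ => by rw [Ty.subst_cl]; exact HasTy.const c noLinear_many
  | lam ht ih =>
    exact fun h => .lam (ih (push_subst h _))
      ((Tm.cnt_subst_upS_zero _ _ _).trans ((ht.cnt_eq 0).1 rfl))
  | app _ _ _ ih₁ ih₂ => exact fun h => .app (ih₁ h) (ih₂ h)
  | tensor _ _ _ ih₁ ih₂ => exact fun h => .tensor (ih₁ h) (ih₂ h)
  | bang _ _ ih => exact fun h => .bang (ih h)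
  | tyLam _ ih => exact fun h => .tyLam (ih (wkCtx_subst h))
  | tyApp τ _ ih => exact fun h => .tyApp' (ih h) (Ty.inst_subst _ _ _).symm
  | letStar _ _ _ ih₁ ih₂ => exact fun h => .letStar (ih₁ h) (ih₂ h)
  | letTensor _ _ ht ih₁ ih₂ =>
    exact fun h => .letTensor (ih₁ h) (ih₂ (push_subst (push_subst h _) _))
      ((Tm.cnt_subst_upS_zero _ _ _).trans ((ht.cnt_eq 0).1 rfl))
      ((Tm.cnt_subst_upS_upS_one _ _ _).trans ((ht.cnt_eq 1).1 rfl))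
  | letBang _ _ _ ih₁ ih₂ => exact fun h => .letBang (ih₁ h) (ih₂ (push_subst h _))

theorem HasTyI.subst {k n k' n' : ℕ} {Γ : Fin n → Typ S k} {t : Tm S k n} {τ : Typ S k}
    {Γ' : Fin n' → Typ S k'} {θ : Fin k → Typ S k'} {s : Fin n → Tm S k' n'} (ht : HasTyI Γ t τ)
    (h : ∀ i, HasTyI Γ' (s i) ((Γ i).subst θ)) : HasTyI Γ' (t.subst θ s) (τ.subst θ) :=
  HasTy.subst ht h

theorem HasTyI.inst {k n : ℕ} {Γ : Fin n → Typ S k} {t : Tm S k (n + 1)} {s : Tm S k n}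
    {σ τ : Typ S k} (ht : HasTyI (push σ Γ) t τ) (hs : HasTyI Γ s σ) : HasTyI Γ (t.inst s) τ := by
  have := ht.subst (Γ' := Γ) (θ := Ty.var) (s := push s Tm.var)
    (Fin.cases (by rw [Ty.subst_var]; exact hs) fun i => by rw [Ty.subst_var]; exact .var i)
  rwa [Ty.subst_var] at this

theorem HasTyI.inst2 {k n : ℕ} {Γ : Fin n → Typ S k} {t : Tm S k (n + 2)} {s s' : Tm S k n}
    {σ σ' τ : Typ S k} (ht : HasTyI (push σ' (push σ Γ)) t τ) (hs : HasTyI Γ s σ)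
    (hs' : HasTyI Γ s' σ') : HasTyI Γ (t.inst2 s s') τ := by
  have := ht.subst (Γ' := Γ) (θ := Ty.var) (s := push s' (push s Tm.var))
    (Fin.cases (by rw [Ty.subst_var]; exact hs')
      (Fin.cases (by rw [Ty.subst_var]; exact hs) fun i => by rw [Ty.subst_var]; exact .var i))
  rwa [Ty.subst_var] at this

theorem HasTyI.instTy {k n : ℕ} {Γ : Fin n → Typ S k} {t : Tm S (k + 1) n} {τ : Typ S (k + 1)}
    (ht : HasTyI (wkCtx Γ) t τ) (σ : Typ S k) : HasTyI Γ (t.instTy σ) (τ.inst σ) :=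
  ht.subst fun i => by rw [wkCtx, Ty.wk_subst_push, Ty.subst_var]; exact .var i

theorem HasTyI.cl {k n : ℕ} {Γ : Fin n → Typ S k} {t : Tm S 0 0} {τ : Typ S 0}
    (ht : HasTyI Fin.elim0 t τ) : HasTyI Γ t.cl τ.cl :=
  HasTy.ren ht fun i => i.elim0

end Typing

attribute [simp] Ty.subst_var Tm.subst_var Form.subst_var Rel.subst_var
attribute [simp] Ty.subst Tm.subst Form.subst Rel.subst Ty.ren Tm.ren Form.ren Rel.ren
attribute [simp] Tm.cnt

-- Simplification rules for weakening followed by substitution.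

section TermLemmas

variable {S : Sig.{u, v}}

namespace Tm

variable {k n k' n' : ℕ}

@[simp] theorem upS_zero (s : Fin n → Tm S k n') : upS s 0 = var 0 := rfl

@[simp] theorem upS_one (s : Fin (n + 1) → Tm S k n') : upS s 1 = (s 0).wk := rfl

@[simp] theorem upS_succ' (s : Fin n → Tm S k n') (i : Fin n) : upS s i.succ = (s i).wk := rfl

@[simp] theorem upS_var_id : upS (var : Fin n → Tm S k n) = var :=
  push_ext rfl fun _ => rfl

@[simp] theorem wk_var (i : Fin n) : (var i : Tm S k n).wk = var i.succ := rfl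

@[simp] theorem wkTy_var (i : Fin n) : (var i : Tm S k n).wkTy = var i := rfl

@[simp] theorem wk_subst_push (a : Tm S k' n') (θ : Fin k → Typ S k') (s : Fin n → Tm S k' n')
    (t : Tm S k n) : t.wk.subst θ (push a s) = t.subst θ s := subst_ren _ _ _ _ _

@[simp] theorem wk_subst_upS (θ : Fin k → Typ S k') (s : Fin n → Tm S k' n') (t : Tm S k n) :
    t.wk.subst θ (upS s) = (t.subst θ s).wk := by
  simp only [wk, subst_ren, ren_subst, id_eq, Ty.ren_id]
  rfl

@[simp] theorem wkTy_subst_push (σ : Typ S k') (θ : Fin k → Typ S k') (s : Fin n → Tm S k' n')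
    (t : Tm S k n) : t.wkTy.subst (push σ θ) s = t.subst θ s := subst_ren _ _ _ _ _

@[simp] theorem subst_wkTy' (θ : Fin k → Typ S k') (s : Fin n → Tm S k' n') (t : Tm S k n) :
    t.wkTy.subst (Ty.upS θ) (fun i => (s i).wkTy) = (t.subst θ s).wkTy := subst_wkTy t θ s

theorem wkTy_push (a : Tm S k n') (s : Fin n → Tm S k n') :
    (fun i => (push a s i : Tm S k n').wkTy) = push a.wkTy fun i => (s i).wkTy :=
  push_ext rfl fun _ => rfl

theorem subst_congr {θ θ' : Fin k → Typ S k'} {s s' : Fin n → Tm S k' n'}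
    (h : ∀ i, θ i = θ' i) (h' : ∀ i, s i = s' i) (t : Tm S k n) :
    t.subst θ s = t.subst θ' s' := by
  rw [funext h, funext h']

@[simp] theorem subst_cl (t : Tm S 0 0) (θ : Fin k → Typ S k') (s : Fin n → Tm S k' n') :
    (t.cl : Tm S k n).subst θ s = t.cl := by
  rw [cl, cl, subst_ren, ren_eq_subst]
  exact subst_congr (fun i => i.elim0) (fun i => i.elim0) t

@[simp] theorem ren_cl (t : Tm S 0 0) (f : Fin k → Fin k') (g : Fin n → Fin n') :
    (t.cl : Tm S k n).ren f g = t.cl := by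
  rw [ren_eq_subst, subst_cl]

@[simp] theorem wk_cl (t : Tm S 0 0) : (t.cl : Tm S k n).wk = t.cl := ren_cl t _ _

@[simp] theorem wkTy_cl (t : Tm S 0 0) : (t.cl : Tm S k n).wkTy = t.cl := ren_cl t _ _

@[simp] theorem cl_self (t : Tm S 0 0) : t.cl = t := by
  rw [cl, ren_eq_subst]
  exact (subst_congr (fun i => i.elim0) (fun i => i.elim0) t).trans t.subst_var

/-- Under one binder, a term in which the variable below is skipped. -/
@[simp] theorem ren_up_succ_subst (t : Tm S k (n + 1)) (a b : Tm S k' n') (θ : Fin k → Typ S k')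
    (s : Fin n → Tm S k' n') :
    (t.ren id (up Fin.succ)).subst θ (push a (push b s)) = t.subst θ (push a s) := by
  rw [subst_ren]
  exact subst_congr (fun _ => rfl) (Fin.cases rfl fun _ => rfl) t

attribute [simp] cnt_wk_zero cnt_wk_succ cnt_wkTy cnt_cl cnt_ren_up_zero cnt_subst_upS_zero

@[simp] theorem cnt_wk_one (t : Tm S k (n + 1)) : t.wk.cnt 1 = t.cnt 0 := cnt_wk_succ t 0

@[simp] theorem cnt_wk_two (t : Tm S k (n + 2)) : t.wk.cnt 2 = t.cnt 1 := cnt_wk_succ t 1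

@[simp] theorem cnt_ren_up_one (f : Fin k → Fin k') (t : Tm S k (n + 1)) :
    (t.ren f (up Fin.succ)).cnt (1 : Fin (n + 2)) = 0 := by
  have : (1 : Fin (n + 2)) = Fin.succ 0 := rfl
  rw [this, cnt_ren_up_succ]
  simp

end Tm

namespace Rel

variable {k n r k' n' r' : ℕ}

@[simp] theorem wk2_subst_push (a b : Tm S k' n') (θ : Fin k → Typ S k') (s : Fin n → Tm S k' n')
    (q : Fin r → Rel S k' n' r') (ρ : Rel S k n r) :
    ρ.wk2.subst θ (push a (push b s)) q = ρ.subst θ s q := subst_ren _ _ _ _ _ _ _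

@[simp] theorem wk2_subst_upS (θ : Fin k → Typ S k') (s : Fin n → Tm S k' n')
    (q : Fin r → Rel S k' n' r') (ρ : Rel S k n r) :
    ρ.wk2.subst θ (Tm.upS (Tm.upS s)) (fun j => (q j).ren id (fun i => i.succ.succ) id) =
      (ρ.subst θ s q).wk2 := by
  simp only [wk2, subst_ren, ren_subst, id_eq, Ty.ren_id, Tm.upS_two_succ]

theorem subst_congr {θ θ' : Fin k → Typ S k'} {s s' : Fin n → Tm S k' n'}
    {q q' : Fin r → Rel S k' n' r'} (h : ∀ i, θ i = θ' i) (h' : ∀ i, s i = s' i)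
    (h'' : ∀ i, q i = q' i) (ρ : Rel S k n r) : ρ.subst θ s q = ρ.subst θ' s' q' := by
  rw [funext h, funext h', funext h'']

end Rel

namespace Form

variable {k n r k' n' r' : ℕ}

@[simp] theorem wkTm_subst_push (a : Tm S k' n') (θ : Fin k → Typ S k') (s : Fin n → Tm S k' n')
    (q : Fin r → Rel S k' n' r') (φ : Form S k n r) :
    φ.wkTm.subst θ (push a s) q = φ.subst θ s q := subst_ren _ _ _ _ _ _ _

@[simp] theorem wkTy_subst_push (σ : Typ S k') (θ : Fin k → Typ S k') (s : Fin n → Tm S k' n')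
    (q : Fin r → Rel S k' n' r') (φ : Form S k n r) :
    φ.wkTy.subst (push σ θ) s q = φ.subst θ s q := subst_ren _ _ _ _ _ _ _

@[simp] theorem wkRel_subst_push (ρ : Rel S k' n' r') (θ : Fin k → Typ S k')
    (s : Fin n → Tm S k' n') (q : Fin r → Rel S k' n' r') (φ : Form S k n r) :
    φ.wkRel.subst θ s (push ρ q) = φ.subst θ s q := subst_ren _ _ _ _ _ _ _

end Form

end TermLemmas

-- Derived rules of the logic and internal equality.

section Logic

variable {S : Sig.{u, v}} {Ax : Form S 0 0 0 → Prop} {k n r : ℕ} {Γ : Fin n → Typ S k}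
  {Θ : Fin r → RelDecl S k} {Φ : List (Form S k n r)}

theorem RelWF.var' {σ τ : Typ S k} {j : Fin r} (h : (Θ j).dom = σ) (h' : (Θ j).cod = τ) :
    RelWF Ax Γ Θ (.var j) σ τ := by
  subst h h'
  exact .var j

theorem Adm.var' {σ τ : Typ S k} {j : Fin r} (h₀ : (Θ j).adm = true) (h : (Θ j).dom = σ)
    (h' : (Θ j).cod = τ) : Adm Ax Γ Θ (.var j) σ τ := by
  subst h h'
  exact .var j h₀

/-- A substitution between contexts of the logic. -/
structure CtxSubst (Ax : Form S 0 0 0 → Prop) {k n r k' n' r' : ℕ} (Γ : Fin n → Typ S k)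
    (Θ : Fin r → RelDecl S k) (Γ' : Fin n' → Typ S k') (Θ' : Fin r' → RelDecl S k')
    (θ : Fin k → Typ S k') (s : Fin n → Tm S k' n') (q : Fin r → Rel S k' n' r') : Prop where
  tm : ∀ i, HasTyI Γ' (s i) ((Γ i).subst θ)
  rel : ∀ j, RelWF Ax Γ' Θ' (q j) ((Θ j).dom.subst θ) ((Θ j).cod.subst θ)
  adm : ∀ j, (Θ j).adm = true → Adm Ax Γ' Θ' (q j) ((Θ j).dom.subst θ) ((Θ j).cod.subst θ)

theorem Prov.substCtx {k' n' r' : ℕ} {Γ' : Fin n' → Typ S k'} {Θ' : Fin r' → RelDecl S k'}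
    {θ : Fin k → Typ S k'} {s : Fin n → Tm S k' n'} {q : Fin r → Rel S k' n' r'}
    {φ : Form S k n r} (hs : CtxSubst Ax Γ Θ Γ' Θ' θ s q) (h : Prov Ax Γ Θ Φ φ) :
    Prov Ax Γ' Θ' (Φ.map (Form.subst θ s q)) (φ.subst θ s q) :=
  .subst θ s q hs.tm hs.rel hs.adm h

theorem CtxSubst.pushTm {t : Tm S k n} {σ : Typ S k} (ht : HasTyI Γ t σ) :
    CtxSubst Ax (push σ Γ) Θ Γ Θ Ty.var (push t Tm.var) Rel.var where
  tm := Fin.cases (by simpa using ht) fun i => .var' (by simp)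
  rel j := .var' (by simp) (by simp)
  adm j h := .var' h (by simp) (by simp)

theorem CtxSubst.pushTy (σ : Typ S k) :
    CtxSubst Ax (wkCtx Γ) (wkRCtx Θ) Γ Θ (push σ Ty.var) Tm.var Rel.var where
  tm i := .var' (by simp [wkCtx])
  rel j := .var' (by simp [wkRCtx]) (by simp [wkRCtx])
  adm j h := .var' h (by simp [wkRCtx]) (by simp [wkRCtx])

theorem CtxSubst.pushRel {ρ : Rel S k n r} {σ τ : Typ S k} (hρ : Adm Ax Γ Θ ρ σ τ) (a : Bool) :
    CtxSubst Ax Γ (push ⟨a, σ, τ⟩ Θ) Γ Θ Ty.var Tm.var (push ρ Rel.var) where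
  tm i := .var' (by simp)
  rel := Fin.cases (by simpa using .ofAdm hρ) fun j => .var' (by simp) (by simp)
  adm := Fin.cases (fun _ => by simpa using hρ) fun j h => .var' h (by simp) (by simp)

theorem CtxSubst.wkTm (σ : Typ S k) :
    CtxSubst Ax Γ Θ (push σ Γ) Θ Ty.var (fun i => Tm.var i.succ) Rel.var where
  tm i := .var' (by simp)
  rel j := .var' (by simp) (by simp)
  adm j h := .var' h (by simp) (by simp)

theorem CtxSubst.wkTy :
    CtxSubst Ax Γ Θ (wkCtx Γ) (wkRCtx Θ) (fun i => Ty.var i.succ) Tm.var Rel.var where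
  tm i := .var' (Ty.ren_eq_subst _ _)
  rel j := .var' (Ty.ren_eq_subst _ _) (Ty.ren_eq_subst _ _)
  adm j h := .var' h (Ty.ren_eq_subst _ _) (Ty.ren_eq_subst _ _)

theorem CtxSubst.wkRel (d : RelDecl S k) :
    CtxSubst Ax Γ Θ Γ (push d Θ) Ty.var Tm.var fun j => Rel.var j.succ where
  tm i := .var' (by simp)
  rel j := .var' (by simp) (by simp)
  adm j h := .var' h (by simp) (by simp)

theorem Form.wkTm_eq_subst (φ : Form S k n r) :
    φ.wkTm = φ.subst Ty.var (fun i => Tm.var i.succ) Rel.var := Form.ren_eq_subst _ _ _ _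

theorem Form.wkTy_eq_subst (φ : Form S k n r) :
    φ.wkTy = φ.subst (fun i => Ty.var i.succ) Tm.var Rel.var := Form.ren_eq_subst _ _ _ _

theorem Form.wkRel_eq_subst (φ : Form S k n r) :
    φ.wkRel = φ.subst Ty.var Tm.var fun j => Rel.var j.succ := Form.ren_eq_subst _ _ _ _

theorem Prov.wkTm {φ : Form S k n r} (σ : Typ S k) (h : Prov Ax Γ Θ Φ φ) :
    Prov Ax (push σ Γ) Θ (Φ.map Form.wkTm) φ.wkTm := by
  rw [Form.wkTm_eq_subst, List.map_congr_left fun φ _ => Form.wkTm_eq_subst φ]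
  exact h.substCtx (.wkTm σ)

theorem Prov.wkTy {φ : Form S k n r} (h : Prov Ax Γ Θ Φ φ) :
    Prov Ax (wkCtx Γ) (wkRCtx Θ) (Φ.map Form.wkTy) φ.wkTy := by
  rw [Form.wkTy_eq_subst, List.map_congr_left fun φ _ => Form.wkTy_eq_subst φ]
  exact h.substCtx .wkTy

theorem Prov.wkRel {φ : Form S k n r} (d : RelDecl S k) (h : Prov Ax Γ Θ Φ φ) :
    Prov Ax Γ (push d Θ) (Φ.map Form.wkRel) φ.wkRel := by
  rw [Form.wkRel_eq_subst, List.map_congr_left fun φ _ => Form.wkRel_eq_subst φ]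
  exact h.substCtx (.wkRel d)

/-- The elimination rule only opens the quantifier by adding a variable; instantiation is then the
substitution rule. The hypotheses, weakened and then substituted, are the original ones. Quantifiers
over types and relations are treated alike. -/
theorem Prov.allTm_elim {σ : Typ S k} {φ : Form S k (n + 1) r} {t : Tm S k n}
    (h : Prov Ax Γ Θ Φ (.allTm σ φ)) (ht : HasTyI Γ t σ) :
    Prov Ax Γ Θ Φ (φ.subst Ty.var (push t Tm.var) Rel.var) := by
  have := h.allTmE.substCtx (.pushTm ht)
  rwa [List.map_map, List.map_congr_left (g := id) fun φ _ => by simp, List.map_id] at this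

theorem Prov.allTy_elim {φ : Form S (k + 1) n r} (h : Prov Ax Γ Θ Φ (.allTy φ)) (σ : Typ S k) :
    Prov Ax Γ Θ Φ (φ.subst (push σ Ty.var) Tm.var Rel.var) := by
  have := h.allTyE.substCtx (.pushTy σ)
  rwa [List.map_map, List.map_congr_left (g := id) fun φ _ => by simp, List.map_id] at this

theorem Prov.allRel_elim {a : Bool} {σ τ : Typ S k} {φ : Form S k n (r + 1)} {ρ : Rel S k n r}
    (h : Prov Ax Γ Θ Φ (.allRel a σ τ φ)) (hρ : Adm Ax Γ Θ ρ σ τ) :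
    Prov Ax Γ Θ Φ (φ.subst Ty.var Tm.var (push ρ Rel.var)) := by
  have := h.allRelE.substCtx (.pushRel hρ a)
  rwa [List.map_map, List.map_congr_left (g := id) fun φ _ => by simp, List.map_id] at this

theorem Prov.weaken_nil {φ : Form S k n r} (h : Prov Ax Γ Θ [] φ) : Prov Ax Γ Θ Φ φ :=
  .weaken (by simp) h

theorem Prov.rel_abs {σ τ : Typ S k} {φ : Form S k (n + 2) r} {t s : Tm S k n}
    (hφ : FormWF Ax (push τ (push σ Γ)) Θ φ) (ht : HasTyI Γ t σ) (hs : HasTyI Γ s τ) :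
    Prov Ax Γ Θ Φ (.rel (.abs σ τ φ) t s) ↔ Prov Ax Γ Θ Φ (φ.inst2 t s) :=
  ⟨fun h => .impE (.andE₁ (.defRel hφ ht hs)) h, fun h => .impE (.andE₂ (.defRel hφ ht hs)) h⟩

theorem Prov.equiv_iff {σ τ : Typ S k} {ρ ρ' : Rel S k n r} {t s : Tm S k n}
    (h : Prov Ax Γ Θ Φ (Rel.equiv σ τ ρ ρ')) (ht : HasTyI Γ t σ) (hs : HasTyI Γ s τ) :
    Prov Ax Γ Θ Φ (.rel ρ t s) ↔ Prov Ax Γ Θ Φ (.rel ρ' t s) := by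
  have h₁ := (h.allTm_elim ht).allTm_elim (t := s) (by rwa [Ty.subst_var])
  simp only [Form.iff, Form.subst, Form.subst_subst, Rel.subst_subst, Tm.subst] at h₁
  have key : ∀ ρ : Rel S k n r,
      (ρ.wk2.subst Ty.var (Tm.upS (push t Tm.var)) fun j => (Rel.var j).ren id Fin.succ id).subst
        Ty.var (push s Tm.var) Rel.var = ρ := fun ρ => by
    rw [Rel.wk2, Rel.subst_ren, Rel.subst_subst]
    exact (Rel.subst_congr (fun i => by simp) (fun i => by simp) (fun i => by simp) ρ).trans
      ρ.subst_var
  simp only [Rel.subst_subst] at key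
  simp only [key] at h₁
  have e : (Tm.upS (push t Tm.var) 1).subst Ty.var (push s Tm.var) = t := by simp
  have e' : (Tm.upS (push t Tm.var) 0).subst Ty.var (push s Tm.var) = s := by simp
  simp only [e, e'] at h₁
  exact ⟨fun h => .impE (.andE₁ h₁) h, fun h => .impE (.andE₂ h₁) h⟩

/-- Well-typed terms that are provably equal. -/
structure IEq (Ax : Form S 0 0 0 → Prop) {k n r : ℕ} (Γ : Fin n → Typ S k)
    (Θ : Fin r → RelDecl S k) (Φ : List (Form S k n r)) (σ : Typ S k) (t s : Tm S k n) : Prop where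
  left : HasTyI Γ t σ
  right : HasTyI Γ s σ
  prov : Prov Ax Γ Θ Φ (.eq σ t s)

namespace IEq

variable {σ τ : Typ S k} {t s t' s' w : Tm S k n}

theorem ofExt (ht : HasTyI Γ t σ) (hs : HasTyI Γ s σ) (h : ExtEq Γ (fun _ => .many) t s σ) :
    IEq Ax Γ Θ Φ σ t s := ⟨ht, hs, .extEq ht hs h⟩

theorem refl (ht : HasTyI Γ t σ) : IEq Ax Γ Θ Φ σ t t := .ofExt ht ht (.refl ht)

theorem symm (h : IEq Ax Γ Θ Φ σ t s) : IEq Ax Γ Θ Φ σ s t := ⟨h.right, h.left, .symm h.prov⟩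

theorem trans (h : IEq Ax Γ Θ Φ σ t s) (h' : IEq Ax Γ Θ Φ σ s w) : IEq Ax Γ Θ Φ σ t w :=
  ⟨h.left, h'.right, .trans h.prov h'.prov⟩

/-- Leibniz's principle: the relation (x, y). C[t] = C[y] holds at (t, t), and the substitution
axiom moves its second argument to s. The congruence rules for constructors without binders are
instances; the one for abstraction needs extensionality. -/
theorem cong {C : Tm S k (n + 1)} (hC : HasTyI (push σ Γ) C τ) (h : IEq Ax Γ Θ Φ σ t s) :
    IEq Ax Γ Θ Φ τ (C.inst t) (C.inst s) := by
  have hwf : FormWF Ax (push σ (push σ Γ)) Θ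
      (.eq τ (C.inst t).wk.wk (C.ren id (up Fin.succ)) : Form S k (n + 2) r) := by
    refine .eq (((hC.inst h.left).wk _).wk _) ?_
    have := HasTy.ren hC (Γ' := push σ (push σ Γ)) (f := id) (g := up Fin.succ)
      (Fin.cases (Ty.ren_id _).symm fun i => (Ty.ren_id _).symm)
    rwa [Ty.ren_id] at this
  have e : ∀ s : Tm S k n,
      (Form.eq τ (C.inst t).wk.wk (C.ren id (up Fin.succ)) : Form S k (n + 2) r).inst2 t s =
        .eq τ (C.inst t) (C.inst s) := fun s => by
    simp only [Form.inst2, Form.subst, Tm.wk_subst_push, Tm.subst_var, Ty.subst_var,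
      Tm.ren_up_succ_subst]
    rfl
  refine ⟨hC.inst h.left, hC.inst h.right, ?_⟩
  have h₁ : Prov Ax Γ Θ Φ (.rel (.abs σ σ (.eq τ (C.inst t).wk.wk (C.ren id (up Fin.succ)))) t t) := by
    rw [Prov.rel_abs hwf h.left h.left, e]
    exact (refl (hC.inst h.left)).prov
  have h₂ := Prov.substitution (.abs hwf) h₁ (refl h.left).prov h.prov
  rwa [Prov.rel_abs hwf h.left h.right, e] at h₂

theorem app (h : IEq Ax Γ Θ Φ (.lolli σ τ) t t') (h' : IEq Ax Γ Θ Φ σ s s') :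
    IEq Ax Γ Θ Φ τ (.app t s) (.app t' s') := by
  have h₁ := cong (C := .app (.var 0) s.wk) (.app (.var 0) (h'.left.wk _)) h
  have h₂ := cong (C := .app t'.wk (.var 0)) (.app (h.right.wk _) (.var 0)) h'
  simp only [Tm.inst, Tm.subst, Tm.wk_subst_push, Tm.subst_var, push_zero] at h₁ h₂
  exact h₁.trans h₂

theorem appL (h : IEq Ax Γ Θ Φ (.lolli σ τ) t t') (hs : HasTyI Γ s σ) :
    IEq Ax Γ Θ Φ τ (.app t s) (.app t' s) := h.app (.refl hs)

theorem appR (ht : HasTyI Γ t (.lolli σ τ)) (h : IEq Ax Γ Θ Φ σ s s') :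
    IEq Ax Γ Θ Φ τ (.app t s) (.app t s') := (refl ht).app h

theorem tensor (h : IEq Ax Γ Θ Φ σ t t') (h' : IEq Ax Γ Θ Φ τ s s') :
    IEq Ax Γ Θ Φ (.tensor σ τ) (.tensor t s) (.tensor t' s') := by
  have h₁ := cong (C := .tensor (.var 0) s.wk) (.tensor (.var 0) (h'.left.wk _)) h
  have h₂ := cong (C := .tensor t'.wk (.var 0)) (.tensor (h.right.wk _) (.var 0)) h'
  simp only [Tm.inst, Tm.subst, Tm.wk_subst_push, Tm.subst_var, push_zero] at h₁ h₂
  exact h₁.trans h₂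

theorem bang (h : IEq Ax Γ Θ Φ σ t t') : IEq Ax Γ Θ Φ (.bang σ) (.bang t) (.bang t') := by
  have h₁ := cong (C := .bang (.var 0)) (.bang (.var 0)) h
  simpa only [Tm.inst, Tm.subst, push_zero] using h₁

theorem tyApp {τ : Typ S (k + 1)} (h : IEq Ax Γ Θ Φ (.all τ) t t') (σ : Typ S k) :
    IEq Ax Γ Θ Φ (τ.inst σ) (.tyApp t σ) (.tyApp t' σ) := by
  have h₁ := cong (C := .tyApp (.var 0) σ) (.tyApp σ (.var 0)) h
  simpa only [Tm.inst, Tm.subst, push_zero, Ty.subst_var] using h₁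

theorem tyApp' {τ : Typ S (k + 1)} {τ' : Typ S k} (h : IEq Ax Γ Θ Φ (.all τ) t t') {σ : Typ S k}
    (e : τ.inst σ = τ') : IEq Ax Γ Θ Φ τ' (.tyApp t σ) (.tyApp t' σ) := e ▸ h.tyApp σ

theorem beta {t : Tm S k (n + 1)} (ht : HasTyI (push σ Γ) t τ) (hc : t.cnt 0 = 1)
    (hs : HasTyI Γ s σ) : IEq Ax Γ Θ Φ τ (.app (.lam σ t) s) (t.inst s) :=
  have h := HasTyI.app (.lam ht hc) hs
  .ofExt h (ht.inst hs) (.beta h)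

theorem ilam_typed {t : Tm S k (n + 1)} (ht : HasTyI (push σ Γ) t τ) :
    HasTyI Γ (.ilam σ t) (.arrow σ τ) := by
  refine .lam (.letBang (.var 0) ?_) (by simp)
  have := HasTy.ren ht (Γ' := push σ (push (.bang σ) Γ)) (f := id) (g := up Fin.succ)
    (Fin.cases (Ty.ren_id _).symm fun i => (Ty.ren_id _).symm)
  rwa [Ty.ren_id] at this

theorem ext (hE : Extensionality Ax) (ht : HasTyI Γ t (.lolli σ τ)) (hs : HasTyI Γ s (.lolli σ τ))
    (h : IEq Ax (push σ Γ) Θ (Φ.map Form.wkTm) τ (.app t.wk (.var 0)) (.app s.wk (.var 0))) :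
    IEq Ax Γ Θ Φ (.lolli σ τ) t s :=
  ⟨ht, hs, .impE (.weaken_nil (hE.1 k n r Γ Θ σ τ t s ht hs)) (.allTmI h.prov)⟩

theorem extTy (hE : Extensionality Ax) {τ : Typ S (k + 1)} (ht : HasTyI Γ t (.all τ))
    (hs : HasTyI Γ s (.all τ)) (h : IEq Ax (wkCtx Γ) (wkRCtx Θ) (Φ.map Form.wkTy) τ
      (.tyApp t.wkTy (.var 0)) (.tyApp s.wkTy (.var 0))) :
    IEq Ax Γ Θ Φ (.all τ) t s :=
  ⟨ht, hs, .impE (.weaken_nil (hE.2 k n r Γ Θ τ t s ht hs)) (.allTyI h.prov)⟩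

theorem wk (h : IEq Ax Γ Θ Φ τ t s) (σ : Typ S k) :
    IEq Ax (push σ Γ) Θ (Φ.map Form.wkTm) τ t.wk s.wk :=
  ⟨h.left.wk σ, h.right.wk σ, by
    have := h.prov.wkTm σ
    rwa [Form.wkTm, Form.ren, Ty.ren_id] at this⟩

end IEq

end Logic

-- Substitution in relations built from graphs, ⊸ and →.

section RelSubst

variable {S : Sig.{u, v}} {k n r k' n' r' : ℕ}

namespace Rel

@[simp] theorem graph_subst (σ τ : Typ S k) (f : Tm S k n) (θ : Fin k → Typ S k')
    (s : Fin n → Tm S k' n') (q : Fin r → Rel S k' n' r') :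
    (graph σ τ f : Rel S k n r).subst θ s q = graph (σ.subst θ) (τ.subst θ) (f.subst θ s) := by
  simp [graph]

theorem ren_wk (t : Tm S k n) (f : Fin k → Fin k') (g : Fin n → Fin n') :
    t.wk.ren f (up g) = (t.ren f g).wk := by
  simp only [Tm.wk, Tm.ren_ren, up_succ, id_eq]

@[simp] theorem graph_ren (σ τ : Typ S k) (g : Tm S k n) (f : Fin k → Fin k') (f' : Fin n → Fin n')
    (h : Fin r → Fin r') :
    (graph σ τ g : Rel S k n r).ren f f' h = graph (σ.ren f) (τ.ren f) (g.ren f f') := by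
  simp [graph, ren_wk]

/-- The relational interpretation of a type at graphs. -/
def gr {m : ℕ} (σ : Typ S m) (a b : Fin m → Typ S k) (f : Fin m → Tm S k n) : Rel S k n r :=
  .interp σ fun i => graph (a i) (b i) (f i)

@[simp] theorem gr_ren {m : ℕ} (σ : Typ S m) (a b : Fin m → Typ S k) (f : Fin m → Tm S k n)
    (g : Fin k → Fin k') (g' : Fin n → Fin n') (h : Fin r → Fin r') :
    (gr σ a b f : Rel S k n r).ren g g' h =
      gr σ (fun i => (a i).ren g) (fun i => (b i).ren g) fun i => (f i).ren g g' := by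
  simp only [gr, ren, graph_ren]

/-- The defining formula of `ρ ⊸ ρ'`, at two terms. -/
def lolliForm (σ τ : Typ S k) (ρ ρ' : Rel S k n r) (t s : Tm S k n) : Form S k n r :=
  .allTm2 σ τ (.imp (.rel ρ.wk2 (.var 1) (.var 0))
    (.rel ρ'.wk2 (.app t.wk.wk (.var 1)) (.app s.wk.wk (.var 0))))

/-- The defining formula of `ρ → ρ'`, at two terms. -/
def arrowForm (σ τ : Typ S k) (ρ ρ' : Rel S k n r) (t s : Tm S k n) : Form S k n r :=
  .allTm2 σ τ (.imp (.rel ρ.wk2 (.var 1) (.var 0))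
    (.rel ρ'.wk2 (.app t.wk.wk (.bang (.var 1))) (.app s.wk.wk (.bang (.var 0)))))

theorem wk2_wk2_subst (ρ : Rel S k n r) (t s : Tm S k n) :
    ρ.wk2.wk2.subst Ty.var (Tm.upS (Tm.upS (push s (push t Tm.var))))
      (fun j => ((Rel.var j : Rel S k n r).ren id Fin.succ id).ren id Fin.succ id) = ρ.wk2 := by
  rw [wk2, wk2, subst_ren, subst_ren, ren_eq_subst]
  exact subst_congr (fun i => rfl) (fun i => by simp) (fun i => rfl) ρ

theorem lolliForm_eq (σ τ : Typ S k) (ρ ρ' : Rel S k n r) (t s : Tm S k n) :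
    (Form.allTm2 σ τ (.imp (.rel ρ.wk2.wk2 (.var 1) (.var 0))
      (.rel ρ'.wk2.wk2 (.app (.var 3) (.var 1)) (.app (.var 2) (.var 0))))).inst2 t s =
    lolliForm σ τ ρ ρ' t s := by
  simp only [lolliForm, Form.inst2, Form.allTm2, Form.subst, wk2_wk2_subst, Ty.subst_var, Tm.subst]
  rfl

theorem arrowForm_eq (σ τ : Typ S k) (ρ ρ' : Rel S k n r) (t s : Tm S k n) :
    (Form.allTm2 σ τ (.imp (.rel ρ.wk2.wk2 (.var 1) (.var 0))
      (.rel ρ'.wk2.wk2 (.app (.var 3) (.bang (.var 1))) (.app (.var 2) (.bang (.var 0)))))).inst2 t s =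
    arrowForm σ τ ρ ρ' t s := by
  simp only [arrowForm, Form.inst2, Form.allTm2, Form.subst, wk2_wk2_subst, Ty.subst_var, Tm.subst]
  rfl

theorem wk2_wk2_subst_up (ρ : Rel S k n r) (θ : Fin k → Typ S k') (s : Fin n → Tm S k' n')
    (q : Fin r → Rel S k' n' r') :
    ρ.wk2.wk2.subst θ (Tm.upS (Tm.upS (Tm.upS (Tm.upS s))))
      (fun j => (((q j).ren id (fun i => i.succ.succ) id).ren id Fin.succ id).ren id Fin.succ id) =
      (ρ.subst θ s q).wk2.wk2 := by
  rw [← wk2_subst_upS, ← wk2_subst_upS]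
  refine subst_congr (fun _ => rfl) (fun _ => rfl) (fun i => ?_) _
  simp only [ren_ren]
  rfl

@[simp] theorem lolli_subst (σ τ σ' τ' : Typ S k) (ρ ρ' : Rel S k n r) (θ : Fin k → Typ S k')
    (s : Fin n → Tm S k' n') (q : Fin r → Rel S k' n' r') :
    (lolli σ τ σ' τ' ρ ρ').subst θ s q =
      lolli (σ.subst θ) (τ.subst θ) (σ'.subst θ) (τ'.subst θ) (ρ.subst θ s q) (ρ'.subst θ s q) := by
  simp only [lolli, Form.allTm2, Rel.subst, Form.subst, wk2_wk2_subst_up, Ty.subst, Tm.subst]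
  rfl

@[simp] theorem arrow_subst (σ τ σ' τ' : Typ S k) (ρ ρ' : Rel S k n r) (θ : Fin k → Typ S k')
    (s : Fin n → Tm S k' n') (q : Fin r → Rel S k' n' r') :
    (arrow σ τ σ' τ' ρ ρ').subst θ s q =
      arrow (σ.subst θ) (τ.subst θ) (σ'.subst θ) (τ'.subst θ) (ρ.subst θ s q) (ρ'.subst θ s q) := by
  simp only [arrow, Form.allTm2, Rel.subst, Form.subst, wk2_wk2_subst_up, Ty.subst, Tm.subst,
    Ty.arrow]
  rfl

end Rel

end RelSubst

-- Admissibility of graphs, and identity extension at arbitrary instances.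

section Logic

variable {S : Sig.{u, v}} {Ax : Form S 0 0 0 → Prop} {k n r m : ℕ} {Γ : Fin n → Typ S k}
  {Θ : Fin r → RelDecl S k} {Φ : List (Form S k n r)}

theorem HasTyI.idTm (σ : Typ S k) : HasTyI Γ (Tm.idTm σ) (.lolli σ σ) := .lam (.var 0) rfl

theorem IEq.betaId {σ : Typ S k} {t : Tm S k n} (ht : HasTyI Γ t σ) :
    IEq Ax Γ Θ Φ σ (.app (Tm.idTm σ) t) t :=
  .beta (.var 0) rfl ht

theorem FormWF.graph {σ τ : Typ S k} {f : Tm S k n} (hf : HasTyI Γ f (.lolli σ τ)) :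
    FormWF Ax (push τ (push σ Γ)) Θ (.eq τ (.app f.wk.wk (.var 1)) (.var 0)) :=
  .eq (.app ((hf.wk _).wk _) (.var 1)) (.var 0)

theorem RelWF.graph {σ τ : Typ S k} {f : Tm S k n} (hf : HasTyI Γ f (.lolli σ τ)) :
    RelWF Ax Γ Θ (Rel.graph σ τ f) σ τ := .abs (.graph hf)

theorem Prov.graph_iff {σ τ : Typ S k} {f t s : Tm S k n} (hf : HasTyI Γ f (.lolli σ τ))
    (ht : HasTyI Γ t σ) (hs : HasTyI Γ s τ) :
    Prov Ax Γ Θ Φ (.rel (Rel.graph σ τ f) t s) ↔ IEq Ax Γ Θ Φ τ (.app f t) s := by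
  rw [Rel.graph, Prov.rel_abs (.graph hf) ht hs]
  have e : (Form.eq τ (.app f.wk.wk (.var 1)) (.var 0) : Form S k (n + 2) r).inst2 t s =
      .eq τ (.app f t) s := by
    simp [Form.inst2]
  rw [e]
  exact ⟨fun h => ⟨.app hf ht, hs, h⟩, fun h => h.prov⟩

theorem Prov.eqRel_iff {σ : Typ S k} {t s : Tm S k n} (ht : HasTyI Γ t σ) (hs : HasTyI Γ s σ) :
    Prov Ax Γ Θ Φ (.rel (Rel.eqRel σ) t s) ↔ IEq Ax Γ Θ Φ σ t s := by
  rw [Rel.eqRel, Prov.graph_iff (.idTm σ) ht hs]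
  exact ⟨fun h => (IEq.betaId ht).symm.trans h, fun h => (IEq.betaId ht).trans h⟩

/-- The graph of f is, up to provable equivalence, the pullback of equality along f and the
identity: f x = id y against f x = y. Admissibility is closed under both operations. Linearity of f
enters through the pullback rule. -/
theorem Adm.graph {σ τ : Typ S k} {f : Tm S k n} (hf : HasTyI Γ f (.lolli σ τ)) :
    Adm Ax Γ Θ (Rel.graph σ τ f) σ τ := by
  have hp := Adm.pullback (Ax := Ax) (Θ := Θ) (.eqRel τ) hf (.idTm (Γ := Γ) τ)
  refine .equiv hp (.graph hf) (.allTmI (.allTmI ?_))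
  have hf' := (hf.wk σ).wk τ
  set Γ' : Fin (n + 2) → Typ S k := push τ (push σ Γ) with hΓ'
  have h1 : HasTyI Γ' (.var 1) σ := .var 1
  have h0 : HasTyI Γ' (.var 0) τ := .var 0
  have wkwk : ∀ t : Tm S k n, t.ren id (fun i => i.succ.succ) = t.wk.wk := fun t => by
    simp only [Tm.wk, Tm.ren_ren]; rfl
  have eg : (Rel.graph σ τ f : Rel S k n r).wk2 = Rel.graph σ τ f.wk.wk := by
    rw [Rel.wk2, Rel.graph_ren, Ty.ren_id, Ty.ren_id, wkwk]
  have ep : (Rel.pullback σ τ f (Tm.idTm τ) (Rel.eqRel τ) : Rel S k n r).wk2 =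
      Rel.pullback σ τ f.wk.wk (Tm.idTm τ) (Rel.eqRel τ) := by
    simp only [Rel.wk2, Rel.pullback, Rel.eqRel, Rel.ren, Form.ren, Rel.graph_ren, Ty.ren_id,
      Rel.ren_wk, Tm.ren, wkwk, Tm.idTm, up_zero, up_one]
    rfl
  rw [eg, ep]
  have hid : ∀ {Γ : Fin (n + 2 + 2) → Typ S k}, HasTyI Γ (Tm.idTm τ).wk.wk (.lolli τ τ) := by
    intro Γ
    have e : (Tm.idTm τ : Tm S k (n + 2)).wk.wk = Tm.idTm τ := by
      simp [Tm.wk, Tm.idTm, Ty.ren_id]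
    rw [e]
    exact .idTm τ
  have wf : FormWF Ax (push τ (push σ Γ')) Θ (.rel (Rel.eqRel τ).wk2
      (.app f.wk.wk.wk.wk (.var 1)) (.app (Tm.idTm τ).wk.wk (.var 0)) : Form S k (n + 2 + 2) r) := by
    refine .rel (σ := τ) (τ := τ) ?_ (.app ((hf'.wk _).wk _) (.var 1)) (.app hid (.var 0))
    have e : (Rel.eqRel τ : Rel S k (n + 2) r).wk2 = Rel.eqRel τ := by
      simp [Rel.wk2, Rel.eqRel, Tm.idTm, Ty.ren_id]
    rw [e]
    exact .graph (.idTm τ)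
  have key : ∀ Ψ : List (Form S k (n + 2) r),
      Prov Ax Γ' Θ Ψ (.rel (Rel.pullback σ τ f.wk.wk (Tm.idTm τ) (Rel.eqRel τ)) (.var 1) (.var 0)) ↔
      Prov Ax Γ' Θ Ψ (.rel (Rel.graph σ τ f.wk.wk) (.var 1) (.var 0)) := by
    intro Ψ
    have e : (Form.rel (Rel.eqRel τ).wk2
      (.app f.wk.wk.wk.wk (.var 1)) (.app (Tm.idTm τ).wk.wk (.var 0)) :
        Form S k (n + 2 + 2) r).inst2 (.var 1) (.var 0) =
      .rel (Rel.eqRel τ) (.app f.wk.wk (.var 1)) (.app (Tm.idTm τ) (.var 0)) := by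
      simp only [Form.inst2, Form.subst, Tm.subst, Tm.wk_subst_push, Tm.subst_var, push_zero,
        push_one, Rel.wk2_subst_push, Rel.subst_var]
    rw [Rel.pullback, Prov.rel_abs wf h1 h0, e,
      Prov.eqRel_iff (.app hf' h1) (.app (.idTm τ) h0), Prov.graph_iff hf' h1 h0]
    exact ⟨fun h => h.trans (.betaId h0), fun h => h.trans (IEq.betaId h0).symm⟩
  have wg := FormWF.rel (RelWF.graph (Ax := Ax) (Θ := Θ) hf') h1 h0
  have wp := FormWF.rel (RelWF.abs wf) h1 h0
  exact .andI (.impI wp ((key _).1 (.hyp (List.mem_cons_self ..) wp)))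
    (.impI wg ((key _).2 (.hyp (List.mem_cons_self ..) wg)))

theorem Prov.of_closeTy {φ : Form S m 0 0}
    (h : Prov Ax (Fin.elim0 : Fin 0 → Typ S 0) (Fin.elim0 : Fin 0 → RelDecl S 0) [] φ.closeTy) :
    Prov Ax (Fin.elim0 : Fin 0 → Typ S m) (Fin.elim0 : Fin 0 → RelDecl S m) [] φ := by
  induction m with
  | zero => exact h
  | succ m ih =>
    have := (ih h).allTyE
    rwa [show wkCtx (Fin.elim0 : Fin 0 → Typ S m) = Fin.elim0 from funext fun i => i.elim0,
      show wkRCtx (Fin.elim0 : Fin 0 → RelDecl S m) = Fin.elim0 from funext fun i => i.elim0] at this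

/-- A family of maps between two families of types. -/
def MapEnv (Γ : Fin n → Typ S k) (a b : Fin m → Typ S k) (f : Fin m → Tm S k n) : Prop :=
  ∀ i, HasTyI Γ (f i) (.lolli (a i) (b i))

theorem MapEnv.id (a : Fin m → Typ S k) : MapEnv Γ a a fun i => Tm.idTm (a i) :=
  fun i => .idTm (a i)

variable {a b : Fin m → Typ S k} {f : Fin m → Tm S k n}

theorem MapEnv.adm (h : MapEnv Γ a b f) (i : Fin m) :
    Adm Ax Γ Θ (Rel.graph (a i) (b i) (f i)) (a i) (b i) := .graph (h i)

theorem MapEnv.relWF (h : MapEnv Γ a b f) (σ : Typ S m) :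
    RelWF Ax Γ Θ (Rel.gr σ a b f) (σ.subst a) (σ.subst b) :=
  .ofAdm (.interp σ h.adm)

theorem MapEnv.wk (h : MapEnv Γ a b f) (σ : Typ S k) :
    MapEnv (push σ Γ) a b fun i => (f i).wk := fun i => (h i).wk σ

theorem MapEnv.push (h : MapEnv Γ a b f) {A B : Typ S k} {g : Tm S k n}
    (hg : HasTyI Γ g (.lolli A B)) : MapEnv Γ (push A a) (push B b) (push g f) :=
  Fin.cases hg h

/-- The schema is an equivalence with type variables as parameters; substituting the types a for
them gives every instance. Since equality is defined as the graph of the identity, σ[eq] is again an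
interpretation at graphs. -/
theorem IEq.of_identityExtension (hId : IdentityExtension Ax) (σ : Typ S m) (a : Fin m → Typ S k)
    {t s : Tm S k n} (ht : HasTyI Γ t (σ.subst a)) (hs : HasTyI Γ s (σ.subst a)) :
    Prov Ax Γ Θ Φ (.rel (Rel.gr σ a a fun i => Tm.idTm (a i)) t s) ↔
      IEq Ax Γ Θ Φ (σ.subst a) t s := by
  have h := (Prov.of_closeTy (hId m σ)).substCtx (Γ' := Γ) (Θ' := Θ) (θ := a) (s := Fin.elim0)
    (q := Fin.elim0) ⟨fun i => i.elim0, fun i => i.elim0, fun i => i.elim0⟩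
  have e : (Rel.equiv σ σ (.interp σ fun i => Rel.eqRel (.var i)) (Rel.eqRel σ) :
      Form S m 0 0).subst a Fin.elim0 Fin.elim0 = (Rel.equiv (σ.subst a) (σ.subst a)
        (Rel.gr σ a a fun i => Tm.idTm (a i)) (Rel.eqRel (σ.subst a)) : Form S k n r) := by
    simp only [Rel.equiv, Form.allTm2, Form.iff, Form.subst, Tm.subst, Rel.wk2, Rel.subst_ren,
      Rel.ren, Rel.subst, Rel.eqRel, Rel.graph_subst, Rel.graph_ren, Ty.subst, Tm.idTm, Rel.gr,
      Tm.ren, Tm.upS_zero, Tm.upS_one, Ty.ren_id, up_zero, Tm.wk_var, id_eq, Fin.succ_zero_eq_one]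
  rw [e] at h
  rw [Prov.equiv_iff (Prov.weaken_nil h) ht hs, Prov.eqRel_iff ht hs]

end Logic

-- Well-formed relations that stay well formed under renaming.

section Renamings

variable {S : Sig.{u, v}} {k n r k' n' r' k'' n'' r'' : ℕ}

/-- Renaming of a declaration of a relation variable. -/
def RelDecl.ren (f : Fin k → Fin k') (d : RelDecl S k) : RelDecl S k' :=
  ⟨d.adm, d.dom.ren f, d.cod.ren f⟩

/-- A renaming between contexts of the logic. -/
structure CtxRen (Γ : Fin n → Typ S k) (Θ : Fin r → RelDecl S k) (Γ' : Fin n' → Typ S k')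
    (Θ' : Fin r' → RelDecl S k') (f : Fin k → Fin k') (g : Fin n → Fin n') (h : Fin r → Fin r') :
    Prop where
  tm : ∀ i, Γ' (g i) = (Γ i).ren f
  rel : ∀ j, Θ' (h j) = (Θ j).ren f

namespace CtxRen

variable {Γ : Fin n → Typ S k} {Θ : Fin r → RelDecl S k} {Γ' : Fin n' → Typ S k'}
  {Θ' : Fin r' → RelDecl S k'} {Γ'' : Fin n'' → Typ S k''} {Θ'' : Fin r'' → RelDecl S k''}
  {f : Fin k → Fin k'} {g : Fin n → Fin n'} {h : Fin r → Fin r'}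
  {f' : Fin k' → Fin k''} {g' : Fin n' → Fin n''} {h' : Fin r' → Fin r''}

theorem refl : CtxRen Γ Θ Γ Θ id id id :=
  ⟨fun i => (Ty.ren_id _).symm, fun j => by simp [RelDecl.ren, Ty.ren_id]⟩

theorem trans (h₁ : CtxRen Γ Θ Γ' Θ' f g h) (h₂ : CtxRen Γ' Θ' Γ'' Θ'' f' g' h') :
    CtxRen Γ Θ Γ'' Θ'' (fun i => f' (f i)) (fun i => g' (g i)) fun i => h' (h i) :=
  ⟨fun i => by rw [h₂.tm, h₁.tm, Ty.ren_ren], fun j => by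
    rw [h₂.rel, h₁.rel]
    simp only [RelDecl.ren, Ty.ren_ren]⟩

theorem pushTm (h₁ : CtxRen Γ Θ Γ' Θ' f g h) (σ : Typ S k') :
    CtxRen Γ Θ (push σ Γ') Θ' f (fun i => (g i).succ) h :=
  ⟨h₁.tm, h₁.rel⟩

theorem wkTy (h₁ : CtxRen Γ Θ Γ' Θ' f g h) :
    CtxRen Γ Θ (wkCtx Γ') (wkRCtx Θ') (fun i => (f i).succ) g h :=
  ⟨fun i => by rw [wkCtx, h₁.tm, Ty.wk, Ty.ren_ren], fun j => by
    simp only [wkRCtx, h₁.rel, RelDecl.ren, Ty.wk, Ty.ren_ren]⟩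

theorem pushRel (h₁ : CtxRen Γ Θ Γ' Θ' f g h) (d : RelDecl S k') :
    CtxRen Γ Θ Γ' (push d Θ') f g fun i => (h i).succ :=
  ⟨h₁.tm, h₁.rel⟩

end CtxRen

variable (Ax : Form S 0 0 0 → Prop)

/-- A relation that is well formed in every context to which its context can be renamed. -/
def StableRel (Γ : Fin n → Typ S k) (Θ : Fin r → RelDecl S k) (ρ : Rel S k n r) (σ τ : Typ S k) :
    Prop :=
  ∀ ⦃k' n' r' : ℕ⦄ ⦃Γ' : Fin n' → Typ S k'⦄ ⦃Θ' : Fin r' → RelDecl S k'⦄ ⦃f : Fin k → Fin k'⦄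
    ⦃g : Fin n → Fin n'⦄ ⦃h : Fin r → Fin r'⦄, CtxRen Γ Θ Γ' Θ' f g h →
    RelWF Ax Γ' Θ' (ρ.ren f g h) (σ.ren f) (τ.ren f)

variable {Ax} {Γ : Fin n → Typ S k} {Θ : Fin r → RelDecl S k} {Γ' : Fin n' → Typ S k'}
  {Θ' : Fin r' → RelDecl S k'} {f : Fin k → Fin k'} {g : Fin n → Fin n'} {h : Fin r → Fin r'}
  {ρ ρ' : Rel S k n r} {σ τ σ' τ' : Typ S k}

namespace StableRel

/-- Well-formedness of relations is defined together with admissibility and provability, so a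
general renaming lemma would be an induction over all derivations. Carrying stability as a
hypothesis avoids it: the relations that occur are variables, graphs, interpretations at graphs, and
those built from them by ⊸ and →, and for these stability is checked directly. -/
theorem ren (hρ : StableRel Ax Γ Θ ρ σ τ) (hr : CtxRen Γ Θ Γ' Θ' f g h) :
    StableRel Ax Γ' Θ' (ρ.ren f g h) (σ.ren f) (τ.ren f) := fun _ _ _ _ _ _ _ _ h' => by
  rw [Rel.ren_ren, Ty.ren_ren, Ty.ren_ren]
  exact hρ (hr.trans h')

theorem wf (hρ : StableRel Ax Γ Θ ρ σ τ) : RelWF Ax Γ Θ ρ σ τ := by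
  have := hρ .refl
  rwa [ren_id_form_rel.2, Ty.ren_id, Ty.ren_id] at this

theorem wk2 (hρ : StableRel Ax Γ Θ ρ σ τ) (A B : Typ S k) :
    StableRel Ax (push A (push B Γ)) Θ ρ.wk2 σ τ := by
  have := hρ.ren ((CtxRen.refl.pushTm B).pushTm A)
  rwa [Ty.ren_id, Ty.ren_id] at this

theorem wkAll (hρ : StableRel Ax Γ Θ ρ σ τ) (d : RelDecl S (k + 2)) (A B : Typ S (k + 2)) :
    StableRel Ax (push A (push B (wkCtx (wkCtx Γ)))) (push d (wkRCtx (wkRCtx Θ))) ρ.wkAll σ.wk.wk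
      τ.wk.wk := by
  have := hρ.ren ((((CtxRen.refl.wkTy.wkTy).pushRel d).pushTm B).pushTm A)
  rw [Ty.wk, Ty.wk, Ty.wk, Ty.wk, Ty.ren_ren, Ty.ren_ren]
  exact this

theorem var' {j : Fin r} (h₁ : (Θ j).dom = σ) (h₂ : (Θ j).cod = τ) :
    StableRel Ax Γ Θ (.var j) σ τ := fun _ _ _ _ _ _ _ _ hr =>
  .var' (by rw [hr.rel, RelDecl.ren, h₁]) (by rw [hr.rel, RelDecl.ren, h₂])

theorem graph {f : Tm S k n} (hf : HasTyI Γ f (.lolli σ τ)) :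
    StableRel Ax Γ Θ (Rel.graph σ τ f) σ τ := fun _ _ _ _ _ _ _ _ hr => by
  rw [Rel.graph_ren]
  exact .graph (HasTy.ren hf hr.tm)

theorem gr {m : ℕ} {a b : Fin m → Typ S k} {f : Fin m → Tm S k n} (h : MapEnv Γ a b f)
    (σ : Typ S m) : StableRel Ax Γ Θ (Rel.gr σ a b f) (σ.subst a) (σ.subst b) := fun _ _ _ _ _ _ _ _ hr => by
  rw [Rel.gr_ren, Ty.ren_subst, Ty.ren_subst]
  exact MapEnv.relWF (fun i => HasTy.ren (h i) hr.tm) σ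

end StableRel

namespace Rel

theorem lolli_ren (σ τ σ' τ' : Typ S k) (ρ ρ' : Rel S k n r) (f : Fin k → Fin k')
    (g : Fin n → Fin n') (h : Fin r → Fin r') :
    (lolli σ τ σ' τ' ρ ρ').ren f g h =
      lolli (σ.ren f) (τ.ren f) (σ'.ren f) (τ'.ren f) (ρ.ren f g h) (ρ'.ren f g h) := by
  rw [ren_eq_subst, lolli_subst]
  simp only [← ren_eq_subst, ← Ty.ren_eq_subst]

theorem arrow_ren (σ τ σ' τ' : Typ S k) (ρ ρ' : Rel S k n r) (f : Fin k → Fin k')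
    (g : Fin n → Fin n') (h : Fin r → Fin r') :
    (arrow σ τ σ' τ' ρ ρ').ren f g h =
      arrow (σ.ren f) (τ.ren f) (σ'.ren f) (τ'.ren f) (ρ.ren f g h) (ρ'.ren f g h) := by
  rw [ren_eq_subst, arrow_subst]
  simp only [← ren_eq_subst, ← Ty.ren_eq_subst]

theorem lolli_wk2 (σ τ σ' τ' : Typ S k) (ρ ρ' : Rel S k n r) :
    (lolli σ τ σ' τ' ρ ρ').wk2 = lolli σ τ σ' τ' ρ.wk2 ρ'.wk2 := by
  rw [wk2, lolli_ren]
  simp only [Ty.ren_id]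
  rfl

theorem wk_wk_eq (t : Tm S k n) : t.ren id (fun i => i.succ.succ) = t.wk.wk := by
  simp only [Tm.wk, Tm.ren_ren]
  rfl

theorem graph_wk2 (σ τ : Typ S k) (f : Tm S k n) :
    (graph σ τ f : Rel S k n r).wk2 = graph σ τ f.wk.wk := by
  rw [wk2, graph_ren, Ty.ren_id, Ty.ren_id, wk_wk_eq]

theorem gr_wk2 {m : ℕ} (σ : Typ S m) (a b : Fin m → Typ S k) (f : Fin m → Tm S k n) :
    (gr σ a b f : Rel S k n r).wk2 = gr σ a b fun i => (f i).wk.wk := by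
  rw [wk2, gr_ren]
  simp only [Ty.ren_id, wk_wk_eq]

end Rel

theorem FormWF.lolli (hρ : StableRel Ax Γ Θ ρ σ τ) (hρ' : StableRel Ax Γ Θ ρ' σ' τ') :
    FormWF Ax (push (.lolli τ τ') (push (.lolli σ σ') Γ)) Θ (.allTm2 σ τ
      (.imp (.rel ρ.wk2.wk2 (.var 1) (.var 0))
      (.rel ρ'.wk2.wk2 (.app (.var 3) (.var 1)) (.app (.var 2) (.var 0))))) :=
  .allTm (.allTm (.imp (.rel ((hρ.wk2 _ _).wk2 _ _).wf (.var 1) (.var 0))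
    (.rel ((hρ'.wk2 _ _).wk2 _ _).wf (.app (σ := σ) (.var 3) (.var 1))
      (.app (σ := τ) (.var 2) (.var 0)))))

theorem FormWF.arrow (hρ : StableRel Ax Γ Θ ρ σ τ) (hρ' : StableRel Ax Γ Θ ρ' σ' τ') :
    FormWF Ax (push (.arrow τ τ') (push (.arrow σ σ') Γ)) Θ (.allTm2 σ τ
      (.imp (.rel ρ.wk2.wk2 (.var 1) (.var 0))
      (.rel ρ'.wk2.wk2 (.app (.var 3) (.bang (.var 1))) (.app (.var 2) (.bang (.var 0)))))) :=
  .allTm (.allTm (.imp (.rel ((hρ.wk2 _ _).wk2 _ _).wf (.var 1) (.var 0))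
    (.rel ((hρ'.wk2 _ _).wk2 _ _).wf (.app (σ := .bang σ) (.var 3) (.bang (.var 1)))
      (.app (σ := .bang τ) (.var 2) (.bang (.var 0))))))

theorem StableRel.lolli (hρ : StableRel Ax Γ Θ ρ σ τ) (hρ' : StableRel Ax Γ Θ ρ' σ' τ') :
    StableRel Ax Γ Θ (Rel.lolli σ τ σ' τ' ρ ρ') (.lolli σ σ') (.lolli τ τ') := fun _ _ _ _ _ _ _ _ hr => by
  rw [Rel.lolli_ren]
  exact .abs (.lolli (hρ.ren hr) (hρ'.ren hr))

theorem StableRel.arrow (hρ : StableRel Ax Γ Θ ρ σ τ) (hρ' : StableRel Ax Γ Θ ρ' σ' τ') :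
    StableRel Ax Γ Θ (Rel.arrow σ τ σ' τ' ρ ρ') (.arrow σ σ') (.arrow τ τ') := fun _ _ _ _ _ _ _ _ hr => by
  rw [Rel.arrow_ren]
  exact .abs (.arrow (hρ.ren hr) (hρ'.ren hr))

end Renamings

-- Introduction and elimination for the relations ⊸ and →, and for quantification over admissible
-- relations.

section Rules

variable {S : Sig.{u, v}} {Ax : Form S 0 0 0 → Prop} {k n r m : ℕ} {Γ : Fin n → Typ S k}
  {Θ : Fin r → RelDecl S k} {Φ : List (Form S k n r)} {ρ ρ' : Rel S k n r}
  {σ τ σ' τ' : Typ S k} {t s x y : Tm S k n}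

theorem Form.subst_congr {k' n' r' : ℕ} {θ θ' : Fin k → Typ S k'} {s s' : Fin n → Tm S k' n'}
    {q q' : Fin r → Rel S k' n' r'} (h : ∀ i, θ i = θ' i) (h' : ∀ i, s i = s' i)
    (h'' : ∀ i, q i = q' i) (φ : Form S k n r) : φ.subst θ s q = φ.subst θ' s' q' := by
  rw [funext h, funext h', funext h'']

theorem Prov.allTm2_elim {φ : Form S k (n + 2) r} (h : Prov Ax Γ Θ Φ (.allTm2 σ τ φ))
    (ht : HasTyI Γ t σ) (hs : HasTyI Γ s τ) : Prov Ax Γ Θ Φ (φ.inst2 t s) := by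
  have h₁ := (h.allTm_elim ht).allTm_elim (t := s) (by rwa [Ty.subst_var])
  rw [Form.subst_subst] at h₁
  convert h₁ using 1
  exact Form.subst_congr (fun i => rfl)
    (Fin.cases (by simp) (Fin.cases (by simp) fun i => by simp)) (fun i => by simp) φ

theorem Prov.allTm2_intro {φ : Form S k (n + 2) r}
    (h : Prov Ax (push τ (push σ Γ)) Θ ((Φ.map Form.wkTm).map Form.wkTm) φ) :
    Prov Ax Γ Θ Φ (.allTm2 σ τ φ) := .allTmI (.allTmI h)

theorem Rel.wk2_inst2 (ρ : Rel S k n r) (t s : Tm S k n) :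
    ρ.wk2.subst Ty.var (push s (push t Tm.var)) Rel.var = ρ := by simp

theorem Prov.lolli_elim (hρ : StableRel Ax Γ Θ ρ σ τ) (hρ' : StableRel Ax Γ Θ ρ' σ' τ')
    (ht : HasTyI Γ t (.lolli σ σ')) (hs : HasTyI Γ s (.lolli τ τ'))
    (h : Prov Ax Γ Θ Φ (.rel (Rel.lolli σ τ σ' τ' ρ ρ') t s)) (hx : HasTyI Γ x σ)
    (hy : HasTyI Γ y τ) (h' : Prov Ax Γ Θ Φ (.rel ρ x y)) :
    Prov Ax Γ Θ Φ (.rel ρ' (.app t x) (.app s y)) := by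
  rw [Rel.lolli, Prov.rel_abs (.lolli hρ hρ') ht hs, Rel.lolliForm_eq] at h
  have h₁ := h.allTm2_elim hx hy
  simp only [Form.inst2, Form.subst, Rel.wk2_inst2, Tm.subst, push_one, push_zero,
    Tm.wk_subst_push, Tm.subst_var] at h₁
  exact .impE h₁ h'

theorem Prov.lolli_intro (hρ : StableRel Ax Γ Θ ρ σ τ) (hρ' : StableRel Ax Γ Θ ρ' σ' τ')
    (ht : HasTyI Γ t (.lolli σ σ')) (hs : HasTyI Γ s (.lolli τ τ'))
    (h : Prov Ax (push τ (push σ Γ)) Θ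
      (.rel ρ.wk2 (.var 1) (.var 0) :: (Φ.map Form.wkTm).map Form.wkTm)
      (.rel ρ'.wk2 (.app t.wk.wk (.var 1)) (.app s.wk.wk (.var 0)))) :
    Prov Ax Γ Θ Φ (.rel (Rel.lolli σ τ σ' τ' ρ ρ') t s) := by
  rw [Rel.lolli, Prov.rel_abs (.lolli hρ hρ') ht hs, Rel.lolliForm_eq]
  exact .allTm2_intro (.impI (.rel (hρ.wk2 _ _).wf (.var 1) (.var 0)) h)

theorem Prov.arrow_elim (hρ : StableRel Ax Γ Θ ρ σ τ) (hρ' : StableRel Ax Γ Θ ρ' σ' τ')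
    (ht : HasTyI Γ t (.arrow σ σ')) (hs : HasTyI Γ s (.arrow τ τ'))
    (h : Prov Ax Γ Θ Φ (.rel (Rel.arrow σ τ σ' τ' ρ ρ') t s)) (hx : HasTyI Γ x σ)
    (hy : HasTyI Γ y τ) (h' : Prov Ax Γ Θ Φ (.rel ρ x y)) :
    Prov Ax Γ Θ Φ (.rel ρ' (.app t (.bang x)) (.app s (.bang y))) := by
  rw [Rel.arrow, Prov.rel_abs (.arrow hρ hρ') ht hs, Rel.arrowForm_eq] at h
  have h₁ := h.allTm2_elim hx hy
  simp only [Form.inst2, Form.subst, Rel.wk2_inst2, Tm.subst, push_one, push_zero,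
    Tm.wk_subst_push, Tm.subst_var] at h₁
  exact .impE h₁ h'

theorem Prov.arrow_intro (hρ : StableRel Ax Γ Θ ρ σ τ) (hρ' : StableRel Ax Γ Θ ρ' σ' τ')
    (ht : HasTyI Γ t (.arrow σ σ')) (hs : HasTyI Γ s (.arrow τ τ'))
    (h : Prov Ax (push τ (push σ Γ)) Θ
      (.rel ρ.wk2 (.var 1) (.var 0) :: (Φ.map Form.wkTm).map Form.wkTm)
      (.rel ρ'.wk2 (.app t.wk.wk (.bang (.var 1))) (.app s.wk.wk (.bang (.var 0))))) :
    Prov Ax Γ Θ Φ (.rel (Rel.arrow σ τ σ' τ' ρ ρ') t s) := by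
  rw [Rel.arrow, Prov.rel_abs (.arrow hρ hρ') ht hs, Rel.arrowForm_eq]
  exact .allTm2_intro (.impI (.rel (hρ.wk2 _ _).wf (.var 1) (.var 0)) h)

theorem Prov.allAdm_elim {φ : Form S (k + 2) n (r + 1)} {A B : Typ S k} {R : Rel S k n r}
    (h : Prov Ax Γ Θ Φ (Rel.allAdm φ)) (hR : Adm Ax Γ Θ R A B) :
    Prov Ax Γ Θ Φ (φ.subst (push B (push A Ty.var)) Tm.var (push R Rel.var)) := by
  have h₁ := ((h.allTy_elim A).allTy_elim B).allRel_elim (ρ := R) (by simpa [Ty.upS] using hR)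
  rw [Form.subst_subst, Form.subst_subst] at h₁
  convert h₁ using 1
  exact Form.subst_congr (Fin.cases (by simp [Ty.upS]) (Fin.cases (by simp [Ty.upS])
    fun i => by simp [Ty.upS, Ty.wk])) (fun i => by simp)
    (Fin.cases (by simp [Rel.upS]) fun i => by simp [Rel.upS]) φ

theorem Prov.allAdm_intro {φ : Form S (k + 2) n (r + 1)}
    (h : Prov Ax (wkCtx (wkCtx Γ)) (push ⟨true, .var 1, .var 0⟩ (wkRCtx (wkRCtx Θ)))
      (((Φ.map Form.wkTy).map Form.wkTy).map Form.wkRel) φ) :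
    Prov Ax Γ Θ Φ (Rel.allAdm φ) := .allTyI (.allTyI (.allRelI h))

/-- Weakening by two type variables, a relation variable between them and two term variables. -/
theorem Prov.wkAll {φ : Form S k n r} (h : Prov Ax Γ Θ Φ φ) (d : RelDecl S (k + 2))
    (A B : Typ S (k + 2)) :
    Prov Ax (push A (push B (wkCtx (wkCtx Γ)))) (push d (wkRCtx (wkRCtx Θ)))
      (((((Φ.map Form.wkTy).map Form.wkTy).map Form.wkRel).map Form.wkTm).map Form.wkTm)
      (φ.ren (fun i => i.succ.succ) (fun i => i.succ.succ) Fin.succ) := by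
  have h₁ := (((h.wkTy.wkTy).wkRel d).wkTm B).wkTm A
  simp only [Form.wkTm, Form.wkTy, Form.wkRel, Form.ren_ren, id_eq] at h₁ ⊢
  exact h₁

end Rules

-- The defining propositions of !ρ and ρ ⊗ ρ' at given terms.

section Forms

variable {S : Sig.{u, v}} {k n r : ℕ}

@[simp] theorem Ty.upS_var_id {T : TySig.{u}} {k : ℕ} : Ty.upS (Ty.var : Fin k → Ty T k) = Ty.var :=
  push_ext rfl fun _ => rfl

/-- Weakening of a term by two type variables and two term variables. -/
def Tm.wkAll (t : Tm S k n) : Tm S (k + 2) (n + 2) :=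
  t.ren (fun i => i.succ.succ) fun i => i.succ.succ

@[simp] theorem Tm.wkAll_subst_push {k' n' : ℕ} (t : Tm S k n) (A B : Typ S k')
    (θ : Fin k → Typ S k') (x y : Tm S k' n') (s : Fin n → Tm S k' n') :
    t.wkAll.subst (push A (push B θ)) (push x (push y s)) = t.subst θ s := Tm.subst_ren _ _ _ _ _

@[simp] theorem Rel.wkAll_subst_push {k' n' r' : ℕ} (ρ : Rel S k n r) (A B : Typ S k')
    (θ : Fin k → Typ S k') (x y : Tm S k' n') (s : Fin n → Tm S k' n') (R : Rel S k' n' r')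
    (q : Fin r → Rel S k' n' r') :
    ρ.wkAll.subst (push A (push B θ)) (push x (push y s)) (push R q) = ρ.subst θ s q :=
  Rel.subst_ren _ _ _ _ _ _ _

theorem Rel.wkAll_wk2_subst (ρ : Rel S k n r) (t s : Tm S k n) :
    ρ.wkAll.wk2.subst Ty.var
      (Tm.upS (Tm.upS fun i => (push s (push t Tm.var) i : Tm S k n).wkTy.wkTy))
      (fun j => ((Rel.upS (fun j => ((Rel.var j : Rel S k n r).ren Fin.succ id id).ren Fin.succ
        id id) j).ren id Fin.succ id).ren id Fin.succ id) = ρ.wkAll := by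
  rw [wkAll, wk2, subst_ren, subst_ren, ren_eq_subst]
  exact subst_congr (fun i => rfl) (fun i => by simp) (fun i => by simp [upS]) ρ

theorem Tm.wk_wk_wkTy_wkTy (t : Tm S k n) : t.wkTy.wkTy.wk.wk = t.wkAll := by
  simp only [wkAll, wkTy, wk, ren_ren]
  rfl

/-- The defining formula of `!ρ`, at two terms. -/
def Rel.bangForm (σ τ : Typ S k) (ρ : Rel S k n r) (t s : Tm S k n) : Form S k n r :=
  allAdm (.allTm2 (.arrow σ.wk.wk (.var 1)) (.arrow τ.wk.wk (.var 0))
    (.imp (.rel (arrow σ.wk.wk τ.wk.wk (.var 1) (.var 0) ρ.wkAll (.var 0)) (.var 1) (.var 0))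
      (.rel (.var 0) (.app (.var 1) t.wkAll) (.app (.var 0) s.wkAll))))

theorem Rel.bangForm_eq (σ τ : Typ S k) (ρ : Rel S k n r) (t s : Tm S k n) :
    (allAdm (.allTm2 (.arrow σ.wk.wk (.var 1)) (.arrow τ.wk.wk (.var 0))
      (.imp
        (.rel (arrow σ.wk.wk τ.wk.wk (.var 1) (.var 0) ρ.wkAll.wk2 (.var 0)) (.var 1) (.var 0))
        (.rel (.var 0) (.app (.var 1) (.var 3)) (.app (.var 0) (.var 2))))) :
        Form S k (n + 2) r).inst2 t s = bangForm σ τ ρ t s := by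
  simp only [bangForm, Form.inst2, Form.allTm2, allAdm, Form.subst, arrow_subst, Ty.upS_var_id,
    Ty.subst_var, Tm.subst, wkAll_wk2_subst]
  have e₁ : Tm.upS (Tm.upS fun i => (push s (push t Tm.var) i : Tm S k n).wkTy.wkTy) 3 = t.wkAll :=
    Tm.wk_wk_wkTy_wkTy t
  have e₂ : Tm.upS (Tm.upS fun i => (push s (push t Tm.var) i : Tm S k n).wkTy.wkTy) 2 = s.wkAll :=
    Tm.wk_wk_wkTy_wkTy s
  rw [e₁, e₂]
  rfl

/-- The defining formula of `ρ ⊗ ρ'`, at two terms. -/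
def Rel.tensorForm (σ τ σ' τ' : Typ S k) (ρ ρ' : Rel S k n r) (t s : Tm S k n) : Form S k n r :=
  allAdm
    (.allTm2 (.lolli σ.wk.wk (.lolli σ'.wk.wk (.var 1)))
      (.lolli τ.wk.wk (.lolli τ'.wk.wk (.var 0)))
      (.imp
        (.rel (lolli σ.wk.wk τ.wk.wk (.lolli σ'.wk.wk (.var 1)) (.lolli τ'.wk.wk (.var 0))
            ρ.wkAll (lolli σ'.wk.wk τ'.wk.wk (.var 1) (.var 0) ρ'.wkAll (.var 0)))
          (.var 1) (.var 0))
        (.rel (.var 0)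
          (.letTensor σ.wk.wk σ'.wk.wk t.wkAll (.app (.app (.var 3) (.var 1)) (.var 0)))
          (.letTensor τ.wk.wk τ'.wk.wk s.wkAll (.app (.app (.var 2) (.var 1)) (.var 0))))))

theorem Rel.tensorForm_eq (σ τ σ' τ' : Typ S k) (ρ ρ' : Rel S k n r) (t s : Tm S k n) :
    (allAdm
    (.allTm2 (.lolli σ.wk.wk (.lolli σ'.wk.wk (.var 1)))
      (.lolli τ.wk.wk (.lolli τ'.wk.wk (.var 0)))
      (.imp
        (.rel (lolli σ.wk.wk τ.wk.wk (.lolli σ'.wk.wk (.var 1)) (.lolli τ'.wk.wk (.var 0))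
            ρ.wkAll.wk2 (lolli σ'.wk.wk τ'.wk.wk (.var 1) (.var 0) ρ'.wkAll.wk2 (.var 0)))
          (.var 1) (.var 0))
        (.rel (.var 0)
          (.letTensor σ.wk.wk σ'.wk.wk (.var 3) (.app (.app (.var 3) (.var 1)) (.var 0)))
          (.letTensor τ.wk.wk τ'.wk.wk (.var 2) (.app (.app (.var 2) (.var 1)) (.var 0)))))) :
        Form S k (n + 2) r).inst2 t s = tensorForm σ τ σ' τ' ρ ρ' t s := by
  simp only [tensorForm, Form.inst2, Form.allTm2, allAdm, Form.subst, lolli_subst, Ty.upS_var_id,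
    Ty.subst_var, Tm.subst, wkAll_wk2_subst]
  have e₁ : Tm.upS (Tm.upS fun i => (push s (push t Tm.var) i : Tm S k n).wkTy.wkTy) 3 = t.wkAll :=
    Tm.wk_wk_wkTy_wkTy t
  have e₂ : Tm.upS (Tm.upS fun i => (push s (push t Tm.var) i : Tm S k n).wkTy.wkTy) 2 = s.wkAll :=
    Tm.wk_wk_wkTy_wkTy s
  rw [e₁, e₂]
  rfl

end Forms

-- Rules for !ρ and ρ ⊗ ρ', and relatedness at graphs.

section Rules

variable {S : Sig.{u, v}} {Ax : Form S 0 0 0 → Prop} {k n r m : ℕ} {Γ : Fin n → Typ S k}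
  {Θ : Fin r → RelDecl S k} {Φ : List (Form S k n r)} {ρ ρ' : Rel S k n r}
  {σ τ σ' τ' : Typ S k} {t s x y : Tm S k n}

theorem HasTyI.wkAll (h : HasTyI Γ t σ) (A B : Typ S (k + 2)) :
    HasTyI (push A (push B (wkCtx (wkCtx Γ)))) t.wkAll σ.wk.wk := by
  rw [← Tm.wk_wk_wkTy_wkTy]
  exact (h.wkTy.wkTy.wk B).wk A

theorem FormWF.bang (hρ : StableRel Ax Γ Θ ρ σ τ) :
    FormWF Ax (push (.bang τ) (push (.bang σ) Γ)) Θ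
      (Rel.allAdm (.allTm2 (.arrow σ.wk.wk (.var 1)) (.arrow τ.wk.wk (.var 0))
      (.imp
        (.rel (Rel.arrow σ.wk.wk τ.wk.wk (.var 1) (.var 0) ρ.wkAll.wk2 (.var 0)) (.var 1) (.var 0))
        (.rel (.var 0) (.app (.var 1) (.var 3)) (.app (.var 0) (.var 2)))))) := by
  refine .allTy (.allTy (.allRel (.allTm (.allTm (.imp (.rel (StableRel.wf (.arrow ?_ ?_))
    (.var 1) (.var 0)) (.rel (.var' rfl rfl) (.app (σ := .bang σ.wk.wk) (.var 1) (.var 3))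
      (.app (σ := .bang τ.wk.wk) (.var 0) (.var 2))))))))
  · have h := hρ.ren ((((((CtxRen.refl.pushTm (.bang σ)).pushTm (.bang τ)).wkTy.wkTy).pushRel
      ⟨true, .var 1, .var 0⟩).pushTm (.arrow σ.wk.wk (.var 1))).pushTm (.arrow τ.wk.wk (.var 0)))
    simp only [Rel.wk2, Rel.wkAll, Rel.ren_ren, Ty.wk, Ty.ren_ren, id_eq] at h ⊢
    exact h
  · exact .var' rfl rfl

theorem FormWF.tensor (hρ : StableRel Ax Γ Θ ρ σ τ) (hρ' : StableRel Ax Γ Θ ρ' σ' τ') :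
    FormWF Ax (push (.tensor τ τ') (push (.tensor σ σ') Γ)) Θ
    (Rel.allAdm
    (.allTm2 (.lolli σ.wk.wk (.lolli σ'.wk.wk (.var 1)))
      (.lolli τ.wk.wk (.lolli τ'.wk.wk (.var 0)))
      (.imp
        (.rel (Rel.lolli σ.wk.wk τ.wk.wk (.lolli σ'.wk.wk (.var 1)) (.lolli τ'.wk.wk (.var 0))
            ρ.wkAll.wk2 (Rel.lolli σ'.wk.wk τ'.wk.wk (.var 1) (.var 0) ρ'.wkAll.wk2 (.var 0)))
          (.var 1) (.var 0))
        (.rel (.var 0)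
          (.letTensor σ.wk.wk σ'.wk.wk (.var 3) (.app (.app (.var 3) (.var 1)) (.var 0)))
          (.letTensor τ.wk.wk τ'.wk.wk (.var 2) (.app (.app (.var 2) (.var 1)) (.var 0))))))) := by
  refine .allTy (.allTy (.allRel (.allTm (.allTm (.imp (.rel (StableRel.wf (.lolli ?_ (.lolli ?_ ?_)))
    (.var 1) (.var 0)) (.rel (.var' rfl rfl)
      (.letTensor (.var 3) (.app (σ := σ'.wk.wk) (.app (σ := σ.wk.wk) (.var 3) (.var 1)) (.var 0))
        rfl rfl)
      (.letTensor (.var 2) (.app (σ := τ'.wk.wk) (.app (σ := τ.wk.wk) (.var 2) (.var 1)) (.var 0))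
        rfl rfl)))))))
  · have h := hρ.ren ((((((CtxRen.refl.pushTm (.tensor σ σ')).pushTm
      (.tensor τ τ')).wkTy.wkTy).pushRel ⟨true, .var 1, .var 0⟩).pushTm
      (.lolli σ.wk.wk (.lolli σ'.wk.wk (.var 1)))).pushTm (.lolli τ.wk.wk (.lolli τ'.wk.wk (.var 0))))
    simp only [Rel.wk2, Rel.wkAll, Rel.ren_ren, Ty.wk, Ty.ren_ren, id_eq] at h ⊢
    exact h
  · have h := hρ'.ren ((((((CtxRen.refl.pushTm (.tensor σ σ')).pushTm
      (.tensor τ τ')).wkTy.wkTy).pushRel ⟨true, .var 1, .var 0⟩).pushTm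
      (.lolli σ.wk.wk (.lolli σ'.wk.wk (.var 1)))).pushTm (.lolli τ.wk.wk (.lolli τ'.wk.wk (.var 0))))
    simp only [Rel.wk2, Rel.wkAll, Rel.ren_ren, Ty.wk, Ty.ren_ren, id_eq] at h ⊢
    exact h
  · exact .var' rfl rfl

/-- By definition !ρ tests a pair against all admissible R and all g, g' related by ρ → R. On !t and
!s such a test is exactly the elimination rule for ρ → R at t and s. -/
theorem Prov.bang_intro (hρ : StableRel Ax Γ Θ ρ σ τ) (ht : HasTyI Γ t σ) (hs : HasTyI Γ s τ)
    (h : Prov Ax Γ Θ Φ (.rel ρ t s)) :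
    Prov Ax Γ Θ Φ (.rel (Rel.bang σ τ ρ) (.bang t) (.bang s)) := by
  rw [Rel.bang, Prov.rel_abs (.bang hρ) ht.bang hs.bang, Rel.bangForm_eq]
  refine .allAdm_intro (.allTm2_intro ?_)
  have hρ₁ := hρ.wkAll ⟨true, .var 1, .var 0⟩ (.arrow τ.wk.wk (.var 0)) (.arrow σ.wk.wk (.var 1))
  have hR : StableRel Ax (push (.arrow τ.wk.wk (.var 0)) (push (.arrow σ.wk.wk (.var 1))
    (wkCtx (wkCtx Γ)))) (push ⟨true, .var 1, .var 0⟩ (wkRCtx (wkRCtx Θ))) (.var 0) (.var 1) (.var 0) :=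
    .var' rfl rfl
  have wf : FormWF Ax (push (.arrow τ.wk.wk (.var 0)) (push (.arrow σ.wk.wk (.var 1))
      (wkCtx (wkCtx Γ)))) (push ⟨true, .var 1, .var 0⟩ (wkRCtx (wkRCtx Θ)))
      (.rel (Rel.arrow σ.wk.wk τ.wk.wk (.var 1) (.var 0) ρ.wkAll (.var 0)) (.var 1) (.var 0)) :=
    .rel (hρ₁.arrow hR).wf (.var 1) (.var 0)
  refine .impI wf (.arrow_elim hρ₁ hR (.var 1) (.var 0) (.hyp (List.mem_cons_self ..) wf)
    (ht.wkAll _ _) (hs.wkAll _ _) (.weaken (fun χ hχ => List.mem_cons_of_mem _ hχ) ?_))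
  exact h.wkAll _ _ _

theorem Prov.allAdm_allTm2_elim {A B : Typ S k} {R : Rel S k n r} {g g' : Tm S k n}
    {X Y : Typ S (k + 2)} {ψ : Form S (k + 2) (n + 2) (r + 1)}
    (h : Prov Ax Γ Θ Φ (Rel.allAdm (.allTm2 X Y ψ))) (hR : Adm Ax Γ Θ R A B)
    (hg : HasTyI Γ g (X.subst (push B (push A Ty.var))))
    (hg' : HasTyI Γ g' (Y.subst (push B (push A Ty.var)))) :
    Prov Ax Γ Θ Φ (ψ.subst (push B (push A Ty.var)) (push g' (push g Tm.var)) (push R Rel.var)) := by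
  have h₁ := h.allAdm_elim hR
  rw [Form.allTm2, Form.subst, Form.subst] at h₁
  have h₂ := Prov.allTm2_elim h₁ hg hg'
  rw [Form.inst2, Form.subst_subst] at h₂
  convert h₂ using 1
  refine Form.subst_congr (fun i => by simp)
    (Fin.cases (by simp) (Fin.cases (by simp) fun i => by simp)) (Fin.cases ?_ fun i => by simp) ψ
  simp only [push_zero, Rel.ren_ren, Rel.subst_ren]
  exact R.subst_var.symm

theorem Prov.bang_elim {A B : Typ S k} {R : Rel S k n r} {g g' : Tm S k n}
    (hρ : StableRel Ax Γ Θ ρ σ τ) (ht : HasTyI Γ t (.bang σ))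
    (hs : HasTyI Γ s (.bang τ)) (h : Prov Ax Γ Θ Φ (.rel (Rel.bang σ τ ρ) t s))
    (hR : Adm Ax Γ Θ R A B) (hg : HasTyI Γ g (.arrow σ A)) (hg' : HasTyI Γ g' (.arrow τ B))
    (h' : Prov Ax Γ Θ Φ (.rel (Rel.arrow σ τ A B ρ R) g g')) :
    Prov Ax Γ Θ Φ (.rel R (.app g t) (.app g' s)) := by
  rw [Rel.bang, Prov.rel_abs (.bang hρ) ht hs, Rel.bangForm_eq] at h
  have h₁ := h.allAdm_allTm2_elim hR (g := g) (g' := g') (by simpa [Ty.arrow] using hg)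
    (by simpa [Ty.arrow] using hg')
  simp only [Form.subst, Rel.arrow_subst, Ty.wk_subst_push, Ty.subst_var, Rel.wkAll_subst_push,
    Rel.subst_var, Ty.subst, Rel.subst, Tm.subst, push_zero, push_one, Tm.wkAll_subst_push,
    Tm.subst_var] at h₁
  exact .impE h₁ h'

theorem Prov.tensor_elim {A B : Typ S k} {R : Rel S k n r} {g g' : Tm S k n}
    (hρ : StableRel Ax Γ Θ ρ σ τ) (hρ' : StableRel Ax Γ Θ ρ' σ' τ') (ht : HasTyI Γ t (.tensor σ σ'))
    (hs : HasTyI Γ s (.tensor τ τ')) (h : Prov Ax Γ Θ Φ (.rel (Rel.tensor σ τ σ' τ' ρ ρ') t s))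
    (hR : Adm Ax Γ Θ R A B) (hg : HasTyI Γ g (.lolli σ (.lolli σ' A)))
    (hg' : HasTyI Γ g' (.lolli τ (.lolli τ' B)))
    (h' : Prov Ax Γ Θ Φ (.rel (Rel.lolli σ τ (.lolli σ' A) (.lolli τ' B) ρ
      (Rel.lolli σ' τ' A B ρ' R)) g g')) :
    Prov Ax Γ Θ Φ (.rel R (.letTensor σ σ' t (.app (.app g.wk.wk (.var 1)) (.var 0)))
      (.letTensor τ τ' s (.app (.app g'.wk.wk (.var 1)) (.var 0)))) := by
  rw [Rel.tensor, Prov.rel_abs (.tensor hρ hρ') ht hs, Rel.tensorForm_eq] at h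
  have h₁ := h.allAdm_allTm2_elim hR (g := g) (g' := g') (by simpa using hg) (by simpa using hg')
  simp only [Form.subst, Rel.lolli_subst, Ty.wk_subst_push, Ty.subst_var, Rel.wkAll_subst_push,
    Rel.subst_var, Ty.subst, Rel.subst, Tm.subst, push_zero, push_one, Tm.wkAll_subst_push,
    Tm.subst_var] at h₁
  exact .impE h₁ h'

/-- Well-typed terms that are related by the interpretation of a type at graphs. -/
structure Related (Ax : Form S 0 0 0 → Prop) {k n r m : ℕ} (Γ : Fin n → Typ S k)
    (Θ : Fin r → RelDecl S k) (Φ : List (Form S k n r)) (σ : Typ S m) (a b : Fin m → Typ S k)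
    (f : Fin m → Tm S k n) (t s : Tm S k n) : Prop where
  left : HasTyI Γ t (σ.subst a)
  right : HasTyI Γ s (σ.subst b)
  prov : Prov Ax Γ Θ Φ (.rel (Rel.gr σ a b f) t s)

namespace Related

variable {a b : Fin m → Typ S k} {f : Fin m → Tm S k n}

theorem of_eq (hId : IdentityExtension Ax) {σ : Typ S m} (h : IEq Ax Γ Θ Φ (σ.subst a) t s) :
    Related Ax Γ Θ Φ σ a a (fun i => Tm.idTm (a i)) t s :=
  ⟨h.left, h.right, (IEq.of_identityExtension hId σ a h.left h.right).2 h⟩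

theorem eq (hId : IdentityExtension Ax) {σ : Typ S m}
    (h : Related Ax Γ Θ Φ σ a a (fun i => Tm.idTm (a i)) t s) : IEq Ax Γ Θ Φ (σ.subst a) t s :=
  (IEq.of_identityExtension hId σ a h.left h.right).1 h.prov

theorem var (hf : MapEnv Γ a b f) {i : Fin m} (h : IEq Ax Γ Θ Φ (b i) (.app (f i) t) s)
    (ht : HasTyI Γ t (a i)) : Related Ax Γ Θ Φ (.var i) a b f t s :=
  ⟨ht, h.right, ((Prov.interpVar i hf.adm).equiv_iff ht h.right).2
    ((Prov.graph_iff (hf i) ht h.right).2 h)⟩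

theorem var_eq (hf : MapEnv Γ a b f) {i : Fin m} (h : Related Ax Γ Θ Φ (.var i) a b f t s) :
    IEq Ax Γ Θ Φ (b i) (.app (f i) t) s :=
  (Prov.graph_iff (hf i) h.left h.right).1
    (((Prov.interpVar i hf.adm).equiv_iff h.left h.right).1 h.prov)

theorem lolli_elim (hf : MapEnv Γ a b f) {σ τ : Typ S m}
    (h : Related Ax Γ Θ Φ (.lolli σ τ) a b f t s) (h' : Related Ax Γ Θ Φ σ a b f x y) :
    Related Ax Γ Θ Φ τ a b f (.app t x) (.app s y) :=
  ⟨.app h.left h'.left, .app h.right h'.right, Prov.lolli_elim (.gr hf σ) (.gr hf τ) h.left h.right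
    (((Prov.interpLolli σ τ hf.adm).equiv_iff h.left h.right).1 h.prov) h'.left h'.right h'.prov⟩

/-- The premise is required for every extra hypothesis Ψ: an application may use that Ψ makes the
two new variables related, but never needs to know its form. -/
theorem lolli_intro (hf : MapEnv Γ a b f) {σ τ : Typ S m} (ht : HasTyI Γ t ((Ty.lolli σ τ).subst a))
    (hs : HasTyI Γ s ((Ty.lolli σ τ).subst b))
    (h : ∀ Ψ, Related Ax (push (σ.subst b) (push (σ.subst a) Γ)) Θ
      (Ψ :: (Φ.map Form.wkTm).map Form.wkTm) σ a b (fun i => (f i).wk.wk) (.var 1) (.var 0) →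
      Related Ax (push (σ.subst b) (push (σ.subst a) Γ)) Θ
      (Ψ :: (Φ.map Form.wkTm).map Form.wkTm) τ a b (fun i => (f i).wk.wk)
        (.app t.wk.wk (.var 1)) (.app s.wk.wk (.var 0))) :
    Related Ax Γ Θ Φ (.lolli σ τ) a b f t s := by
  refine ⟨ht, hs, ((Prov.interpLolli σ τ hf.adm).equiv_iff ht hs).2
    (.lolli_intro (ρ := Rel.gr σ a b f) (ρ' := Rel.gr τ a b f) (.gr hf σ) (.gr hf τ) ht hs ?_)⟩
  rw [Rel.gr_wk2, Rel.gr_wk2]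
  exact (h _ ⟨.var 1, .var 0, .hyp (List.mem_cons_self ..)
    (.rel (MapEnv.relWF ((hf.wk _).wk _) σ) (.var 1) (.var 0))⟩).prov

theorem bang (hf : MapEnv Γ a b f) {σ : Typ S m} (h : Related Ax Γ Θ Φ σ a b f t s) :
    Related Ax Γ Θ Φ (.bang σ) a b f (.bang t) (.bang s) :=
  ⟨h.left.bang, h.right.bang, ((Prov.interpBang σ hf.adm).equiv_iff h.left.bang h.right.bang).2
    (.bang_intro (.gr hf σ) h.left h.right h.prov)⟩

/-- The elimination rule for `!`, at the graph of `g`. -/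
theorem bang_elim (hf : MapEnv Γ a b f) {σ : Typ S m} {A B : Typ S k} {g u w : Tm S k n}
    (h : Related Ax Γ Θ Φ (.bang σ) a b f t s) (hg : HasTyI Γ g (.lolli A B))
    (hu : HasTyI Γ u (.arrow (σ.subst a) A)) (hw : HasTyI Γ w (.arrow (σ.subst b) B))
    (h' : ∀ Ψ, Related Ax (push (σ.subst b) (push (σ.subst a) Γ)) Θ
      (Ψ :: (Φ.map Form.wkTm).map Form.wkTm) σ a b (fun i => (f i).wk.wk) (.var 1) (.var 0) →
      IEq Ax (push (σ.subst b) (push (σ.subst a) Γ)) Θ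
      (Ψ :: (Φ.map Form.wkTm).map Form.wkTm) B
        (.app g.wk.wk (.app u.wk.wk (.bang (.var 1)))) (.app w.wk.wk (.bang (.var 0)))) :
    IEq Ax Γ Θ Φ B (.app g (.app u t)) (.app w s) := by
  refine (Prov.graph_iff hg (.app hu h.left) (.app hw h.right)).1 (.bang_elim (.gr hf σ) h.left
    h.right (((Prov.interpBang σ hf.adm).equiv_iff h.left h.right).1 h.prov) (.graph hg) hu hw
    (.arrow_intro (ρ := Rel.gr σ a b f) (.gr hf σ) (.graph hg) hu hw ?_))
  rw [Rel.gr_wk2, Rel.graph_wk2]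
  have hu' : HasTyI (push (σ.subst b) (push (σ.subst a) Γ)) _ _ := (hu.wk _).wk _
  have hw' : HasTyI (push (σ.subst b) (push (σ.subst a) Γ)) _ _ := (hw.wk _).wk _
  exact (Prov.graph_iff ((hg.wk _).wk _) (.app hu' (.bang (.var 1))) (.app hw' (.bang (.var 0)))).2
    (h' _ ⟨.var 1, .var 0, .hyp (List.mem_cons_self ..)
      (.rel (MapEnv.relWF ((hf.wk _).wk _) σ) (.var 1) (.var 0))⟩)

/-- The relation quantified over in the interpretation of Π is instantiated at the graph of g. The
enlarged family of relations again consists of graphs, so the conclusion is again an instance of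
`Related`, and the rule can be iterated. -/
theorem all_elim (hf : MapEnv Γ a b f) {σ : Typ S (m + 1)} {A B : Typ S k} {g : Tm S k n}
    (h : Related Ax Γ Θ Φ (.all σ) a b f t s) (hg : HasTyI Γ g (.lolli A B)) :
    Related Ax Γ Θ Φ σ (push A a) (push B b) (push g f) (.tyApp t A) (.tyApp s B) := by
  refine ⟨.tyApp' h.left (Ty.upS_inst _ _ _), .tyApp' h.right (Ty.upS_inst _ _ _), ?_⟩
  have h₁ := ((Prov.interpAll σ hf.adm).equiv_iff h.left h.right).1 h.prov
  have wf : FormWF Ax (push (.all (σ.subst (Ty.upS b))) (push (.all (σ.subst (Ty.upS a))) Γ)) Θ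
      (Rel.allAdm (.rel (Rel.interp σ (push (.var 0) fun i =>
        (Rel.graph (a i) (b i) (f i) : Rel S k n r).ren (fun i => i.succ.succ) id Fin.succ)).wk2
        (.tyApp (.var 1) (.var 1)) (.tyApp (.var 0) (.var 0)))) := by
    refine .allTy (.allTy (.allRel (.rel (.ofAdm (.interp σ (τ := push (.var 1) fun i => (a i).wk.wk)
      (τ' := push (.var 0) fun i => (b i).wk.wk) ?_)) ?_ ?_)))
    · refine Fin.cases (.var' rfl rfl rfl) fun i => ?_
      have := (hf i).wk (.all (σ.subst (Ty.upS a)))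
      have := (this.wk (.all (σ.subst (Ty.upS b)))).wkTy.wkTy
      have := Adm.graph (Ax := Ax) (Θ := push ⟨true, .var 1, .var 0⟩ (wkRCtx (wkRCtx Θ))) this
      convert this using 1 <;> [skip; rfl; rfl]
      simp only [push_succ, Rel.graph_ren, Ty.wk, Ty.ren_ren, Ty.ren_id, Tm.wk, Tm.wkTy, Tm.ren_ren]
      rfl
    · refine .tyApp' (τ := (σ.subst (Ty.upS fun i => (a i).wk.wk))) (.var' ?_) (Ty.upS_inst _ _ _)
      simp [wkCtx, Ty.wk, Ty.ren_subst, Ty.ren_upS, Ty.ren_ren]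
    · refine .tyApp' (τ := (σ.subst (Ty.upS fun i => (b i).wk.wk))) (.var' ?_) (Ty.upS_inst _ _ _)
      simp [wkCtx, Ty.wk, Ty.ren_subst, Ty.ren_upS, Ty.ren_ren]
  rw [Rel.all, Prov.rel_abs wf h.left h.right, Form.inst2, Rel.allAdm, Form.subst, Form.subst,
    Form.subst] at h₁
  have h₂ := Prov.allAdm_elim h₁ (Adm.graph hg)
  simp only [Form.subst, Rel.wk2, Rel.ren, Rel.subst, Rel.subst_ren, Rel.graph_ren, Rel.graph_subst] at h₂
  convert h₂ using 2
  · rw [Rel.gr]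
    congr 1
    funext i
    refine Fin.cases rfl (fun i => ?_) i
    simp [Rel.subst, Rel.graph_subst, Ty.subst_ren, Tm.subst_ren, Ty.subst_subst, Tm.subst_subst]
  · simp [Tm.subst]
  · simp [Tm.subst]

theorem ren {m' : ℕ} {a b : Fin m' → Typ S k} {f : Fin m' → Tm S k n} (hf : MapEnv Γ a b f)
    {σ : Typ S m} {e : Fin m → Fin m'} (he : Function.Injective e) :
    Related Ax Γ Θ Φ (σ.ren e) a b f t s ↔
      Related Ax Γ Θ Φ σ (fun i => a (e i)) (fun i => b (e i)) (fun i => f (e i)) t s := by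
  have e₁ : (σ.ren e).subst a = σ.subst fun i => a (e i) := Ty.subst_ren _ _ _
  have e₂ : (σ.ren e).subst b = σ.subst fun i => b (e i) := Ty.subst_ren _ _ _
  have h := fun ht hs => (Prov.interpRen (Ax := Ax) (Θ := Θ) (Φ := Φ) σ e he hf.adm).equiv_iff
    (t := t) (s := s) ht hs
  constructor
  · rintro ⟨ht, hs, hp⟩
    exact ⟨e₁ ▸ ht, e₂ ▸ hs, (h ht hs).1 hp⟩
  · rintro ⟨ht, hs, hp⟩
    rw [← e₁] at ht
    rw [← e₂] at hs
    exact ⟨ht, hs, (h ht hs).2 hp⟩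

end Related

end Rules

@[simp] theorem fin_zero_ne_two (n : ℕ) : ¬ (0 : Fin (n + 3)) = 2 := by
  simp [Fin.ext_iff, Nat.mod_eq_of_lt]

@[simp] theorem fin_two_ne_zero (n : ℕ) : ¬ (2 : Fin (n + 3)) = 0 := by
  simp [Fin.ext_iff, Nat.mod_eq_of_lt]

@[simp] theorem fin_one_ne_two (n : ℕ) : ¬ (1 : Fin (n + 3)) = 2 := by
  simp [Fin.ext_iff, Nat.mod_eq_of_lt]

@[simp] theorem fin_two_ne_one (n : ℕ) : ¬ (2 : Fin (n + 3)) = 1 := by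
  simp [Fin.ext_iff, Nat.mod_eq_of_lt]

@[simp] theorem fin_zero_eq_succ {n : ℕ} (i : Fin n) : ¬ 0 = i.succ := (Fin.succ_ne_zero i).symm

@[simp] theorem fin_one_eq_succ {n : ℕ} (i : Fin (n + 1)) : 1 = i.succ ↔ 0 = i := by
  rw [← Fin.succ_zero_eq_one, Fin.succ_inj]

-- Weakening of compound terms.

section TermLemmas

variable {S : Sig.{u, v}} {k n : ℕ}

attribute [simp] Ty.ren_id Tm.ren_id

namespace Tm

theorem ren_up_succ_inst_var (t : Tm S k (n + 1)) : (t.ren id (up Fin.succ)).inst (var 0) = t := by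
  rw [inst, subst_ren]
  refine (subst_congr (fun _ => rfl) (Fin.cases rfl fun i => ?_) t).trans t.subst_var
  simp

theorem cl_eq_wk (t : Tm S 0 0) : t.wk = t.cl := by
  rw [wk, cl]
  congr 1 <;> exact Subsingleton.elim _ _

@[simp] theorem ren_id_succ (t : Tm S k n) : t.ren id Fin.succ = t.wk := rfl

@[simp] theorem ren_succ_id (t : Tm S k n) : t.ren Fin.succ id = t.wkTy := rfl

@[simp] theorem wk_ren_up {k' n' : ℕ} (t : Tm S k n) (f : Fin k → Fin k') (g : Fin n → Fin n') :
    t.wk.ren f (up g) = (t.ren f g).wk := by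
  simp only [wk, ren_ren]
  rfl

@[simp] theorem app_wk (t s : Tm S k n) : (app t s).wk = app t.wk s.wk := rfl
@[simp] theorem tensor_wk (t s : Tm S k n) : (tensor t s).wk = tensor t.wk s.wk := rfl
@[simp] theorem bang_wk (t : Tm S k n) : (bang t).wk = bang t.wk := rfl

@[simp] theorem tyApp_wk (t : Tm S k n) (σ : Typ S k) : (tyApp t σ).wk = tyApp t.wk σ := by
  simp only [wk, ren, Ty.ren_id]

@[simp] theorem lam_wk (t : Tm S k (n + 1)) (σ : Typ S k) :
    (lam σ t).wk = lam σ (t.ren id (up Fin.succ)) := by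
  simp only [wk, ren, Ty.ren_id]

@[simp] theorem app_wkTy (t s : Tm S k n) : (app t s).wkTy = app t.wkTy s.wkTy := rfl
@[simp] theorem bang_wkTy (t : Tm S k n) : (bang t).wkTy = bang t.wkTy := rfl

@[simp] theorem tyApp_wkTy (t : Tm S k n) (σ : Typ S k) :
    (tyApp t σ).wkTy = tyApp t.wkTy σ.wk := rfl

theorem wk_wkTy (t : Tm S k n) : t.wk.wkTy = t.wkTy.wk := by
  simp only [wk, wkTy, ren_ren]
  rfl

@[simp] theorem comp_subst {k' n' : ℕ} (θ : Fin k → Typ S k') (q : Fin n → Tm S k' n') (σ : Typ S k)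
    (t s : Tm S k n) : (comp σ t s).subst θ q = comp (σ.subst θ) (t.subst θ q) (s.subst θ q) := by
  simp [comp]

@[simp] theorem comp_cnt (σ : Typ S k) (t s : Tm S k n) (i : Fin n) :
    (comp σ t s).cnt i = t.cnt i + s.cnt i := by
  simp [comp]

@[simp] theorem idTm_subst {k' n' : ℕ} (θ : Fin k → Typ S k') (q : Fin n → Tm S k' n')
    (σ : Typ S k) : (idTm σ : Tm S k n).subst θ q = idTm (σ.subst θ) := by
  simp [idTm]

theorem wk_eq_subst (t : Tm S k n) : t.wk = t.subst Ty.var fun i => var i.succ :=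
  ren_eq_subst _ _ _

theorem wkTy_eq_subst (t : Tm S k n) : t.wkTy = t.subst (fun i => Ty.var i.succ) var :=
  ren_eq_subst _ _ _

@[simp] theorem comp_wk (σ : Typ S k) (t s : Tm S k n) : (comp σ t s).wk = comp σ t.wk s.wk := by
  simp [wk_eq_subst]

@[simp] theorem idTm_wk (σ : Typ S k) : (idTm σ : Tm S k n).wk = idTm σ := by
  simp [wk_eq_subst]

@[simp] theorem idTm_wkTy (σ : Typ S k) : (idTm σ : Tm S k n).wkTy = idTm σ.wk := by
  simp [wkTy_eq_subst, Ty.wk, Ty.ren_eq_subst]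

@[simp] theorem idTm_cnt (σ : Typ S k) (i : Fin n) : (idTm σ : Tm S k n).cnt i = 0 := by
  simp [idTm, (Fin.succ_ne_zero i).symm]

end Tm

end TermLemmas

-- Equational reasoning, and extensionality for ! and ⊗.

section Equations

variable {S : Sig.{u, v}} {Ax : Form S 0 0 0 → Prop} {k n r : ℕ} {Γ : Fin n → Typ S k}
  {Θ : Fin r → RelDecl S k} {Φ : List (Form S k n r)} {σ τ σ' : Typ S k} {t s t' s' w : Tm S k n}

theorem HasTyI.comp {A B C : Typ S k} {f g : Tm S k n} (hg : HasTyI Γ g (.lolli B C))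
    (hf : HasTyI Γ f (.lolli A B)) : HasTyI Γ (Tm.comp A g f) (.lolli A C) :=
  .lam (.app (hg.wk A) (.app (hf.wk A) (.var 0))) (by simp)

namespace IEq

theorem weaken {Φ' : List (Form S k n r)} (h : IEq Ax Γ Θ Φ σ t s) (hΦ : ∀ χ ∈ Φ, χ ∈ Φ') :
    IEq Ax Γ Θ Φ' σ t s := ⟨h.left, h.right, h.prov.weaken hΦ⟩

theorem beta' {t : Tm S k (n + 1)} (ht : HasTyI (push σ Γ) t τ) (hc : t.cnt 0 = 1)
    (hs : HasTyI Γ s σ) (e : t.inst s = w) : IEq Ax Γ Θ Φ τ (.app (.lam σ t) s) w :=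
  e ▸ beta ht hc hs

/-- The typings of body and argument are read off by inversion from that of the redex. A chain of
reductions therefore needs a typing only for its first term, the others being supplied by
`IEq.right`. The variants below serve the same purpose. -/
theorem beta_of_typed {t : Tm S k (n + 1)} (h : HasTyI Γ (.app (.lam σ t) s) τ)
    (e : t.inst s = w) : IEq Ax Γ Θ Φ τ (.app (.lam σ t) s) w := by
  cases id h with
  | app _ h₁ h₂ =>
    cases h₁ with
    | lam h₁ => exact ofExt h (e ▸ h₁.toI.inst h₂.toI) (e ▸ .beta h)

theorem betaTy_of_typed {t : Tm S (k + 1) n} (h : HasTyI Γ (.tyApp (.tyLam t) σ) τ)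
    (e : t.instTy σ = w) : IEq Ax Γ Θ Φ τ (.tyApp (.tyLam t) σ) w := by
  cases id h with
  | tyApp _ h₁ =>
    cases h₁ with
    | tyLam h₁ => exact ofExt h (e ▸ h₁.toI.instTy σ) (e ▸ .betaTy h)

theorem betaTensor_of_typed {t : Tm S k (n + 2)}
    (h : HasTyI Γ (.letTensor σ σ' (.tensor s s') t) τ)
    (e : t.inst2 s s' = w) : IEq Ax Γ Θ Φ τ (.letTensor σ σ' (.tensor s s') t) w := by
  cases id h with
  | letTensor _ h₁ h₂ =>
    cases h₁ with
    | tensor _ h₁ h₁' =>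
      exact ofExt h (e ▸ h₂.toI.inst2 h₁.toI h₁'.toI) (e ▸ .betaTensor h)

theorem betaBang_of_typed {t : Tm S k (n + 1)} (h : HasTyI Γ (.letBang σ (.bang s) t) τ)
    (e : t.inst s = w) : IEq Ax Γ Θ Φ τ (.letBang σ (.bang s) t) w := by
  cases id h with
  | letBang _ h₁ h₂ =>
    cases h₁ with
    | bang _ h₁ => exact ofExt h (e ▸ h₂.toI.inst h₁.toI) (e ▸ .betaBang h)

theorem betaI_of_typed {t : Tm S k (n + 1)} (h : HasTyI Γ (.app (.ilam σ t) (.bang s)) τ)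
    (e : t.inst s = w) : IEq Ax Γ Θ Φ τ (.app (.ilam σ t) (.bang s)) w := by
  have h₁ := beta_of_typed (Ax := Ax) (Θ := Θ) (Φ := Φ) h rfl
  have e' : (Tm.letBang σ (.var 0) (t.ren id (up Fin.succ))).inst (.bang s) =
      .letBang σ (.bang s) t := by
    simp only [Tm.inst, Tm.subst, push_zero, Ty.subst_var, Tm.subst_ren, id_eq]
    congr 1
    exact (Tm.subst_congr (fun _ => rfl) (Fin.cases rfl fun i => by simp) t).trans t.subst_var
  rw [e'] at h₁
  exact h₁.trans (betaBang_of_typed h₁.right e)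

theorem substTm {n' : ℕ} {Γ' : Fin n' → Typ S k} {q : Fin n → Tm S k n'}
    (hq : ∀ i, HasTyI Γ' (q i) (Γ i)) (h : IEq Ax Γ Θ Φ τ t s) :
    IEq Ax Γ' Θ (Φ.map (Form.subst Ty.var q Rel.var)) τ (t.subst Ty.var q) (s.subst Ty.var q) := by
  have hq' : ∀ i, HasTyI Γ' (q i) ((Γ i).subst Ty.var) := fun i => by simpa using hq i
  have hc : CtxSubst Ax Γ Θ Γ' Θ Ty.var q Rel.var :=
    ⟨hq', fun j => .var' (by simp) (by simp), fun j hj => .var' hj (by simp) (by simp)⟩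
  have h₁ := h.left.subst hq'
  have h₂ := h.right.subst hq'
  have h₃ := h.prov.substCtx hc
  rw [Form.subst] at h₃
  rw [Ty.subst_var] at h₁ h₂ h₃
  exact ⟨h₁, h₂, h₃⟩

/-- Both abstractions, applied to the variable, β-reduce to their bodies, and extensionality
concludes. External equality has such a rule as a primitive; the internal one obtains it here. -/
theorem lam (hE : Extensionality Ax) {t s : Tm S k (n + 1)}
    (h : IEq Ax (push σ Γ) Θ (Φ.map Form.wkTm) τ t s) (ht : t.cnt 0 = 1) (hs : s.cnt 0 = 1) :
    IEq Ax Γ Θ Φ (.lolli σ τ) (.lam σ t) (.lam σ s) := by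
  refine ext hE (.lam h.left ht) (.lam h.right hs) ?_
  have key : ∀ {t : Tm S k (n + 1)}, HasTyI (push σ Γ) t τ → t.cnt 0 = 1 →
      IEq Ax (push σ Γ) Θ (Φ.map Form.wkTm) τ (.app (Tm.lam σ t).wk (.var 0)) t := by
    intro t ht hc
    have ht' := HasTy.ren ht (Γ' := push σ (push σ Γ)) (f := id) (g := up Fin.succ)
      (Fin.cases (Ty.ren_id _).symm fun i => (Ty.ren_id _).symm)
    rw [Ty.ren_id] at ht'
    rw [Tm.wk, Tm.ren, Ty.ren_id]
    exact beta' ht' (by simpa using hc) (.var 0) (Tm.ren_up_succ_inst_var t)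
  exact (key h.left ht).trans (h.trans (key h.right hs).symm)

/-- Two maps on `!σ` are equal if they agree on all `!x`. -/
theorem ext_bang (hId : IdentityExtension Ax) (hE : Extensionality Ax)
    (ht : HasTyI Γ t (.arrow σ τ)) (hs : HasTyI Γ s (.arrow σ τ))
    (h : IEq Ax (push σ Γ) Θ (Φ.map Form.wkTm) τ (.app t.wk (.bang (.var 0)))
      (.app s.wk (.bang (.var 0)))) :
    IEq Ax Γ Θ Φ (.arrow σ τ) t s := by
  refine ext hE ht hs ?_
  have hv : HasTyI (push (.bang σ) Γ) (.var 0) (.bang σ) := .var 0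
  have ht' := ht.wk (.bang σ)
  have hs' := hs.wk (.bang σ)
  -- By identity extension the variable z : !σ is related to itself by (!σ)[eq], that is by
  -- !(σ[eq]). Testing this at equality on τ leaves only the arguments !x and !y with x = y.
  have h₁ := Related.of_eq (Θ := Θ) (Φ := Φ.map Form.wkTm) (σ := Ty.bang σ) (a := Ty.var) hId
    (IEq.refl (by simpa using hv))
  have h₂ := h₁.bang_elim (MapEnv.id Ty.var) (HasTyI.idTm τ) (u := t.wk) (w := s.wk)
    (by simpa using ht') (by simpa using hs') ?_
  · exact (betaId (.app ht' hv)).symm.trans h₂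
  intro Ψ hr
  have hxy := hr.eq hId
  rw [Ty.subst_var] at hxy ⊢
  -- The context is now z, x, y, with x of index 1. The hypothesis, stated over one variable, is
  -- used at x; the equality of x and y then replaces x on one side.
  have h₃ := h.substTm (Γ' := push σ (push σ (push (.bang σ) Γ)))
    (q := push (.var 1) fun i => .var i.succ.succ.succ) (Fin.cases (.var 1) fun i => .var i.succ.succ.succ)
  have e : ∀ t : Tm S k n, t.wk.subst Ty.var (push (.var 1) fun i => .var i.succ.succ.succ) =
      t.wk.wk.wk := by
    intro t
    rw [Tm.wk_subst_push, Tm.wk_eq_subst, Tm.wk_eq_subst, Tm.wk_eq_subst, Tm.subst_subst, Tm.subst_subst]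
    simp
  simp only [Tm.subst, push_zero, e] at h₃
  have h₄ := h₃.weaken (Φ' := Ψ :: ((Φ.map Form.wkTm).map Form.wkTm).map Form.wkTm) (by
    intro χ hχ
    refine List.mem_cons_of_mem _ ?_
    rw [List.map_map] at hχ
    rw [List.map_map, List.map_map]
    convert hχ using 2
    funext φ
    simp only [Function.comp, Form.wkTm, Form.ren_ren, Form.subst_ren, Form.ren_eq_subst]
    simp only [Form.subst_subst]
    rfl)
  have hs₃ := ((hs'.wk σ).wk σ)
  rw [Tm.idTm_wk, Tm.idTm_wk]
  exact (betaId h₄.left).trans (h₄.trans (appR hs₃ hxy.bang))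

/-- A map on `σ ⊗ σ'` applied to `t` is determined by its values on the `x ⊗ y`. -/
theorem app_eq_letTensor (ht : HasTyI Γ t (.lolli (.tensor σ σ') τ))
    (hs : HasTyI Γ s (.tensor σ σ')) :
    IEq Ax Γ Θ Φ τ (.app t s) (.letTensor σ σ' s (.app (.app
      (Tm.lam σ (.lam σ' (.app t.wk.wk (.tensor (.var 1) (.var 0))))).wk.wk (.var 1)) (.var 0))) := by
  have hv : HasTyI (push σ' (push σ Γ)) (.tensor (.var 1) (.var 0)) (.tensor σ σ') :=
    .tensor (.var 1) (.var 0)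
  have hg : ∀ {n : ℕ} {Γ : Fin n → Typ S k} {t : Tm S k n}, HasTyI Γ t (.lolli (.tensor σ σ') τ) →
      HasTyI (push σ Γ) (.lam σ' (.app t.wk.wk (.tensor (.var 1) (.var 0)))) (.lolli σ' τ) :=
    fun ht => .lam (.app ((ht.wk _).wk _) (.tensor (.var 1) (.var 0))) (by simp)
  have hlet := HasTyI.letTensor hs hv (by simp) (by simp)
  have htw : HasTyI (push σ' (push σ Γ)) t.wk.wk (.lolli (.tensor σ σ') τ) := (ht.wk _).wk _
  have hbody := HasTyI.app htw hv
  -- The η rule writes s as let x ⊗ y be s in x ⊗ y; the commuting conversion then moves t under the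
  -- let.
  have h₁ : IEq Ax Γ Θ Φ τ (.app t s) (.app t (.letTensor σ σ' s (.tensor (.var 1) (.var 0)))) :=
    appR ht (ofExt hs hlet (.symm (.etaTensor hs)))
  have hmid := HasTyI.letTensor hs hbody (by simp) (by simp)
  refine (h₁.trans (w := .letTensor σ σ' s (.app t.wk.wk (.tensor (.var 1) (.var 0))))
    (ofExt h₁.right hmid (.symm ?_))).trans ?_
  · have := ExtEq.commTensor (e := .app t.wk (.var 0)) splits_many
      ((HasTyI.app (ht.wk (.tensor σ σ')) (.var 0)).linear (by simp)) hlet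
    convert this using 1
    · have e : ∀ t : Tm S k n, t.ren id (fun i => i.succ.succ) = t.wk.wk := fun t =>
        Rel.wk_wk_eq t
      simp [Tm.inst, e]
    · simp [Tm.inst]
  · have e : (Tm.lam σ (.lam σ' (.app t.wk.wk (.tensor (.var 1) (.var 0))))).wk.wk =
        (.lam σ (.lam σ' (.app t.wk.wk.wk.wk (.tensor (.var 1) (.var 0)))) : Tm S k (n + 2)) := by
      simp
    rw [e]
    have hf := HasTyI.app (.app (.lam (hg htw) (by simp)) (.var 1)) (.var 0)
    refine ofExt hmid (.letTensor hs hf (by simp) (by simp)) (.letTensor splits_many (.refl hs)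
      (.symm ?_))
    -- The remaining two β steps happen below the let, where x and y are linear, so external
    -- equality with explicit multiplicities is needed. In the function part only x (index 1) is
    -- available; y (index 0) belongs to the argument.
    have h₁ : ExtEq (push σ' (push σ Γ)) (push .zero (push .one fun _ => .many))
        (.app (.lam σ (.lam σ' (.app t.wk.wk.wk.wk (.tensor (.var 1) (.var 0))))) (.var 1))
        (.lam σ' (.app t.wk.wk.wk (.tensor (.var 2) (.var 0)))) (.lolli σ' τ) := by
      have := ExtEq.beta (HasTy.of_cnt (u' := push .zero (push .one fun _ => .many))
        (HasTyI.app (.lam (hg htw) (by simp)) (.var (1 : Fin (n + 2)))) ?_)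
      · convert this using 1
        simp [Tm.inst]
      · refine Fin.cases ⟨nofun, fun _ => ?_⟩ (Fin.cases ⟨fun _ => ?_, nofun⟩ fun _ => ⟨nofun, nofun⟩)
        · simp
        · simp
    have h₂ := ExtEq.beta (HasTy.of_cnt (u' := push .one (push .one fun _ => .many))
      (HasTyI.app (Γ := push σ' (push σ Γ)) (.lam (σ := σ') (.app (htw.wk σ')
        (.tensor (.var 2) (.var 0))) (by simp)) (.var (0 : Fin (n + 2)))) ?_)
    · have h₃ := ExtEq.app (u := push .one (push .one fun _ => .many))
        (u₂ := push .one (push .zero fun _ => .many))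
        (Fin.cases .right (Fin.cases .left fun _ => .many)) h₁
        (.refl (.of_cnt (HasTyI.var (0 : Fin (n + 2))) ?_))
      · refine h₃.trans ?_
        convert h₂ using 1
        simp [Tm.inst]
      · exact Fin.cases ⟨fun _ => by simp, nofun⟩ (Fin.cases ⟨nofun, fun _ => by simp⟩
          fun _ => ⟨nofun, nofun⟩)
    · refine Fin.cases ⟨fun _ => ?_, nofun⟩ (Fin.cases ⟨fun _ => ?_, nofun⟩ fun _ => ⟨nofun, nofun⟩)
      · simp
      · simp

theorem iff_rel_id (hId : IdentityExtension Ax) (ht : HasTyI Γ t σ) (hs : HasTyI Γ s σ) :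
    Prov Ax Γ Θ Φ (.rel (Rel.gr σ Ty.var Ty.var fun i => Tm.idTm (.var i)) t s) ↔
      IEq Ax Γ Θ Φ σ t s := by
  have := of_identityExtension (Θ := Θ) (Φ := Φ) (t := t) (s := s) hId σ Ty.var (Γ := Γ)
  rw [Ty.subst_var] at this
  exact this ht hs

/-- The test relation in the elimination rule for ⊗ is built explicitly from `Rel.lolli` and ends in
equality; it is not itself an interpretation. Equal maps satisfy it because identity extension turns
related arguments into equal ones. -/
theorem rel_lolli_lolli (hId : IdentityExtension Ax)
    (h : IEq Ax Γ Θ Φ (.lolli σ (.lolli σ' τ)) t s) :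
    Prov Ax Γ Θ Φ (.rel (Rel.lolli σ σ (.lolli σ' τ) (.lolli σ' τ)
      (Rel.gr σ Ty.var Ty.var fun i => Tm.idTm (.var i)) (Rel.lolli σ' σ' τ τ
        (Rel.gr σ' Ty.var Ty.var fun i => Tm.idTm (.var i)) (Rel.eqRel τ))) t s) := by
  have wf : ∀ {n : ℕ} (Γ : Fin n → Typ S k) (σ : Typ S k), StableRel Ax Γ Θ
      (Rel.gr σ Ty.var Ty.var fun i => Tm.idTm (.var i)) σ σ := by
    intro n Γ σ
    simpa using StableRel.gr (Ax := Ax) (Θ := Θ) (MapEnv.id (Γ := Γ) Ty.var) σ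
  have wf' : ∀ {n : ℕ} (Γ : Fin n → Typ S k), StableRel Ax Γ Θ (Rel.eqRel τ) τ τ :=
    fun Γ => .graph (.idTm τ)
  have ew : ∀ {n : ℕ}, (Rel.eqRel τ : Rel S k n r).wk2 = Rel.eqRel τ := by
    intro n
    rw [Rel.eqRel, Rel.graph_wk2, Tm.idTm_wk, Tm.idTm_wk]
    rfl
  refine Prov.lolli_intro (wf Γ σ) (.lolli (wf Γ σ') (wf' Γ)) h.left h.right ?_
  simp only [Rel.lolli_wk2, Rel.gr_wk2, Tm.idTm_wk, ew]
  have ht := h.left.wk σ |>.wk σ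
  have hs := h.right.wk σ |>.wk σ
  have hw := fun Ψ => ((h.wk σ).wk σ).weaken fun χ hχ => List.mem_cons_of_mem Ψ hχ
  refine Prov.lolli_intro (wf _ σ') (wf' _) (.app ht (.var 1)) (.app hs (.var 0)) ?_
  simp only [Rel.gr_wk2, Tm.idTm_wk, ew]
  refine (Prov.eqRel_iff (.app (.app ((ht.wk σ').wk σ') (.var 3)) (.var 1))
    (.app (.app ((hs.wk σ').wk σ') (.var 2)) (.var 0))).2
    (app (σ := σ') (app (σ := σ) (τ := .lolli σ' τ) ?_ ?_) ?_)
  · exact (((hw _).wk σ').wk σ').weaken fun χ hχ => List.mem_cons_of_mem _ hχ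
  · have h := (iff_rel_id (Θ := Θ) (Φ := (Form.rel
      (Rel.gr σ Ty.var Ty.var fun i => Tm.idTm (.var i)) (.var 1) (.var 0) ::
      (Φ.map Form.wkTm).map Form.wkTm)) (Γ := push σ (push σ Γ)) (σ := σ) (t := .var 1) (s := .var 0)
      hId (.var 1) (.var 0)).1 (.hyp (List.mem_cons_self ..)
        (.rel (wf _ σ).wf (.var 1) (.var 0)))
    exact ((h.wk σ').wk σ').weaken fun χ hχ => List.mem_cons_of_mem _ hχ
  · exact (iff_rel_id hId (.var 1) (.var 0)).1 (.hyp (List.mem_cons_self ..)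
      (.rel (wf _ σ').wf (.var 1) (.var 0)))

/-- Two maps on `σ ⊗ σ'` are equal if they agree on all `x ⊗ y`. -/
theorem ext_tensor (hId : IdentityExtension Ax) (hE : Extensionality Ax)
    (ht : HasTyI Γ t (.lolli (.tensor σ σ') τ)) (hs : HasTyI Γ s (.lolli (.tensor σ σ') τ))
    (h : IEq Ax (push σ' (push σ Γ)) Θ ((Φ.map Form.wkTm).map Form.wkTm) τ
      (.app t.wk.wk (.tensor (.var 1) (.var 0))) (.app s.wk.wk (.tensor (.var 1) (.var 0)))) :
    IEq Ax Γ Θ Φ (.lolli (.tensor σ σ') τ) t s := by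
  -- The curried forms of the two maps are equal by the hypothesis. They serve below as the two
  -- tests to which the variable of type σ ⊗ σ' is subjected.
  have h₀ : IEq Ax Γ Θ Φ (.lolli σ (.lolli σ' τ))
      (.lam σ (.lam σ' (.app t.wk.wk (.tensor (.var 1) (.var 0)))))
      (.lam σ (.lam σ' (.app s.wk.wk (.tensor (.var 1) (.var 0))))) :=
    lam hE (lam hE h (by simp) (by simp)) (by simp) (by simp)
  refine ext hE ht hs ?_
  have h₁ := h₀.wk (.tensor σ σ')
  have e : ∀ t : Tm S k n, (Tm.lam σ (.lam σ' (.app t.wk.wk (.tensor (.var 1) (.var 0))))).wk =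
      .lam σ (.lam σ' (.app t.wk.wk.wk (.tensor (.var 1) (.var 0)))) := fun t => by simp
  rw [e, e] at h₁
  have hv : HasTyI (push (.tensor σ σ') Γ) (.var 0) (.tensor σ σ') := .var 0
  refine (app_eq_letTensor (ht.wk _) hv).trans (.trans ?_ (app_eq_letTensor (hs.wk _) hv).symm)
  have m := MapEnv.id (Γ := push (.tensor σ σ') Γ) (Ty.var : Fin k → Typ S k)
  have h₂ := Related.of_eq (Θ := Θ) (Φ := Φ.map Form.wkTm) (σ := Ty.tensor σ σ') (a := Ty.var) hId
    (IEq.refl (by simpa using hv))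
  -- As for !, the variable is related to itself by the tensor of the two identity interpretations;
  -- this is eliminated at equality on τ.
  have h₃ := ((Prov.interpTensor σ σ' m.adm).equiv_iff h₂.left h₂.right).1 h₂.prov
  simp only [Ty.subst_var] at h₃
  have wf := fun ω : Typ S k =>
    StableRel.gr (Ax := Ax) (Θ := Θ) (MapEnv.id (Γ := push (.tensor σ σ') Γ) Ty.var) ω
  simp only [Ty.subst_var] at wf
  refine (Prov.eqRel_iff ?_ ?_).1 (Prov.tensor_elim (wf σ) (wf σ') hv hv h₃ (.eqRel τ) h₁.left
    h₁.right (rel_lolli_lolli hId h₁))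
  · exact .letTensor hv (.app (.app ((h₁.left.wk _).wk _) (.var 1)) (.var 0)) (by simp) (by simp)
  · exact .letTensor hv (.app (.app ((h₁.right.wk _).wk _) (.var 1)) (.var 0)) (by simp) (by simp)

theorem comp_app {A B C : Typ S k} {f g x : Tm S k n} (hg : HasTyI Γ g (.lolli B C))
    (hf : HasTyI Γ f (.lolli A B)) (hx : HasTyI Γ x A) :
    IEq Ax Γ Θ Φ C (.app (.comp A g f) x) (.app g (.app f x)) :=
  beta' (.app (hg.wk A) (.app (hf.wk A) (.var 0))) (by simp) hx (by simp [Tm.inst])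

variable {A B C D : Typ S k} {f f' g g' : Tm S k n}

theorem comp (hE : Extensionality Ax) (h : IEq Ax Γ Θ Φ (.lolli B C) g g')
    (h' : IEq Ax Γ Θ Φ (.lolli A B) f f') :
    IEq Ax Γ Θ Φ (.lolli A C) (.comp A g f) (.comp A g' f') :=
  lam hE (app (h.wk A) (app (h'.wk A) (refl (.var 0)))) (by simp) (by simp)

theorem compL (hE : Extensionality Ax) (h : IEq Ax Γ Θ Φ (.lolli B C) g g')
    (hf : HasTyI Γ f (.lolli A B)) :
    IEq Ax Γ Θ Φ (.lolli A C) (.comp A g f) (.comp A g' f) := comp hE h (refl hf)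

theorem compR (hE : Extensionality Ax) (hg : HasTyI Γ g (.lolli B C))
    (h' : IEq Ax Γ Θ Φ (.lolli A B) f f') :
    IEq Ax Γ Θ Φ (.lolli A C) (.comp A g f) (.comp A g f') := comp hE (refl hg) h'

theorem comp_assoc (hE : Extensionality Ax) {h : Tm S k n} (hh : HasTyI Γ h (.lolli C D))
    (hg : HasTyI Γ g (.lolli B C)) (hf : HasTyI Γ f (.lolli A B)) :
    IEq Ax Γ Θ Φ (.lolli A D) (.comp A (.comp B h g) f) (.comp A h (.comp A g f)) := by
  refine lam hE ?_ (by simp) (by simp)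
  rw [Tm.comp_wk, Tm.comp_wk]
  have hv : HasTyI (push A Γ) (.var 0) A := .var 0
  exact (comp_app (hh.wk A) (hg.wk A) (.app (hf.wk A) hv)).trans
    (appR (hh.wk A) (comp_app (hg.wk A) (hf.wk A) hv).symm)

theorem comp_id (hE : Extensionality Ax) (hf : HasTyI Γ f (.lolli A B)) :
    IEq Ax Γ Θ Φ (.lolli A B) (.comp A f (Tm.idTm A)) f := by
  have hv : HasTyI (push A Γ) (.var 0) A := .var 0
  refine ext hE (hf.comp (.idTm A)) hf ?_
  rw [Tm.comp_wk, Tm.idTm_wk]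
  exact (comp_app (hf.wk A) (.idTm A) hv).trans (appR (hf.wk A) (betaId hv))

theorem id_comp (hE : Extensionality Ax) (hf : HasTyI Γ f (.lolli A B)) :
    IEq Ax Γ Θ Φ (.lolli A B) (.comp A (Tm.idTm B) f) f := by
  have hv : HasTyI (push A Γ) (.var 0) A := .var 0
  refine ext hE (.comp (.idTm B) hf) hf ?_
  rw [Tm.comp_wk, Tm.idTm_wk]
  exact (comp_app (.idTm B) (hf.wk A) hv).trans (betaId (.app (hf.wk A) hv))

/-- Equality of composites, from their values on a variable. -/
theorem ext_comp (hE : Extensionality Ax) {B' : Typ S k} (hg : HasTyI Γ g (.lolli B C))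
    (hf : HasTyI Γ f (.lolli A B)) (hg' : HasTyI Γ g' (.lolli B' C))
    (hf' : HasTyI Γ f' (.lolli A B'))
    (h : IEq Ax (push A Γ) Θ (Φ.map Form.wkTm) C (.app g.wk (.app f.wk (.var 0)))
      (.app g'.wk (.app f'.wk (.var 0)))) :
    IEq Ax Γ Θ Φ (.lolli A C) (.comp A g f) (.comp A g' f') :=
  lam hE h (by simp) (by simp)

/-- Equal composites have equal values. -/
theorem of_comp {B' : Typ S k} {x : Tm S k n} (hg : HasTyI Γ g (.lolli B C))
    (hf : HasTyI Γ f (.lolli A B)) (hg' : HasTyI Γ g' (.lolli B' C))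
    (hf' : HasTyI Γ f' (.lolli A B'))
    (h : IEq Ax Γ Θ Φ (.lolli A C) (.comp A g f) (.comp A g' f')) (hx : HasTyI Γ x A) :
    IEq Ax Γ Θ Φ C (.app g (.app f x)) (.app g' (.app f' x)) :=
  (comp_app hg hf hx).symm.trans ((appL h hx).trans (comp_app hg' hf' hx))

end IEq

end Equations

-- Occurrences of type variables, and typing of the functorial action.

theorem Ty.subst_congr_of_occ {T : TySig.{u}} {m k : ℕ} {σ : Ty T m} {θ θ' : Fin m → Ty T k}
    (h : ∀ i p, Ty.Occ p i σ → θ i = θ' i) : σ.subst θ = σ.subst θ' := by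
  induction σ generalizing k with
  | var i => exact h i true ⟨rfl, rfl⟩
  | con c args ih =>
    rw [Ty.subst, Ty.subst]
    congr 1
    funext j
    exact ih j fun i p hp => h i true ⟨j, by cases p <;> simp [hp]⟩
  | one => rfl
  | tensor σ τ ih₁ ih₂ =>
    rw [Ty.subst, Ty.subst, ih₁ fun i p hp => h i p (.inl hp), ih₂ fun i p hp => h i p (.inr hp)]
  | lolli σ τ ih₁ ih₂ =>
    rw [Ty.subst, Ty.subst, ih₁ fun i p hp => h i (!p) (.inl (by simpa using hp)),
      ih₂ fun i p hp => h i p (.inr hp)]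
  | bang σ ih => rw [Ty.subst, Ty.subst, ih fun i p hp => h i p hp]
  | all σ ih =>
    rw [Ty.subst, Ty.subst, ih]
    exact Fin.cases (fun _ _ => rfl) fun i p hp => congrArg Ty.wk (h i p hp)

theorem Ty.occ_ren {T : TySig.{u}} {m k : ℕ} {σ : Ty T m} {f : Fin m → Fin k} {p : Bool} {i : Fin k}
    (h : Ty.Occ p i (σ.ren f)) : ∃ j, f j = i ∧ Ty.Occ p j σ := by
  induction σ generalizing k p with
  | var j => exact ⟨j, h.2.symm, h.1, rfl⟩
  | con c args ih =>
    obtain ⟨j, h | h⟩ := h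
    · obtain ⟨j', e, h'⟩ := ih j h
      exact ⟨j', e, j, .inl h'⟩
    · obtain ⟨j', e, h'⟩ := ih j h
      exact ⟨j', e, j, .inr h'⟩
  | one => exact h.elim
  | tensor σ τ ih₁ ih₂ =>
    rcases h with h | h
    · obtain ⟨j, e, h'⟩ := ih₁ h
      exact ⟨j, e, .inl h'⟩
    · obtain ⟨j, e, h'⟩ := ih₂ h
      exact ⟨j, e, .inr h'⟩
  | lolli σ τ ih₁ ih₂ =>
    rcases h with h | h
    · obtain ⟨j, e, h'⟩ := ih₁ h
      exact ⟨j, e, .inl h'⟩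
    · obtain ⟨j, e, h'⟩ := ih₂ h
      exact ⟨j, e, .inr h'⟩
  | bang σ ih => exact ih h
  | all σ ih =>
    obtain ⟨j, e, h'⟩ := ih (f := up f) h
    revert e h'
    refine Fin.cases (fun e => ?_) (fun j e h' => ⟨j, Fin.succ_injective _ e, h'⟩) j
    exact absurd e (fin_zero_eq_succ _)

theorem Ty.ren_up_succ_inst_var {T : TySig.{u}} {k : ℕ} (σ : Ty T (k + 1)) :
    (σ.ren (up Fin.succ)).inst (.var 0) = σ := by
  rw [inst, subst_ren]
  exact (subst_congr (Fin.cases rfl fun i => by simp) σ).trans σ.subst_var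

section Action

variable {S : Sig.{u, v}}

theorem act_subst {m : ℕ} (σ : Typ S m) : ∀ {k n k' n' : ℕ} (a b : Fin m → Typ S k)
    (F : Fin m → Tm S k n) (θ : Fin k → Typ S k') (s : Fin n → Tm S k' n'),
    (act σ a b F).subst θ s =
      act σ (fun i => (a i).subst θ) (fun i => (b i).subst θ) fun i => (F i).subst θ s := by
  induction σ with
  | var i => intros; rfl
  | con c args ih => intros; simp [act, Ty.subst_subst]
  | one => intros; simp [act]
  | tensor σ τ ih₁ ih₂ => intros; simp [act, ih₁, ih₂, Ty.subst_subst]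
  | lolli σ τ ih₁ ih₂ => intros; simp [act, ih₁, ih₂, Ty.subst_subst]
  | bang σ ih => intros; simp [act, ih, Ty.subst_subst]
  | all σ ih =>
    intro k n k' n' a b F θ s
    have e : ∀ {j : ℕ} (a : Fin j → Typ S k), (fun i => (Ty.upS a i).subst (Ty.upS θ)) =
        Ty.upS fun i => (a i).subst θ :=
      fun a => funext (Fin.cases rfl fun i => Ty.wk_subst_upS θ (a i))
    simp only [act, Tm.subst, ih, e, Ty.subst, Ty.subst_subst]
    congr 6
    refine push_ext ?_ fun i => ?_
    · simp [Ty.upS]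
    · simp only [push_succ]
      exact (Tm.subst_wkTy' _ _ _).trans (by rw [Tm.wk_subst_upS])

/-- Only absence of a variable is preserved: the action may duplicate or drop the maps F i. This is
enough for the linear binders that it introduces, and it explains why M_σ takes its argument in the
form !f. -/
theorem act_cnt {m : ℕ} (σ : Typ S m) : ∀ {k n : ℕ} (a b : Fin m → Typ S k)
    (F : Fin m → Tm S k n) (j : Fin n), (∀ i, (F i).cnt j = 0) → (act σ a b F).cnt j = 0 := by
  induction σ with
  | var i => exact fun _ _ _ _ h => h i
  | con c args ih => intros; simp [act]
  | one => intros; simp [act]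
  | tensor σ τ ih₁ ih₂ =>
    intro k n a b F j h
    simp [act, ih₁ a b (fun i => (F i).wk.wk.wk) j.succ.succ.succ (by simpa using h),
      ih₂ a b (fun i => (F i).wk.wk.wk) j.succ.succ.succ (by simpa using h)]
  | lolli σ τ ih₁ ih₂ =>
    intro k n a b F j h
    simp [act, ih₁ b a (fun i => (F i).wk.wk) j.succ.succ (by simpa using h),
      ih₂ a b (fun i => (F i).wk.wk) j.succ.succ (by simpa using h)]
  | bang σ ih =>
    intro k n a b F j h
    simp [act, ih a b (fun i => (F i).wk.wk) j.succ.succ (by simpa using h)]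
  | all σ ih =>
    intro k n a b F j h
    simp only [act, Tm.cnt]
    rw [ih _ _ _ _ (Fin.cases (by simp) (by simpa using h))]
    simp

/-- Entries at variables that do not occur are irrelevant. They can be replaced by identities, which
makes `IEq.act_id` applicable to a subtype that contains only parameters. -/
theorem act_congr {m : ℕ} (σ : Typ S m) : ∀ {k n : ℕ} {a b a' b' : Fin m → Typ S k}
    {F F' : Fin m → Tm S k n},
    (∀ i p, Ty.Occ p i σ → a i = a' i ∧ b i = b' i ∧ F i = F' i) → act σ a b F = act σ a' b' F' := by
  induction σ with
  | var i => exact fun h => (h i true ⟨rfl, rfl⟩).2.2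
  | con c args ih =>
    intro k n a b a' b' F F' h
    rw [act, act, Ty.subst_congr_of_occ fun i p hp => (h i p hp).1]
  | one => intros; rfl
  | tensor σ τ ih₁ ih₂ =>
    intro k n a b a' b' F F' h
    rw [act, act, Ty.subst_congr_of_occ (σ := σ.tensor τ) fun i p hp => (h i p hp).1,
      Ty.subst_congr_of_occ (σ := σ) fun i p hp => (h i p (.inl hp)).1,
      Ty.subst_congr_of_occ (σ := τ) fun i p hp => (h i p (.inr hp)).1,
      ih₁ fun i p hp => ⟨(h i p (.inl hp)).1, (h i p (.inl hp)).2.1, by rw [(h i p (.inl hp)).2.2]⟩,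
      ih₂ fun i p hp => ⟨(h i p (.inr hp)).1, (h i p (.inr hp)).2.1, by rw [(h i p (.inr hp)).2.2]⟩]
  | lolli σ τ ih₁ ih₂ =>
    intro k n a b a' b' F F' h
    have hσ := fun i p (hp : Ty.Occ p i σ) => h i (!p) (.inl (by simpa using hp))
    rw [act, act, Ty.subst_congr_of_occ (σ := σ.lolli τ) fun i p hp => (h i p hp).1,
      Ty.subst_congr_of_occ (σ := σ) fun i p hp => (hσ i p hp).2.1,
      ih₁ fun i p hp => ⟨(hσ i p hp).2.1, (hσ i p hp).1, by rw [(hσ i p hp).2.2]⟩,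
      ih₂ fun i p hp => ⟨(h i p (.inr hp)).1, (h i p (.inr hp)).2.1, by rw [(h i p (.inr hp)).2.2]⟩]
  | bang σ ih =>
    intro k n a b a' b' F F' h
    have h' : ∀ i p, Ty.Occ p i σ → a i = a' i ∧ b i = b' i ∧ F i = F' i := h
    rw [act, act, Ty.subst_congr_of_occ (σ := σ.bang) fun i p hp => (h i p hp).1,
      Ty.subst_congr_of_occ (σ := σ) fun i p hp => (h' i p hp).1,
      ih fun i p hp => ⟨(h' i p hp).1, (h' i p hp).2.1, by rw [(h' i p hp).2.2]⟩]
  | all σ ih =>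
    intro k n a b a' b' F F' h
    rw [act, act, Ty.subst_congr_of_occ (σ := σ.all) fun i p hp => (h i p hp).1, ih]
    refine Fin.cases (fun _ _ => ⟨rfl, rfl, rfl⟩) fun i p hp => ?_
    obtain ⟨h₁, h₂, h₃⟩ := h i p hp
    simp only [Ty.upS, push_succ, h₁, h₂, h₃, and_self]

/-- The hypotheses on `F`, for `act σ a b F` to be a map. -/
def ActEnv {m k n : ℕ} (Γ : Fin n → Typ S k) (σ : Typ S m) (a b : Fin m → Typ S k)
    (F : Fin m → Tm S k n) : Prop :=
  ∀ i, (Ty.Occ true i σ → HasTyI Γ (F i) (.lolli (a i) (b i))) ∧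
    (Ty.Occ false i σ → HasTyI Γ (F i) (.lolli (b i) (a i))) ∧
    (Ty.Occ true i σ → Ty.Occ false i σ → a i = b i)

theorem ActEnv.wk {m k n : ℕ} {Γ : Fin n → Typ S k} {σ : Typ S m} {a b : Fin m → Typ S k}
    {F : Fin m → Tm S k n} (h : ActEnv Γ σ a b F) (τ : Typ S k) :
    ActEnv (push τ Γ) σ a b fun i => (F i).wk :=
  fun i => ⟨fun ho => ((h i).1 ho).wk τ, fun ho => ((h i).2.1 ho).wk τ, (h i).2.2⟩

theorem ActEnv.mono {m k n : ℕ} {Γ : Fin n → Typ S k} {σ σ' : Typ S m} {a b : Fin m → Typ S k}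
    {F : Fin m → Tm S k n} (h : ActEnv Γ σ a b F) (ho : ∀ p i, Ty.Occ p i σ' → Ty.Occ p i σ) :
    ActEnv Γ σ' a b F :=
  fun i => ⟨fun h₁ => (h i).1 (ho _ _ h₁), fun h₁ => (h i).2.1 (ho _ _ h₁),
    fun h₁ h₂ => (h i).2.2 (ho _ _ h₁) (ho _ _ h₂)⟩

theorem ActEnv.swap {m k n : ℕ} {Γ : Fin n → Typ S k} {σ σ' : Typ S m} {a b : Fin m → Typ S k}
    {F : Fin m → Tm S k n} (h : ActEnv Γ σ a b F) (ho : ∀ p i, Ty.Occ p i σ' → Ty.Occ (!p) i σ) :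
    ActEnv Γ σ' b a F :=
  fun i => ⟨fun h₁ => (h i).2.1 (ho _ _ h₁), fun h₁ => (h i).1 (ho _ _ h₁),
    fun h₁ h₂ => ((h i).2.2 (ho _ _ h₂) (ho _ _ h₁)).symm⟩

theorem ActEnv.all {m k n : ℕ} {Γ : Fin n → Typ S k} {σ : Typ S (m + 1)} {a b : Fin m → Typ S k}
    {F : Fin m → Tm S k n} (h : ActEnv Γ (.all σ) a b F) (τ : Typ S k) :
    ActEnv (wkCtx (push τ Γ)) σ (Ty.upS a) (Ty.upS b)
      (push (Tm.idTm (.var 0)) fun i => (F i).wk.wkTy) :=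
  Fin.cases ⟨fun _ => .idTm _, fun _ => .idTm _, fun _ _ => rfl⟩ fun i =>
    ⟨fun ho => (((h i).1 ho).wk τ).wkTy, fun ho => (((h i).2.1 ho).wk τ).wkTy,
      fun h₁ h₂ => congrArg Ty.wk ((h i).2.2 h₁ h₂)⟩

theorem HasTyI.act {m : ℕ} (σ : Typ S m) : ∀ {k n : ℕ} {Γ : Fin n → Typ S k}
    {a b : Fin m → Typ S k} {F : Fin m → Tm S k n}, ActEnv Γ σ a b F →
    HasTyI Γ (act σ a b F) (.lolli (σ.subst a) (σ.subst b)) := by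
  induction σ with
  | var i => exact fun h => (h i).1 ⟨rfl, rfl⟩
  | con c args ih =>
    intro k n Γ a b F h
    -- A variable in an argument of a type constant occurs with both variances, so a and b agree
    -- there. Hence source and target coincide and the identity has the required type.
    have e : (Ty.con c args).subst b = (Ty.con c args).subst a :=
      Ty.subst_congr_of_occ fun i p hp => ((h i).2.2 hp hp).symm
    rw [e]
    exact .idTm _
  | one => exact fun h => .idTm _
  | tensor σ τ ih₁ ih₂ =>
    intro k n Γ a b F h
    refine .lam (.letTensor (.var 0) (.tensor (.app (ih₁ ?_) (.var 1)) (.app (ih₂ ?_) (.var 0)))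
      ?_ ?_) ?_
    · exact (((h.mono fun _ _ => .inl).wk _).wk _).wk _
    · exact (((h.mono fun _ _ => .inr).wk _).wk _).wk _
    all_goals simp [act_cnt]
  | lolli σ τ ih₁ ih₂ =>
    intro k n Γ a b F h
    refine .lam (.lam (.app (ih₂ ?_) (.app (.var 1) (.app (ih₁ ?_) (.var 0)))) ?_) ?_
    · exact ((h.mono fun _ _ => .inr).wk _).wk _
    · exact ((h.swap fun p i hp => .inl (by simpa using hp)).wk _).wk _
    all_goals simp [act_cnt]
  | bang σ ih =>
    intro k n Γ a b F h
    refine .lam (.letBang (.var 0) (.bang (.app (ih ?_) (.var 0)))) ?_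
    · exact ((h.mono (σ' := σ) fun _ _ h => h).wk _).wk _
    · simp [act_cnt]
  | all σ ih =>
    intro k n Γ a b F h
    refine .lam (.tyLam (.app (ih (h.all _)) (.tyApp' (.var' rfl) ?_))) ?_
    · exact Ty.ren_up_succ_inst_var _
    · simp only [Tm.cnt]
      rw [act_cnt _ _ _ _ _ (Fin.cases (by simp) (by simp))]
      simp

end Action

-- Computation rules of the functorial action, and preservation of identities.

section Functor

theorem act_wk {S : Sig.{u, v}} {m k n : ℕ} (σ : Typ S m) (a b : Fin m → Typ S k)
    (F : Fin m → Tm S k n) : (act σ a b F).wk = act σ a b fun i => (F i).wk := by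
  rw [Tm.wk_eq_subst, act_subst]
  simp [Tm.wk_eq_subst]

theorem act_wkTy {S : Sig.{u, v}} {m k n : ℕ} (σ : Typ S m) (a b : Fin m → Typ S k)
    (F : Fin m → Tm S k n) :
    (act σ a b F).wkTy = act σ (fun i => (a i).wk) (fun i => (b i).wk) fun i => (F i).wkTy := by
  rw [Tm.wkTy_eq_subst, act_subst]
  simp [Tm.wkTy_eq_subst, Ty.wk, Ty.ren_eq_subst]

variable {S : Sig.{u, v}} {Ax : Form S 0 0 0 → Prop}

namespace IEq

section

variable {k n r m : ℕ} {Γ : Fin n → Typ S k} {Θ : Fin r → RelDecl S k} {Φ : List (Form S k n r)}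
  {σ τ : Typ S m} {a b : Fin m → Typ S k} {F : Fin m → Tm S k n} {u x y : Tm S k n}

theorem act_tensor (h : ActEnv Γ (.tensor σ τ) a b F) (hx : HasTyI Γ x (σ.subst a))
    (hy : HasTyI Γ y (τ.subst a)) :
    IEq Ax Γ Θ Φ (.tensor (σ.subst b) (τ.subst b)) (.app (act (.tensor σ τ) a b F) (.tensor x y))
      (.tensor (.app (act σ a b F) x) (.app (act τ a b F) y)) := by
  have h₁ : HasTyI Γ _ _ := .app (.act _ h) (.tensor hx hy)
  have h₂ := beta_of_typed (Ax := Ax) (Θ := Θ) (Φ := Φ) h₁ rfl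
  refine h₂.trans ?_
  have h₃ := h₂.right
  simp only [Tm.inst, Tm.subst, push_zero, Ty.subst_var, act_subst] at h₃ ⊢
  refine betaTensor_of_typed h₃ ?_
  simp [Tm.inst2, act_subst]

theorem act_bang (h : ActEnv Γ (.bang σ) a b F) (hx : HasTyI Γ x (σ.subst a)) :
    IEq Ax Γ Θ Φ (.bang (σ.subst b)) (.app (act (.bang σ) a b F) (.bang x))
      (.bang (.app (act σ a b F) x)) := by
  have h₁ : HasTyI Γ _ _ := .app (.act _ h) (.bang hx)
  have h₂ := beta_of_typed (Ax := Ax) (Θ := Θ) (Φ := Φ) h₁ rfl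
  refine h₂.trans ?_
  have h₃ := h₂.right
  simp only [Tm.inst, Tm.subst, push_zero, Ty.subst_var, act_subst] at h₃ ⊢
  refine betaBang_of_typed h₃ ?_
  simp [Tm.inst, act_subst]

theorem act_lolli (h : ActEnv Γ (.lolli σ τ) a b F) (hu : HasTyI Γ u ((Ty.lolli σ τ).subst a))
    (hx : HasTyI Γ x (σ.subst b)) :
    IEq Ax Γ Θ Φ (τ.subst b) (.app (.app (act (.lolli σ τ) a b F) u) x)
      (.app (act τ a b F) (.app u (.app (act σ b a F) x))) := by
  have h₁ : HasTyI Γ _ _ := .app (.act _ h) hu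
  have h₂ := (beta_of_typed (Ax := Ax) (Θ := Θ) (Φ := Φ) h₁ rfl).appL hx
  refine h₂.trans ?_
  have h₃ := h₂.right
  simp only [Tm.inst, Tm.subst, push_zero, Ty.subst_var, act_subst] at h₃ ⊢
  refine beta_of_typed h₃ ?_
  simp [Tm.inst, act_subst]

theorem act_all {σ : Typ S (m + 1)} (h : ActEnv Γ (.all σ) a b F)
    (hu : HasTyI Γ u ((Ty.all σ).subst a)) (A : Typ S k) :
    IEq Ax Γ Θ Φ (σ.subst (push A b)) (.tyApp (.app (act (.all σ) a b F) u) A)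
      (.app (act σ (push A a) (push A b) (push (Tm.idTm A) F)) (.tyApp u A)) := by
  have h₁ : HasTyI Γ _ _ := .app (.act _ h) hu
  have h₂ := (beta_of_typed (Ax := Ax) (Θ := Θ) (Φ := Φ) h₁ rfl).tyApp' (σ := A) (Ty.upS_inst σ A b)
  refine h₂.trans ?_
  have h₃ := h₂.right
  simp only [Tm.inst, Tm.subst, push_zero, Ty.subst_var, act_subst] at h₃ ⊢
  refine betaTy_of_typed h₃ ?_
  simp only [Tm.instTy, act_subst, Tm.subst, Ty.subst, push_zero, Tm.wkTy_subst_push, Tm.subst_var,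
    Ty.upS_var_id]
  congr 2
  · exact funext (Fin.cases rfl fun i => by simp [Ty.upS])
  · exact funext (Fin.cases rfl fun i => by simp [Ty.upS])
  · exact funext (Fin.cases (by simp) fun i => by
      simp only [push_succ, Tm.wkTy_push, Tm.wk_wkTy, Tm.wk_subst_push, Tm.wkTy_var, Tm.subst_var,
        Tm.wkTy_subst_push])

end

/-- The functorial action preserves identities. -/
theorem act_id (hId : IdentityExtension Ax) (hE : Extensionality Ax) {m : ℕ} (σ : Typ S m) :
    ∀ {k n r : ℕ} {Γ : Fin n → Typ S k} {Θ : Fin r → RelDecl S k} {Φ : List (Form S k n r)}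
      (a : Fin m → Typ S k), IEq Ax Γ Θ Φ (.lolli (σ.subst a) (σ.subst a))
        (act σ a a fun i => Tm.idTm (a i)) (Tm.idTm (σ.subst a)) := by
  have henv : ∀ {m : ℕ} {σ : Typ S m} {k n : ℕ} {Γ : Fin n → Typ S k} (a : Fin m → Typ S k),
      ActEnv Γ σ a a fun i => Tm.idTm (a i) :=
    fun a i => ⟨fun _ => .idTm _, fun _ => .idTm _, fun _ _ => rfl⟩
  have hact : ∀ {m : ℕ} (σ : Typ S m) {k n : ℕ} {Γ : Fin n → Typ S k} (a : Fin m → Typ S k),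
      HasTyI Γ (act σ a a fun i => Tm.idTm (a i)) (.lolli (σ.subst a) (σ.subst a)) :=
    fun σ _ _ _ a => .act σ (henv a)
  induction σ with
  | var i => exact fun a => refl (.idTm _)
  | con c args ih => exact fun a => refl (.idTm _)
  | one => exact fun a => refl (.idTm _)
  | tensor σ τ ih₁ ih₂ =>
    intro k n r Γ Θ Φ a
    refine ext_tensor hId hE (hact _ a) (.idTm _) ?_
    have hv : HasTyI (push (τ.subst a) (push (σ.subst a) Γ)) (.tensor (.var 1) (.var 0))
      (.tensor (σ.subst a) (τ.subst a)) := .tensor (.var 1) (.var 0)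
    rw [Tm.idTm_wk, Tm.idTm_wk, act_wk, act_wk]
    simp only [Tm.idTm_wk]
    refine .trans ?_ (betaId hv).symm
    refine (act_tensor (henv a) (.var 1) (.var 0)).trans ?_
    exact ((appL (ih₁ a) (.var 1)).trans (betaId (.var 1))).tensor
      ((appL (ih₂ a) (.var 0)).trans (betaId (.var 0)))
  | lolli σ τ ih₁ ih₂ =>
    intro k n r Γ Θ Φ a
    refine ext hE (hact _ a) (.idTm _) ?_
    rw [Tm.idTm_wk, act_wk]
    simp only [Tm.idTm_wk]
    have hu : HasTyI (push ((σ.lolli τ).subst a) Γ) (.var 0) ((σ.lolli τ).subst a) := .var 0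
    refine .trans ?_ (betaId hu).symm
    refine ext hE (.app (hact (σ.lolli τ) a) hu) hu ?_
    rw [Tm.app_wk, act_wk]
    simp only [Tm.idTm_wk]
    have hu' := hu.wk (σ.subst a)
    have hx : HasTyI (push (σ.subst a) (push ((σ.lolli τ).subst a) Γ)) (.var 0) (σ.subst a) :=
      .var 0
    refine (act_lolli (henv a) hu' hx).trans ?_
    have h₁ := appR (Ax := Ax) (Θ := Θ) (Φ := (Φ.map Form.wkTm).map Form.wkTm) hu' ((appL (ih₁ a) hx).trans (betaId hx))
    exact (app (ih₂ a) h₁).trans (betaId h₁.right)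
  | bang σ ih =>
    intro k n r Γ Θ Φ a
    refine ext_bang hId hE (hact _ a) (.idTm _) ?_
    have hv : HasTyI (push (σ.subst a) Γ) (.bang (.var 0)) (.bang (σ.subst a)) := .bang (.var 0)
    rw [Tm.idTm_wk, act_wk]
    simp only [Tm.idTm_wk]
    refine .trans ?_ (betaId hv).symm
    exact (act_bang (henv a) (.var 0)).trans ((appL (ih a) (.var 0)).trans (betaId (.var 0))).bang
  | all σ ih =>
    intro k n r Γ Θ Φ a
    refine ext hE (hact _ a) (.idTm _) ?_
    rw [Tm.idTm_wk]
    refine .trans ?_ (betaId (.var 0)).symm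
    refine extTy hE (.app ((hact _ a).wk _) (.var 0)) (.var 0) ?_
    -- The variable bound by Π is acted on by its identity, so the extended family again consists of
    -- identities and the induction hypothesis applies to the body.
    have e : (fun i => Tm.idTm (Ty.upS a i) : Fin _ → Tm S (k + 1) (n + 1)) =
        push (Tm.idTm (.var 0)) fun i => Tm.idTm (a i).wk := funext (Fin.cases rfl fun i => rfl)
    have hu : HasTyI (wkCtx (push (σ.all.subst a) Γ)) (.var 0) (σ.all.subst fun i => (a i).wk) :=
      .var' (Ty.ren_subst _ _ _)
    have h := (act_all (Ax := Ax) (Θ := wkRCtx Θ) (Φ := (Φ.map Form.wkTm).map Form.wkTy)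
      (henv fun i => (a i).wk) hu (.var 0)).trans
      (e ▸ appL (ih (Ty.upS a)) (HasTyI.tyApp' hu (Ty.upS_inst _ _ _)))
    rw [act_wk, Tm.app_wkTy, act_wkTy]
    simp only [Tm.idTm_wk, Tm.idTm_wkTy]
    exact h.trans (betaId (.tyApp' hu (Ty.upS_inst _ _ _)))

end IEq

end Functor

@[simp] theorem Ty.wk_var {T : TySig.{u}} {k : ℕ} (i : Fin k) :
    (Ty.var i : Ty T k).wk = .var i.succ := rfl

-- The map σ(f), and the interpretation of σ at a graph.

section Fmap

variable {S : Sig.{u, v}} {k n r : ℕ} {σ : Typ S 1}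

@[simp] theorem fmap_wk (σ : Typ S 1) (A B : Typ S k) (f : Tm S k n) :
    (fmap σ A B f).wk = fmap σ A B f.wk := by
  simp [fmap]

@[simp] theorem fmap_subst {k' n' : ℕ} (θ : Fin k → Typ S k') (s : Fin n → Tm S k' n') (σ : Typ S 1)
    (A B : Typ S k) (f : Tm S k n) :
    (fmap σ A B f).subst θ s = fmap σ (A.subst θ) (B.subst θ) (f.subst θ s) := by
  simp [fmap]

@[simp] theorem fmap_cnt (σ : Typ S 1) (A B : Typ S k) (f : Tm S k n) (i : Fin n) :
    (fmap σ A B f).cnt i = 2 * f.cnt i := by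
  simp [fmap]

/-- The type of `mapTm σ`. -/
def mapTy (σ : Typ S 1) : Typ S 0 :=
  .all (.all (.arrow (.lolli (.var 1) (.var 0)) (.lolli (σ.at1 (.var 1)) (σ.at1 (.var 0)))))

theorem ActEnv.of_pos (hpos : Ty.OnlyPositive 0 σ) {Γ : Fin n → Typ S k} {A B : Typ S k}
    {f : Tm S k n} (hf : HasTyI Γ f (.lolli A B)) :
    ActEnv Γ σ (fun _ => A) (fun _ => B) fun _ => f :=
  Fin.cases ⟨fun _ => hf, fun h => (hpos h).elim, fun _ h => (hpos h).elim⟩ nofun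

theorem HasTyI.mapTm (hpos : Ty.OnlyPositive 0 σ) {Γ : Fin 0 → Typ S 0} :
    HasTyI Γ (mapTm σ) (mapTy σ) :=
  .tyLam (.tyLam (IEq.ilam_typed (.act σ (.of_pos hpos (.var 0)))))

variable {Ax : Form S 0 0 0 → Prop} {Γ : Fin n → Typ S k}
  {Θ : Fin r → RelDecl S k} {Φ : List (Form S k n r)} {A B C : Typ S k} {f g t s x : Tm S k n}

theorem Tm.cl_eq_subst {k n : ℕ} (t : Tm S 0 0) :
    (t.cl : Tm S k n) = t.subst Fin.elim0 Fin.elim0 :=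
  (Tm.ren_eq_subst _ _ _).trans (Tm.subst_congr (fun i => i.elim0) (fun i => i.elim0) t)

@[simp] theorem Tm.ilam_subst {k' n' : ℕ} (θ : Fin k → Typ S k') (s : Fin n → Tm S k' n')
    (σ : Typ S k) (t : Tm S k (n + 1)) :
    (Tm.ilam σ t).subst θ s = .ilam (σ.subst θ) (t.subst θ (Tm.upS s)) := by
  simp only [Tm.ilam, Tm.subst, Tm.upS_zero, Ty.subst, Tm.subst_ren, Tm.ren_subst]
  congr 2
  refine Tm.subst_congr (fun i => (Ty.ren_id _).symm) (Fin.cases rfl fun i => ?_) t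
  simp

theorem HasTyI.mapTm_cl₁ (hpos : Ty.OnlyPositive 0 σ) (A : Typ S k) :
    HasTyI Γ (.tyApp (LAPL.mapTm σ).cl A) (.all (.arrow (.lolli A.wk (.var 0))
      (.lolli (σ.at1 A.wk) (σ.at1 (.var 0))))) := by
  have h : HasTyI Γ (LAPL.mapTm σ).cl (mapTy σ).cl := (HasTyI.mapTm hpos (Γ := Fin.elim0)).cl
  rw [← Ty.subst_zero _ Fin.elim0] at h
  exact .tyApp' h ((Ty.upS_inst _ _ _).trans (by simp [Ty.arrow, Ty.upS]))

theorem HasTyI.mapTm_cl (hpos : Ty.OnlyPositive 0 σ) (A B : Typ S k) :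
    HasTyI Γ (.tyApp (.tyApp (LAPL.mapTm σ).cl A) B)
      (.arrow (.lolli A B) (.lolli (σ.at1 A) (σ.at1 B))) :=
  .tyApp' (HasTyI.mapTm_cl₁ hpos A) (by simp [Ty.arrow, Ty.inst])

theorem HasTyI.fmap (hpos : Ty.OnlyPositive 0 σ) (hf : HasTyI Γ f (.lolli A B)) :
    HasTyI Γ (fmap σ A B f) (.lolli (σ.at1 A) (σ.at1 B)) :=
  .app (.mapTm_cl hpos A B) hf.bang

namespace IEq

/-- There are two descriptions of σ(f). As an instance of the closed term M_σ it is subject to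
parametricity; as `act` it can be computed by recursion on σ. The first is β-reduced to the second.
-/
theorem fmap_eq_act (hpos : Ty.OnlyPositive 0 σ) (hf : HasTyI Γ f (.lolli A B)) :
    IEq Ax Γ Θ Φ (.lolli (σ.at1 A) (σ.at1 B)) (fmap σ A B f)
      (act σ (fun _ => A) (fun _ => B) fun _ => f) := by
  have e : (mapTm σ).cl = (Tm.tyLam (.tyLam (.ilam (.lolli (.var 1) (.var 0))
      (act σ (fun _ => .var 1) (fun _ => .var 0) fun _ => .var 0))) : Tm S k n) := by
    rw [Tm.cl_eq_subst, mapTm, Tm.subst, Tm.subst, Tm.ilam_subst, act_subst]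
    simp [Ty.upS]
  have h := HasTyI.mapTm_cl₁ hpos A (Γ := Γ)
  have hm := HasTyI.mapTm_cl hpos A B (Γ := Γ)
  have hff := HasTyI.fmap hpos hf
  simp only [LAPL.fmap, e] at h hm hff ⊢
  have h₁ := betaTy_of_typed (Ax := Ax) (Θ := Θ) (Φ := Φ) h rfl
  have h₂ := h₁.tyApp' (σ := B) (τ' := .arrow (.lolli A B) (.lolli (σ.at1 A) (σ.at1 B)))
    (by simp [Ty.arrow, Ty.inst])
  have h₃ := h₂.right
  simp only [Tm.instTy, Tm.subst, Tm.ilam_subst, act_subst] at h₂ h₃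
  have h₄ := (h₂.trans (betaTy_of_typed h₃ rfl)).appL hf.bang
  refine h₄.trans ?_
  have h₅ := h₄.right
  simp only [Tm.instTy, Tm.subst, Tm.ilam_subst, act_subst] at h₅ ⊢
  refine betaI_of_typed h₅ ?_
  simp [Tm.inst, act_subst, Ty.upS]

theorem fmap (hpos : Ty.OnlyPositive 0 σ) (h : IEq Ax Γ Θ Φ (.lolli A B) f g) :
    IEq Ax Γ Θ Φ (.lolli (σ.at1 A) (σ.at1 B)) (fmap σ A B f) (fmap σ A B g) :=
  appR (.mapTm_cl hpos A B) h.bang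

theorem fmap_id (hId : IdentityExtension Ax) (hE : Extensionality Ax) (hpos : Ty.OnlyPositive 0 σ) :
    IEq Ax Γ Θ Φ (.lolli (σ.at1 A) (σ.at1 A)) (LAPL.fmap σ A A (Tm.idTm A)) (Tm.idTm (σ.at1 A)) :=
  (fmap_eq_act hpos (.idTm A)).trans (act_id hId hE σ fun _ => A)

theorem wk₂ (h : IEq Ax Γ Θ Φ A t s) (B C : Typ S k) (Ψ : Form S k (n + 2) r) :
    IEq Ax (push C (push B Γ)) Θ (Ψ :: (Φ.map Form.wkTm).map Form.wkTm) A t.wk.wk s.wk.wk :=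
  ((h.wk B).wk C).weaken fun _ h => List.mem_cons_of_mem _ h

end IEq

namespace Related

variable {m : ℕ} {a b : Fin m → Typ S k} {F : Fin m → Tm S k n}

/-- Instances of parametricity produce σ(αᵢ) in a context with several type variables. As only αᵢ
occurs, this is σ at the single graph of F i, by insensitivity of the interpretation to the other
variables; the renaming that sends the only variable of σ to i is trivially injective. -/
theorem at1_var (hF : MapEnv Γ a b F) (i : Fin m) :
    Related Ax Γ Θ Φ (σ.at1 (.var i)) a b F t s ↔
      Related Ax Γ Θ Φ σ (fun _ => a i) (fun _ => b i) (fun _ => F i) t s := by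
  have e : σ.at1 (.var i) = σ.ren fun _ => i := (Ty.ren_eq_subst _ _).symm
  rw [e]
  exact ren hF (e := fun _ : Fin 1 => i) fun _ _ _ => Subsingleton.elim _ _

theorem congr (hF : MapEnv Γ a b F) {τ : Typ S m} {t' s' : Tm S k n}
    (h : Related Ax Γ Θ Φ τ a b F t s) (ht : IEq Ax Γ Θ Φ (τ.subst a) t t')
    (hs : IEq Ax Γ Θ Φ (τ.subst b) s s') : Related Ax Γ Θ Φ τ a b F t' s' :=
  ⟨ht.right, hs.right, .substitution (hF.relWF τ) h.prov ht.prov hs.prov⟩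

/-- Parametricity of a closed term. -/
theorem closed (hId : IdentityExtension Ax) {ω : Typ S 0} (h : IEq Ax Γ Θ Φ ω.cl t s) :
    Related Ax Γ Θ Φ ω Fin.elim0 Fin.elim0 (fun i => Tm.idTm (Fin.elim0 i)) t s := by
  refine of_eq hId ?_
  rwa [Ty.subst_zero]

/-- Parametricity of M_σ : Πα. Πβ. (α ⊸ β) → σ(α) ⊸ σ(β) at the graphs of g₁ and g₂. The commuting
square says that φ and ψ are related by ⟨g₁⟩ ⊸ ⟨g₂⟩, so their actions take pairs in σ[⟨g₁⟩] to pairs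
in σ[⟨g₂⟩]. -/
theorem fmap (hId : IdentityExtension Ax) (hpos : Ty.OnlyPositive 0 σ) {A₁ A₂ B₁ B₂ : Typ S k}
    {g₁ g₂ φ ψ x y : Tm S k n} (hg₁ : HasTyI Γ g₁ (.lolli A₁ B₁)) (hg₂ : HasTyI Γ g₂ (.lolli A₂ B₂))
    (hφ : HasTyI Γ φ (.lolli A₁ A₂)) (hψ : HasTyI Γ ψ (.lolli B₁ B₂))
    (h : IEq Ax Γ Θ Φ (.lolli A₁ B₂) (.comp A₁ g₂ φ) (.comp A₁ ψ g₁))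
    (hxy : Related Ax Γ Θ Φ σ (fun _ => A₁) (fun _ => B₁) (fun _ => g₁) x y) :
    Related Ax Γ Θ Φ σ (fun _ => A₂) (fun _ => B₂) (fun _ => g₂) (.app (fmap σ A₁ A₂ φ) x)
      (.app (fmap σ B₁ B₂ ψ) y) := by
  have m₀ : MapEnv Γ (Fin.elim0 : Fin 0 → Typ S k) Fin.elim0 fun i => Tm.idTm (Fin.elim0 i) := nofun
  have m₁ := m₀.push hg₁
  have m₂ := m₁.push hg₂
  have h₀ := closed (Ax := Ax) (Γ := Γ) (Θ := Θ) (Φ := Φ) hId (IEq.refl (HasTyI.mapTm hpos).cl)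
  -- After both instantiations α is variable 1, interpreted by the graph of g₁, and β is variable 0,
  -- interpreted by the graph of g₂.
  have h₁ := (h₀.all_elim m₀ hg₁).all_elim m₁ hg₂
  have h₂ := lolli_intro (Ax := Ax) (Θ := Θ) (Φ := Φ) m₂ (σ := .var 1) (τ := .var 0) hφ hψ ?_
  · have h₃ := (h₁.lolli_elim m₂ (h₂.bang m₂)).lolli_elim m₂ ((at1_var m₂ 1).2 hxy)
    exact (at1_var m₂ 0).1 h₃
  · intro Ψ hr
    have m₄ := (m₂.wk A₁).wk B₁
    have h₃ := hr.var_eq m₄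
    refine var m₄ ?_ (.app ((hφ.wk A₁).wk B₁) (.var 1))
    have h₄ := h.wk₂ A₁ B₁ Ψ
    rw [Tm.comp_wk, Tm.comp_wk, Tm.comp_wk, Tm.comp_wk] at h₄
    exact (IEq.of_comp ((hg₂.wk _).wk _) ((hφ.wk _).wk _) ((hψ.wk _).wk _) ((hg₁.wk _).wk _) h₄
      (.var 1)).trans (IEq.appR ((hψ.wk _).wk _) h₃)

/-- The relational interpretation of `σ` at the graph of `f` is the graph of `σ(f)`. -/
theorem graph_iff (hId : IdentityExtension Ax) (hE : Extensionality Ax)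
    (hpos : Ty.OnlyPositive 0 σ) (hf : HasTyI Γ f (.lolli A B)) :
    Related Ax Γ Θ Φ σ (fun _ => A) (fun _ => B) (fun _ => f) t s ↔
      HasTyI Γ t (σ.at1 A) ∧ IEq Ax Γ Θ Φ (σ.at1 B) (.app (LAPL.fmap σ A B f) t) s := by
  constructor
  · intro h
    refine ⟨h.left, ?_⟩
    -- The square with verticals f and id_B and horizontals f and id_B: it sends the related pair
    -- (t, s) to a pair in σ[eq], so σ(f) t = σ(id) s = s.
    have h₁ := h.fmap hId hpos hf (.idTm B) hf (.idTm B) (.refl (.comp (.idTm B) hf))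
    exact (h₁.eq (a := fun _ => B) hId).trans ((IEq.appL (IEq.fmap_id hId hE hpos) h.right).trans
      (IEq.betaId h.right))
  · rintro ⟨ht, h⟩
    -- The square with verticals id_A and f and horizontals id_A and f: from t related to itself by
    -- σ[eq] it produces σ(id) t related to σ(f) t.
    have h₁ := (of_eq (a := fun _ => A) hId (IEq.refl ht)).fmap (Φ := Φ) (Θ := Θ) hId hpos (.idTm A)
      hf (.idTm A) hf (.refl (.comp hf (.idTm A)))
    exact h₁.congr (fun _ => hf) ((IEq.appL (IEq.fmap_id hId hE hpos) ht).trans (IEq.betaId ht)) h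

end Related

/-- No induction on σ is needed. The pair (x, σ(f) x) lies in σ[⟨f⟩], and the square with verticals
f and id_C and horizontals g ∘ f and g takes it to the equation σ(g ∘ f) x = σ(g)(σ(f) x). -/
theorem IEq.fmap_comp (hId : IdentityExtension Ax) (hE : Extensionality Ax)
    (hpos : Ty.OnlyPositive 0 σ) (hg : HasTyI Γ g (.lolli B C)) (hf : HasTyI Γ f (.lolli A B)) :
    IEq Ax Γ Θ Φ (.lolli (σ.at1 A) (σ.at1 C)) (.comp (σ.at1 A) (LAPL.fmap σ B C g) (LAPL.fmap σ A B f))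
      (LAPL.fmap σ A C (.comp A g f)) := by
  refine ext hE (.comp (.fmap hpos hg) (.fmap hpos hf)) (.fmap hpos (.comp hg hf)) ?_
  rw [Tm.comp_wk, fmap_wk, fmap_wk, fmap_wk, Tm.comp_wk]
  have hf' := hf.wk (σ.at1 A)
  have hg' := hg.wk (σ.at1 A)
  have hv : HasTyI (push (σ.at1 A) Γ) (.var 0) (σ.at1 A) := .var 0
  refine (comp_app (.fmap hpos hg') (.fmap hpos hf') hv).trans (symm ?_)
  have h₁ := (Related.graph_iff (Ax := Ax) (Θ := Θ) (Φ := Φ.map Form.wkTm) hId hE hpos hf').2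
    ⟨hv, .refl (.app (.fmap hpos hf') hv)⟩
  have h₂ := h₁.fmap hId hpos hf' (.idTm C) (.comp hg' hf') hg' (id_comp hE (.comp hg' hf'))
  exact h₂.eq (a := fun _ => C) hId

end Fmap

theorem Ty.wk_eq_cl {T : TySig.{u}} (σ : Ty T 0) : σ.wk = σ.cl :=
  congrArg (σ.ren ·) (Subsingleton.elim _ _)

@[simp] theorem Ty.at1_cl {T : TySig.{u}} {k : ℕ} (σ : Ty T 1) (τ : Ty T 0) :
    ((σ.at1 τ).cl : Ty T k) = σ.at1 τ.cl := at1_ren _ _ _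

@[simp] theorem Tm.ilam_cnt {S : Sig.{u, v}} {k n : ℕ} (σ : Typ S k) (t : Tm S k (n + 1))
    (i : Fin n) : (Tm.ilam σ t).cnt i = t.cnt i.succ := by
  simp [Tm.ilam, Tm.cnt, Tm.cnt_ren_up_succ]

-- Initial algebras: the type μα.σ.

section Mu

variable {S : Sig.{u, v}} {k n r : ℕ} {σ : Typ S 1} {Ax : Form S 0 0 0 → Prop} {Γ : Fin n → Typ S k}
  {Θ : Fin r → RelDecl S k} {Φ : List (Form S k n r)} {A B C : Typ S k} {f g h t s x z : Tm S k n}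

/-- `fold A !f`. -/
def foldAt (σ : Typ S 1) (A : Typ S k) (f : Tm S k n) : Tm S k n :=
  .app (.tyApp (foldTm σ).cl A) (.bang f)

@[simp] theorem foldAt_wk (A : Typ S k) (f : Tm S k n) : (foldAt σ A f).wk = foldAt σ A f.wk := by
  simp [foldAt]

@[simp] theorem foldAt_subst {k' n' : ℕ} (θ : Fin k → Typ S k') (q : Fin n → Tm S k' n')
    (A : Typ S k) (f : Tm S k n) :
    (foldAt σ A f).subst θ q = foldAt σ (A.subst θ) (f.subst θ q) := by
  simp [foldAt]

theorem mu_cl (σ : Typ S 1) : ((mu σ).cl : Typ S k) =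
    .all (.arrow (.lolli (σ.at1 (.var 0)) (.var 0)) (.var 0)) := by
  simp [mu, Ty.cl, Ty.arrow]

theorem HasTyI.muApp (hx : HasTyI Γ x (mu σ).cl) (A : Typ S k) :
    HasTyI Γ (.tyApp x A) (.arrow (.lolli (σ.at1 A) A) A) := by
  rw [mu_cl] at hx
  exact .tyApp' hx (by simp [Ty.inst, Ty.arrow])

theorem HasTyI.foldTm {Γ : Fin 0 → Typ S 0} : HasTyI Γ (foldTm σ) (.all (.arrow
    (.lolli (σ.at1 (.var 0)) (.var 0)) (.lolli (mu σ).cl (.var 0)))) :=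
  .tyLam (IEq.ilam_typed (.lam (.app (.muApp (.var 0) _) (.bang (.var 1))) (by simp)))

theorem HasTyI.foldTm_cl (A : Typ S k) : HasTyI Γ (.tyApp (LAPL.foldTm σ).cl A) (.arrow
    (.lolli (σ.at1 A) A) (.lolli (mu σ).cl A)) := by
  have h := (HasTyI.foldTm (σ := σ) (Γ := Fin.elim0)).cl (Γ := Γ)
  refine .tyApp' h ?_
  simp [Ty.arrow, Ty.inst, Ty.ren, Ty.subst, up]

theorem HasTyI.foldAt (hf : HasTyI Γ f (.lolli (σ.at1 A) A)) :
    HasTyI Γ (LAPL.foldAt σ A f) (.lolli (mu σ).cl A) := .app (.foldTm_cl A) hf.bang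

theorem HasTyI.inTm (hpos : Ty.OnlyPositive 0 σ) {Γ : Fin 0 → Typ S 0} :
    HasTyI Γ (LAPL.inTm σ) (.lolli (σ.at1 (mu σ)) (mu σ)) :=
  .lam (.tyLam (IEq.ilam_typed (.app (.var 0) (.app (.fmap hpos (.foldAt (.var 0)))
    (.var' (by simp [wkCtx, Ty.wk_eq_cl])))))) (by simp)

theorem HasTyI.inTm_cl (hpos : Ty.OnlyPositive 0 σ) :
    HasTyI Γ (LAPL.inTm σ).cl (.lolli (σ.at1 (mu σ).cl) (mu σ).cl) := by
  have h := (HasTyI.inTm (σ := σ) hpos (Γ := Fin.elim0)).cl (Γ := Γ)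
  rwa [Ty.cl, Ty.ren, ← Ty.cl, Ty.at1_cl] at h

namespace IEq

theorem muApp (h : IEq Ax Γ Θ Φ (mu σ).cl t s) (A : Typ S k) :
    IEq Ax Γ Θ Φ (.arrow (.lolli (σ.at1 A) A) A) (.tyApp t A) (.tyApp s A) := by
  rw [mu_cl] at h
  exact h.tyApp' (by simp [Ty.inst, Ty.arrow])

theorem foldAt_app (hf : HasTyI Γ f (.lolli (σ.at1 A) A)) (hx : HasTyI Γ x (mu σ).cl) :
    IEq Ax Γ Θ Φ A (.app (foldAt σ A f) x) (.app (.tyApp x A) (.bang f)) := by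
  have h := HasTyI.foldTm_cl (Γ := Γ) (σ := σ) A
  have e : ((foldTm σ).cl : Tm S k n) = .tyLam (.ilam (.lolli (σ.at1 (.var 0)) (.var 0))
    (.lam (mu σ).cl (.app (.tyApp (.var 0) (.var 0)) (.bang (.var 1))))) := by
    rw [Tm.cl_eq_subst, foldTm]
    simp [Ty.upS]
  rw [foldAt]
  rw [e] at h ⊢
  have h₁ := betaTy_of_typed (Ax := Ax) (Θ := Θ) (Φ := Φ) h rfl
  simp only [Tm.instTy, Tm.ilam_subst] at h₁
  have h₂ := h₁.appL hf.bang
  have h₃ := (h₂.trans (betaI_of_typed h₂.right rfl)).appL hx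
  refine h₃.trans ?_
  have h₄ := h₃.right
  simp only [Tm.inst, Tm.subst] at h₄ ⊢
  refine beta_of_typed h₄ ?_
  simp [Tm.inst]

theorem in_app (hpos : Ty.OnlyPositive 0 σ) (hf : HasTyI Γ f (.lolli (σ.at1 A) A))
    (hz : HasTyI Γ z (σ.at1 (mu σ).cl)) :
    IEq Ax Γ Θ Φ A (.app (.tyApp (.app (inTm σ).cl z) A) (.bang f))
      (.app f (.app (LAPL.fmap σ (mu σ).cl A (foldAt σ A f)) z)) := by
  have h := HasTyI.app (HasTyI.inTm_cl hpos) hz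
  have e : ((inTm σ).cl : Tm S k n) = .lam (σ.at1 (mu σ).cl) (.tyLam (.ilam
    (.lolli (σ.at1 (.var 0)) (.var 0)) (.app (.var 0)
      (.app (LAPL.fmap σ (mu σ).cl (.var 0) (foldAt σ (.var 0) (.var 0))) (.var 1))))) := by
    rw [Tm.cl_eq_subst, inTm]
    simp [foldAt, Ty.upS, Ty.subst_zero]
  rw [e] at h ⊢
  have h₁ := beta_of_typed (Ax := Ax) (Θ := Θ) (Φ := Φ) h rfl
  simp only [Tm.inst, Tm.subst, Tm.ilam_subst] at h₁
  have h₂ := h₁.muApp A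
  have h₃ := (h₂.trans (betaTy_of_typed h₂.right rfl)).appL hf.bang
  simp only [Tm.instTy, Tm.subst, Tm.ilam_subst] at h₃
  refine h₃.trans (betaI_of_typed h₃.right ?_)
  simp [Tm.inst, ← Tm.wk_wkTy]

/-- Parametricity at the type `μα.σ`. -/
theorem mu_natural (hId : IdentityExtension Ax) (hE : Extensionality Ax)
    (hpos : Ty.OnlyPositive 0 σ) (hf : HasTyI Γ f (.lolli (σ.at1 A) A))
    (hg : HasTyI Γ g (.lolli (σ.at1 B) B)) (hh : HasTyI Γ h (.lolli A B))
    (hc : AlgMap Ax σ Γ Θ Φ A B f g h) (hx : HasTyI Γ x (mu σ).cl) :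
    IEq Ax Γ Θ Φ B (.app h (.app (.tyApp x A) (.bang f))) (.app (.tyApp x B) (.bang g)) := by
  have m₁ := MapEnv.push (a := Fin.elim0) (b := Fin.elim0) (f := fun i => Tm.idTm (Fin.elim0 i))
    (fun i => i.elim0) hh
  have h₁ := (Related.closed (Ax := Ax) (Θ := Θ) (Φ := Φ) hId (refl hx)).all_elim (fun i => i.elim0) hh
  -- The algebras f and g are related by σ[⟨h⟩] ⊸ ⟨h⟩. By the graph lemma the assumption on
  -- arguments x, y is σ(h) x = y, and then h (f x) = g (σ(h) x) = g y because h is an algebra map.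
  have h₂ : Related Ax Γ Θ Φ (.lolli (σ.at1 (.var 0)) (.var 0)) _ _ _ f g :=
    .lolli_intro m₁ (by simpa using hf) (by simpa using hg) ?_
  · exact (h₁.lolli_elim m₁ (h₂.bang m₁)).var_eq m₁
  · intro Ψ hr
    simp only [Ty.at1_subst] at hr ⊢
    have m₂ := (m₁.wk (σ.at1 A)).wk (σ.at1 B)
    have h₃ := ((Related.graph_iff hId hE hpos ((hh.wk (σ.at1 A)).wk (σ.at1 B))).1
      ((Related.at1_var m₂ 0).1 hr)).2
    have hc' := IEq.wk₂ ⟨.comp hh hf, .comp hg (.fmap hpos hh), hc⟩ (σ.at1 A) (σ.at1 B) Ψ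
    simp only [Tm.comp_wk, fmap_wk] at hc'
    refine .var m₂ ?_ (.app ((hf.wk _).wk _) (.var 1))
    exact (of_comp ((hh.wk _).wk _) ((hf.wk _).wk _) ((hg.wk _).wk _)
      (.fmap hpos ((hh.wk _).wk _)) hc' (.var 1)).trans (appR ((hg.wk _).wk _) h₃)

end IEq

namespace AlgMap

theorem toIEq (hpos : Ty.OnlyPositive 0 σ) (hf : HasTyI Γ f (.lolli (σ.at1 A) A))
    (hg : HasTyI Γ g (.lolli (σ.at1 B) B)) (hh : HasTyI Γ h (.lolli A B))
    (hc : AlgMap Ax σ Γ Θ Φ A B f g h) : IEq Ax Γ Θ Φ (.lolli (σ.at1 A) B) (.comp (σ.at1 A) h f)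
      (.comp (σ.at1 A) g (fmap σ A B h)) :=
  ⟨.comp hh hf, .comp hg (.fmap hpos hh), hc⟩

theorem comp (hId : IdentityExtension Ax) (hE : Extensionality Ax)
    (hpos : Ty.OnlyPositive 0 σ) {c h' : Tm S k n} (hf : HasTyI Γ f (.lolli (σ.at1 A) A))
    (hg : HasTyI Γ g (.lolli (σ.at1 B) B)) (hc : HasTyI Γ c (.lolli (σ.at1 C) C))
    (hh : HasTyI Γ h (.lolli A B)) (hh' : HasTyI Γ h' (.lolli B C))
    (m : AlgMap Ax σ Γ Θ Φ A B f g h) (m' : AlgMap Ax σ Γ Θ Φ B C g c h') :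
    AlgMap Ax σ Γ Θ Φ A C f c (.comp A h' h) := by
  have e := m.toIEq hpos hf hg hh
  have e' := m'.toIEq hpos hg hc hh'
  refine IEq.prov (σ := .lolli (σ.at1 A) C) ?_
  have hF := HasTyI.fmap hpos hh
  have hF' := HasTyI.fmap hpos hh'
  exact (((IEq.comp_assoc hE hh' hh hf).trans (e.compR hE hh')).trans
    ((IEq.comp_assoc hE hh' hg hF).symm.trans (e'.compL hE hF))).trans
    ((IEq.comp_assoc hE hc hF' hF).trans (.compR hE hc (.fmap_comp hId hE hpos hh' hh)))

theorem id (hId : IdentityExtension Ax) (hE : Extensionality Ax) (hpos : Ty.OnlyPositive 0 σ)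
    (hf : HasTyI Γ f (.lolli (σ.at1 A) A)) : AlgMap Ax σ Γ Θ Φ A A f f (Tm.idTm A) :=
  ((IEq.id_comp hE hf).trans
    ((IEq.compR hE hf (.fmap_id hId hE hpos)).trans (.comp_id hE hf)).symm).prov

theorem wk (hpos : Ty.OnlyPositive 0 σ) (hf : HasTyI Γ f (.lolli (σ.at1 A) A))
    (hg : HasTyI Γ g (.lolli (σ.at1 B) B)) (hh : HasTyI Γ h (.lolli A B))
    (hc : AlgMap Ax σ Γ Θ Φ A B f g h) (C : Typ S k) :
    AlgMap Ax σ (push C Γ) Θ (Φ.map Form.wkTm) A B f.wk g.wk h.wk := by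
  simpa only [AlgMap, Tm.comp_wk, fmap_wk] using ((hc.toIEq hpos hf hg hh).wk C).prov

end AlgMap

theorem foldAt_algMap (hE : Extensionality Ax) (hpos : Ty.OnlyPositive 0 σ)
    (hf : HasTyI Γ f (.lolli (σ.at1 A) A)) :
    AlgMap Ax σ Γ Θ Φ (mu σ).cl A (inTm σ).cl f (foldAt σ A f) := by
  refine (IEq.ext_comp hE (.foldAt hf) (.inTm_cl hpos) hf (.fmap hpos (.foldAt hf)) ?_).prov
  have hf' := hf.wk (σ.at1 (mu σ).cl)
  have hi := HasTyI.app (HasTyI.inTm_cl hpos) (HasTyI.var (Γ := push (σ.at1 (mu σ).cl) Γ) 0)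
  simp only [foldAt_wk, fmap_wk, Tm.wk_cl]
  exact (IEq.foldAt_app hf' hi).trans (IEq.in_app hpos hf' (.var 0))

namespace IEq

/-- Folding with `in` is the identity. By extensionality it suffices to compare at a type α and an
algebra f. There fold f is an algebra map from `in` to f, so naturality of x gives fold f (x μ !in)
= x α !f, while the left side is also (x μ !in) α !f by the β rules. -/
theorem tyApp_mu_in (hId : IdentityExtension Ax) (hE : Extensionality Ax)
    (hpos : Ty.OnlyPositive 0 σ) (hx : HasTyI Γ x (mu σ).cl) :
    IEq Ax Γ Θ Φ (mu σ).cl (.app (.tyApp x (mu σ).cl) (.bang (inTm σ).cl)) x := by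
  have hy := (hx.muApp (mu σ).cl).app (HasTyI.inTm_cl hpos).bang
  have hx' := hx
  have hy' := hy
  rw [mu_cl] at hx'
  rw [show HasTyI Γ _ (mu σ).cl = HasTyI Γ _ _ from congrArg _ (mu_cl σ)] at hy'
  -- Only the type at which equality is taken is unfolded, so that extensionality for Π applies; the
  -- occurrences of μα.σ inside the terms stay folded.
  conv => arg 5; rw [mu_cl]
  refine extTy hE hy' hx' ?_
  have hxw := hx.wkTy
  have hyw := hy.wkTy
  rw [Ty.wk_cl] at hxw hyw
  refine ext_bang hId hE (hyw.muApp (.var 0)) (hxw.muApp (.var 0)) ?_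
  have hxv := hxw.wk (.lolli (σ.at1 (.var 0)) (.var 0))
  have hyv := hyw.wk (.lolli (σ.at1 (.var 0)) (.var 0))
  have hv : HasTyI (push (.lolli (σ.at1 (.var 0)) (.var 0)) (wkCtx Γ)) (.var 0)
    (.lolli (σ.at1 (.var 0)) (.var 0)) := .var 0
  have h₁ := mu_natural (Ax := Ax) (Θ := wkRCtx Θ) (Φ := (Φ.map Form.wkTy).map Form.wkTm) hId hE
    hpos (.inTm_cl hpos) hv (.foldAt hv) (foldAt_algMap hE hpos hv) hxv
  have h₂ := foldAt_app (Ax := Ax) (Θ := wkRCtx Θ) (Φ := (Φ.map Form.wkTy).map Form.wkTm) hv hyv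
  simp only [Tm.app_wk, Tm.bang_wk, Tm.tyApp_wk, Tm.wk_cl, Ty.wk_cl, Tm.app_wkTy, Tm.bang_wkTy,
    Tm.tyApp_wkTy, Tm.wkTy_cl] at h₂ ⊢
  exact h₂.symm.trans h₁

/-- For an algebra map h from `in` to f: h x = h (x μ !in) = x A !f = fold f x, by `tyApp_mu_in`,
naturality of x and β. -/
theorem foldAt_unique (hId : IdentityExtension Ax) (hE : Extensionality Ax)
    (hpos : Ty.OnlyPositive 0 σ) (hf : HasTyI Γ f (.lolli (σ.at1 A) A))
    (hh : HasTyI Γ h (.lolli (mu σ).cl A)) (hc : AlgMap Ax σ Γ Θ Φ (mu σ).cl A (inTm σ).cl f h) :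
    IEq Ax Γ Θ Φ (.lolli (mu σ).cl A) h (foldAt σ A f) := by
  refine ext hE hh (.foldAt hf) ?_
  have hf' := hf.wk (mu σ).cl
  have hh' := hh.wk (mu σ).cl
  have hv : HasTyI (push (mu σ).cl Γ) (.var 0) (mu σ).cl := .var 0
  have hc' := hc.wk hpos (.inTm_cl hpos) hf hh (mu σ).cl
  rw [Tm.wk_cl] at hc'
  rw [foldAt_wk]
  exact ((appR hh' (tyApp_mu_in hId hE hpos hv)).symm.trans
    (mu_natural hId hE hpos (.inTm_cl hpos) hf' hh' hc' hv)).trans (foldAt_app hf' hv).symm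

end IEq

/-- The inverse of `in`. -/
def inInv (σ : Typ S 1) : Tm S k n :=
  foldAt σ (σ.at1 (mu σ).cl) (fmap σ (σ.at1 (mu σ).cl) (mu σ).cl (inTm σ).cl)

@[simp] theorem inInv_cl (σ : Typ S 1) : ((inInv σ : Tm S 0 0).cl : Tm S k n) = inInv σ := by
  rw [Tm.cl_eq_subst]
  simp [inInv, Ty.subst_zero, ← Tm.cl_eq_subst]

theorem HasTyI.inInv (hpos : Ty.OnlyPositive 0 σ) :
    HasTyI Γ (LAPL.inInv σ) (.lolli (mu σ).cl (σ.at1 (mu σ).cl)) :=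
  .foldAt (.fmap hpos (.inTm_cl hpos))

namespace IEq

/-- Lambek's argument. The map `in` is itself an algebra map from σ(in) to `in`, so in ∘ in⁻¹ is an
algebra endomorphism of the initial algebra and equals the identity. -/
theorem in_inInv (hId : IdentityExtension Ax) (hE : Extensionality Ax)
    (hpos : Ty.OnlyPositive 0 σ) : IEq Ax Γ Θ Φ (.lolli (mu σ).cl (mu σ).cl)
      (.comp (mu σ).cl (inTm σ).cl (LAPL.inInv σ)) (Tm.idTm (mu σ).cl) := by
  have hi : HasTyI Γ (inTm σ).cl _ := .inTm_cl hpos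
  have hF := HasTyI.fmap hpos hi
  have h := (foldAt_algMap (Ax := Ax) (Θ := Θ) (Φ := Φ) hE hpos hF).comp hId hE hpos hi hF hi
    (.foldAt hF) hi (refl (.comp hi hF)).prov
  exact (foldAt_unique hId hE hpos hi (.comp hi (.inInv hpos)) h).trans
    (foldAt_unique hId hE hpos hi (.idTm _) (.id hId hE hpos hi)).symm

/-- As the fold of σ(in), in⁻¹ satisfies in⁻¹ ∘ in = σ(in) ∘ σ(in⁻¹) = σ(in ∘ in⁻¹), which is σ(id)
= id. -/
theorem inInv_in (hId : IdentityExtension Ax) (hE : Extensionality Ax)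
    (hpos : Ty.OnlyPositive 0 σ) : IEq Ax Γ Θ Φ (.lolli (σ.at1 (mu σ).cl) (σ.at1 (mu σ).cl))
      (.comp (σ.at1 (mu σ).cl) (LAPL.inInv σ) (inTm σ).cl) (Tm.idTm (σ.at1 (mu σ).cl)) := by
  have hi : HasTyI Γ (inTm σ).cl _ := .inTm_cl hpos
  have hF := HasTyI.fmap hpos hi
  have h := (foldAt_algMap (Ax := Ax) (Θ := Θ) (Φ := Φ) hE hpos hF).toIEq hpos hi hF (.foldAt hF)
  exact (h.trans (fmap_comp hId hE hpos hi (.foldAt hF))).trans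
    ((fmap hpos (in_inInv hId hE hpos)).trans (fmap_id hId hE hpos))

end IEq

theorem inTm_inverse (hId : IdentityExtension Ax) (hE : Extensionality Ax)
    (hpos : Ty.OnlyPositive 0 σ) :
    Inverse Ax (σ.at1 (mu σ)) (mu σ) (inTm σ) (inInv σ) := by
  refine ⟨.inTm hpos, ?_, ?_, ?_⟩
  · simpa [Closed, ClosedEq] using HasTyI.inInv (k := 0) (Γ := Fin.elim0) hpos
  · simpa [Closed, ClosedEq] using (IEq.inInv_in (k := 0) (Γ := Fin.elim0) (Θ := Fin.elim0) (Φ := []) hId hE hpos).prov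
  · simpa [Closed, ClosedEq] using (IEq.in_inInv (k := 0) (Γ := Fin.elim0) (Θ := Fin.elim0) (Φ := []) hId hE hpos).prov

end Mu

@[simp] theorem Ty.upS_zero {T : TySig.{u}} {k m : ℕ} (θ : Fin k → Ty T m) :
    Ty.upS θ 0 = .var 0 := rfl

-- Existential types and maps out of them.

section Pack

variable {S : Sig.{u, v}} {k n r : ℕ} {σ ρ : Typ S 1} {Ax : Form S 0 0 0 → Prop} {Γ : Fin n → Typ S k}
  {Θ : Fin r → RelDecl S k} {Φ : List (Form S k n r)} {A B C : Typ S k} {f g h t s x y z : Tm S k n}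

/-- The type `Πα. ρ(α) ⊸ B` of the maps out of `∐α.ρ`. -/
def elimTy (ρ : Typ S 1) (B : Typ S k) : Typ S k := .all (.lolli (ρ.at1 (.var 0)) B.wk)

theorem exTy_cl (ρ : Typ S 1) :
    ((exTy ρ).cl : Typ S k) = .all (.lolli (elimTy ρ (.var 0)) (.var 0)) := by
  simp [exTy, Ty.cl, elimTy]

@[simp] theorem elimTy_wk (ρ : Typ S 1) (B : Typ S k) : (elimTy ρ B).wk = elimTy ρ B.wk := by
  change Ty.all (.lolli ((ρ.at1 (.var 0)).ren (up Fin.succ)) (B.wk.ren (up Fin.succ))) = _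
  rw [Ty.wk_ren_up, Ty.at1_ren]
  rfl

@[simp] theorem elimTy_subst {k' : ℕ} (ρ : Typ S 1) (B : Typ S k) (θ : Fin k → Typ S k') :
    (elimTy ρ B).subst θ = elimTy ρ (B.subst θ) := by
  simp [elimTy]

theorem HasTyI.elimApp (hg : HasTyI Γ g (elimTy ρ B)) (A : Typ S k) :
    HasTyI Γ (.tyApp g A) (.lolli (ρ.at1 A) B) :=
  .tyApp' hg (by simp [Ty.inst])

theorem HasTyI.exApp (hx : HasTyI Γ x (exTy ρ).cl) (B : Typ S k) :
    HasTyI Γ (.tyApp x B) (.lolli (elimTy ρ B) B) := by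
  rw [exTy_cl] at hx
  exact .tyApp' hx (by simp [Ty.inst])

theorem HasTyI.packTm {Γ : Fin 0 → Typ S 0} :
    HasTyI Γ (packTm ρ) (elimTy ρ (exTy ρ)) :=
  .tyLam (by
    rw [Ty.wk_eq_cl, exTy_cl]
    exact .lam (.tyLam (.lam (.app (.elimApp (B := .var 0) (.var 0) (.var 1))
      (.var' (by simp [wkCtx]))) (by simp))) (by simp))

theorem HasTyI.packTm_cl : HasTyI Γ (LAPL.packTm ρ).cl (elimTy ρ (exTy ρ).cl) := by
  have h := (HasTyI.packTm (ρ := ρ) (Γ := Fin.elim0)).cl (Γ := Γ)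
  rwa [← Ty.subst_zero _ Fin.elim0, elimTy_subst, Ty.subst_zero] at h

namespace IEq

theorem exApp (h : IEq Ax Γ Θ Φ (exTy ρ).cl t s) (B : Typ S k) :
    IEq Ax Γ Θ Φ (.lolli (elimTy ρ B) B) (.tyApp t B) (.tyApp s B) := by
  rw [exTy_cl] at h
  exact h.tyApp' (by simp [Ty.inst])

theorem pack_app (hx : HasTyI Γ x (ρ.at1 A)) (hg : HasTyI Γ g (elimTy ρ B)) :
    IEq Ax Γ Θ Φ B (.app (.tyApp (.app (.tyApp (packTm ρ).cl A) x) B) g) (.app (.tyApp g A) x) := by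
  have h := HasTyI.packTm_cl (Γ := Γ) (ρ := ρ)
  have e : ((packTm ρ).cl : Tm S k n) = .tyLam (.lam (ρ.at1 (.var 0)) (.tyLam
    (.lam (elimTy ρ (.var 0)) (.app (.tyApp (.var 0) (.var 1)) (.var 1))))) := by
    rw [Tm.cl_eq_subst, packTm]
    simp [Ty.upS, elimTy]
  rw [e] at h ⊢
  have h₁ := (betaTy_of_typed (Ax := Ax) (Θ := Θ) (Φ := Φ) (h.elimApp A) rfl).appL hx
  have h₂ := h₁.trans (beta_of_typed h₁.right rfl)
  simp only [Tm.inst, Tm.instTy, Tm.subst] at h₂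
  have h₃ := h₂.exApp B
  have h₄ := (h₃.trans (betaTy_of_typed h₃.right rfl)).appL hg
  simp only [Tm.instTy, Tm.subst] at h₄
  refine h₄.trans (beta_of_typed h₄.right ?_)
  simp [Tm.inst, ← Tm.wk_wkTy, Ty.upS]

end IEq

theorem occ_at1_var {m : ℕ} {ρ : Typ S 1} {i j : Fin m} {p : Bool}
    (h : Ty.Occ p i (ρ.at1 (.var j))) : i = j := by
  rw [Ty.at1, ← Ty.ren_eq_subst (f := fun _ => j)] at h
  obtain ⟨_, hj, -⟩ := Ty.occ_ren h
  exact hj.symm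

theorem elimTy_pos (ρ : Typ S 1) : Ty.OnlyPositive 0 (elimTy ρ (.var (0 : Fin 1))) := by
  rintro (h | h)
  · exact absurd (occ_at1_var h) (Fin.succ_ne_zero _)
  · exact absurd h.1 (by simp)

/-- The functor X ↦ Πα. ρ(α) ⊸ X acts by postcomposition with h. On the domain ρ(α) only identities
act, and they act as the identity whatever the variance of α in ρ. -/
theorem IEq.act_elim (hId : IdentityExtension Ax) (hE : Extensionality Ax)
    (hf : HasTyI Γ f (elimTy ρ A)) (hh : HasTyI Γ h (.lolli A B)) (hx : HasTyI Γ x (ρ.at1 C)) :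
    IEq Ax Γ Θ Φ B (.app (.tyApp (.app (act (elimTy ρ (.var (0 : Fin 1))) (fun _ => A) (fun _ => B)
      fun _ => h) f) C) x) (.app h (.app (.tyApp f C) x)) := by
  have henv := ActEnv.of_pos (elimTy_pos ρ) hh
  have h₁ := IEq.act_all (Ax := Ax) (Θ := Θ) (Φ := Φ) henv (u := f)
    (by change HasTyI Γ f ((elimTy ρ (.var 0)).subst _); simpa using hf) C
  have hx' : HasTyI Γ x ((ρ.at1 (.var 0)).subst (push C fun _ : Fin 1 => B)) := by simpa using hx
  have h₂ := (show IEq Ax Γ Θ Φ (.lolli _ _) _ _ from h₁).appL hx'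
  have henv' : ActEnv Γ (.lolli (ρ.at1 (.var 0)) (.var 1) : Typ S 2) (push C fun _ => A)
      (push C fun _ => B) (push (Tm.idTm C) fun _ => h) := by
    refine Fin.cases ⟨fun _ => .idTm C, fun _ => .idTm C, fun _ _ => rfl⟩ (fun i =>
      ⟨fun _ => hh, ?_, fun _ => ?_⟩)
    · rintro (h | h)
      · exact absurd (occ_at1_var h) (Fin.succ_ne_zero _)
      · exact absurd h.1 (by simp)
    · rintro (h | h)
      · exact absurd (occ_at1_var h) (Fin.succ_ne_zero _)
      · exact absurd h.1 (by simp)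
  have h₃ := IEq.act_lolli (Ax := Ax) (Θ := Θ) (Φ := Φ) henv' (u := .tyApp f C)
    (x := x) (by simpa [Ty.subst] using hf.elimApp C) hx'
  refine (h₂.trans h₃).trans (.appR hh (.appR (hf.elimApp C) ?_))
  have h₄ := (IEq.act_id (Ax := Ax) (Θ := Θ) (Φ := Φ) (Γ := Γ) hId hE (ρ.at1 (.var 0))
    (push C fun _ : Fin 1 => B)).appL hx'
  -- Only variable 0 occurs in ρ(α), so the entries A, B and h belonging to variable 1 may be
  -- exchanged for an identity, as required by `IEq.act_id`.
  rw [act_congr (a := push C fun _ : Fin 1 => B) (b := push C fun _ => A)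
    (F := push (Tm.idTm C) fun _ => h) (a' := push C fun _ : Fin 1 => B)
    (b' := push C fun _ : Fin 1 => B) (F' := fun i => Tm.idTm (push C (fun _ : Fin 1 => B) i))
    (ρ.at1 (.var 0)) (by rintro i p ho; cases occ_at1_var ho; exact ⟨rfl, rfl, rfl⟩)]
  simpa using h₄.trans (.betaId (by simpa using hx'))

/-- The interpretation of Πα. ρ(α) ⊸ β quantifies over all admissible relations between two
instances of α, whereas the hypothesis only concerns a single type α. The gap is closed by the graph
lemma for the functor X ↦ Πα. ρ(α) ⊸ X: relatedness at the graph of h means that the action of h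
sends f to g, and by `IEq.act_elim` this is the hypothesis. -/
theorem Related.of_elim (hId : IdentityExtension Ax) (hE : Extensionality Ax)
    (hf : HasTyI Γ f (elimTy ρ A)) (hg : HasTyI Γ g (elimTy ρ B)) (hh : HasTyI Γ h (.lolli A B))
    (e : IEq Ax (push (ρ.at1 (.var 0)) (wkCtx Γ)) (wkRCtx Θ) ((Φ.map Form.wkTy).map Form.wkTm) B.wk
      (.app h.wkTy.wk (.app (.tyApp f.wkTy.wk (.var 0)) (.var 0)))
      (.app (.tyApp g.wkTy.wk (.var 0)) (.var 0))) :
    Related Ax Γ Θ Φ (elimTy ρ (.var 0)) (fun _ : Fin 1 => A) (fun _ => B) (fun _ => h) f g := by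
  have hf' : HasTyI Γ f ((elimTy ρ (.var 0)).at1 A) := by simpa [Ty.at1] using hf
  refine (graph_iff hId hE (elimTy_pos ρ) hh).2 ⟨hf', ?_⟩
  refine (IEq.appL (IEq.fmap_eq_act (elimTy_pos ρ) hh) hf').trans ?_
  have hF := (HasTyI.act _ (ActEnv.of_pos (elimTy_pos ρ) hh)).app (by simpa using hf)
  rw [Ty.at1]
  rw [elimTy_subst] at hF ⊢
  refine IEq.extTy hE hF hg ?_
  have hFw := hF.wkTy
  have hgw := hg.wkTy
  rw [elimTy_wk] at hFw hgw
  refine IEq.ext hE (hFw.elimApp (.var 0)) (hgw.elimApp (.var 0)) ?_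
  have hfw := hf.wkTy.wk (ρ.at1 (.var 0))
  rw [elimTy_wk] at hfw
  have h₁ := IEq.act_elim (Ax := Ax) (Θ := wkRCtx Θ) (Φ := (Φ.map Form.wkTy).map Form.wkTm) hId hE
    hfw (hh.wkTy.wk _) (HasTyI.var 0)
  simp only [Tm.app_wk, Tm.tyApp_wk, Tm.app_wkTy, act_wkTy, act_wk]
  exact h₁.trans e

end Pack

theorem push_fin_one {A : Type*} (a : A) (f : Fin 0 → A) : push a f = fun _ => a :=
  funext (Fin.cases rfl nofun)

-- Naturality of existential types, and computation rules for unfold and out.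

section Nu

variable {S : Sig.{u, v}} {k n r : ℕ} {σ ρ : Typ S 1} {Ax : Form S 0 0 0 → Prop} {Γ : Fin n → Typ S k}
  {Θ : Fin r → RelDecl S k} {Φ : List (Form S k n r)} {A B C : Typ S k} {f g h t s x y z : Tm S k n}

/-- Parametricity at the type `∐α.ρ`. -/
theorem IEq.ex_natural (hId : IdentityExtension Ax) (hE : Extensionality Ax)
    (hx : HasTyI Γ x (exTy ρ).cl)
    (hf : HasTyI Γ f (elimTy ρ A)) (hg : HasTyI Γ g (elimTy ρ B)) (hh : HasTyI Γ h (.lolli A B))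
    (e : IEq Ax (push (ρ.at1 (.var 0)) (wkCtx Γ)) (wkRCtx Θ) ((Φ.map Form.wkTy).map Form.wkTm) B.wk
      (.app h.wkTy.wk (.app (.tyApp f.wkTy.wk (.var 0)) (.var 0)))
      (.app (.tyApp g.wkTy.wk (.var 0)) (.var 0))) :
    IEq Ax Γ Θ Φ B (.app h (.app (.tyApp x A) f)) (.app (.tyApp x B) g) := by
  have m₁ := MapEnv.push (a := Fin.elim0) (b := Fin.elim0) (f := fun i => Tm.idTm (Fin.elim0 i))
    (fun i => i.elim0) hh
  have h₁ := (Related.closed (Ax := Ax) (Θ := Θ) (Φ := Φ) hId (refl hx)).all_elim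
    (fun i => i.elim0) hh
  have h₂ := Related.of_elim hId hE hf hg hh e
  rw [← push_fin_one A Fin.elim0, ← push_fin_one B Fin.elim0,
    ← push_fin_one h fun i => Tm.idTm (Fin.elim0 i)] at h₂
  exact (h₁.lolli_elim m₁ h₂).var_eq m₁

/-- Packing is inverse to unpacking. -/
theorem IEq.tyApp_ex_pack (hId : IdentityExtension Ax) (hE : Extensionality Ax)
    (hx : HasTyI Γ x (exTy ρ).cl) :
    IEq Ax Γ Θ Φ (exTy ρ).cl (.app (.tyApp x (exTy ρ).cl) (packTm ρ).cl) x := by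
  have hy := (hx.exApp (exTy ρ).cl).app HasTyI.packTm_cl
  have hx' := hx
  have hy' := hy
  rw [exTy_cl] at hx'
  rw [show HasTyI Γ _ (exTy ρ).cl = HasTyI Γ _ _ from congrArg _ (exTy_cl ρ)] at hy'
  conv => arg 5; rw [exTy_cl]
  refine extTy hE hy' hx' ?_
  have hxw := hx.wkTy
  have hyw := hy.wkTy
  rw [Ty.wk_cl] at hxw hyw
  refine ext hE (hyw.exApp (.var 0)) (hxw.exApp (.var 0)) ?_
  have hxv := hxw.wk (elimTy ρ (.var 0))
  have hyv := hyw.wk (elimTy ρ (.var 0))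
  have hv : HasTyI (push (elimTy ρ (.var 0)) (wkCtx Γ)) (.var 0) (elimTy ρ (.var 0)) := .var 0
  -- At a type β and a test v : Πα. ρ(α) ⊸ β, naturality is used for the map y ↦ y β v. It carries
  -- pack at α to v at α, hence (x ∐ρ pack) β v = x β v.
  have hh : HasTyI (push (elimTy ρ (.var 0)) (wkCtx Γ))
      (.lam (exTy ρ).cl (.app (.tyApp (.var 0) (.var 0)) (.var 1)))
      (.lolli (exTy ρ).cl (.var 0)) :=
    .lam (.app (.exApp (.var 0) _) (.var 1)) (by simp)
  have h₁ := ex_natural (Ax := Ax) (Θ := wkRCtx Θ) (Φ := (Φ.map Form.wkTy).map Form.wkTm) hId hE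
    hxv .packTm_cl hv hh (by
      have h₂ := hh.wkTy.wk (ρ.at1 (.var 0))
      rw [show (Ty.lolli (exTy ρ).cl (.var 0) : Typ S (k + 1)).wk =
        .lolli (exTy ρ).cl.wk (.var 1) from rfl, Ty.wk_cl] at h₂
      have h₃ : HasTyI (push (ρ.at1 (.var 0)) (wkCtx (push (elimTy ρ (.var 0)) (wkCtx Γ))))
        (.var 0) (ρ.at1 (.var 0)) := .var 0
      have h₄ := hv.wkTy.wk (ρ.at1 (.var 0))
      rw [elimTy_wk] at h₄
      have h₅ := h₂.app ((HasTyI.packTm_cl.elimApp _).app h₃)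
      refine (beta_of_typed (by simpa [Tm.wkTy, Tm.ren] using h₅) rfl).trans ?_
      simpa [Tm.inst] using pack_app h₃ h₄)
  have h₂ := beta_of_typed (Ax := Ax) (Θ := wkRCtx Θ) (Φ := (Φ.map Form.wkTy).map Form.wkTm)
    (hh.app hyv) rfl
  simp only [Tm.app_wk, Tm.bang_wk, Tm.tyApp_wk, Tm.wk_cl, Ty.wk_cl, Tm.app_wkTy, Tm.bang_wkTy,
    Tm.tyApp_wkTy, Tm.wkTy_cl, Tm.inst, Tm.subst] at h₁ h₂ ⊢
  exact h₂.symm.trans h₁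

/-- `unfold A !f`. -/
def unfoldAt (σ : Typ S 1) (A : Typ S k) (f : Tm S k n) : Tm S k n :=
  .app (.tyApp (unfoldTm σ).cl A) (.bang f)

@[simp] theorem unfoldAt_wk (A : Typ S k) (f : Tm S k n) :
    (unfoldAt σ A f).wk = unfoldAt σ A f.wk := by
  simp [unfoldAt]

@[simp] theorem unfoldAt_subst {k' n' : ℕ} (θ : Fin k → Typ S k') (q : Fin n → Tm S k' n')
    (A : Typ S k) (f : Tm S k n) :
    (unfoldAt σ A f).subst θ q = unfoldAt σ (A.subst θ) (f.subst θ q) := by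
  simp [unfoldAt]

@[simp] theorem unfoldAt_cnt (A : Typ S k) (f : Tm S k n) (i : Fin n) :
    (unfoldAt σ A f).cnt i = 2 * f.cnt i := by
  simp [unfoldAt]

theorem nuBody_at1 (σ : Typ S 1) (A : Typ S k) :
    (nuBody σ).at1 A = .tensor (.bang (.lolli A (σ.at1 A))) A := by
  change Ty.tensor (.bang (.lolli _ ((σ.at1 (.var 0)).subst _))) _ = _
  rw [Ty.at1_subst]
  rfl

theorem HasTyI.unfoldTm {Γ : Fin 0 → Typ S 0} : HasTyI Γ (LAPL.unfoldTm σ) (.all (.arrow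
    (.lolli (.var 0) (σ.at1 (.var 0))) (.lolli (.var 0) (nu σ).cl))) :=
  .tyLam (.lam (.lam (.app (.elimApp .packTm_cl _)
    (by rw [nuBody_at1]; exact .tensor (.var 1) (.var 0))) (by simp)) (by simp))

theorem HasTyI.unfoldTm_cl (A : Typ S k) : HasTyI Γ (.tyApp (LAPL.unfoldTm σ).cl A) (.arrow
    (.lolli A (σ.at1 A)) (.lolli A (nu σ).cl)) := by
  have h := (HasTyI.unfoldTm (σ := σ) (Γ := Fin.elim0)).cl (Γ := Γ)
  exact .tyApp' h (by simp [Ty.arrow, Ty.inst, Ty.ren, Ty.subst, up])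

theorem HasTyI.unfoldAt (hf : HasTyI Γ f (.lolli A (σ.at1 A))) :
    HasTyI Γ (LAPL.unfoldAt σ A f) (.lolli A (nu σ).cl) := .app (.unfoldTm_cl A) hf.bang

theorem HasTyI.outAux (hpos : Ty.OnlyPositive 0 σ) {Γ : Fin 0 → Typ S 0} :
    HasTyI Γ (LAPL.outAux σ) (elimTy (nuBody σ) (σ.at1 (nu σ))) := by
  refine .tyLam ?_
  rw [nuBody_at1, Ty.at1_wk, Ty.wk_eq_cl]
  exact .lam (.letTensor (.var 0) (.letBang (.var 1) (.app (.fmap hpos (.unfoldAt (.var 0)))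
    (.app (.var 0) (.var 1)))) (by simp) (by simp)) (by simp)

theorem HasTyI.outAux_cl (hpos : Ty.OnlyPositive 0 σ) :
    HasTyI Γ (LAPL.outAux σ).cl (elimTy (nuBody σ) (σ.at1 (nu σ).cl)) := by
  have h := (HasTyI.outAux (σ := σ) hpos (Γ := Fin.elim0)).cl (Γ := Γ)
  rwa [← Ty.subst_zero _ Fin.elim0, elimTy_subst, Ty.subst_zero, Ty.at1_cl] at h

theorem HasTyI.outTm (hpos : Ty.OnlyPositive 0 σ) {Γ : Fin 0 → Typ S 0} :
    HasTyI Γ (LAPL.outTm σ) (.lolli (nu σ) (σ.at1 (nu σ))) := by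
  refine .lam (.app (.exApp (ρ := nuBody σ) (.var' (by simp [nu])) _) ?_) (by simp)
  simpa using HasTyI.outAux_cl (k := 0) (Γ := push (nu σ) Γ) hpos

theorem HasTyI.outTm_cl (hpos : Ty.OnlyPositive 0 σ) :
    HasTyI Γ (LAPL.outTm σ).cl (.lolli (nu σ).cl (σ.at1 (nu σ).cl)) := by
  have h := (HasTyI.outTm (σ := σ) hpos (Γ := Fin.elim0)).cl (Γ := Γ)
  rwa [Ty.cl, Ty.ren, ← Ty.cl, ← Ty.cl, Ty.at1_cl] at h

namespace IEq

/-- Stated for an arbitrary w of type !(A ⊸ σ(A)), not only for !f, because in `unfoldAt_pack` it is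
applied to a variable. -/
theorem unfold_app {w : Tm S k n} (hw : HasTyI Γ w (.bang (.lolli A (σ.at1 A))))
    (hx : HasTyI Γ x A) :
    IEq Ax Γ Θ Φ (nu σ).cl (.app (.app (.tyApp (unfoldTm σ).cl A) w) x)
      (.app (.tyApp (packTm (nuBody σ)).cl A) (.tensor w x)) := by
  have h := HasTyI.unfoldTm_cl (Γ := Γ) (σ := σ) A
  have e : ((unfoldTm σ).cl : Tm S k n) = .tyLam (.lam (.bang (.lolli (.var 0) (σ.at1 (.var 0))))
    (.lam (.var 0) (.app (.tyApp (packTm (nuBody σ)).cl (.var 0))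
      (.tensor (.var 1) (.var 0))))) := by
    rw [Tm.cl_eq_subst, unfoldTm]
    simp [Ty.upS]
  rw [e] at h ⊢
  have h₁ := (betaTy_of_typed (Ax := Ax) (Θ := Θ) (Φ := Φ) h rfl).appL hw
  have h₂ := (h₁.trans (beta_of_typed h₁.right rfl)).appL hx
  simp only [Tm.inst, Tm.instTy, Tm.subst] at h₂
  refine h₂.trans (beta_of_typed h₂.right ?_)
  simp [Tm.inst, ← Tm.cl_eq_subst]

theorem unfoldAt_app (hf : HasTyI Γ f (.lolli A (σ.at1 A))) (hx : HasTyI Γ x A) :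
    IEq Ax Γ Θ Φ (nu σ).cl (.app (unfoldAt σ A f) x)
      (.app (.tyApp (packTm (nuBody σ)).cl A) (.tensor (.bang f) x)) := unfold_app hf.bang hx

theorem outAux_app (hpos : Ty.OnlyPositive 0 σ) (hf : HasTyI Γ f (.lolli A (σ.at1 A)))
    (hx : HasTyI Γ x A) :
    IEq Ax Γ Θ Φ (σ.at1 (nu σ).cl) (.app (.tyApp (outAux σ).cl A) (.tensor (.bang f) x))
      (.app (LAPL.fmap σ A (nu σ).cl (unfoldAt σ A f)) (.app f x)) := by
  have h := (HasTyI.outAux_cl (Γ := Γ) hpos).elimApp A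
  have e : ((outAux σ).cl : Tm S k n) = .tyLam (.lam
      (.tensor (.bang (.lolli (.var 0) (σ.at1 (.var 0)))) (.var 0))
      (.letTensor (.bang (.lolli (.var 0) (σ.at1 (.var 0)))) (.var 0) (.var 0)
        (.letBang (.lolli (.var 0) (σ.at1 (.var 0))) (.var 1)
          (.app (LAPL.fmap σ (.var 0) (nu σ).cl (unfoldAt σ (.var 0) (.var 0)))
            (.app (.var 0) (.var 1)))))) := by
    rw [Tm.cl_eq_subst, outAux]
    simp [Ty.upS, nuBody, unfoldAt]
  rw [e] at h ⊢
  have h₁ := (betaTy_of_typed (Ax := Ax) (Θ := Θ) (Φ := Φ) h rfl).appL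
    (by rw [nuBody_at1]; exact hf.bang.tensor hx)
  have h₂ := h₁.trans (beta_of_typed h₁.right rfl)
  simp only [Tm.inst, Tm.instTy, Tm.subst] at h₂
  have h₃ := h₂.trans (betaTensor_of_typed h₂.right rfl)
  simp only [Tm.inst2, Tm.subst] at h₃
  refine h₃.trans (betaBang_of_typed h₃.right ?_)
  simp [Tm.inst]

theorem out_app (hpos : Ty.OnlyPositive 0 σ) (hf : HasTyI Γ f (.lolli A (σ.at1 A)))
    (hx : HasTyI Γ x A) :
    IEq Ax Γ Θ Φ (σ.at1 (nu σ).cl) (.app (outTm σ).cl (.app (unfoldAt σ A f) x))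
      (.app (LAPL.fmap σ A (nu σ).cl (unfoldAt σ A f)) (.app f x)) := by
  have h := (HasTyI.outTm_cl (Γ := Γ) hpos).app ((HasTyI.unfoldAt hf).app hx)
  have e : ((outTm σ).cl : Tm S k n) = .lam (nu σ).cl (.app (.tyApp (.var 0) (σ.at1 (nu σ).cl))
      (outAux σ).cl) := by
    rw [Tm.cl_eq_subst, outTm]
    simp [Ty.subst_zero]
  rw [e] at h ⊢
  have h₁ := beta_of_typed (Ax := Ax) (Θ := Θ) (Φ := Φ) h rfl
  refine (beta_of_typed h rfl).trans ?_
  have h₂ := ((unfoldAt_app (Ax := Ax) (Θ := Θ) (Φ := Φ) hf hx).exApp (σ.at1 (nu σ).cl)).appL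
    (HasTyI.outAux_cl hpos)
  have h₃ := pack_app (Ax := Ax) (Θ := Θ) (Φ := Φ) (ρ := nuBody σ) (A := A)
    (by rw [nuBody_at1]; exact hf.bang.tensor hx) (HasTyI.outAux_cl hpos)
  simpa [Tm.inst] using (h₂.trans h₃).trans (outAux_app hpos hf hx)

end IEq

end Nu

@[simp] theorem Tm.comp_ren {S : Sig.{u, v}} {k n k' n' : ℕ} (f : Fin k → Fin k')
    (g : Fin n → Fin n') (σ : Typ S k) (t s : Tm S k n) :
    (comp σ t s).ren f g = comp (σ.ren f) (t.ren f g) (s.ren f g) := by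
  simp [comp, ren]

-- Final coalgebras: the type να.σ.

section Final

variable {S : Sig.{u, v}} {k n r : ℕ} {σ ρ : Typ S 1} {Ax : Form S 0 0 0 → Prop} {Γ : Fin n → Typ S k}
  {Θ : Fin r → RelDecl S k} {Φ : List (Form S k n r)} {A B C : Typ S k} {f g h t s x y z : Tm S k n}

namespace CoalgMap

theorem toIEq (hpos : Ty.OnlyPositive 0 σ) (hf : HasTyI Γ f (.lolli A (σ.at1 A)))
    (hg : HasTyI Γ g (.lolli B (σ.at1 B))) (hh : HasTyI Γ h (.lolli A B))
    (hc : CoalgMap Ax σ Γ Θ Φ A B f g h) : IEq Ax Γ Θ Φ (.lolli A (σ.at1 B)) (.comp A g h)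
      (.comp A (fmap σ A B h) f) :=
  ⟨.comp hg hh, .comp (.fmap hpos hh) hf, hc⟩

theorem comp (hId : IdentityExtension Ax) (hE : Extensionality Ax)
    (hpos : Ty.OnlyPositive 0 σ) {c h' : Tm S k n} (hf : HasTyI Γ f (.lolli A (σ.at1 A)))
    (hg : HasTyI Γ g (.lolli B (σ.at1 B))) (hc : HasTyI Γ c (.lolli C (σ.at1 C)))
    (hh : HasTyI Γ h (.lolli A B)) (hh' : HasTyI Γ h' (.lolli B C))
    (m : CoalgMap Ax σ Γ Θ Φ A B f g h) (m' : CoalgMap Ax σ Γ Θ Φ B C g c h') :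
    CoalgMap Ax σ Γ Θ Φ A C f c (.comp A h' h) := by
  have e := m.toIEq hpos hf hg hh
  have e' := m'.toIEq hpos hg hc hh'
  refine IEq.prov (σ := .lolli A (σ.at1 C)) ?_
  have hF := HasTyI.fmap hpos hh
  have hF' := HasTyI.fmap hpos hh'
  exact (((IEq.comp_assoc hE hc hh' hh).symm.trans (e'.compL hE hh)).trans
    ((IEq.comp_assoc hE hF' hg hh).trans (e.compR hE hF'))).trans
    ((IEq.comp_assoc hE hF' hF hf).symm.trans (.compL hE (.fmap_comp hId hE hpos hh' hh) hf))

theorem id (hId : IdentityExtension Ax) (hE : Extensionality Ax) (hpos : Ty.OnlyPositive 0 σ)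
    (hf : HasTyI Γ f (.lolli A (σ.at1 A))) : CoalgMap Ax σ Γ Θ Φ A A f f (Tm.idTm A) :=
  ((IEq.comp_id hE hf).trans
    ((IEq.compL hE (.fmap_id hId hE hpos) hf).trans (.id_comp hE hf)).symm).prov

theorem wk (hpos : Ty.OnlyPositive 0 σ) (hf : HasTyI Γ f (.lolli A (σ.at1 A)))
    (hg : HasTyI Γ g (.lolli B (σ.at1 B))) (hh : HasTyI Γ h (.lolli A B))
    (hc : CoalgMap Ax σ Γ Θ Φ A B f g h) (C : Typ S k) :
    CoalgMap Ax σ (push C Γ) Θ (Φ.map Form.wkTm) A B f.wk g.wk h.wk := by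
  simpa only [CoalgMap, Tm.comp_wk, fmap_wk] using ((hc.toIEq hpos hf hg hh).wk C).prov

end CoalgMap

theorem unfoldAt_coalgMap (hE : Extensionality Ax) (hpos : Ty.OnlyPositive 0 σ)
    (hf : HasTyI Γ f (.lolli A (σ.at1 A))) :
    CoalgMap Ax σ Γ Θ Φ A (nu σ).cl f (outTm σ).cl (unfoldAt σ A f) := by
  refine (IEq.ext_comp hE (.outTm_cl hpos) (.unfoldAt hf) (.fmap hpos (.unfoldAt hf)) hf ?_).prov
  simp only [unfoldAt_wk, fmap_wk, Tm.wk_cl]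
  exact IEq.out_app hpos (hf.wk A) (.var 0)

namespace IEq

/-- Parametricity of the closed term `unfold` at the graph of h. A coalgebra map h makes f and g
related by ⟨h⟩ ⊸ σ[⟨h⟩], again by the graph lemma, and the points x and h x are related by ⟨h⟩. -/
theorem unfold_natural (hId : IdentityExtension Ax) (hE : Extensionality Ax)
    (hpos : Ty.OnlyPositive 0 σ) (hf : HasTyI Γ f (.lolli A (σ.at1 A)))
    (hg : HasTyI Γ g (.lolli B (σ.at1 B))) (hh : HasTyI Γ h (.lolli A B))
    (hc : CoalgMap Ax σ Γ Θ Φ A B f g h) (hx : HasTyI Γ x A) :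
    IEq Ax Γ Θ Φ (nu σ).cl (.app (unfoldAt σ A f) x) (.app (unfoldAt σ B g) (.app h x)) := by
  have m₀ : MapEnv Γ (Fin.elim0 : Fin 0 → Typ S k) Fin.elim0 fun i => Tm.idTm (Fin.elim0 i) :=
    fun i => i.elim0
  have m₁ := m₀.push hh
  have h₁ := (Related.closed (Ax := Ax) (Θ := Θ) (Φ := Φ) hId
    (refl (HasTyI.unfoldTm (σ := σ)).cl)).all_elim m₀ hh
  have h₂ : Related Ax Γ Θ Φ (.lolli (.var 0) (σ.at1 (.var 0))) _ _ _ f g :=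
    .lolli_intro m₁ (by simpa using hf) (by simpa using hg) ?_
  · have h₃ := (h₁.lolli_elim m₁ (h₂.bang m₁)).lolli_elim m₁
      (.var m₁ (i := 0) (refl (hh.app hx)) hx)
    -- The result type να.σ contains no type variable, so it is a renaming along the empty map. Its
    -- interpretation is then the one without relations, which is equality by identity extension.
    have h₄ := (Related.ren m₁ fun i => i.elim0).1 h₃
    rw [← Ty.subst_zero _ Fin.elim0]
    refine Related.eq hId ?_
    convert h₄ using 1 <;> rfl
  · intro Ψ hr
    have m₂ := (m₁.wk A).wk B
    refine (Related.at1_var m₂ 0).2 ((Related.graph_iff hId hE hpos ((hh.wk A).wk B)).2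
      ⟨((hf.wk A).wk B).app (.var 1), ?_⟩)
    have hc' := (hc.toIEq hpos hf hg hh).wk₂ A B Ψ
    simp only [Tm.comp_wk, fmap_wk] at hc'
    exact (of_comp ((hg.wk _).wk _) ((hh.wk _).wk _) (.fmap hpos ((hh.wk _).wk _))
      ((hf.wk _).wk _) hc' (.var 1)).symm.trans (appR ((hg.wk _).wk _) (hr.var_eq m₂))

/-- The map unfold f is a coalgebra map from f to `out`, so `unfold_natural` applies to it. -/
theorem comp_unfoldAt (hId : IdentityExtension Ax) (hE : Extensionality Ax)
    (hpos : Ty.OnlyPositive 0 σ) (hf : HasTyI Γ f (.lolli A (σ.at1 A))) :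
    IEq Ax Γ Θ Φ (.lolli A (nu σ).cl) (.comp A (unfoldAt σ (nu σ).cl (outTm σ).cl) (unfoldAt σ A f))
      (unfoldAt σ A f) := by
  have hu := HasTyI.unfoldAt (Γ := Γ) (HasTyI.outTm_cl hpos)
  have hv := HasTyI.var (Γ := push A Γ) 0
  refine ext hE (.comp hu (.unfoldAt hf)) (.unfoldAt hf) ?_
  simp only [Tm.comp_wk, unfoldAt_wk, Tm.wk_cl]
  exact (comp_app (.unfoldAt (.outTm_cl hpos)) (.unfoldAt (hf.wk A)) hv).trans
    (unfold_natural hId hE hpos (hf.wk A) (.outTm_cl hpos) (.unfoldAt (hf.wk A))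
      (unfoldAt_coalgMap hE hpos (hf.wk A)) hv).symm

/-- Passes from coalgebras !f to an arbitrary w : !(A ⊸ σ(A)). Extensionality for ! reduces the
statement to `comp_unfoldAt` at a variable. -/
theorem comp_unfold (hId : IdentityExtension Ax) (hE : Extensionality Ax)
    (hpos : Ty.OnlyPositive 0 σ) (A : Typ S k) :
    IEq Ax Γ Θ Φ (.arrow (.lolli A (σ.at1 A)) (.lolli A (nu σ).cl))
      (.lam (.bang (.lolli A (σ.at1 A))) (.comp A (unfoldAt σ (nu σ).cl (outTm σ).cl)
        (.app (.tyApp (unfoldTm σ).cl A) (.var 0)))) (.tyApp (unfoldTm σ).cl A) := by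
  have ht {m : ℕ} {Δ : Fin m → Typ S k} : HasTyI Δ (.lam (.bang (.lolli A (σ.at1 A)))
      (.comp A (unfoldAt σ (nu σ).cl (outTm σ).cl)
        (.app (.tyApp (unfoldTm σ).cl A) (.var 0)))) _ :=
    .lam (.comp (.unfoldAt (.outTm_cl hpos)) (.app (.unfoldTm_cl A) (.var 0))) (by simp)
  refine ext_bang hId hE ht (.unfoldTm_cl A) ?_
  have hv := HasTyI.var (Γ := push (.lolli A (σ.at1 A)) Γ) 0
  have h := beta_of_typed (Ax := Ax) (Θ := Θ) (Φ := Φ.map Form.wkTm) (ht.app hv.bang) rfl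
  have h' := comp_unfoldAt (Ax := Ax) (Θ := Θ) (Φ := Φ.map Form.wkTm) hId hE hpos hv
  simp only [Tm.inst, Tm.comp_subst, unfoldAt_subst, Tm.subst] at h
  simp [unfoldAt, Tm.ren] at h h' ⊢
  exact h.trans h'

/-- By extensionality for ⊗ the argument is w ⊗ z with w, z variables, and pack (w ⊗ z) is unfold w
z. So the claim is `comp_unfold` evaluated at w and z. -/
theorem unfoldAt_pack (hId : IdentityExtension Ax) (hE : Extensionality Ax)
    (hpos : Ty.OnlyPositive 0 σ) (A : Typ S k) :
    IEq Ax Γ Θ Φ (.lolli ((nuBody σ).at1 A) (nu σ).cl)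
      (.comp ((nuBody σ).at1 A) (unfoldAt σ (nu σ).cl (outTm σ).cl)
        (.tyApp (packTm (nuBody σ)).cl A)) (.tyApp (packTm (nuBody σ)).cl A) := by
  have hP {m : ℕ} {Δ : Fin m → Typ S k} :
      HasTyI Δ (.tyApp (packTm (nuBody σ)).cl A) (.lolli ((nuBody σ).at1 A) (nu σ).cl) :=
    HasTyI.packTm_cl.elimApp A
  rw [nuBody_at1] at hP ⊢
  have hU {m : ℕ} {Δ : Fin m → Typ S k} := HasTyI.unfoldAt (Γ := Δ) (HasTyI.outTm_cl hpos)
  refine ext_tensor hId hE (.comp hU hP) hP ?_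
  have hw : HasTyI (push A (push (.bang (.lolli A (σ.at1 A))) Γ)) (.var 1) _ := .var 1
  have hz : HasTyI (push A (push (.bang (.lolli A (σ.at1 A))) Γ)) (.var 0) _ := .var 0
  simp only [Tm.comp_wk, unfoldAt_wk, Tm.wk_cl, Tm.tyApp_wk]
  have h₁ := unfold_app (Ax := Ax) (Θ := Θ) (Φ := (Φ.map Form.wkTm).map Form.wkTm) (σ := σ) hw hz
  have h₀ := comp_unfold (Ax := Ax) (Γ := push A (push (.bang (.lolli A (σ.at1 A))) Γ)) (Θ := Θ)
    (Φ := (Φ.map Form.wkTm).map Form.wkTm) hId hE hpos A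
  have h₂ := (h₀.appL hw).appL hz
  have h₃ := (beta_of_typed (Ax := Ax) (Θ := Θ) (Φ := (Φ.map Form.wkTm).map Form.wkTm)
    (h₀.left.app hw) rfl).appL hz
  simp only [Tm.inst, Tm.comp_subst, unfoldAt_subst, Tm.subst] at h₃
  refine (comp_app hU hP (hw.tensor hz)).trans ((appR hU h₁.symm).trans ?_)
  refine (comp_app hU (.app (.unfoldTm_cl A) hw) hz).symm.trans ?_
  simp [-List.map_map] at h₃
  exact h₃.symm.trans (h₂.trans h₁)

/-- Unfolding `out` is the identity: it fixes every packed element by `unfoldAt_pack`, hence by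
naturality of x it fixes x ν pack, which is x itself. -/
theorem unfoldAt_out (hId : IdentityExtension Ax) (hE : Extensionality Ax)
    (hpos : Ty.OnlyPositive 0 σ) (hx : HasTyI Γ x (nu σ).cl) :
    IEq Ax Γ Θ Φ (nu σ).cl (.app (unfoldAt σ (nu σ).cl (outTm σ).cl) x) x := by
  have hu := HasTyI.unfoldAt (Γ := Γ) (HasTyI.outTm_cl hpos)
  have h₁ := tyApp_ex_pack (Ax := Ax) (Θ := Θ) (Φ := Φ) (ρ := nuBody σ) hId hE hx
  refine (appR hu h₁.symm).trans ((ex_natural hId hE hx .packTm_cl .packTm_cl hu ?_).trans h₁)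
  have h₂ := unfoldAt_pack (Ax := Ax) (Γ := push ((nuBody σ).at1 (.var 0)) (wkCtx Γ))
    (Θ := wkRCtx Θ) (Φ := (Φ.map Form.wkTy).map Form.wkTm) hId hE hpos (.var 0)
  have hv := HasTyI.var (Γ := push ((nuBody σ).at1 (.var 0)) (wkCtx Γ)) 0
  have hp := HasTyI.packTm_cl (Γ := push ((nuBody σ).at1 (.var 0)) (wkCtx Γ)) (ρ := nuBody σ)
    |>.elimApp (.var 0)
  have h₃ := (comp_app (.unfoldAt (.outTm_cl hpos)) hp hv).symm.trans (h₂.appL hv)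
  simpa [unfoldAt, nu] using h₃

/-- For a coalgebra map h from f to `out`: unfold f x = unfold out (h x) = h x. -/
theorem unfoldAt_unique (hId : IdentityExtension Ax) (hE : Extensionality Ax)
    (hpos : Ty.OnlyPositive 0 σ) (hf : HasTyI Γ f (.lolli A (σ.at1 A)))
    (hh : HasTyI Γ h (.lolli A (nu σ).cl))
    (hc : CoalgMap Ax σ Γ Θ Φ A (nu σ).cl f (outTm σ).cl h) :
    IEq Ax Γ Θ Φ (.lolli A (nu σ).cl) h (unfoldAt σ A f) := by
  refine ext hE hh (.unfoldAt hf) ?_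
  have hv := HasTyI.var (Γ := push A Γ) 0
  have h₁ := unfold_natural hId hE hpos (hf.wk A) ((HasTyI.outTm_cl hpos).wk A) (hh.wk A)
    (hc.wk hpos hf (.outTm_cl hpos) hh A) hv
  rw [Tm.wk_cl] at h₁
  rw [unfoldAt_wk]
  exact (h₁.trans (unfoldAt_out hId hE hpos ((hh.wk A).app hv))).symm

end IEq

/-- The inverse of `out`. -/
def outInv (σ : Typ S 1) : Tm S k n :=
  unfoldAt σ (σ.at1 (nu σ).cl) (fmap σ (nu σ).cl (σ.at1 (nu σ).cl) (outTm σ).cl)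

@[simp] theorem outInv_cl (σ : Typ S 1) : ((outInv σ : Tm S 0 0).cl : Tm S k n) = outInv σ := by
  rw [Tm.cl_eq_subst]
  simp [outInv, Ty.subst_zero, ← Tm.cl_eq_subst]

theorem HasTyI.outInv (hpos : Ty.OnlyPositive 0 σ) :
    HasTyI Γ (LAPL.outInv σ) (.lolli (σ.at1 (nu σ).cl) (nu σ).cl) :=
  .unfoldAt (.fmap hpos (.outTm_cl hpos))

namespace IEq

/-- Dual to Lambek's argument for `in`: `out` is a coalgebra map from `out` to σ(out), so out⁻¹ ∘
out is a coalgebra endomorphism of the final coalgebra. The other composite is then σ(out⁻¹ ∘ out) =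
id. -/
theorem outInv_out (hId : IdentityExtension Ax) (hE : Extensionality Ax)
    (hpos : Ty.OnlyPositive 0 σ) : IEq Ax Γ Θ Φ (.lolli (nu σ).cl (nu σ).cl)
      (.comp (nu σ).cl (LAPL.outInv σ) (outTm σ).cl) (Tm.idTm (nu σ).cl) := by
  have ho : HasTyI Γ (outTm σ).cl _ := .outTm_cl hpos
  have hF := HasTyI.fmap hpos ho
  have h := CoalgMap.comp hId hE hpos ho hF ho ho (.unfoldAt hF) (refl (.comp hF ho)).prov
    (unfoldAt_coalgMap (Ax := Ax) (Θ := Θ) (Φ := Φ) hE hpos hF)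
  exact (unfoldAt_unique hId hE hpos ho (.comp (.outInv hpos) ho) h).trans
    (unfoldAt_unique hId hE hpos ho (.idTm _) (.id hId hE hpos ho)).symm

theorem out_outInv (hId : IdentityExtension Ax) (hE : Extensionality Ax)
    (hpos : Ty.OnlyPositive 0 σ) : IEq Ax Γ Θ Φ (.lolli (σ.at1 (nu σ).cl) (σ.at1 (nu σ).cl))
      (.comp (σ.at1 (nu σ).cl) (outTm σ).cl (LAPL.outInv σ)) (Tm.idTm (σ.at1 (nu σ).cl)) := by
  have ho : HasTyI Γ (outTm σ).cl _ := .outTm_cl hpos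
  have hF := HasTyI.fmap hpos ho
  have h := (unfoldAt_coalgMap (Ax := Ax) (Θ := Θ) (Φ := Φ) hE hpos hF).toIEq hpos hF ho
    (.unfoldAt hF)
  exact (h.trans (fmap_comp hId hE hpos (.unfoldAt hF) ho)).trans
    ((fmap hpos (outInv_out hId hE hpos)).trans (fmap_id hId hE hpos))

end IEq

theorem outTm_inverse (hId : IdentityExtension Ax) (hE : Extensionality Ax)
    (hpos : Ty.OnlyPositive 0 σ) :
    Inverse Ax (nu σ) (σ.at1 (nu σ)) (outTm σ) (outInv σ) := by
  refine ⟨.outTm hpos, ?_, ?_, ?_⟩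
  · simpa [Closed, ClosedEq] using HasTyI.outInv (k := 0) (Γ := Fin.elim0) hpos
  · simpa [Closed, ClosedEq] using
      (IEq.outInv_out (k := 0) (Γ := Fin.elim0) (Θ := Fin.elim0) (Φ := []) hId hE hpos).prov
  · simpa [Closed, ClosedEq] using
      (IEq.out_outInv (k := 0) (Γ := Fin.elim0) (Θ := Fin.elim0) (Φ := []) hId hE hpos).prov

end Final

-- Parametricity of the fixed-point combinator, and fusion laws.

section FixedPoints

variable {S : Sig.{u, v}} {k n r : ℕ} {σ : Typ S 1} {Ax : Form S 0 0 0 → Prop} {Γ : Fin n → Typ S k}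
  {Θ : Fin r → RelDecl S k} {Φ : List (Form S k n r)} {A A' B B' C D : Typ S k}
  {F G L a a' c c' e f g h t s x y z : Tm S k n}

@[simp] theorem Tm.ilam_wk (A : Typ S k) (t : Tm S k (n + 1)) :
    (ilam A t).wk = ilam A (t.ren id (up Fin.succ)) := by
  rw [wk_eq_subst, ilam_subst, Ty.subst_var, Tm.ren_eq_subst]
  exact congrArg _ (Tm.subst_congr (fun _ => rfl) (Fin.cases rfl fun _ => rfl) t)

@[simp] theorem fmap_ren {k' n' : ℕ} (p : Fin k → Fin k') (q : Fin n → Fin n') (σ : Typ S 1)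
    (A B : Typ S k) (f : Tm S k n) :
    (fmap σ A B f).ren p q = fmap σ (A.ren p) (B.ren p) (f.ren p q) := by
  simp [fmap, Tm.ren]

theorem HasTyI.fixAt (hF : HasTyI Γ F (.arrow C C)) :
    HasTyI Γ (.app (.tyApp .fix C) (.bang F)) C :=
  .app (.tyApp' .fix (by simp [Ty.fixTy, Ty.cl, Ty.arrow, Ty.inst, Ty.ren, up])) hF.bang

/-- Parametricity of the fixed-point combinator. -/
theorem IEq.fix_natural (hId : IdentityExtension Ax) (hE : Extensionality Ax)
    (hF : HasTyI Γ F (.arrow C C)) (hG : HasTyI Γ G (.arrow D D)) (hL : HasTyI Γ L (.lolli C D))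
    (e : IEq Ax (push C Γ) Θ (Φ.map Form.wkTm) D (.app L.wk (.app F.wk (.bang (.var 0))))
      (.app G.wk (.bang (.app L.wk (.var 0))))) :
    IEq Ax Γ Θ Φ D (.app L (.app (.tyApp .fix C) (.bang F)))
      (.app (.tyApp .fix D) (.bang G)) := by
  have hT {m : ℕ} {Δ : Fin m → Typ S k} {L G : Tm S k m} (hL : HasTyI Δ L (.lolli C D))
      (hG : HasTyI Δ G (.arrow D D)) :
      HasTyI Δ (.ilam C (.app G.wk (.bang (.app L.wk (.var 0))))) (.arrow C D) :=
    ilam_typed (.app (hG.wk C) (.bang (.app (hL.wk C) (.var 0))))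
  have hv := HasTyI.var (Γ := push C Γ) 0
  -- The hypothesis, an equation with a free variable, is rewritten as an equation between maps on
  -- !C, so that it can be weakened to the larger contexts below and applied there.
  have e' : IEq Ax Γ Θ Φ (.arrow C D) (.comp (.bang C) L F)
      (.ilam C (.app G.wk (.bang (.app L.wk (.var 0))))) := by
    refine ext_bang hId hE (.comp hL hF) (hT hL hG) ?_
    rw [Tm.comp_wk]
    refine (comp_app (hL.wk C) (hF.wk C) hv.bang).trans (e.trans (symm ?_))
    simp only [Tm.ilam_wk]
    have h := ((hT hL hG).wk C).app hv.bang
    simp only [Tm.ilam_wk] at h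
    refine betaI_of_typed h ?_
    simp [Tm.inst, Tm.ren]
  have m₀ : MapEnv Γ (Fin.elim0 : Fin 0 → Typ S k) Fin.elim0 fun i => Tm.idTm (Fin.elim0 i) :=
    fun i => i.elim0
  have m₁ := m₀.push hL
  -- Y is related to itself by the interpretation of its closed type, here instantiated at the graph
  -- of L. What has to be shown is that F and G are related by !⟨L⟩ ⊸ ⟨L⟩.
  have h₁ := (Related.closed (Ax := Ax) (Θ := Θ) (Φ := Φ) hId
    (refl (HasTyI.fix (S := S)))).all_elim m₀ hL
  have h₂ : Related Ax Γ Θ Φ (.arrow (.var 0) (.var 0)) _ _ _ F G :=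
    .lolli_intro m₁ (by simpa [Ty.arrow] using hF) (by simpa [Ty.arrow] using hG) ?_
  · exact (h₁.lolli_elim m₁ (h₂.bang m₁)).var_eq m₁
  · intro Ψ hr
    have m₂ := (m₁.wk (.bang C)).wk (.bang D)
    have hL₂ := (hL.wk (.bang C)).wk (.bang D)
    have hF₂ := (hF.wk (.bang C)).wk (.bang D)
    have hG₂ := (hG.wk (.bang C)).wk (.bang D)
    -- For arguments related by !⟨L⟩, elimination of ! leaves the case of !x and !y with L x = y.
    refine .var m₂ (hr.bang_elim m₂ hL₂ hF₂ hG₂ ?_) (hF₂.app (.var 1))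
    intro Ψ' hr'
    have m₃ := (m₂.wk C).wk D
    have h₃ := hr'.var_eq m₃
    have h₄ := ((e'.wk₂ (.bang C) (.bang D) Ψ).wk₂ C D Ψ').appL
      (HasTyI.bang (HasTyI.var (Γ := push D (push C (push (.bang D) (push (.bang C) Γ)))) 1))
    have hL₃ := (hL₂.wk C).wk D
    have hF₃ := (hF₂.wk C).wk D
    have hG₃ := (hG₂.wk C).wk D
    simp only [Tm.comp_wk] at h₄
    refine (comp_app hL₃ hF₃ (.bang (.var 1))).symm.trans (h₄.trans ?_)
    have h₅ := h₄.right
    simp only [Tm.ilam_wk] at h₅ ⊢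
    refine (betaI_of_typed h₅ ?_).trans (appR hG₃ h₃.bang)
    simp [Tm.inst, Tm.ren]

/-- The functional whose fixed points are the maps `h = a ∘ σ(h) ∘ c`. -/
def hyloStep (σ : Typ S 1) (A B : Typ S k) (a c : Tm S k n) : Tm S k n :=
  .ilam (.lolli A B) (.comp A a.wk (.comp A (fmap σ A B (.var 0)) c.wk))

/-- The fixed point `h = a ∘ σ(h) ∘ c`. -/
def hylo (σ : Typ S 1) (A B : Typ S k) (a c : Tm S k n) : Tm S k n :=
  .app (.tyApp .fix (.lolli A B)) (.bang (hyloStep σ A B a c))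

@[simp] theorem hyloStep_wk (A B : Typ S k) (a c : Tm S k n) :
    (hyloStep σ A B a c).wk = hyloStep σ A B a.wk c.wk := by
  simp [hyloStep, Tm.ren]

theorem HasTyI.hyloStep (hpos : Ty.OnlyPositive 0 σ) (ha : HasTyI Γ a (.lolli (σ.at1 B) B))
    (hc : HasTyI Γ c (.lolli A (σ.at1 A))) :
    HasTyI Γ (LAPL.hyloStep σ A B a c) (.arrow (.lolli A B) (.lolli A B)) :=
  IEq.ilam_typed (.comp (ha.wk _) (.comp (.fmap hpos (.var 0)) (hc.wk _)))

theorem HasTyI.hylo (hpos : Ty.OnlyPositive 0 σ) (ha : HasTyI Γ a (.lolli (σ.at1 B) B))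
    (hc : HasTyI Γ c (.lolli A (σ.at1 A))) :
    HasTyI Γ (LAPL.hylo σ A B a c) (.lolli A B) := .fixAt (.hyloStep hpos ha hc)

namespace IEq

theorem hyloStep_app (hpos : Ty.OnlyPositive 0 σ) (ha : HasTyI Γ a (.lolli (σ.at1 B) B))
    (hc : HasTyI Γ c (.lolli A (σ.at1 A))) (hh : HasTyI Γ h (.lolli A B)) :
    IEq Ax Γ Θ Φ (.lolli A B) (.app (LAPL.hyloStep σ A B a c) (.bang h))
      (.comp A a (.comp A (LAPL.fmap σ A B h) c)) := by
  refine betaI_of_typed ((HasTyI.hyloStep hpos ha hc).app hh.bang) ?_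
  simp [Tm.inst]

theorem hylo_eq (hpos : Ty.OnlyPositive 0 σ) (ha : HasTyI Γ a (.lolli (σ.at1 B) B))
    (hc : HasTyI Γ c (.lolli A (σ.at1 A))) :
    IEq Ax Γ Θ Φ (.lolli A B) (hylo σ A B a c)
      (.comp A a (.comp A (LAPL.fmap σ A B (hylo σ A B a c)) c)) := by
  have hF := HasTyI.hyloStep hpos ha hc
  exact (ofExt (hF.app hF.fixAt.bang) hF.fixAt (.fixpoint noLinear_many hF)).symm.trans
    (hyloStep_app hpos ha hc hF.fixAt)

/-- Fusion on the right, by `fix_natural` for precomposition with g: (a ∘ σ(h) ∘ c) ∘ g = a ∘ σ(h) ∘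
σ(g) ∘ c' = a ∘ σ(h ∘ g) ∘ c'. -/
theorem hylo_comp (hId : IdentityExtension Ax) (hE : Extensionality Ax)
    (hpos : Ty.OnlyPositive 0 σ) (ha : HasTyI Γ a (.lolli (σ.at1 B) B))
    (hc : HasTyI Γ c (.lolli A (σ.at1 A))) (hc' : HasTyI Γ c' (.lolli A' (σ.at1 A')))
    (hg : HasTyI Γ g (.lolli A' A)) (m : CoalgMap Ax σ Γ Θ Φ A' A c' c g) :
    IEq Ax Γ Θ Φ (.lolli A' B) (.comp A' (hylo σ A B a c) g) (hylo σ A' B a c') := by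
  -- The map h ↦ h ∘ g uses h once, so it is linear and its graph is admissible. The statement
  -- covers every context because it is also used after weakening.
  have hL {m : ℕ} {Δ : Fin m → Typ S k} {g : Tm S k m} (hg : HasTyI Δ g (.lolli A' A)) :
      HasTyI Δ (.lam (.lolli A B) (.comp A' (.var 0) g.wk)) (.lolli (.lolli A B) (.lolli A' B)) :=
    .lam (.comp (.var 0) (hg.wk _)) (by simp)
  have hβ {m r : ℕ} {Δ : Fin m → Typ S k} {Θ : Fin r → RelDecl S k} {Φ : List (Form S k m r)}
      {g x : Tm S k m} (hg : HasTyI Δ g (.lolli A' A)) (hx : HasTyI Δ x (.lolli A B)) :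
      IEq Ax Δ Θ Φ (.lolli A' B) (.app (.lam (.lolli A B) (.comp A' (.var 0) g.wk)) x)
        (.comp A' x g) :=
    beta_of_typed ((hL hg).app hx) (by simp [Tm.inst])
  refine (hβ hg (.hylo hpos ha hc)).symm.trans
    (fix_natural hId hE (.hyloStep hpos ha hc) (.hyloStep hpos ha hc') (hL hg) ?_)
  have hgw := hg.wk (.lolli A B)
  have haw := ha.wk (.lolli A B)
  have hcw := hc.wk (.lolli A B)
  have hcw' := hc'.wk (.lolli A B)
  have hx : HasTyI (push (.lolli A B) Γ) (.var 0) (.lolli A B) := .var 0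
  have hFx := HasTyI.fmap hpos hx
  have hFg := HasTyI.fmap hpos hgw
  have m' := (m.wk hpos hc' hc hg (.lolli A B)).toIEq hpos hcw' hcw hgw
  have e₁ : (Tm.lam (.lolli A B) (.comp A' (.var 0) g.wk) : Tm S k n).wk =
      .lam (.lolli A B) (.comp A' (.var 0) g.wk.wk) := by simp [Tm.ren]
  rw [e₁, hyloStep_wk, hyloStep_wk]
  have h₁ := (appR (Ax := Ax) (Θ := Θ) (Φ := Φ.map Form.wkTm) (hL hgw)
    (hyloStep_app hpos haw hcw hx)).trans (hβ hgw (.comp haw (.comp hFx hcw)))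
  have h₂ := (comp_assoc (Ax := Ax) (Θ := Θ) (Φ := Φ.map Form.wkTm) hE haw (.comp hFx hcw)
    hgw).trans (compR hE haw ((comp_assoc hE hFx hcw hgw).trans
      ((compR hE hFx m').trans ((comp_assoc hE hFx hFg hcw').symm.trans
        (compL hE (fmap_comp hId hE hpos hx hgw) hcw')))))
  have h₃ := (appR (Ax := Ax) (Θ := Θ) (Φ := Φ.map Form.wkTm) (.hyloStep hpos haw hcw')
    (hβ hgw hx).bang).trans (hyloStep_app hpos haw hcw' (.comp hx hgw))
  exact h₁.trans (h₂.trans h₃.symm)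

/-- Fusion on the left, by `fix_natural` for postcomposition with g: g ∘ (a ∘ σ(h) ∘ c) = a' ∘ σ(g)
∘ σ(h) ∘ c = a' ∘ σ(g ∘ h) ∘ c. This is linear in h because g is a linear map; it plays the part of
the strictness condition in domain-theoretic fusion. -/
theorem comp_hylo (hId : IdentityExtension Ax) (hE : Extensionality Ax)
    (hpos : Ty.OnlyPositive 0 σ) (ha : HasTyI Γ a (.lolli (σ.at1 B) B))
    (ha' : HasTyI Γ a' (.lolli (σ.at1 B') B')) (hc : HasTyI Γ c (.lolli A (σ.at1 A)))
    (hg : HasTyI Γ g (.lolli B B')) (m : AlgMap Ax σ Γ Θ Φ B B' a a' g) :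
    IEq Ax Γ Θ Φ (.lolli A B') (.comp A g (hylo σ A B a c)) (hylo σ A B' a' c) := by
  have hL {m : ℕ} {Δ : Fin m → Typ S k} {g : Tm S k m} (hg : HasTyI Δ g (.lolli B B')) :
      HasTyI Δ (.lam (.lolli A B) (.comp A g.wk (.var 0))) (.lolli (.lolli A B) (.lolli A B')) :=
    .lam (.comp (hg.wk _) (.var 0)) (by simp)
  have hβ {m r : ℕ} {Δ : Fin m → Typ S k} {Θ : Fin r → RelDecl S k} {Φ : List (Form S k m r)}
      {g x : Tm S k m} (hg : HasTyI Δ g (.lolli B B')) (hx : HasTyI Δ x (.lolli A B)) :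
      IEq Ax Δ Θ Φ (.lolli A B') (.app (.lam (.lolli A B) (.comp A g.wk (.var 0))) x)
        (.comp A g x) :=
    beta_of_typed ((hL hg).app hx) (by simp [Tm.inst])
  refine (hβ hg (.hylo hpos ha hc)).symm.trans
    (fix_natural hId hE (.hyloStep hpos ha hc) (.hyloStep hpos ha' hc) (hL hg) ?_)
  have hgw := hg.wk (.lolli A B)
  have haw := ha.wk (.lolli A B)
  have haw' := ha'.wk (.lolli A B)
  have hcw := hc.wk (.lolli A B)
  have hx : HasTyI (push (.lolli A B) Γ) (.var 0) (.lolli A B) := .var 0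
  have hFx := HasTyI.fmap hpos hx
  have hFg := HasTyI.fmap hpos hgw
  have m' := (m.wk hpos ha ha' hg (.lolli A B)).toIEq hpos haw haw' hgw
  have e₁ : (Tm.lam (.lolli A B) (.comp A g.wk (.var 0)) : Tm S k n).wk =
      .lam (.lolli A B) (.comp A g.wk.wk (.var 0)) := by simp [Tm.ren]
  rw [e₁, hyloStep_wk, hyloStep_wk]
  have h₁ := (appR (Ax := Ax) (Θ := Θ) (Φ := Φ.map Form.wkTm) (hL hgw)
    (hyloStep_app hpos haw hcw hx)).trans (hβ hgw (.comp haw (.comp hFx hcw)))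
  have h₂ := (comp_assoc (Ax := Ax) (Θ := Θ) (Φ := Φ.map Form.wkTm) hE hgw haw
    (.comp hFx hcw)).symm.trans ((compL hE m' (.comp hFx hcw)).trans
      ((comp_assoc hE haw' hFg (.comp hFx hcw)).trans (compR hE haw'
        ((comp_assoc hE hFg hFx hcw).symm.trans
          (compL hE (fmap_comp hId hE hpos hgw hx) hcw)))))
  have h₃ := (appR (Ax := Ax) (Θ := Θ) (Φ := Φ.map Form.wkTm) (.hyloStep hpos haw' hcw)
    (hβ hgw hx).bang).trans (hyloStep_app hpos haw' hcw (.comp hgw hx))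
  exact h₁.trans (h₂.trans h₃.symm)

end IEq

end FixedPoints

-- Algebraic compactness, and the isomorphism of να.σ and μα.σ.

section Compactness

variable {S : Sig.{u, v}} {k n r : ℕ} {σ : Typ S 1} {Ax : Form S 0 0 0 → Prop} {Γ : Fin n → Typ S k}
  {Θ : Fin r → RelDecl S k} {Φ : List (Form S k n r)} {A B : Typ S k} {a c f g h : Tm S k n}

/-- The fixed-point equation h = in ∘ σ(h) ∘ in⁻¹, composed with `in`, says that h is an algebra
endomorphism of the initial algebra. -/
theorem hylo_in_inInv (hId : IdentityExtension Ax) (hE : Extensionality Ax)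
    (hpos : Ty.OnlyPositive 0 σ) : IEq Ax Γ Θ Φ (.lolli (mu σ).cl (mu σ).cl)
      (hylo σ (mu σ).cl (mu σ).cl (inTm σ).cl (inInv σ)) (Tm.idTm (mu σ).cl) := by
  have hi : HasTyI Γ (inTm σ).cl _ := .inTm_cl hpos
  have hj : HasTyI Γ (inInv σ) _ := .inInv hpos
  have hh := HasTyI.hylo hpos hi hj
  have hF := HasTyI.fmap hpos hh
  have h := (IEq.compL (Ax := Ax) (Θ := Θ) (Φ := Φ) hE (.hylo_eq hpos hi hj) hi).trans
    ((IEq.comp_assoc hE hi (.comp hF hj) hi).trans (.compR hE hi ((IEq.comp_assoc hE hF hj hi).trans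
      ((IEq.compR hE hF (.inInv_in hId hE hpos)).trans (.comp_id hE hF)))))
  exact (IEq.foldAt_unique hId hE hpos hi hh h.prov).trans
    (IEq.foldAt_unique hId hE hpos hi (.idTm _) (.id hId hE hpos hi)).symm

/-- Dually, the equation h = out⁻¹ ∘ σ(h) ∘ out makes h a coalgebra endomorphism of the final
coalgebra. -/
theorem hylo_outInv_out (hId : IdentityExtension Ax) (hE : Extensionality Ax)
    (hpos : Ty.OnlyPositive 0 σ) : IEq Ax Γ Θ Φ (.lolli (nu σ).cl (nu σ).cl)
      (hylo σ (nu σ).cl (nu σ).cl (outInv σ) (outTm σ).cl) (Tm.idTm (nu σ).cl) := by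
  have ho : HasTyI Γ (outTm σ).cl _ := .outTm_cl hpos
  have hj : HasTyI Γ (outInv σ) _ := .outInv hpos
  have hh := HasTyI.hylo hpos hj ho
  have hF := HasTyI.fmap hpos hh
  have h := (IEq.compR (Ax := Ax) (Θ := Θ) (Φ := Φ) hE ho (.hylo_eq hpos hj ho)).trans
    ((IEq.comp_assoc hE ho hj (.comp hF ho)).symm.trans
      ((IEq.compL hE (.out_outInv hId hE hpos) (.comp hF ho)).trans (.id_comp hE (.comp hF ho))))
  exact (IEq.unfoldAt_unique hId hE hpos ho hh h.prov).trans
    (IEq.unfoldAt_unique hId hE hpos ho (.idTm _) (.id hId hE hpos ho)).symm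

/-- Composing h = in ∘ σ(h) ∘ f with in⁻¹ on the left cancels `in`. The algebra version cancels
`out` on the right. -/
theorem hylo_coalgMap (hId : IdentityExtension Ax) (hE : Extensionality Ax)
    (hpos : Ty.OnlyPositive 0 σ) (hf : HasTyI Γ f (.lolli A (σ.at1 A))) :
    CoalgMap Ax σ Γ Θ Φ A (mu σ).cl f (inInv σ) (hylo σ A (mu σ).cl (inTm σ).cl f) := by
  have hi : HasTyI Γ (inTm σ).cl _ := .inTm_cl hpos
  have hj : HasTyI Γ (inInv σ) _ := .inInv hpos
  have hF := HasTyI.fmap hpos (.hylo hpos hi hf)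
  exact ((IEq.compR (Ax := Ax) (Θ := Θ) (Φ := Φ) hE hj (.hylo_eq hpos hi hf)).trans
    ((IEq.comp_assoc hE hj hi (.comp hF hf)).symm.trans
      ((IEq.compL hE (.inInv_in hId hE hpos) (.comp hF hf)).trans (.id_comp hE (.comp hF hf))))).prov

theorem hylo_algMap (hId : IdentityExtension Ax) (hE : Extensionality Ax)
    (hpos : Ty.OnlyPositive 0 σ) (hf : HasTyI Γ f (.lolli (σ.at1 A) A)) :
    AlgMap Ax σ Γ Θ Φ (nu σ).cl A (outInv σ) f (hylo σ (nu σ).cl A f (outTm σ).cl) := by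
  have ho : HasTyI Γ (outTm σ).cl _ := .outTm_cl hpos
  have hj : HasTyI Γ (outInv σ) _ := .outInv hpos
  have hF := HasTyI.fmap hpos (.hylo hpos hf ho)
  exact ((IEq.compL (Ax := Ax) (Θ := Θ) (Φ := Φ) hE (.hylo_eq hpos hf ho) hj).trans
    ((IEq.comp_assoc hE hf (.comp hF ho) hj).trans (.compR hE hf ((IEq.comp_assoc hE hF ho hj).trans
      ((IEq.compR hE hF (.out_outInv hId hE hpos)).trans (.comp_id hE hF)))))).prov

/-- Any coalgebra map h is id ∘ h = hylo(in, in⁻¹) ∘ h, and fusion along h turns this into hylo(in,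
f), which does not depend on h. -/
theorem coalgMap_unique (hId : IdentityExtension Ax) (hE : Extensionality Ax)
    (hpos : Ty.OnlyPositive 0 σ) (hf : HasTyI Γ f (.lolli A (σ.at1 A)))
    (hh : HasTyI Γ h (.lolli A (mu σ).cl)) (m : CoalgMap Ax σ Γ Θ Φ A (mu σ).cl f (inInv σ) h) :
    IEq Ax Γ Θ Φ (.lolli A (mu σ).cl) h (hylo σ A (mu σ).cl (inTm σ).cl f) :=
  ((IEq.id_comp hE hh).symm.trans (.compL hE (hylo_in_inInv hId hE hpos).symm hh)).trans
    (.hylo_comp hId hE hpos (.inTm_cl hpos) (.inInv hpos) hf hh m)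

/-- Here h = h ∘ hylo(out⁻¹, out), and fusion on the left gives hylo(f, out). -/
theorem algMap_unique (hId : IdentityExtension Ax) (hE : Extensionality Ax)
    (hpos : Ty.OnlyPositive 0 σ) (hf : HasTyI Γ f (.lolli (σ.at1 A) A))
    (hh : HasTyI Γ h (.lolli (nu σ).cl A)) (m : AlgMap Ax σ Γ Θ Φ (nu σ).cl A (outInv σ) f h) :
    IEq Ax Γ Θ Φ (.lolli (nu σ).cl A) h (hylo σ (nu σ).cl A f (outTm σ).cl) :=
  ((IEq.comp_id hE hh).symm.trans (.compR hE hh (hylo_outInv_out hId hE hpos).symm)).trans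
    (.comp_hylo hId hE hpos (.outInv hpos) hf (.outTm_cl hpos) hh m)

theorem inInv_final (hId : IdentityExtension Ax) (hE : Extensionality Ax)
    (hpos : Ty.OnlyPositive 0 σ) : FinalCoalgebra Ax σ (mu σ) (inInv σ) := by
  refine ⟨(inTm_inverse hId hE hpos).2.1, fun k n r Γ Θ Φ τ f hf =>
    ⟨hylo σ τ (mu σ).cl (inTm σ).cl f, .hylo hpos (.inTm_cl hpos) hf, ?_, fun h' hh' m => ?_⟩⟩
  · rw [inInv_cl]
    exact hylo_coalgMap hId hE hpos hf
  · rw [inInv_cl] at m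
    exact (coalgMap_unique hId hE hpos hf hh' m).prov

theorem outInv_initial (hId : IdentityExtension Ax) (hE : Extensionality Ax)
    (hpos : Ty.OnlyPositive 0 σ) : InitialAlgebra Ax σ (nu σ) (outInv σ) := by
  refine ⟨(outTm_inverse hId hE hpos).2.1, fun k n r Γ Θ Φ τ f hf =>
    ⟨hylo σ (nu σ).cl τ f (outTm σ).cl, .hylo hpos hf (.outTm_cl hpos), ?_, fun h' hh' m => ?_⟩⟩
  · rw [outInv_cl]
    exact hylo_algMap hId hE hpos hf
  · rw [outInv_cl] at m
    exact (algMap_unique hId hE hpos hf hh' m).prov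

theorem nuToMu_eq (σ : Typ S 1) :
    nuToMu σ = hylo σ (nu σ).cl (mu σ).cl (inTm σ).cl (outTm σ).cl := by
  simp [nuToMu, hylo, hyloStep, Tm.cl_eq_wk]

theorem nuToMu_coalgMap (hId : IdentityExtension Ax) (hE : Extensionality Ax)
    (hpos : Ty.OnlyPositive 0 σ) :
    ClosedCoalgMap Ax σ (nu σ) (mu σ) (outTm σ) (inInv σ) (nuToMu σ) := by
  have h := hylo_coalgMap (Ax := Ax) (Γ := (Fin.elim0 : Fin 0 → Typ S 0)) (Θ := Fin.elim0) (Φ := [])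
    hId hE hpos (.outTm_cl hpos)
  rw [← nuToMu_eq] at h
  simpa [ClosedCoalgMap] using h

theorem nuToMu_algMap (hId : IdentityExtension Ax) (hE : Extensionality Ax)
    (hpos : Ty.OnlyPositive 0 σ) :
    ClosedAlgMap Ax σ (nu σ) (mu σ) (outInv σ) (inTm σ) (nuToMu σ) := by
  have h := hylo_algMap (Ax := Ax) (Γ := (Fin.elim0 : Fin 0 → Typ S 0)) (Θ := Fin.elim0) (Φ := [])
    hId hE hpos (.inTm_cl hpos)
  rw [← nuToMu_eq] at h
  simpa [ClosedAlgMap] using h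

/-- The inverse is the fold of out⁻¹. Both maps are algebra maps between out⁻¹ and `in`, so their
composites are algebra endomorphisms of initial algebras: on ν uniqueness comes from `algMap_unique`
with `hylo_outInv_out`, on μ from `IEq.foldAt_unique`. -/
theorem nuToMu_inverse (hId : IdentityExtension Ax) (hE : Extensionality Ax)
    (hpos : Ty.OnlyPositive 0 σ) :
    Inverse Ax (nu σ) (mu σ) (nuToMu σ) (foldAt σ (nu σ) (outInv σ)) := by
  have hi : HasTyI (Fin.elim0 : Fin 0 → Typ S 0) (inTm σ).cl _ := .inTm_cl hpos
  have ho : HasTyI (Fin.elim0 : Fin 0 → Typ S 0) (outTm σ).cl _ := .outTm_cl hpos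
  have hj : HasTyI (Fin.elim0 : Fin 0 → Typ S 0) (outInv σ) _ := .outInv hpos
  have hh := HasTyI.hylo hpos hi ho
  have hk := HasTyI.foldAt hj
  have m := hylo_algMap (Ax := Ax) (Θ := Fin.elim0) (Φ := []) hId hE hpos hi
  have m' := foldAt_algMap (Ax := Ax) (Θ := Fin.elim0) (Φ := []) hE hpos hj
  have e₁ := (algMap_unique hId hE hpos hj (.comp hk hh)
    (m.comp hId hE hpos hj hi hj hh hk m')).trans (hylo_outInv_out hId hE hpos)
  have e₂ := (IEq.foldAt_unique hId hE hpos hi (.comp hh hk)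
    (m'.comp hId hE hpos hi hj hi hk hh m)).trans
      (IEq.foldAt_unique hId hE hpos hi (.idTm _) (.id hId hE hpos hi)).symm
  rw [← nuToMu_eq] at hh e₁ e₂
  simp only [Ty.cl_self] at hh hk e₁ e₂
  exact ⟨hh, hk, e₁.prov, e₂.prov⟩

end Compactness

end LAPL

theorem mainTheorem5 (S : LAPL.Sig.{u, v}) (Ax : LAPL.Form S 0 0 0 → Prop)
    (hId : LAPL.IdentityExtension Ax) (hExt : LAPL.Extensionality Ax)
    (σ : LAPL.Typ S 1) (hσ : LAPL.Ty.Inductively σ) (hpos : LAPL.Ty.OnlyPositive 0 σ) :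
    ∃ inInv outInv : LAPL.Tm S 0 0,
      LAPL.Inverse Ax (σ.at1 (LAPL.mu σ)) (LAPL.mu σ) (LAPL.inTm σ) inInv ∧
      LAPL.Inverse Ax (LAPL.nu σ) (σ.at1 (LAPL.nu σ)) (LAPL.outTm σ) outInv ∧
      LAPL.FinalCoalgebra Ax σ (LAPL.mu σ) inInv ∧
      LAPL.InitialAlgebra Ax σ (LAPL.nu σ) outInv ∧
      (∃ k : LAPL.Tm S 0 0, LAPL.Inverse Ax (LAPL.nu σ) (LAPL.mu σ) (LAPL.nuToMu σ) k) ∧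
      LAPL.ClosedCoalgMap Ax σ (LAPL.nu σ) (LAPL.mu σ) (LAPL.outTm σ) inInv (LAPL.nuToMu σ) ∧
      LAPL.ClosedAlgMap Ax σ (LAPL.nu σ) (LAPL.mu σ) outInv (LAPL.inTm σ) (LAPL.nuToMu σ) :=
  ⟨LAPL.inInv σ, LAPL.outInv σ, LAPL.inTm_inverse hId hExt hpos, LAPL.outTm_inverse hId hExt hpos,
    LAPL.inInv_final hId hExt hpos, LAPL.outInv_initial hId hExt hpos,
    ⟨_, LAPL.nuToMu_inverse hId hExt hpos⟩, LAPL.nuToMu_coalgMap hId hExt hpos,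
    LAPL.nuToMu_algMap hId hExt hpos⟩
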